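/- **Setting.** Let $n\in\mathbb N$ and let $\Phi:\mathbb C^n\to\mathbb R$ be a strictly convex real quadratic form. $H_\Phi$ is the Hilbert space of entire functions on $\mathbb C^n$ that lie in $L^2(\mathbb C^n;e^{-2\Phi(x)}\,dL(x))$, with $dL$ Lebesgue measure. For $\alpha\in\mathbb N_0^n$ put $$\Pi_\alpha u(x)=(\alpha!)^{-1}\,(\partial^\alpha u(0))\,x^\alpha .$$ Write $\Phi''_{\bar xx}=(\partial_{\bar x_j}\partial_{x_k}\Phi)$, $\Phi''_{xx}=(\partial_{x_j}\partial_{x_k}\Phi)$ and choose an invertible $G$ with $\Phi''_{\bar xx}=\frac14G^*G$. Put $C_+=-4G^{-t}\Phi''_{xx}G^{-1}$, $E=(1-C_+^*C_+)^{-1/2}$, $G^\dagger=E(G^*)^{-1}$, $C_+^\dagger=-E^{-t}C_+E$. The dual weight $\Phi^\dagger$ is the real quadratic form on $\mathbb C^n$ with $(\Phi^\dagger)''_{\bar xx}=\frac14(G^\dagger)^*G^\dagger$ and $(\Phi^\dagger)''_{xx}=-\frac14(G^\dagger)^tC_+^\dagger G^\dagger$ (it does not depend on the choice of $G$). For $\beta\in[0,\infty)^n$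 and $\omega\in\mathbb C^n$ let $|\omega^\beta|^2=\prod_j|\omega_j|^{2\beta_j}$ (with $0^0=1$), let $|\omega|$ be the Euclidean norm, and let $$g(\beta,\Phi)=\tfrac12\log\Big(\sup_{|\omega|=1}\frac{|\omega^\beta|^2}{4\Phi(\omega)}\Big)+\tfrac12\log\Big(\sup_{|\omega|=1}\frac{|\omega^\beta|^2}{4\Phi^\dagger(\omega)}\Big)-\sum_{j:\beta_j\neq0}\beta_j\log\beta_j .$$ **(1)** Every $\Pi_\alpha$ is a bounded operator on $H_\Phi$. For each fixed $\beta\in[0,\infty)^n$ with $\sum_j\beta_j=1$, $$\lambda^{-1}\log\|\Pi_{\lambda\beta}\|_{\mathcal L(H_\Phi)}=g(\beta,\Phi)+\mathcal O(\lambda^{-1}\log\lambda)$$ as $\lambda\to\infty$ through those real $\lambda>0$ with $\lambda\beta\in\mathbb N_0^n$. **(2)** Let $q:\mathbb R^{2n}\to\mathbb C$ be a quadratic form with Hamilton map $F(x,\xi)=\frac12(\partial_\xi q,-\partial_xq)$. Suppose $\operatorname{Re}q\ge0$ on $\mathbb R^{2n}$ and $\bigcap_{k\ge0}\ker\big((\operatorname{Re}F)(\operatorname{Im}F)^k\big)=\{0\}$.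 A *normal form* of $q$ consists of a complex linear canonical transformation $\varkappa$ of $\mathbb C^{2n}$, a matrix $M$ in Jordan normal form with diagonal $2\lambda_1,\dots,2\lambda_n$, where $\lambda_1,\dots,\lambda_n$ are the eigenvalues of $F$ with positive imaginary part counted with algebraic multiplicity, and a strictly convex real quadratic form $\Phi_2$ on $\mathbb C^n$, such that $$(q\circ\varkappa^{-1})(x,\xi)=(Mx)\cdot\xi,\qquad \varkappa(\mathbb R^{2n})=\{(x,\tfrac2i\partial_x\Phi_2(x)):x\in\mathbb C^n\}.$$ Then $q$ has a normal form. Fix any normal form and put $\mu_\alpha=\frac1i\sum_j(2\alpha_j+1)\lambda_j$. Let $q^w(x,D_x)$ be the Weyl quantization of $q$ on $L^2(\mathbb R^n)$ with its maximal domain. For an isolated point $\mu$ of its spectrum let $$P_{\{\mu\}}=(2\pi i)^{-1}\int_\Gamma(\zeta-q^w(x,D_x))^{-1}\,d\zeta$$ with $\Gamma$ a small positively oriented circle about $\mu$; $\mu$ is a simple eigenvalue if it is isolated in the spectrum and $P_{\{\mu\}}$ has rank one. Then, whenever $\mu_\alpha$ is a simple eigenvalue of $q^w(x,D_x)$, $$\|P_{\{\mu_\alpha\}}\|_{\mathcal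 L(L^2(\mathbb R^n))}=\|\Pi_\alpha\|_{\mathcal L(H_{\Phi_2})}.$$ Consequently, for each fixed $\beta\in[0,\infty)^n$ with $\sum_j\beta_j=1$, $$\lambda^{-1}\log\|P_{\{\mu_{\lambda\beta}\}}\|_{\mathcal L(L^2(\mathbb R^n))}=g(\beta,\Phi_2)+\mathcal O(\lambda^{-1}\log\lambda)$$ as $\lambda\to\infty$ through those real $\lambda>0$ for which $\lambda\beta\in\mathbb N_0^n$ and $\mu_{\lambda\beta}$ is simple. -/

import Mathlib

open scoped Matrix SchwartzMap LineDeriv ENNReal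

noncomputable section

namespace QuadGrowth

/-! ## Real quadratic weights on `ℂⁿ` and the dual weight -/

section Weights

variable {n : ℕ}

/-- The standard basis vector `e_j` of `ℂⁿ`. -/
def e (j : Fin n) : Fin n → ℂ := Pi.single j 1

/-- The vector `i e_j`, that is, the direction of `Im x_j`. -/
def ie (j : Fin n) : Fin n → ℂ := Pi.single j Complex.I

/-- `Φ (u + v) - Φ u - Φ v`. For a quadratic form `Φ` this is both the real derivative of `Φ` at `u`
in the direction `v` and the real second derivative of `Φ` in the directions `u`, `v`. -/
def bil (Φ : QuadraticForm ℝ (Fin n → ℂ)) (u v : Fin n → ℂ) : ℂ :=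
  ((Φ (u + v) - Φ u - Φ v : ℝ) : ℂ)

/-- The holomorphic gradient `∂_x Φ`, with `∂_x = (∂_{Re x} - i ∂_{Im x}) / 2`. -/
def gradX (Φ : QuadraticForm ℝ (Fin n → ℂ)) (x : Fin n → ℂ) (j : Fin n) : ℂ :=
  (1 / 2) * (bil Φ x (e j) - Complex.I * bil Φ x (ie j))

/-- The matrix `Φ''_{x x} = (∂_{x_j} ∂_{x_k} Φ)`. -/
def hessXX (Φ : QuadraticForm ℝ (Fin n → ℂ)) : Matrix (Fin n) (Fin n) ℂ :=
  Matrix.of fun j k => (1 / 4) *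
    (bil Φ (e j) (e k) - bil Φ (ie j) (ie k)
      - Complex.I *
        (bil Φ (ie j) (e k) + bil Φ (e j) (ie k)))

/-- The matrix `Φ''_{x̄ x} = (∂_{x̄_j} ∂_{x_k} Φ)`. -/
def hessBarX (Φ : QuadraticForm ℝ (Fin n → ℂ)) : Matrix (Fin n) (Fin n) ℂ :=
  Matrix.of fun j k => (1 / 4) *
    (bil Φ (e j) (e k) + bil Φ (ie j) (ie k)
      + Complex.I *
        (bil Φ (ie j) (e k) - bil Φ (e j) (ie k)))

/-- With `H = 4 Φ''_{x̄ x}` and `P = 4 Φ''_{x x}`, the matrix `(H - P* H̄⁻¹ P)⁻¹`, which is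
`4 (Φ†)''_{x̄ x}`. -/
def dualH (Φ : QuadraticForm ℝ (Fin n → ℂ)) : Matrix (Fin n) (Fin n) ℂ :=
  ((4 : ℂ) • hessBarX Φ -
    ((4 : ℂ) • hessXX Φ)ᴴ * (((4 : ℂ) • hessBarX Φ).map star)⁻¹ * ((4 : ℂ) • hessXX Φ))⁻¹

/-- With `H = 4 Φ''_{x̄ x}` and `P = 4 Φ''_{x x}`, the matrix `- H̄⁻¹ P (H - P* H̄⁻¹ P)⁻¹`, which is
`4 (Φ†)''_{x x}`. -/
def dualP (Φ : QuadraticForm ℝ (Fin n → ℂ)) : Matrix (Fin n) (Fin n) ℂ :=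
  -((((4 : ℂ) • hessBarX Φ).map star)⁻¹ * ((4 : ℂ) • hessXX Φ) * dualH Φ)

/-- The dual weight `Φ†`: the real quadratic form
`Φ†(x) = (Φ†''_{x̄ x} x) · x̄ + Re ((Φ†''_{x x} x) · x)` with the second derivatives `dualH Φ / 4`
and `dualP Φ / 4`. See `dualWeight_matrices` for the description through the matrices
`G`, `C₊`, `G†`, `C₊†`. -/
def dualWeight (Φ : QuadraticForm ℝ (Fin n → ℂ)) (x : Fin n → ℂ) : ℝ :=
  (1 / 4) * ((star x ⬝ᵥ (dualH Φ *ᵥ x)).re + (x ⬝ᵥ (dualP Φ *ᵥ x)).re)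

open scoped ComplexOrder in
/-- If `Φ''_{x̄ x} = G* G / 4` and `Φ''_{x x} = - Gᵗ C₊ G / 4` with `G` invertible, and if
`E = (1 - C₊* C₊)^{-1/2}`, then the second derivatives of the dual weight are
`(G†)* G† / 4` and `- (G†)ᵗ C₊† G† / 4` with `G† = E (G*)⁻¹` and `C₊† = - (Eᵗ)⁻¹ C₊ E`. -/
theorem dualWeight_matrices (Φ : QuadraticForm ℝ (Fin n → ℂ))
    (G C E Gd Cd : Matrix (Fin n) (Fin n) ℂ) (hG : IsUnit G.det)
    (hH : hessBarX Φ = (1 / 4 : ℂ) • (Gᴴ * G))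
    (hP : hessXX Φ = -((1 / 4 : ℂ) • (Gᵀ * C * G)))
    (hE : E.PosDef) (hE2 : E * E = (1 - Cᴴ * C)⁻¹)
    (hGd : Gd = E * (Gᴴ)⁻¹) (hCd : Cd = -((Eᵀ)⁻¹ * C * E)) :
    (1 / 4 : ℂ) • dualH Φ = (1 / 4 : ℂ) • (Gdᴴ * Gd) ∧
      (1 / 4 : ℂ) • dualP Φ = -((1 / 4 : ℂ) • (Gdᵀ * Cd * Gd)) := by
  have h4 : (4 : ℂ) • hessBarX Φ = Gᴴ * G := by rw [hH, smul_smul]; norm_num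
  have h4P : (4 : ℂ) • hessXX Φ = -(Gᵀ * C * G) := by rw [hP, smul_neg, smul_smul]; norm_num
  have hGt : IsUnit Gᵀ.det := by rwa [Matrix.det_transpose]
  have hGb : IsUnit (Gᴴ)ᵀ.det := by
    rw [Matrix.det_transpose, Matrix.det_conjTranspose]; exact hG.star
  have hEd : IsUnit E.det := (Matrix.isUnit_iff_isUnit_det E).mp hE.isUnit
  have hEt : IsUnit Eᵀ.det := by rwa [Matrix.det_transpose]
  have hcomm : (Gᵀ)ᴴ = (Gᴴ)ᵀ := rfl
  have hbar : (Gᴴ * G).map star = Gᵀ * (Gᴴ)ᵀ := by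
    have h : (Gᴴ * G).map star = ((Gᴴ * G)ᴴ)ᵀ := rfl
    rw [h, Matrix.conjTranspose_mul, Matrix.conjTranspose_conjTranspose, Matrix.transpose_mul]
  have hbarinv : ((Gᴴ * G).map star)⁻¹ = ((Gᴴ)ᵀ)⁻¹ * (Gᵀ)⁻¹ := by
    rw [hbar, Matrix.mul_inv_rev]
  have c1 : (Gᵀ)⁻¹ * Gᵀ = 1 := Matrix.nonsing_inv_mul _ hGt
  have c2 : (Gᴴ)ᵀ * ((Gᴴ)ᵀ)⁻¹ = 1 := Matrix.mul_nonsing_inv _ hGb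
  have c3 : G * G⁻¹ = 1 := Matrix.mul_nonsing_inv _ hG
  have c4 : Eᵀ * (Eᵀ)⁻¹ = 1 := Matrix.mul_nonsing_inv _ hEt
  have hQ : ((Gᴴ)ᵀ)⁻¹ * (Gᵀ)⁻¹ * (Gᵀ * C * G) = ((Gᴴ)ᵀ)⁻¹ * C * G := by
    calc _ = ((Gᴴ)ᵀ)⁻¹ * ((Gᵀ)⁻¹ * Gᵀ) * C * G := by noncomm_ring
      _ = _ := by rw [c1, mul_one]
  have hK : dualH Φ = G⁻¹ * (E * E) * (Gᴴ)⁻¹ := by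
    have h1 : (-(Gᵀ * C * G))ᴴ = -(Gᴴ * Cᴴ * (Gᴴ)ᵀ) := by
      rw [Matrix.conjTranspose_neg, Matrix.conjTranspose_mul, Matrix.conjTranspose_mul, hcomm,
        mul_assoc]
    have key : Gᴴ * G - -(Gᴴ * Cᴴ * (Gᴴ)ᵀ) * (((Gᴴ)ᵀ)⁻¹ * (Gᵀ)⁻¹) * -(Gᵀ * C * G) =
        Gᴴ * ((1 - Cᴴ * C) * G) := by
      calc _ = Gᴴ * G - Gᴴ * Cᴴ * (Gᴴ)ᵀ * (((Gᴴ)ᵀ)⁻¹ * (Gᵀ)⁻¹ * (Gᵀ * C * G)) := by noncomm_ring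
        _ = Gᴴ * G - Gᴴ * Cᴴ * ((Gᴴ)ᵀ * ((Gᴴ)ᵀ)⁻¹) * C * G := by rw [hQ]; noncomm_ring
        _ = _ := by rw [c2]; noncomm_ring
    rw [dualH, h4, h4P, hbarinv, h1, key, hE2, Matrix.mul_inv_rev, Matrix.mul_inv_rev]
  have hP' : dualP Φ = ((Gᴴ)ᵀ)⁻¹ * C * (E * E) * (Gᴴ)⁻¹ := by
    rw [dualP, h4, h4P, hbarinv, hK, mul_neg, neg_mul, neg_neg, hQ]
    calc _ = ((Gᴴ)ᵀ)⁻¹ * C * (G * G⁻¹) * (E * E) * (Gᴴ)⁻¹ := by noncomm_ring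
      _ = _ := by rw [c3, mul_one]
  have hi1 : ((Gᴴ)⁻¹)ᴴ = G⁻¹ := by
    rw [Matrix.conjTranspose_nonsing_inv, Matrix.conjTranspose_conjTranspose]
  constructor
  · rw [hK, hGd, Matrix.conjTranspose_mul, hE.isHermitian.eq, hi1]
    congr 1
    noncomm_ring
  · rw [hP', hGd, hCd, Matrix.transpose_mul, Matrix.transpose_nonsing_inv, ← smul_neg]
    congr 1
    calc _ = ((Gᴴ)ᵀ)⁻¹ * (1 : Matrix (Fin n) (Fin n) ℂ) * C * (E * E) * (Gᴴ)⁻¹ := by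
          rw [mul_one]
      _ = _ := by rw [← c4]; noncomm_ring

/-- `|ω^β|² = ∏_j |ω_j|^{2 β_j}` for a vector of exponents `β`, with `0^0 = 1`. -/
def absPowSq (β : Fin n → ℝ) (ω : Fin n → ℂ) : ℝ := ∏ j, ‖ω j‖ ^ (2 * β j)

/-- The Euclidean unit sphere of `ℂⁿ`. -/
def unitSphere (n : ℕ) : Set (Fin n → ℂ) := {ω | ∑ j, ‖ω j‖ ^ 2 = 1}

/-- The rate of exponential growth. -/
def growthRate (Φ : QuadraticForm ℝ (Fin n → ℂ)) (β : Fin n → ℝ) : ℝ :=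
  (1 / 2) * Real.log (sSup ((fun ω => (4 * Φ ω)⁻¹ * absPowSq β ω) '' unitSphere n))
    + (1 / 2) * Real.log (sSup ((fun ω => (4 * dualWeight Φ ω)⁻¹ * absPowSq β ω) '' unitSphere n))
    - ∑ j with β j ≠ 0, β j * Real.log (β j)

end Weights

/-! ## The weighted space `H_Φ(ℂⁿ; 1)` and the projections `Π_α` -/

section WeightedSpace

variable {n : ℕ}

/-- The measure `e^{-2 Φ(x)} dL(x)` on `ℂⁿ`. -/
def weightMeasure (Φ : QuadraticForm ℝ (Fin n → ℂ)) : MeasureTheory.Measure (Fin n → ℂ) :=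
  MeasureTheory.volume.withDensity fun x => ENNReal.ofReal (Real.exp (-2 * Φ x))

/-- `H_Φ(ℂⁿ; 1)`: the elements of `L²(ℂⁿ; e^{-2 Φ} dL)` that are represented by an entire function,
with the norm of that space. -/
def HPhi (Φ : QuadraticForm ℝ (Fin n → ℂ)) :
    Submodule ℂ (MeasureTheory.Lp ℂ 2 (weightMeasure Φ)) where
  carrier := {u | ∃ f : (Fin n → ℂ) → ℂ, Differentiable ℂ f ∧ u =ᵐ[weightMeasure Φ] f}
  zero_mem' := ⟨0, differentiable_const 0, MeasureTheory.Lp.coeFn_zero _ _ _⟩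
  add_mem' := by
    rintro u v ⟨f, hf, huf⟩ ⟨g, hg, hvg⟩
    exact ⟨f + g, hf.add hg, (MeasureTheory.Lp.coeFn_add u v).trans (huf.add hvg)⟩
  smul_mem' := by
    rintro c u ⟨f, hf, huf⟩
    exact ⟨c • f, hf.const_smul c,
      (MeasureTheory.Lp.coeFn_smul c u).trans (huf.const_smul c)⟩

/-- The holomorphic partial derivative `∂_{x_j}`. -/
def pderiv (j : Fin n) (f : (Fin n → ℂ) → ℂ) : (Fin n → ℂ) → ℂ := fun x => fderiv ℂ f x (e j)

/-- `∂^α = ∂_{x_1}^{α_1} ⋯ ∂_{x_n}^{α_n}`. -/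
def multiDeriv (α : Fin n → ℕ) (f : (Fin n → ℂ) → ℂ) : (Fin n → ℂ) → ℂ :=
  (List.finRange n).foldr (fun j g => (pderiv j)^[α j] g) f

/-- `T` is the projection `Π_α u(x) = (α!)⁻¹ (∂^α u(0)) x^α` as a bounded operator on `H_Φ`. -/
def IsTaylorProj (Φ : QuadraticForm ℝ (Fin n → ℂ)) (α : Fin n → ℕ)
    (T : HPhi Φ →L[ℂ] HPhi Φ) : Prop :=
  ∀ (u : HPhi Φ) (f : (Fin n → ℂ) → ℂ), Differentiable ℂ f →
    (u : MeasureTheory.Lp ℂ 2 (weightMeasure Φ)) =ᵐ[weightMeasure Φ] f →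
    ((T u : HPhi Φ) : MeasureTheory.Lp ℂ 2 (weightMeasure Φ)) =ᵐ[weightMeasure Φ]
      fun x => (∏ j, ((α j).factorial : ℂ))⁻¹ * multiDeriv α f 0 * ∏ j, x j ^ α j

open Classical in
/-- The projection `Π_α` on `H_Φ` (the bounded operator singled out by `IsTaylorProj`). -/
def taylorProj (Φ : QuadraticForm ℝ (Fin n → ℂ)) (α : Fin n → ℕ) : HPhi Φ →L[ℂ] HPhi Φ :=
  if h : ∃ T, IsTaylorProj Φ α T then h.choose else 0

end WeightedSpace

/-! ## Quadratic symbols `q(X) = X · Q X` on `ℝ²ⁿ`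

A quadratic form `q : ℝⁿ_x × ℝⁿ_ξ → ℂ` is given by its symmetric complex matrix `Q`; the index
`Sum.inl j` stands for `x_j` and `Sum.inr j` for `ξ_j`. -/

section Symbols

variable {n : ℕ}

/-- The value `q(X) = X · Q X`, also for complex `X`. -/
def symbol (Q : Matrix (Fin n ⊕ Fin n) (Fin n ⊕ Fin n) ℂ) (X : Fin n ⊕ Fin n → ℂ) : ℂ :=
  X ⬝ᵥ (Q *ᵥ X)

/-- The inclusion `ℝ²ⁿ ⊆ ℂ²ⁿ`. -/
def toC (X : Fin n ⊕ Fin n → ℝ) : Fin n ⊕ Fin n → ℂ := fun a => (X a : ℂ)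

/-- The Hamilton map `F = H_q / 2`, that is, `F (x, ξ) = (∂_ξ q, - ∂_x q) / 2`. -/
def hamiltonMap (Q : Matrix (Fin n ⊕ Fin n) (Fin n ⊕ Fin n) ℂ) :
    Matrix (Fin n ⊕ Fin n) (Fin n ⊕ Fin n) ℂ :=
  Matrix.fromBlocks Q.toBlocks₂₁ Q.toBlocks₂₂ (-Q.toBlocks₁₁) (-Q.toBlocks₁₂)

/-- `Re q ≥ 0` on `ℝ²ⁿ`. -/
def ReNonneg (Q : Matrix (Fin n ⊕ Fin n) (Fin n ⊕ Fin n) ℂ) : Prop :=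
  ∀ X : Fin n ⊕ Fin n → ℝ, 0 ≤ (symbol Q (toC X)).re

/-- The singular space `⋂_{k ≥ 0} ker ((Re F) (Im F)^k) ⊆ ℝ²ⁿ` is trivial. -/
def TrivialSingularSpace (Q : Matrix (Fin n ⊕ Fin n) (Fin n ⊕ Fin n) ℂ) : Prop :=
  ∀ X : Fin n ⊕ Fin n → ℝ,
    (∀ k : ℕ, ((hamiltonMap Q).map Complex.re * (hamiltonMap Q).map Complex.im ^ k) *ᵥ X = 0) →
      X = 0

/-- `M` is in Jordan normal form: block diagonal, each block having a constant diagonal, ones on the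
superdiagonal and zeros elsewhere. -/
def IsJordanForm (M : Matrix (Fin n) (Fin n) ℂ) : Prop :=
  ∀ j k, j ≠ k → M j k ≠ 0 → (k : ℕ) = j + 1 ∧ M j k = 1 ∧ M j j = M k k

/-- A reduction of `q` to normal form: a complex linear canonical transformation `ϰ` of `ℂ²ⁿ` with
`(q ∘ ϰ⁻¹)(x, ξ) = (M x) · ξ`, where `M` is in Jordan normal form and has on its diagonal the numbers
`2 λ_1, …, 2 λ_n`, with `λ_1, …, λ_n` the eigenvalues of `F` in the upper half-plane repeated
according to algebraic multiplicity, and the associated weight: the strictly convex real quadratic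
form `Φ` on `ℂⁿ` for which `ϰ (ℝ²ⁿ) = Λ_Φ = {(x, (2 / i) ∂_x Φ(x))}`. -/
structure IsNormalForm (Q : Matrix (Fin n ⊕ Fin n) (Fin n ⊕ Fin n) ℂ) (lam : Fin n → ℂ)
    (M : Matrix (Fin n) (Fin n) ℂ) (ϰ : Matrix (Fin n ⊕ Fin n) (Fin n ⊕ Fin n) ℂ)
    (Φ : QuadraticForm ℝ (Fin n → ℂ)) : Prop where
  canonical : ϰ ∈ Matrix.symplecticGroup (Fin n) ℂ
  symbol_eq : ∀ X, symbol Q X =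
    (M *ᵥ fun j => (ϰ *ᵥ X) (Sum.inl j)) ⬝ᵥ fun j => (ϰ *ᵥ X) (Sum.inr j)
  jordan : IsJordanForm M
  diag : ∀ j, M j j = 2 * lam j
  eigenvalues : Finset.univ.val.map lam =
    (hamiltonMap Q).charpoly.roots.filter fun z => 0 < z.im
  convex : StrictConvexOn ℝ Set.univ Φ
  lagrangian : Set.range (fun X : Fin n ⊕ Fin n → ℝ => ϰ *ᵥ toC X) =
    Set.range fun x : Fin n → ℂ => Sum.elim x fun j => 2 / Complex.I * gradX Φ x j

/-- `μ_α = (1 / i) ∑_j (2 α_j + 1) λ_j`. -/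
def mu (lam : Fin n → ℂ) (α : Fin n → ℕ) : ℂ :=
  1 / Complex.I * ∑ j, (2 * (α j : ℂ) + 1) * lam j

end Symbols

/-! ## The Weyl quantization `q^w(x, D_x)` on `L²(ℝⁿ)` -/

section Quantization

variable {n : ℕ}

/-- Multiplication by `x_j` on the Schwartz space. -/
def posOp (j : Fin n) : 𝓢(EuclideanSpace ℝ (Fin n), ℂ) →L[ℂ] 𝓢(EuclideanSpace ℝ (Fin n), ℂ) :=
  SchwartzMap.smulLeftCLM ℂ fun x : EuclideanSpace ℝ (Fin n) => (x j : ℂ)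

theorem posOp_apply (j : Fin n) (φ : 𝓢(EuclideanSpace ℝ (Fin n), ℂ))
    (x : EuclideanSpace ℝ (Fin n)) : posOp j φ x = (x j : ℂ) * φ x := by
  have h : Function.HasTemperateGrowth fun x : EuclideanSpace ℝ (Fin n) => (x j : ℂ) :=
    (Complex.ofRealCLM ∘L
      (EuclideanSpace.proj j : EuclideanSpace ℝ (Fin n) →L[ℝ] ℝ)).hasTemperateGrowth
  rw [posOp, SchwartzMap.smulLeftCLM_apply_apply h, smul_eq_mul]

/-- `D_{x_j} = (1 / i) ∂_{x_j}` on the Schwartz space. -/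
def momOp (j : Fin n) : 𝓢(EuclideanSpace ℝ (Fin n), ℂ) →L[ℂ] 𝓢(EuclideanSpace ℝ (Fin n), ℂ) :=
  (1 / Complex.I) • LineDeriv.lineDerivOpCLM ℂ 𝓢(EuclideanSpace ℝ (Fin n), ℂ)
    (EuclideanSpace.single j (1 : ℝ))

/-- The operators `(x_1, …, x_n, D_1, …, D_n)`. -/
def phaseOp : Fin n ⊕ Fin n →
    (𝓢(EuclideanSpace ℝ (Fin n), ℂ) →L[ℂ] 𝓢(EuclideanSpace ℝ (Fin n), ℂ)) :=
  Sum.elim posOp momOp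

/-- The Weyl quantization of `q(X) = ∑ Q_{ab} X_a X_b` on the Schwartz space: each product
`X_a X_b` becomes the symmetrized product of the corresponding operators. -/
def weylSchwartz (Q : Matrix (Fin n ⊕ Fin n) (Fin n ⊕ Fin n) ℂ) :
    𝓢(EuclideanSpace ℝ (Fin n), ℂ) →L[ℂ] 𝓢(EuclideanSpace ℝ (Fin n), ℂ) :=
  ∑ a, ∑ b, (Q a b / 2) • (phaseOp a ∘L phaseOp b + phaseOp b ∘L phaseOp a)

/-- `L²(ℝⁿ)`. -/
abbrev L2 (n : ℕ) : Type := MeasureTheory.Lp ℂ 2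
  (MeasureTheory.volume : MeasureTheory.Measure (EuclideanSpace ℝ (Fin n)))

/-- The pairs `(u, v)` in `L²(ℝⁿ)` with `q^w(x, D_x) u = v` in the sense of distributions. The
formal adjoint of `q^w(x, D_x)` is the quantization of the complex conjugate symbol. -/
def weylGraph (Q : Matrix (Fin n ⊕ Fin n) (Fin n ⊕ Fin n) ℂ) : Submodule ℂ (L2 n × L2 n) where
  carrier := {p | ∀ φ : 𝓢(EuclideanSpace ℝ (Fin n), ℂ),
    inner ℂ (φ.toLp 2 : L2 n) p.2 = inner ℂ ((weylSchwartz (Q.map star) φ).toLp 2 : L2 n) p.1}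
  zero_mem' := by intro φ; simp
  add_mem' := by
    intro p r hp hr φ
    simp only [Prod.snd_add, Prod.fst_add, inner_add_right]
    rw [hp φ, hr φ]
  smul_mem' := by
    intro c p hp φ
    simp only [Prod.smul_snd, Prod.smul_fst, inner_smul_right]
    rw [hp φ]

/-- The operator `q^w(x, D_x)` on `L²(ℝⁿ)` with its maximal domain
`{u ∈ L² : q^w(x, D_x) u ∈ L²}`. -/
def weylOp (Q : Matrix (Fin n ⊕ Fin n) (Fin n ⊕ Fin n) ℂ) : L2 n →ₗ.[ℂ] L2 n :=
  (weylGraph Q).toLinearPMap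

theorem weylOp_graph (Q : Matrix (Fin n ⊕ Fin n) (Fin n ⊕ Fin n) ℂ) :
    (weylOp Q).graph = weylGraph Q := by
  refine Submodule.toLinearPMap_graph_eq _ ?_
  rintro ⟨u, v⟩ hp (rfl : u = 0)
  have hd : DenseRange fun φ : 𝓢(EuclideanSpace ℝ (Fin n), ℂ) => (φ.toLp 2 : L2 n) :=
    SchwartzMap.denseRange_toLpCLM (F := ℂ) (p := 2) ENNReal.ofNat_ne_top
  refine hd.eq_zero_of_inner_right ℂ fun φ => ?_
  have h := hp φ
  simpa using h

end Quantization

/-! ## Spectrum and spectral projections of unbounded operators -/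

section Spectral

variable {H : Type*} [NormedAddCommGroup H] [NormedSpace ℂ H]

/-- `R` is a bounded two-sided inverse `(z - A)⁻¹` of `z - A : D(A) → H`. -/
def IsResolvent (A : H →ₗ.[ℂ] H) (z : ℂ) (R : H →L[ℂ] H) : Prop :=
  (∀ f : H, ∃ h : R f ∈ A.domain, z • R f - A ⟨R f, h⟩ = f) ∧
    ∀ u : A.domain, R (z • (u : H) - A u) = u

/-- The spectrum of `A`. -/
def spec (A : H →ₗ.[ℂ] H) : Set ℂ := {z | ¬ ∃ R, IsResolvent A z R}

open Classical in
/-- The resolvent `(z - A)⁻¹` (zero when `z` lies in the spectrum). -/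
def resolv (A : H →ₗ.[ℂ] H) (z : ℂ) : H →L[ℂ] H :=
  if h : ∃ R, IsResolvent A z R then h.choose else 0

/-- The closed disc of radius `r > 0` about `z` contains no point of the spectrum other than `z`. -/
def IsIsolatingRadius (A : H →ₗ.[ℂ] H) (z : ℂ) (r : ℝ) : Prop :=
  0 < r ∧ Metric.closedBall z r ∩ spec A ⊆ {z}

open Classical in
/-- The spectral (Riesz) projection `P_{{z}, A} = (2 π i)⁻¹ ∫_Γ (ζ - A)⁻¹ dζ`, where `Γ` is a
circle about `z` separating `z` from the rest of the spectrum (zero if there is none). -/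
def rieszProj (A : H →ₗ.[ℂ] H) (z : ℂ) : H →L[ℂ] H :=
  if h : ∃ r, IsIsolatingRadius A z r then
    (2 * (Real.pi : ℂ) * Complex.I)⁻¹ • ∮ ζ in C(z, h.choose), resolv A ζ
  else 0

/-- `z` is a simple eigenvalue of `A`: an isolated point of the spectrum of algebraic multiplicity
one, that is, whose spectral projection has rank one. -/
def IsSimpleEigenvalue (A : H →ₗ.[ℂ] H) (z : ℂ) : Prop :=
  z ∈ spec A ∧ (∃ r, IsIsolatingRadius A z r) ∧
    Module.finrank ℂ (LinearMap.range (rieszProj A z).toLinearMap) = 1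

end Spectral

end QuadGrowth

end

open QuadGrowth

noncomputable section
namespace QuadGrowth

/-! ## Jordan bases -/

section Jordan

/-! Growth of `Π_α`. This operator has rank one, so its norm is `(α!)⁻¹` times the norm of the
functional `u ↦ ∂^α u(0)` times the norm of `x^α` (`norm_taylorProj`). The weight `Φ†` is the
Legendre transform of `Φ` for the pairing `Re (x̄ · w) / 2` (`dualWeight_legendreMap`, `fenchel`).
Hence the exponential `e^{w̄ · x / 2}` has norm a constant times `e^{Φ†(w)}`, and every element of
`H_Φ` is a superposition of such exponentials with density `⟨u, e_w⟩ e^{-2Φ†(w)}` (`inversion`).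
Differentiating the superposition bounds the functional above by `2^{-|α|} ∫ |w^α| e^{-Φ†}`; testing
on exponentials bounds it below by `2^{-|α|} sup |w^α| e^{-Φ†}`, both up to constants. For `‖x^α‖`
the same roles are played by the integral of `|x^α|² e^{-2Φ}` and by the pointwise bound `|u| ≤ C
e^Φ ‖u‖`. Homogeneity reduces each supremum to one over the unit sphere, the integrals exceed the
suprema by at most powers of `|α|`, and Stirling's formula for `α!` produces the entropy term.

Normal form. The Hamilton map `F` is skew for the symplectic form `σ`, and its failure to be
symmetric for the hermitian form `i σ(X̄, X)` is exactly `Re q`. Nonnegativity of `Re q` and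
triviality of the singular space exclude real eigenvalues and make the hermitian form definite on
the spectral subspaces for the two half-planes (`herm_definite`). These subspaces are Lagrangian. A
Jordan basis of one and its dual basis in the other give the canonical transformation; the image of
real phase space is then a graph, and the definiteness is the strict convexity of the weight
(`exists_isNormalForm`).

Spectral projections. In the normal form variables the Lagrangian condition gives a Gaussian
annihilated by all quantized `ξ_j`. Polynomials in the quantized `x_j` applied to it form a dense
subspace of `L²`. Its scalar product obeys the same algebraic relation as that of polynomials in
`H_Φ`, and this relation determines the scalar product up to a factor (`WeightRelation.inner_eq`).
So `L²` and `H_Φ` are isometric up to scaling on polynomials, with `q^w` acting as `(1/i)(Mx · ∂_x +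
∑ λ_j)`, for which monomials are generalized eigenvectors. A finite Neumann series and the residue
theorem show that the Riesz projection keeps a monomial if its eigenvalue is the given one and kills
it otherwise. Rank one leaves only `x^α`, so the projection is `Π_α` on a dense subspace and the
norms agree. The spectrum as a whole never has to be computed. -/

theorem IsJordanForm.sumBlocks {k m : ℕ} {A : Matrix (Fin k) (Fin k) ℂ}
    {B : Matrix (Fin m) (Fin m) ℂ} (hA : IsJordanForm A) (hB : IsJordanForm B) :
    IsJordanForm ((Matrix.fromBlocks A 0 0 B).reindex finSumFinEquiv finSumFinEquiv) := by
  intro j l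
  induction j using Fin.addCases with
  | left j =>
    induction l using Fin.addCases with
    | left l =>
      simp only [Matrix.reindex_apply, Matrix.submatrix_apply, finSumFinEquiv_symm_apply_castAdd,
        Matrix.fromBlocks_apply₁₁]
      intro hjl h
      have := hA j l (fun h => hjl (by rw [h])) h
      simpa using this
    | right l => simp
  | right j =>
    induction l using Fin.addCases with
    | left l => simp
    | right l =>
      simp only [Matrix.reindex_apply, Matrix.submatrix_apply, finSumFinEquiv_symm_apply_natAdd,
        Matrix.fromBlocks_apply₂₂]
      intro hjl h
      have := hB j l (fun h => hjl (by rw [h])) h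
      simp only [Fin.val_natAdd]
      exact ⟨by omega, this.2⟩

/-- The Jordan block of size `k` with eigenvalue `l`. -/
def jordanBlock (k : ℕ) (l : ℂ) : Matrix (Fin k) (Fin k) ℂ :=
  Matrix.of fun i j => if i = j then l else if (j : ℕ) = i + 1 then 1 else 0

theorem isJordanForm_jordanBlock (k : ℕ) (l : ℂ) : IsJordanForm (jordanBlock k l) := by
  intro i j hij h
  simp only [jordanBlock, Matrix.of_apply, if_neg hij] at h ⊢
  split_ifs at h ⊢ with h1
  · simp [h1]
  · simp at h

variable {V : Type*} [AddCommGroup V] [Module ℂ V]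

/-- An eigenvalue together with a longest Jordan chain for it splits off an invariant complement. -/
theorem exists_jordanChain [FiniteDimensional ℂ V] [Nontrivial V] (S : Module.End ℂ V) :
    ∃ (l : ℂ) (k : ℕ) (c : Fin k → V) (W : Submodule ℂ V), 0 < k ∧
      (∀ j, S (c j) = ∑ i, jordanBlock k l i j • c i) ∧ (∀ x ∈ W, S x ∈ W) ∧
      Submodule.span ℂ (Set.range c) ⊔ W = ⊤ ∧
      Module.finrank ℂ W + k = Module.finrank ℂ V := by
  classical
  obtain ⟨l, hl⟩ := Module.End.exists_eigenvalue S
  set N : Module.End ℂ V := S - algebraMap ℂ _ l with hN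
  -- The least `k` at which the kernels stabilize is the length of the longest Jordan chain for `l`.
  have hex : ∃ k, LinearMap.ker (N ^ k) = LinearMap.ker (N ^ (k + 1)) := by
    obtain ⟨k, -, hk⟩ := Module.End.exists_ker_pow_eq_ker_pow_succ N
    exact ⟨k, hk⟩
  obtain ⟨k, hk, hmin⟩ : ∃ k, LinearMap.ker (N ^ k) = LinearMap.ker (N ^ (k + 1)) ∧
      ∀ j < k, LinearMap.ker (N ^ j) ≠ LinearMap.ker (N ^ (j + 1)) :=
    ⟨Nat.find hex, Nat.find_spec hex, fun j hj => Nat.find_min hex hj⟩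
  have hk0 : k ≠ 0 := by
    rintro rfl
    obtain ⟨x, hx⟩ := hl.exists_hasEigenvector
    have : x ∈ LinearMap.ker (N ^ (0 + 1)) := by
      simp [hN, hx.apply_eq_smul]
    rw [← hk] at this
    exact hx.2 (by simpa using this)
  obtain ⟨k, rfl⟩ := Nat.exists_eq_succ_of_ne_zero hk0
  obtain ⟨v, hv1, hv0⟩ : ∃ v, (N ^ (k + 1)) v = 0 ∧ (N ^ k) v ≠ 0 := by
    by_contra! h
    refine hmin k (Nat.lt_succ_self k) (le_antisymm ?_ fun x hx => ?_)
    · intro x hx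
      rw [LinearMap.mem_ker] at hx ⊢
      rw [pow_succ', Module.End.mul_apply, hx, map_zero]
    · exact LinearMap.mem_ker.2 (h x (LinearMap.mem_ker.1 hx))
  -- If `N^k v = N^{k+1} y`, then `y` is killed by `N^{k+2}`, hence by `N^{k+1}`, which contradicts
  -- `N^k v ≠ 0`. The end of a longest chain therefore cannot be reached by a longer one, and a
  -- functional `φ` can separate it from the range.
  have hnot : (N ^ k) v ∉ LinearMap.range (N ^ (k + 1)) := by
    rintro ⟨y, hy⟩
    have h2 : y ∈ LinearMap.ker (N ^ (k + 1 + 1)) := by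
      rw [LinearMap.mem_ker, pow_succ', Module.End.mul_apply, hy, ← Module.End.mul_apply,
        ← pow_succ', hv1]
    rw [← hk, LinearMap.mem_ker] at h2
    exact hv0 (by rw [← hy, h2])
  obtain ⟨φ, hφ1, hφ0⟩ := Submodule.exists_le_ker_of_notMem hnot
  -- The complement is the common kernel of `φ, φ N, …, φ N^k`. It is invariant because `φ N^{k+1} =
  -- 0`, and `Θ` on the chain is triangular with diagonal `φ (N^k v) ≠ 0`, so the chain and the
  -- kernel together span.
  set Θ : V →ₗ[ℂ] (Fin (k + 1) → ℂ) := LinearMap.pi fun i => φ ∘ₗ (N ^ (i : ℕ)) with hΘ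
  have hΘa : ∀ x i, Θ x i = φ ((N ^ (i : ℕ)) x) := fun x i => rfl
  set c : Fin (k + 1) → V := fun i => (N ^ (k - i : ℕ)) v with hc
  have hvanish : ∀ m, k < m → (N ^ m) v = 0 := by
    intro m hm
    obtain ⟨d, rfl⟩ := Nat.exists_eq_add_of_lt hm
    rw [show k + d + 1 = d + (k + 1) by ring, pow_add, Module.End.mul_apply, hv1, map_zero]
  set T : Matrix (Fin (k + 1)) (Fin (k + 1)) ℂ := Matrix.of fun i j => Θ (c j) i with hT
  have hTt : T.BlockTriangular id := by
    intro i j hij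
    simp only [hT, Matrix.of_apply, hΘa, hc, ← Module.End.mul_apply, ← pow_add, id] at hij ⊢
    rw [hvanish, map_zero]
    have : (j : ℕ) < i := hij
    omega
  have hTdet : T.det ≠ 0 := by
    rw [Matrix.det_of_isUpperTriangular hTt, Finset.prod_ne_zero_iff]
    intro i _
    simp only [hT, Matrix.of_apply, hΘa, hc, ← Module.End.mul_apply, ← pow_add]
    rwa [show (i : ℕ) + (k - i) = k by omega]
  have hcomb : ∀ y : Fin (k + 1) → ℂ, ∃ a : Fin (k + 1) → ℂ, Θ (∑ j, a j • c j) = y := by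
    intro y
    refine ⟨T⁻¹ *ᵥ y, ?_⟩
    have h1 : ∀ a : Fin (k + 1) → ℂ, Θ (∑ j, a j • c j) = T *ᵥ a := by
      intro a
      ext i
      simp [Matrix.mulVec, dotProduct, hT, mul_comm]
    rw [h1, Matrix.mulVec_mulVec, Matrix.mul_nonsing_inv _ (Ne.isUnit hTdet), Matrix.one_mulVec]
  have hsurj : Function.Surjective Θ := fun y => ⟨_, (hcomb y).choose_spec⟩
  refine ⟨l, k + 1, c, LinearMap.ker Θ, k.succ_pos, ?_, ?_, ?_, ?_⟩
  · intro j
    have hS : S (c j) = l • c j + N (c j) := by simp [hN]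
    have hNc : N (c j) = ∑ i : Fin (k + 1), (if (j : ℕ) = i + 1 then (1 : ℂ) else 0) • c i := by
      rcases Nat.eq_zero_or_pos (j : ℕ) with h0 | h0
      · rw [Finset.sum_eq_zero]
        · simp only [hc, h0, Nat.sub_zero, ← Module.End.mul_apply, ← pow_succ', hv1]
        · intro i _
          rw [if_neg (by omega), zero_smul]
      · rw [Finset.sum_eq_single (⟨j - 1, by omega⟩ : Fin (k + 1))]
        · rw [if_pos (by simp; omega), one_smul]
          simp only [hc, ← Module.End.mul_apply, ← pow_succ']
          congr 2
          have := j.2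
          omega
        · intro i _ hi
          rw [if_neg, zero_smul]
          intro h
          exact hi (Fin.ext (by simp; omega))
        · simp
    rw [hS, hNc]
    have : l • c j = ∑ i, (if i = j then l else 0) • c i := by simp [ite_smul]
    rw [this, ← Finset.sum_add_distrib]
    refine Finset.sum_congr rfl fun i _ => ?_
    rw [← add_smul]
    congr 1
    simp only [jordanBlock, Matrix.of_apply]
    by_cases hij : i = j
    · simp [hij]
    · simp [hij]
  · intro x hx
    have hN' : N x ∈ LinearMap.ker Θ := by
      rw [LinearMap.mem_ker] at hx ⊢
      ext i
      rw [hΘa, ← Module.End.mul_apply, ← pow_succ]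
      by_cases hi : (i : ℕ) < k
      · exact (hΘa x ⟨i + 1, by omega⟩).symm.trans (by rw [hx]; rfl)
      · have : (i : ℕ) + 1 = k + 1 := by omega
        rw [this]
        exact hφ0 ⟨x, rfl⟩
    have : S x = N x + l • x := by simp [hN]
    rw [this]
    exact Submodule.add_mem _ hN' (Submodule.smul_mem _ _ hx)
  · rw [eq_top_iff]
    intro x _
    obtain ⟨a, ha⟩ := hcomb (Θ x)
    refine Submodule.mem_sup.2 ⟨∑ j, a j • c j, ?_, x - ∑ j, a j • c j, ?_, by abel⟩
    · exact Submodule.sum_mem _ fun j _ =>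
        Submodule.smul_mem _ _ (Submodule.subset_span ⟨j, rfl⟩)
    · rw [LinearMap.mem_ker, map_sub, ha, sub_self]
  · have := LinearMap.finrank_range_add_finrank_ker Θ
    rw [LinearMap.range_eq_top.2 hsurj, finrank_top, Module.finrank_fin_fun] at this
    omega

/-- Induction on the dimension, over all invariant subspaces of a fixed space, so that the
complement of a longest chain is again an instance of the statement. -/
theorem exists_jordanBasis_aux [FiniteDimensional ℂ V] (T : Module.End ℂ V) (m : ℕ) :
    ∀ W : Submodule ℂ V, Module.finrank ℂ W = m → (∀ x ∈ W, T x ∈ W) →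
      ∃ (b : Fin m → V) (M : Matrix (Fin m) (Fin m) ℂ), Submodule.span ℂ (Set.range b) = W ∧
        IsJordanForm M ∧ ∀ k, T (b k) = ∑ j, M j k • b j := by
  induction m using Nat.strong_induction_on with
  | _ m ih =>
  intro W hW hT
  rcases Nat.eq_zero_or_pos m with rfl | hm
  · refine ⟨Fin.elim0, 0, ?_, fun j => j.elim0, fun j => j.elim0⟩
    rw [Submodule.finrank_eq_zero] at hW
    simp [hW]
  have : Nontrivial W := Module.nontrivial_of_finrank_pos (R := ℂ) (hW ▸ hm)
  obtain ⟨l, k, c, W', hk, hc, hW', htop, hrank⟩ := exists_jordanChain (T.restrict hT)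
  obtain ⟨b', M', hb', hM', hTb'⟩ := ih (Module.finrank ℂ W') (by omega)
    (W'.map W.subtype) (Submodule.finrank_map_subtype_eq W W') (by
      rintro _ ⟨x, hx, rfl⟩
      exact ⟨T.restrict hT x, hW' x hx, rfl⟩)
  obtain rfl : m = k + Module.finrank ℂ W' := by omega
  have hcV : ∀ j, T (c j : V) = ∑ i, jordanBlock k l i j • (c i : V) := by
    intro j
    have := congrArg W.subtype (hc j)
    simpa using this
  refine ⟨Fin.append (fun i => (c i : V)) b', _, ?_,
    (isJordanForm_jordanBlock k l).sumBlocks hM', ?_⟩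
  · have hr : Set.range (Fin.append (fun i => (c i : V)) b') =
        Set.range (fun i => (c i : V)) ∪ Set.range b' := by
      ext x
      constructor
      · rintro ⟨j, rfl⟩
        induction j using Fin.addCases with
        | left j => simp
        | right j => simp
      · rintro (⟨j, rfl⟩ | ⟨j, rfl⟩)
        · exact ⟨Fin.castAdd _ j, by simp⟩
        · exact ⟨Fin.natAdd _ j, by simp⟩
    rw [hr, Submodule.span_union, hb']
    have h1 : Submodule.span ℂ (Set.range fun i => (c i : V)) =
        (Submodule.span ℂ (Set.range c)).map W.subtype := by
      rw [Submodule.map_span, ← Set.range_comp]; rfl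
    rw [h1, ← Submodule.map_sup, htop, Submodule.map_top, Submodule.range_subtype]
  · intro j
    rw [Fin.sum_univ_add]
    induction j using Fin.addCases with
    | left j => simp [hcV]
    | right j => simp [hTb']

theorem exists_jordanBasis [FiniteDimensional ℂ V] (T : Module.End ℂ V) (W : Submodule ℂ V) (m : ℕ)
    (hW : Module.finrank ℂ W = m) (hT : ∀ x ∈ W, T x ∈ W) :
    ∃ (b : Fin m → V) (M : Matrix (Fin m) (Fin m) ℂ), LinearIndependent ℂ b ∧
      Submodule.span ℂ (Set.range b) = W ∧
        IsJordanForm M ∧ ∀ k, T (b k) = ∑ j, M j k • b j := by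
  obtain ⟨b, M, hb, h⟩ := exists_jordanBasis_aux T m W hW hT
  refine ⟨b, M, ?_, hb, h⟩
  rw [linearIndependent_iff_card_eq_finrank_span, Set.finrank, hb, hW, Fintype.card_fin]

end Jordan

end QuadGrowth
end

noncomputable section
namespace QuadGrowth

/-! ## Real quadratic forms on `ℂⁿ` -/

section WeightBasics

open QuadraticMap

variable {n : ℕ} (Φ : QuadraticForm ℝ (Fin n → ℂ))

theorem bil_eq (u v : Fin n → ℂ) : bil Φ u v = ((polar Φ u v : ℝ) : ℂ) := rfl

theorem eq_sum_e (x : Fin n → ℂ) : x = ∑ j, ((x j).re • e j + (x j).im • ie j) := by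
  ext k
  simp only [Finset.sum_apply, Pi.add_apply, Pi.smul_apply, e, ie, Pi.single_apply]
  rw [Finset.sum_eq_single k]
  · simp [Complex.re_add_im]
  · intro j _ hj
    simp [hj.symm]
  · simp

theorem polar_sum_right (x v : Fin n → ℂ) :
    polar Φ x v = ∑ j, ((v j).re * polar Φ x (e j) + (v j).im * polar Φ x (ie j)) := by
  conv_lhs => rw [eq_sum_e v]
  rw [← QuadraticMap.polarBilin_apply_apply, map_sum]
  simp [map_add, map_smul]

theorem gradX_re (x : Fin n → ℂ) (j : Fin n) : (gradX Φ x j).re = (1 / 2) * polar Φ x (e j) := by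
  simp [gradX, bil_eq]

theorem gradX_im (x : Fin n → ℂ) (j : Fin n) :
    (gradX Φ x j).im = -(1 / 2) * polar Φ x (ie j) := by
  simp [gradX, bil_eq]

/-- The derivative of `Φ` at `x` in the direction `v` is `2 Re (v · ∂_x Φ(x))`. -/
theorem polar_eq_gradX (x v : Fin n → ℂ) : polar Φ x v = 2 * (v ⬝ᵥ gradX Φ x).re := by
  rw [polar_sum_right, dotProduct, Complex.re_sum, Finset.mul_sum]
  refine Finset.sum_congr rfl fun j _ => ?_
  rw [Complex.mul_re, gradX_re, gradX_im]
  ring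

/-- Euler's identity for a function homogeneous of degree two. -/
theorem two_mul_apply_eq_gradX (x : Fin n → ℂ) : Φ x = (x ⬝ᵥ gradX Φ x).re := by
  have := polar_eq_gradX Φ x x
  rw [QuadraticMap.polar_self, two_nsmul] at this
  linarith

theorem gradX_apply (x : Fin n → ℂ) (j : Fin n) :
    gradX Φ x j = ∑ k, (hessXX Φ j k * x k + hessBarX Φ k j * star (x k)) := by
  have h1 : ∀ v : Fin n → ℂ, ((polar Φ x v : ℝ) : ℂ) =
      ∑ k, (((x k).re : ℂ) * polar Φ v (e k) + ((x k).im : ℂ) * polar Φ v (ie k)) := by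
    intro v
    rw [QuadraticMap.polar_comm, polar_sum_right]
    push_cast
    rfl
  rw [gradX, bil_eq, bil_eq, h1, h1, Finset.mul_sum, ← Finset.sum_sub_distrib, Finset.mul_sum]
  refine Finset.sum_congr rfl fun k _ => ?_
  simp only [hessXX, hessBarX, Matrix.of_apply, bil_eq]
  rw [QuadraticMap.polar_comm Φ (e k) (e j), QuadraticMap.polar_comm Φ (ie k) (ie j),
    QuadraticMap.polar_comm Φ (ie k) (e j), QuadraticMap.polar_comm Φ (e k) (ie j)]
  have hx : x k = ((x k).re : ℂ) + ((x k).im : ℂ) * Complex.I := (Complex.re_add_im _).symm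
  have hx' : star (x k) = ((x k).re : ℂ) - ((x k).im : ℂ) * Complex.I := by
    rw [Complex.star_def]
    apply Complex.ext <;> simp
  rw [hx', hx]
  simp only [Complex.add_re, Complex.ofReal_re, Complex.mul_re, Complex.I_re, Complex.ofReal_im,
    Complex.I_im, Complex.add_im, Complex.mul_im, mul_zero, mul_one, sub_zero, add_zero,
    zero_add]
  have hI := Complex.I_sq
  ring_nf
  rw [hI]
  ring

theorem gradX_eq (x : Fin n → ℂ) :
    gradX Φ x = hessXX Φ *ᵥ x + (hessBarX Φ)ᵀ *ᵥ star x := by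
  ext j
  rw [gradX_apply, Finset.sum_add_distrib]
  rfl

theorem gradX_add (x y : Fin n → ℂ) : gradX Φ (x + y) = gradX Φ x + gradX Φ y := by
  simp only [gradX_eq, star_add, Matrix.mulVec_add]
  abel

theorem gradX_smul (c : ℝ) (x : Fin n → ℂ) : gradX Φ (c • x) = c • gradX Φ x := by
  simp [gradX_eq, Matrix.mulVec_smul]

theorem hessXX_transpose : (hessXX Φ)ᵀ = hessXX Φ := by
  ext j k
  simp only [Matrix.transpose_apply, hessXX, Matrix.of_apply, bil_eq]
  rw [QuadraticMap.polar_comm Φ (e k) (e j), QuadraticMap.polar_comm Φ (ie k) (ie j),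
    QuadraticMap.polar_comm Φ (ie k) (e j), QuadraticMap.polar_comm Φ (e k) (ie j)]
  ring

theorem hessBarX_conjTranspose : (hessBarX Φ)ᴴ = hessBarX Φ := by
  ext j k
  simp only [Matrix.conjTranspose_apply, hessBarX, Matrix.of_apply, bil_eq]
  rw [QuadraticMap.polar_comm Φ (e k) (e j), QuadraticMap.polar_comm Φ (ie k) (ie j),
    QuadraticMap.polar_comm Φ (ie k) (e j), QuadraticMap.polar_comm Φ (e k) (ie j)]
  simp
  ring

/-- The holomorphic quadratic form `Φ''_{xx} x · x`. -/
def holPart (x : Fin n → ℂ) : ℂ := x ⬝ᵥ (hessXX Φ *ᵥ x)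

theorem dot_gradX (x : Fin n → ℂ) :
    x ⬝ᵥ gradX Φ x = holPart Φ x + star x ⬝ᵥ (hessBarX Φ *ᵥ x) := by
  rw [gradX_eq, dotProduct_add, holPart, Matrix.mulVec_transpose, 
    Matrix.dotProduct_mulVec (star x), dotProduct_comm x (_ ᵥ* _)]

theorem hermPart_im (x : Fin n → ℂ) : (star x ⬝ᵥ (hessBarX Φ *ᵥ x)).im = 0 := by
  have h : star (star x ⬝ᵥ (hessBarX Φ *ᵥ x)) = star x ⬝ᵥ (hessBarX Φ *ᵥ x) := by
    rw [← Matrix.star_dotProduct_star, star_star, Matrix.star_mulVec, hessBarX_conjTranspose,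
      ← Matrix.dotProduct_mulVec]
  exact Complex.conj_eq_iff_im.1 h

theorem holPart_I_smul (x : Fin n → ℂ) : holPart Φ (Complex.I • x) = -holPart Φ x := by
  simp only [holPart, Matrix.mulVec_smul, smul_dotProduct, dotProduct_smul, smul_smul,
    Complex.I_mul_I]
  simp

theorem hermPart_smul (c : ℂ) (hc : ‖c‖ = 1) (x : Fin n → ℂ) :
    star (c • x) ⬝ᵥ (hessBarX Φ *ᵥ (c • x)) = star x ⬝ᵥ (hessBarX Φ *ᵥ x) := by
  simp only [star_smul, Matrix.mulVec_smul, smul_dotProduct, dotProduct_smul, smul_smul]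
  have : c * star c = 1 := by
    rw [mul_comm, Complex.star_def, ← Complex.normSq_eq_conj_mul_self, Complex.normSq_eq_norm_sq, hc]; simp
  rw [this, one_smul]

theorem apply_eq_parts (x : Fin n → ℂ) :
    Φ x = (holPart Φ x).re + (star x ⬝ᵥ (hessBarX Φ *ᵥ x)).re := by
  rw [two_mul_apply_eq_gradX, dot_gradX, Complex.add_re]

/-- Multiplication by `i` reverses the pluriharmonic part of `Φ` and fixes its Hermitian part;
comparing `Φ(x)` with `Φ(ix)` therefore separates the two. -/
theorem apply_I_smul (x : Fin n → ℂ) :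
    Φ (Complex.I • x) = -(holPart Φ x).re + (star x ⬝ᵥ (hessBarX Φ *ᵥ x)).re := by
  rw [apply_eq_parts, holPart_I_smul, hermPart_smul Φ _ Complex.norm_I, Complex.neg_re]

theorem polar_I_smul (x : Fin n → ℂ) : polar Φ x (Complex.I • x) = -2 * (holPart Φ x).im := by
  rw [polar_eq_gradX, smul_dotProduct, dot_gradX, smul_eq_mul, Complex.I_mul_re, Complex.add_im,
    hermPart_im]
  ring

/-- Strict convexity is used only at the midpoint of `x` and `-x`. -/
theorem posDef_of_strictConvexOn (h : StrictConvexOn ℝ Set.univ Φ) : Φ.PosDef := by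
  intro x hx
  have hne : x ≠ -x := fun h' => hx (self_eq_neg.1 h')
  have := h.2 (Set.mem_univ x) (Set.mem_univ (-x)) hne (show (0 : ℝ) < 1 / 2 by norm_num)
    (show (0 : ℝ) < 1 / 2 by norm_num) (by norm_num)
  have h0 : (1 / 2 : ℝ) • x + (1 / 2 : ℝ) • -x = 0 := by simp
  rw [h0, map_zero, QuadraticMap.map_neg, smul_eq_mul] at this
  linarith

/-- The convexity defect `a Φ(x) + b Φ(y) - Φ(ax + by)` equals `a b Φ(x - y)` when `a + b = 1`. -/
theorem strictConvexOn_of_posDef (h : Φ.PosDef) : StrictConvexOn ℝ Set.univ Φ := by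
  refine ⟨convex_univ, fun x _ y _ hxy a b ha hb hab => ?_⟩
  have h1 := h (x - y) (sub_ne_zero.2 hxy)
  have h2 : Φ (x - y) = Φ x + Φ y - polar Φ x y := by
    have := QuadraticMap.map_add Φ x (-y)
    rw [← sub_eq_add_neg, QuadraticMap.map_neg, QuadraticMap.polar_neg_right] at this
    linarith
  have h3 : Φ (a • x + b • y) = a * a * Φ x + b * b * Φ y + a * b * polar Φ x y := by
    rw [QuadraticMap.map_add Φ, QuadraticMap.map_smul, QuadraticMap.map_smul,
      QuadraticMap.polar_smul_left, QuadraticMap.polar_smul_right]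
    simp only [smul_eq_mul]; ring
  rw [h3, smul_eq_mul, smul_eq_mul]
  obtain rfl : b = 1 - a := by linarith
  have : 0 < a * (1 - a) * Φ (x - y) := by positivity
  rw [h2] at this
  nlinarith [this]

end WeightBasics

end QuadGrowth
end

noncomputable section
namespace QuadGrowth

/-! ## The symplectic form and the Hamilton map -/

section Hamilton

variable {n : ℕ}

/-- The symplectic form `σ((x, ξ), (y, η)) = ξ · y - x · η`. -/
def sympl (X Y : Fin n ⊕ Fin n → ℂ) : ℂ := X ⬝ᵥ (Matrix.J (Fin n) ℂ *ᵥ Y)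

theorem star_dotProduct_mulVec {ι : Type*} [Fintype ι] (A : Matrix ι ι ℂ) (X Y : ι → ℂ) :
    star (X ⬝ᵥ (A *ᵥ Y)) = star X ⬝ᵥ (A.map star *ᵥ star Y) := by
  simp [dotProduct, Matrix.mulVec]

theorem dotProduct_mulVec_comm {ι : Type*} [Fintype ι] {A : Matrix ι ι ℂ} (hA : A.IsSymm)
    (X Y : ι → ℂ) : X ⬝ᵥ (A *ᵥ Y) = Y ⬝ᵥ (A *ᵥ X) := by
  rw [Matrix.dotProduct_mulVec, dotProduct_comm, ← Matrix.mulVec_transpose, hA.eq]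

theorem isSymm_map_star {ι : Type*} {A : Matrix ι ι ℂ} (hA : A.IsSymm) :
    (A.map star).IsSymm := by
  ext a b
  simp only [Matrix.transpose_apply, Matrix.map_apply]
  rw [hA.apply]

theorem sympl_add_left (X Y Z : Fin n ⊕ Fin n → ℂ) :
    sympl (X + Y) Z = sympl X Z + sympl Y Z := add_dotProduct _ _ _

theorem sympl_add_right (X Y Z : Fin n ⊕ Fin n → ℂ) :
    sympl X (Y + Z) = sympl X Y + sympl X Z := by
  simp only [sympl, Matrix.mulVec_add, dotProduct_add]

theorem sympl_smul_left (c : ℂ) (X Y : Fin n ⊕ Fin n → ℂ) :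
    sympl (c • X) Y = c * sympl X Y := smul_dotProduct _ _ _

theorem sympl_smul_right (c : ℂ) (X Y : Fin n ⊕ Fin n → ℂ) :
    sympl X (c • Y) = c * sympl X Y := by
  simp only [sympl, Matrix.mulVec_smul, dotProduct_smul, smul_eq_mul]

/-- `sympl` as a bilinear form. -/
def symplB : (Fin n ⊕ Fin n → ℂ) →ₗ[ℂ] (Fin n ⊕ Fin n → ℂ) →ₗ[ℂ] ℂ :=
  LinearMap.mk₂ ℂ sympl sympl_add_left sympl_smul_left sympl_add_right sympl_smul_right

theorem sympl_swap (X Y : Fin n ⊕ Fin n → ℂ) : sympl X Y = -sympl Y X := by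
  rw [sympl, Matrix.dotProduct_mulVec, dotProduct_comm, ← Matrix.mulVec_transpose,
    Matrix.J_transpose, Matrix.neg_mulVec, dotProduct_neg]
  rfl

theorem sympl_eq (X Y : Fin n ⊕ Fin n → ℂ) :
    sympl X Y = (fun j => X (Sum.inr j)) ⬝ᵥ (fun j => Y (Sum.inl j)) -
      (fun j => X (Sum.inl j)) ⬝ᵥ (fun j => Y (Sum.inr j)) := by
  have hY : Y = Sum.elim (Y ∘ Sum.inl) (Y ∘ Sum.inr) := by ext (j | j) <;> rfl
  have hX : X = Sum.elim (X ∘ Sum.inl) (X ∘ Sum.inr) := by ext (j | j) <;> rfl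
  conv_lhs => rw [hX, hY]
  rw [sympl, Matrix.J, Matrix.fromBlocks_mulVec, sumElim_dotProduct_sumElim]
  simp only [Matrix.zero_mulVec, Matrix.neg_mulVec, Matrix.one_mulVec, zero_add, add_zero,
    dotProduct_neg, Function.comp_def, Sum.elim_inl, Sum.elim_inr]
  ring

theorem star_sympl (X Y : Fin n ⊕ Fin n → ℂ) : star (sympl X Y) = sympl (star X) (star Y) := by
  simp [sympl_eq, dotProduct]

theorem eq_zero_of_sympl {X : Fin n ⊕ Fin n → ℂ} (h : ∀ Y, sympl X Y = 0) : X = 0 := by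
  ext (j | j)
  · have := h (Pi.single (Sum.inr j) 1)
    rw [sympl_eq] at this
    simpa [dotProduct, Pi.single_apply, Finset.sum_ite_eq] using this
  · have := h (Pi.single (Sum.inl j) 1)
    rw [sympl_eq] at this
    simpa [dotProduct, Pi.single_apply, Finset.sum_ite_eq] using this

variable {Q : Matrix (Fin n ⊕ Fin n) (Fin n ⊕ Fin n) ℂ}

theorem hamiltonMap_eq (Q : Matrix (Fin n ⊕ Fin n) (Fin n ⊕ Fin n) ℂ) :
    hamiltonMap Q = -(Matrix.J (Fin n) ℂ * Q) := by
  conv_rhs => rw [← Matrix.fromBlocks_toBlocks Q]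
  rw [Matrix.J, Matrix.fromBlocks_multiply, hamiltonMap, Matrix.fromBlocks_neg]
  simp

theorem J_mul_hamiltonMap (Q : Matrix (Fin n ⊕ Fin n) (Fin n ⊕ Fin n) ℂ) :
    Matrix.J (Fin n) ℂ * hamiltonMap Q = Q := by
  rw [hamiltonMap_eq, Matrix.mul_neg, ← Matrix.mul_assoc, Matrix.J_squared]
  simp

theorem sympl_hamiltonMap (X Y : Fin n ⊕ Fin n → ℂ) :
    sympl X (hamiltonMap Q *ᵥ Y) = X ⬝ᵥ (Q *ᵥ Y) := by
  rw [sympl, Matrix.mulVec_mulVec, J_mul_hamiltonMap]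

/-- `F` belongs to the symplectic Lie algebra. This skewness is what makes the spectral subspaces of
the two half-planes isotropic. -/
theorem sympl_hamiltonMap_left (hQ : Q.IsSymm) (X Y : Fin n ⊕ Fin n → ℂ) :
    sympl (hamiltonMap Q *ᵥ X) Y = -sympl X (hamiltonMap Q *ᵥ Y) := by
  rw [sympl_swap, sympl_hamiltonMap, sympl_hamiltonMap, Matrix.dotProduct_mulVec, dotProduct_comm,
    ← Matrix.mulVec_transpose, hQ.eq]

/-- The hermitian form `i σ(X̄, Y)`. -/
def herm (X Y : Fin n ⊕ Fin n → ℂ) : ℂ := Complex.I * sympl (star X) Y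

theorem herm_add_left (X Y Z : Fin n ⊕ Fin n → ℂ) : herm (X + Y) Z = herm X Z + herm Y Z := by
  rw [herm, star_add, sympl_add_left, mul_add]; rfl

theorem herm_add_right (X Y Z : Fin n ⊕ Fin n → ℂ) : herm X (Y + Z) = herm X Y + herm X Z := by
  rw [herm, sympl_add_right, mul_add]; rfl

theorem herm_smul_left (c : ℂ) (X Y : Fin n ⊕ Fin n → ℂ) : herm (c • X) Y = star c * herm X Y := by
  rw [herm, star_smul, sympl_smul_left, herm]; ring

theorem herm_smul_right (c : ℂ) (X Y : Fin n ⊕ Fin n → ℂ) : herm X (c • Y) = c * herm X Y := by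
  rw [herm, sympl_smul_right, herm]; ring

theorem star_herm (X Y : Fin n ⊕ Fin n → ℂ) : star (herm X Y) = herm Y X := by
  rw [herm, star_mul', star_sympl, star_star, sympl_swap, Complex.star_def, Complex.conj_I, herm]
  ring

theorem herm_self_im (X : Fin n ⊕ Fin n → ℂ) : (herm X X).im = 0 :=
  Complex.conj_eq_iff_im.1 (star_herm X X)

/-- The matrix of `2 Re q`. -/
def twoRe (Q : Matrix (Fin n ⊕ Fin n) (Fin n ⊕ Fin n) ℂ) :
    Matrix (Fin n ⊕ Fin n) (Fin n ⊕ Fin n) ℂ := Q + Q.map star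

/-- If `q` were purely imaginary, `F` would be symmetric for the hermitian form. The defect is `Re
q`, which is how a sign of `Re q` controls imaginary parts of eigenvalues. -/
theorem herm_hamiltonMap (hQ : Q.IsSymm) (X Y : Fin n ⊕ Fin n → ℂ) :
    herm X (hamiltonMap Q *ᵥ Y) - herm (hamiltonMap Q *ᵥ X) Y =
      Complex.I * (star X ⬝ᵥ (twoRe Q *ᵥ Y)) := by
  have h2 : herm (hamiltonMap Q *ᵥ X) Y = -(Complex.I * (star X ⬝ᵥ (Q.map star *ᵥ Y))) := by
    rw [← star_herm, herm, sympl_hamiltonMap, star_mul', Complex.star_def, Complex.conj_I,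
      ← Complex.star_def, star_dotProduct_mulVec, star_star,
      dotProduct_mulVec_comm (isSymm_map_star hQ), neg_mul]
  rw [h2, herm, sympl_hamiltonMap, twoRe, Matrix.add_mulVec, dotProduct_add]
  ring

open scoped ComplexOrder in
-- The matrix is real and symmetric, so its value at `a + i b` is the sum of its values at the real
-- vectors `a` and `b`.
theorem twoRe_posSemidef (hQ : Q.IsSymm) (hre : ReNonneg Q) : (twoRe Q).PosSemidef := by
  have hT : (twoRe Q)ᵀ = twoRe Q := by
    rw [twoRe, Matrix.transpose_add, hQ.eq, (isSymm_map_star hQ).eq]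
  have hst : ∀ a b, star (twoRe Q a b) = twoRe Q a b := by
    intro a b
    simp [twoRe, add_comm]
  have hH : (twoRe Q).IsHermitian := by
    ext a b
    rw [Matrix.conjTranspose_apply, hst, ← Matrix.transpose_apply (twoRe Q), hT]
  have hreal : ∀ X : Fin n ⊕ Fin n → ℝ, toC X ⬝ᵥ (twoRe Q *ᵥ toC X) =
      ((2 * (symbol Q (toC X)).re : ℝ) : ℂ) := by
    intro X
    have h1 : star (toC X) = toC X := by ext a; simp [toC]
    have h2 : toC X ⬝ᵥ (Q.map star *ᵥ toC X) = star (symbol Q (toC X)) := by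
      rw [symbol, star_dotProduct_mulVec, h1]
    rw [twoRe, Matrix.add_mulVec, dotProduct_add, h2, Complex.star_def]
    exact Complex.add_conj _
  refine Matrix.PosSemidef.of_dotProduct_mulVec_nonneg hH fun X => ?_
  set a : Fin n ⊕ Fin n → ℝ := fun j => (X j).re
  set b : Fin n ⊕ Fin n → ℝ := fun j => (X j).im
  have hX : X = toC a + Complex.I • toC b := by
    ext j
    simp only [toC, a, b, Pi.add_apply, Pi.smul_apply, smul_eq_mul]
    rw [mul_comm]
    exact (Complex.re_add_im _).symm
  have hX' : star X = toC a - Complex.I • toC b := by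
    rw [hX]
    ext j
    simp [toC, sub_eq_add_neg]
  have hsym : toC b ⬝ᵥ (twoRe Q *ᵥ toC a) = toC a ⬝ᵥ (twoRe Q *ᵥ toC b) := by
    rw [Matrix.dotProduct_mulVec, dotProduct_comm, ← Matrix.mulVec_transpose, hT]
  have : star X ⬝ᵥ (twoRe Q *ᵥ X) = toC a ⬝ᵥ (twoRe Q *ᵥ toC a) +
      toC b ⬝ᵥ (twoRe Q *ᵥ toC b) := by
    rw [hX', hX]
    simp only [Matrix.mulVec_add, Matrix.mulVec_smul, sub_dotProduct, dotProduct_add,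
      smul_dotProduct, dotProduct_smul, hsym, smul_eq_mul]
    linear_combination -(toC b ⬝ᵥ (twoRe Q *ᵥ toC b)) * Complex.I_mul_I
  rw [this, hreal, hreal, ← Complex.ofReal_add, Complex.zero_le_real]
  have := hre a
  have := hre b
  linarith

theorem twoRe_mulVec_eq_zero (hQ : Q.IsSymm) (hre : ReNonneg Q) {X : Fin n ⊕ Fin n → ℂ}
    (h : star X ⬝ᵥ (twoRe Q *ᵥ X) = 0) : twoRe Q *ᵥ X = 0 := by
  classical
  exact ((twoRe_posSemidef hQ hre).dotProduct_mulVec_zero_iff X).1 h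

open scoped ComplexOrder in
theorem dot_twoRe_nonneg (hQ : Q.IsSymm) (hre : ReNonneg Q) (X : Fin n ⊕ Fin n → ℂ) :
    0 ≤ (star X ⬝ᵥ (twoRe Q *ᵥ X)).re := by
  classical
  exact (Complex.le_def.1 ((twoRe_posSemidef hQ hre).dotProduct_mulVec_nonneg X)).1

open scoped ComplexOrder in
theorem twoRe_posSemidef_im (hQ : Q.IsSymm) (hre : ReNonneg Q) (X : Fin n ⊕ Fin n → ℂ) :
    (star X ⬝ᵥ (twoRe Q *ᵥ X)).im = 0 :=
  (Complex.le_def.1 ((twoRe_posSemidef hQ hre).dotProduct_mulVec_nonneg X)).2.symm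

theorem ofReal_mulVec_re (A : Matrix (Fin n ⊕ Fin n) (Fin n ⊕ Fin n) ℝ) (X : Fin n ⊕ Fin n → ℂ) :
    A *ᵥ (fun a => (X a).re) = fun a => ((A.map Complex.ofReal *ᵥ X) a).re := by
  ext a; simp [Matrix.mulVec, dotProduct]

theorem ofReal_mulVec_im (A : Matrix (Fin n ⊕ Fin n) (Fin n ⊕ Fin n) ℝ) (X : Fin n ⊕ Fin n → ℂ) :
    A *ᵥ (fun a => (X a).im) = fun a => ((A.map Complex.ofReal *ᵥ X) a).im := by
  ext a; simp [Matrix.mulVec, dotProduct]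

/-- A vector whose orbit under the Hamilton map is annihilated by `Re q` vanishes. -/
theorem eq_zero_of_orbit (hs : TrivialSingularSpace Q) {X : Fin n ⊕ Fin n → ℂ}
    (h : ∀ k : ℕ, twoRe Q *ᵥ (hamiltonMap Q ^ k *ᵥ X) = 0) : X = 0 := by
  set F := hamiltonMap Q with hF
  set F1 : Matrix (Fin n ⊕ Fin n) (Fin n ⊕ Fin n) ℂ := (F.map Complex.re).map Complex.ofReal
  set F2 : Matrix (Fin n ⊕ Fin n) (Fin n ⊕ Fin n) ℂ := (F.map Complex.im).map Complex.ofReal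
  have hdec : F = F1 + Complex.I • F2 := by
    ext a b
    simp only [F1, F2, Matrix.add_apply, Matrix.map_apply, Matrix.smul_apply, smul_eq_mul]
    rw [mul_comm]
    exact (Complex.re_add_im _).symm
  have hF1 : (2 : ℂ) • F1 = -(Matrix.J (Fin n) ℂ * twoRe Q) := by
    have h1 : (2 : ℂ) • F1 = F + F.map star := by
      ext a b
      simp only [F1, Matrix.smul_apply, Matrix.add_apply, Matrix.map_apply, smul_eq_mul]
      exact (Complex.add_conj _).symm.trans rfl |>.symm ▸ by push_cast; rfl
    have h2 : F.map star = -(Matrix.J (Fin n) ℂ * Q.map star) := by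
      rw [← hamiltonMap_eq, hF]
      ext (a | a) (b | b) <;> simp [hamiltonMap, Matrix.toBlocks₁₁, Matrix.toBlocks₁₂,
        Matrix.toBlocks₂₁, Matrix.toBlocks₂₂]
    rw [h1, h2, hF, hamiltonMap_eq, twoRe, Matrix.mul_add, neg_add]
  have hF1k : ∀ k : ℕ, F1 *ᵥ (F ^ k *ᵥ X) = 0 := by
    intro k
    have h2 : (2 : ℂ) • (F1 *ᵥ (F ^ k *ᵥ X)) = 0 := by
      rw [← Matrix.smul_mulVec, hF1, Matrix.neg_mulVec, ← Matrix.mulVec_mulVec, h k]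
      simp
    exact (smul_eq_zero.1 h2).resolve_left two_ne_zero
  -- Since `Re F` kills every vector of the orbit, `F` acts along it as `i Im F`; the hypothesis on
  -- the orbit thus becomes the defining condition of the singular space, for the real and imaginary
  -- parts of `X` separately.
  have hpow : ∀ k : ℕ, F ^ k *ᵥ X = Complex.I ^ k • (F2 ^ k *ᵥ X) := by
    intro k
    induction k with
    | zero => simp
    | succ k ih =>
      rw [pow_succ', ← Matrix.mulVec_mulVec]
      have h3 : F *ᵥ (F ^ k *ᵥ X) = F1 *ᵥ (F ^ k *ᵥ X) + (Complex.I • F2) *ᵥ (F ^ k *ᵥ X) := by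
        rw [← Matrix.add_mulVec, ← hdec]
      rw [h3, hF1k, zero_add, ih, Matrix.mulVec_smul, Matrix.smul_mulVec, smul_smul,
        Matrix.mulVec_mulVec, ← pow_succ', ← pow_succ]
  have hk : ∀ k : ℕ, (F.map Complex.re * F.map Complex.im ^ k).map Complex.ofReal *ᵥ X = 0 := by
    intro k
    have h1 : (F.map Complex.re * F.map Complex.im ^ k).map Complex.ofReal = F1 * F2 ^ k := by
      have := (Complex.ofRealHom.mapMatrix (m := Fin n ⊕ Fin n)).map_mul (F.map Complex.re)
        (F.map Complex.im ^ k)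
      rw [map_pow] at this
      exact this
    have h2 := hF1k k
    rw [hpow, Matrix.mulVec_smul] at h2
    rw [h1, ← Matrix.mulVec_mulVec]
    exact (smul_eq_zero.1 h2).resolve_left (pow_ne_zero _ Complex.I_ne_zero)
  have hre0 := hs (fun a => (X a).re) fun k => by
    rw [ofReal_mulVec_re, hk]; rfl
  have him0 := hs (fun a => (X a).im) fun k => by
    rw [ofReal_mulVec_im, hk]; rfl
  ext a
  exact Complex.ext (congrFun hre0 a) (congrFun him0 a)

end Hamilton

end QuadGrowth
end

noncomputable section
namespace QuadGrowth

/-! ### Definiteness of the hermitian form on spectral subspaces -/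

section Definite

variable {n : ℕ} {Q : Matrix (Fin n ⊕ Fin n) (Fin n ⊕ Fin n) ℂ}

/-- `herm` as a linear form in its second argument. -/
def hermL (X : Fin n ⊕ Fin n → ℂ) : (Fin n ⊕ Fin n → ℂ) →ₗ[ℂ] ℂ :=
  Complex.I • symplB (star X)

/-- The diagonal of `herm_hamiltonMap`. The hypothesis asks for the eigenvalue equation only after
pairing with `X`, so it also covers vectors that are eigenvectors modulo their orthogonal
complement. -/
theorem im_mul_herm (hQ : Q.IsSymm) {X : Fin n ⊕ Fin n → ℂ} {l : ℂ}
    (h1 : herm X (hamiltonMap Q *ᵥ X) = l * herm X X) :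
    2 * l.im * (herm X X).re = (star X ⬝ᵥ (twoRe Q *ᵥ X)).re := by
  have h2 : herm (hamiltonMap Q *ᵥ X) X = star l * herm X X := by
    rw [← star_herm, h1, star_mul', star_herm]
  have h3 := herm_hamiltonMap hQ X X
  rw [h1, h2] at h3
  have h4 := congrArg Complex.im h3
  simp only [Complex.sub_im, Complex.mul_im, herm_self_im, mul_zero, zero_add, Complex.I_re,
    zero_mul, Complex.I_im, one_mul, Complex.star_def, Complex.conj_im, Complex.conj_re] at h4
  linarith

/-- The vectors `X` in a subspace with `i σ(X̄, X) = 0` form, when the form is semidefinite there,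
an invariant set on which `Re q` vanishes; hence there are none but zero. -/
theorem eq_zero_of_herm_eq_zero (hQ : Q.IsSymm) (hre : ReNonneg Q) (hs : TrivialSingularSpace Q)
    {s : ℝ} (hs0 : s ≠ 0) {W : Submodule ℂ (Fin n ⊕ Fin n → ℂ)}
    (hW : ∀ X ∈ W, hamiltonMap Q *ᵥ X ∈ W) (hsemi : ∀ X ∈ W, 0 ≤ s * (herm X X).re)
    {X : Fin n ⊕ Fin n → ℂ} (hX : X ∈ W) (h0 : (herm X X).re = 0) : X = 0 := by
  -- The Cauchy–Schwarz argument: an isotropic vector of a semidefinite form lies in its radical.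
  have hrad : ∀ X ∈ W, (herm X X).re = 0 → ∀ Y ∈ W, herm Y X = 0 := by
    intro X hX h0 Y hY
    have hz : ∀ r : ℝ, 0 ≤ s * (herm Y Y).re - 2 * r * s ^ 2 * Complex.normSq (herm Y X) := by
      intro r
      -- As `X` is isotropic, moving `Y` by `t X` adds only the cross term. This choice of `t` makes
      -- that term a nonpositive multiple of a free real parameter `r` after multiplication by `s`.
      set t : ℂ := -(r * s : ℝ) * star (herm Y X) with ht
      have h1 := hsemi (Y + t • X) (W.add_mem hY (W.smul_mem _ hX))
      have h2 : (herm (Y + t • X) (Y + t • X)).re = (herm Y Y).re + 2 * (t * herm Y X).re := by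
        rw [herm_add_left, herm_add_right, herm_add_right, herm_smul_left, herm_smul_left,
          herm_smul_right, herm_smul_right, ← star_herm Y X]
        have hXX : herm X X = 0 := Complex.ext h0 (herm_self_im X)
        rw [hXX, ← star_mul']
        simp only [Complex.add_re, Complex.star_def, Complex.conj_re, mul_zero, Complex.zero_re]
        ring
      have h3 : (t * herm Y X).re = -(r * s) * Complex.normSq (herm Y X) := by
        rw [ht, mul_assoc, Complex.star_def, ← Complex.normSq_eq_conj_mul_self,
          ← Complex.ofReal_neg, Complex.re_ofReal_mul, Complex.ofReal_re]
      rw [h2, h3] at h1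
      nlinarith [h1]
    by_contra hne
    have hpos : 0 < s ^ 2 * Complex.normSq (herm Y X) :=
      mul_pos (by positivity) (Complex.normSq_pos.2 hne)
    -- This value of `r` makes the supposedly nonnegative quantity equal to `-1`.
    have := hz ((s * (herm Y Y).re + 1) / (2 * (s ^ 2 * Complex.normSq (herm Y X))))
    have h5 : 2 * ((s * (herm Y Y).re + 1) / (2 * (s ^ 2 * Complex.normSq (herm Y X)))) * s ^ 2 *
        Complex.normSq (herm Y X) = s * (herm Y Y).re + 1 := by
      have := (Complex.normSq_pos.2 hne).ne'
      field_simp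
    rw [h5] at this
    linarith
  -- For `X` in the radical, pairing `F X` with `X` itself gives `Re q(X) = 0`, hence `Re q`
  -- annihilates `X` by semidefiniteness. Then `F X` is orthogonal to all of `W`, so the isotropic
  -- vectors are stable under `F`.
  have hstep : ∀ X ∈ W, (herm X X).re = 0 → twoRe Q *ᵥ X = 0 ∧
      (herm (hamiltonMap Q *ᵥ X) (hamiltonMap Q *ᵥ X)).re = 0 := by
    intro X hX h0
    have hid : ∀ Y ∈ W, herm Y (hamiltonMap Q *ᵥ X) =
        Complex.I * (star Y ⬝ᵥ (twoRe Q *ᵥ X)) := by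
      intro Y hY
      have := herm_hamiltonMap hQ Y X
      rwa [hrad X hX h0 _ (hW Y hY), sub_zero] at this
    have h1 : star X ⬝ᵥ (twoRe Q *ᵥ X) = 0 := by
      have h2 := hid X hX
      rw [← star_herm, hrad X hX h0 _ (hW X hX), star_zero] at h2
      exact (mul_eq_zero.1 h2.symm).resolve_left Complex.I_ne_zero
    have h3 := twoRe_mulVec_eq_zero hQ hre h1
    refine ⟨h3, ?_⟩
    rw [hid _ (hW X hX), h3]
    simp
  refine eq_zero_of_orbit hs fun k => ?_
  have : ∀ k : ℕ, hamiltonMap Q ^ k *ᵥ X ∈ W ∧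
      (herm (hamiltonMap Q ^ k *ᵥ X) (hamiltonMap Q ^ k *ᵥ X)).re = 0 := by
    intro k
    induction k with
    | zero => simpa using ⟨hX, h0⟩
    | succ k ih =>
      rw [pow_succ', ← Matrix.mulVec_mulVec]
      exact ⟨hW _ ih.1, (hstep _ ih.1 ih.2).2⟩
  exact (hstep _ (this k).1 (this k).2).1

/-- On a subspace invariant under the Hamilton map whose eigenvalues there lie in one open
half-plane, the hermitian form `i σ(X̄, X)` is definite, of the sign of the half-plane. -/
theorem herm_definite (hQ : Q.IsSymm) (hre : ReNonneg Q) (hs : TrivialSingularSpace Q)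
    {s : ℝ} (hs0 : s ≠ 0) (m : ℕ) : ∀ W : Submodule ℂ (Fin n ⊕ Fin n → ℂ),
      Module.finrank ℂ W = m → (∀ X ∈ W, hamiltonMap Q *ᵥ X ∈ W) →
      (∀ X ∈ W, X ≠ 0 → ∀ l : ℂ, hamiltonMap Q *ᵥ X = l • X → 0 < s * l.im) →
      ∀ X ∈ W, X ≠ 0 → 0 < s * (herm X X).re := by
  induction m with
  | zero =>
    intro W hW _ _ X hX hX0
    rw [Submodule.finrank_eq_zero] at hW
    rw [hW, Submodule.mem_bot] at hX
    exact absurd hX hX0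
  | succ m ih =>
    intro W hW hinv hev
    have : Nontrivial W := Module.nontrivial_of_finrank_pos (R := ℂ) (by omega)
    set T : Module.End ℂ W := (Matrix.mulVecLin (hamiltonMap Q)).restrict hinv with hT
    obtain ⟨l, hl⟩ := Module.End.exists_eigenvalue T
    obtain ⟨v, hv⟩ := hl.exists_hasEigenvector
    have hlim : 0 < s * l.im := by
      refine hev v v.2 (fun h => hv.2 (Subtype.ext h)) l ?_
      exact congrArg Subtype.val hv.apply_eq_smul
    -- A nonzero functional vanishing on the range of `T - l` is a left eigenvector of `T`, and its
    -- kernel is an invariant hyperplane to which the induction hypothesis applies.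
    have hlt : LinearMap.range (T - algebraMap ℂ _ l) < ⊤ := by
      refine lt_top_iff_ne_top.2 fun h => ?_
      have hinj := LinearMap.injective_iff_surjective.2 (LinearMap.range_eq_top.1 h)
      refine hv.2 (hinj ?_)
      simp [hv.apply_eq_smul]
    obtain ⟨φ, hφ0, hφ⟩ := Submodule.exists_le_ker_of_lt_top _ hlt
    have hφT : ∀ x, φ (T x) = l * φ x := by
      intro x
      have : φ ((T - algebraMap ℂ _ l) x) = 0 := hφ ⟨x, rfl⟩
      simpa [sub_eq_zero] using this
    set W' : Submodule ℂ (Fin n ⊕ Fin n → ℂ) := (LinearMap.ker φ).map W.subtype with hW'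
    have hW'W : ∀ X ∈ W', X ∈ W := by rintro _ ⟨x, _, rfl⟩; exact x.2
    have hrank' : Module.finrank ℂ W' = m := by
      rw [hW', Submodule.finrank_map_subtype_eq]
      have := Module.Dual.finrank_ker_add_one_of_ne_zero hφ0
      omega
    have hpos := ih W' hrank' (by
      rintro _ ⟨x, hx, rfl⟩
      refine ⟨T x, ?_, rfl⟩
      rw [SetLike.mem_coe, LinearMap.mem_ker] at hx ⊢
      rw [hφT, hx, mul_zero]) fun X hX => hev X (hW'W X hX)
    set b := Module.finBasis ℂ W'
    -- Orthogonality to the hyperplane imposes one condition fewer than the dimension of `W`, so a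
    -- nonzero orthogonal vector `e` exists even before the form is known to be nondegenerate.
    set K : W →ₗ[ℂ] (Fin (Module.finrank ℂ W') → ℂ) :=
      LinearMap.pi fun i => hermL (b i : Fin n ⊕ Fin n → ℂ) ∘ₗ W.subtype with hK
    have hker : LinearMap.ker K ≠ ⊥ := LinearMap.ker_ne_bot_of_finrank_lt (by
      rw [Module.finrank_fin_fun]; omega)
    obtain ⟨e, he, he0⟩ := Submodule.exists_mem_ne_zero_of_ne_bot hker
    have horth : ∀ w ∈ W', herm (e : Fin n ⊕ Fin n → ℂ) w = 0 := by
      have h1 : hermL (e : Fin n ⊕ Fin n → ℂ) ∘ₗ W'.subtype = 0 := by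
        refine b.ext fun i => ?_
        have := congrFun (LinearMap.mem_ker.1 he) i
        have h2 : herm (b i : Fin n ⊕ Fin n → ℂ) (e : Fin n ⊕ Fin n → ℂ) = 0 := this
        change herm (e : Fin n ⊕ Fin n → ℂ) (b i : Fin n ⊕ Fin n → ℂ) = 0
        rw [← star_herm, h2, star_zero]
      intro w hw
      exact LinearMap.congr_fun h1 ⟨w, hw⟩
    have heW' : φ e ≠ 0 := by
      intro h
      have hmem : (e : Fin n ⊕ Fin n → ℂ) ∈ W' := ⟨e, h, rfl⟩
      have := hpos e hmem (fun h => he0 (Subtype.ext h))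
      rw [horth e hmem] at this
      simp at this
    -- Modulo the hyperplane, to which `e` is orthogonal, `e` is an eigenvector for `l`; hence `2 Im
    -- l` times `herm e e` is the value of `2 Re q` at `e`. Only a weak inequality results, because
    -- `Re q` may vanish at `e`.
    have hee : 0 ≤ s * (herm (e : Fin n ⊕ Fin n → ℂ) e).re := by
      have h1 : herm (e : Fin n ⊕ Fin n → ℂ) (hamiltonMap Q *ᵥ e) =
          l * herm (e : Fin n ⊕ Fin n → ℂ) e := by
        have h2 : hamiltonMap Q *ᵥ (e : Fin n ⊕ Fin n → ℂ) - l • (e : Fin n ⊕ Fin n → ℂ) ∈ W' := by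
          refine ⟨T e - l • e, ?_, rfl⟩
          rw [SetLike.mem_coe, LinearMap.mem_ker, map_sub, hφT, map_smul, smul_eq_mul, sub_self]
        have h3 := horth _ h2
        rw [sub_eq_add_neg, herm_add_right, ← neg_smul, herm_smul_right] at h3
        linear_combination h3
      have h2 := im_mul_herm hQ h1
      have h3 := dot_twoRe_nonneg hQ hre (e : Fin n ⊕ Fin n → ℂ)
      rw [← h2] at h3
      by_contra hneg
      push Not at hneg
      have h4 := mul_neg_of_pos_of_neg hlim hneg
      nlinarith [sq_nonneg s, mul_nonneg (sq_nonneg s) h3]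
    have hsemi : ∀ X ∈ W, 0 ≤ s * (herm X X).re := by
      intro X hX
      set c : ℂ := φ ⟨X, hX⟩ / φ e with hc
      have hw : X - c • (e : Fin n ⊕ Fin n → ℂ) ∈ W' := by
        refine ⟨⟨X, hX⟩ - c • e, ?_, rfl⟩
        rw [SetLike.mem_coe, LinearMap.mem_ker, map_sub, map_smul, smul_eq_mul, hc,
          div_mul_cancel₀ _ heW', sub_self]
      set w := X - c • (e : Fin n ⊕ Fin n → ℂ) with hwdef
      have hXw : X = w + c • (e : Fin n ⊕ Fin n → ℂ) := by rw [hwdef]; abel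
      have hwe : herm w (e : Fin n ⊕ Fin n → ℂ) = 0 := by
        rw [← star_herm, horth w hw, star_zero]
      have h1 : (herm X X).re = (herm w w).re +
          Complex.normSq c * (herm (e : Fin n ⊕ Fin n → ℂ) e).re := by
        rw [hXw, herm_add_left, herm_add_right, herm_add_right, herm_smul_left, herm_smul_left,
          herm_smul_right, herm_smul_right, horth w hw, hwe, ← mul_assoc, Complex.star_def,
          ← Complex.normSq_eq_conj_mul_self, Complex.add_re, Complex.add_re, Complex.add_re,
          Complex.re_ofReal_mul]
        simp
      rw [h1]
      have h2 : 0 ≤ s * (herm w w).re := by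
        by_cases hw0 : w = 0
        · simp [hw0, herm, sympl]
        · exact (hpos w hw hw0).le
      nlinarith [mul_nonneg (Complex.normSq_nonneg c) hee]
    intro X hX hX0
    -- Strictness is where the trivial singular space enters.
    refine lt_of_le_of_ne (hsemi X hX) fun h => hX0 ?_
    exact eq_zero_of_herm_eq_zero hQ hre hs hs0 hinv hsemi hX
      ((mul_eq_zero.1 h.symm).resolve_left hs0)

/-- The Hamilton map has no real eigenvalues. -/
theorem im_ne_zero_of_eigenvector (hQ : Q.IsSymm) (hre : ReNonneg Q)
    (hs : TrivialSingularSpace Q) {X : Fin n ⊕ Fin n → ℂ} (hX : X ≠ 0) {l : ℂ}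
    (h : hamiltonMap Q *ᵥ X = l • X) : l.im ≠ 0 := by
  intro hl
  have h1 := im_mul_herm hQ (X := X) (l := l) (by rw [h, herm_smul_right])
  rw [hl, mul_zero, zero_mul] at h1
  have h2 := (twoRe_posSemidef_im hQ hre X)
  have h3 := twoRe_mulVec_eq_zero hQ hre (Complex.ext h1.symm h2)
  refine hX (eq_zero_of_orbit hs fun k => ?_)
  have : hamiltonMap Q ^ k *ᵥ X = l ^ k • X := by
    induction k with
    | zero => simp
    | succ k ih => rw [pow_succ', ← Matrix.mulVec_mulVec, ih, Matrix.mulVec_smul, h, smul_smul,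
        ← pow_succ]
  rw [this, Matrix.mulVec_smul, h3, smul_zero]

end Definite

end QuadGrowth
end

noncomputable section
namespace QuadGrowth

/-! ### Hamilton maps under symplectic changes of variables -/

section NormalForm

variable {n : ℕ} {Q : Matrix (Fin n ⊕ Fin n) (Fin n ⊕ Fin n) ℂ}

/-- The symmetric matrix of the quadratic form `(M x) · ξ`. -/
def pairMatrix (M : Matrix (Fin n) (Fin n) ℂ) : Matrix (Fin n ⊕ Fin n) (Fin n ⊕ Fin n) ℂ :=
  (1 / 2 : ℂ) • Matrix.fromBlocks 0 Mᵀ M 0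

theorem pairMatrix_isSymm (M : Matrix (Fin n) (Fin n) ℂ) : (pairMatrix M).IsSymm := by
  rw [pairMatrix, Matrix.IsSymm, Matrix.transpose_smul, Matrix.fromBlocks_transpose]
  simp

theorem symbol_pairMatrix (M : Matrix (Fin n) (Fin n) ℂ) (X : Fin n ⊕ Fin n → ℂ) :
    symbol (pairMatrix M) X = (M *ᵥ fun j => X (Sum.inl j)) ⬝ᵥ fun j => X (Sum.inr j) := by
  have hX : X = Sum.elim (X ∘ Sum.inl) (X ∘ Sum.inr) := by ext (j | j) <;> rfl
  conv_lhs => rw [hX]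
  rw [symbol, pairMatrix, Matrix.smul_mulVec, dotProduct_smul, Matrix.fromBlocks_mulVec,
    sumElim_dotProduct_sumElim]
  simp only [Matrix.zero_mulVec, zero_add, add_zero, Sum.elim_comp_inl, Sum.elim_comp_inr,
    Matrix.mulVec_transpose, smul_eq_mul]
  rw [dotProduct_comm (X ∘ Sum.inl), ← Matrix.dotProduct_mulVec, dotProduct_comm (M *ᵥ _)]
  simp only [Function.comp_def]
  ring

/-- Polarization. -/
theorem isSymm_ext {ι : Type*} [Fintype ι] [DecidableEq ι] {A B : Matrix ι ι ℂ} (hA : A.IsSymm)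
    (hB : B.IsSymm) (h : ∀ X : ι → ℂ, X ⬝ᵥ (A *ᵥ X) = X ⬝ᵥ (B *ᵥ X)) : A = B := by
  have h2 : ∀ X Y : ι → ℂ, X ⬝ᵥ (A *ᵥ Y) = X ⬝ᵥ (B *ᵥ Y) := by
    intro X Y
    have h1 := h (X + Y)
    simp only [Matrix.mulVec_add, add_dotProduct, dotProduct_add] at h1
    rw [h X, h Y, dotProduct_mulVec_comm hA Y X, dotProduct_mulVec_comm hB Y X] at h1
    linear_combination h1 / 2
  ext i j
  have := h2 (Pi.single i 1) (Pi.single j 1)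
  simpa using this

/-- The matrix form of `q ∘ ϰ⁻¹ = (M x) · ξ`. -/
theorem eq_conj_pairMatrix (hQ : Q.IsSymm) {M : Matrix (Fin n) (Fin n) ℂ}
    {K : Matrix (Fin n ⊕ Fin n) (Fin n ⊕ Fin n) ℂ}
    (h : ∀ X, symbol Q X = (M *ᵥ fun j => (K *ᵥ X) (Sum.inl j)) ⬝ᵥ fun j => (K *ᵥ X) (Sum.inr j)) :
    Q = Kᵀ * pairMatrix M * K := by
  refine isSymm_ext hQ ?_ fun X => ?_
  · rw [Matrix.IsSymm, Matrix.transpose_mul, Matrix.transpose_mul, Matrix.transpose_transpose,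
      (pairMatrix_isSymm M).eq, Matrix.mul_assoc]
  · have := h X
    rw [← symbol_pairMatrix] at this
    rw [← symbol, this, symbol, ← Matrix.mulVec_mulVec, ← Matrix.mulVec_mulVec,
      Matrix.mulVec_transpose, dotProduct_comm X, ← Matrix.dotProduct_mulVec, dotProduct_comm]

theorem hamiltonMap_pairMatrix (M : Matrix (Fin n) (Fin n) ℂ) :
    hamiltonMap (pairMatrix M) =
      Matrix.fromBlocks ((1 / 2 : ℂ) • M) 0 0 (-((1 / 2 : ℂ) • Mᵀ)) := by
  rw [pairMatrix, Matrix.fromBlocks_smul, hamiltonMap]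
  simp [Matrix.toBlocks_fromBlocks₁₁]

theorem IsJordanForm.isUpperTriangular {M : Matrix (Fin n) (Fin n) ℂ} (hM : IsJordanForm M) :
    M.IsUpperTriangular := by
  intro i j hij
  by_contra h
  have h1 := (hM i j (ne_of_gt hij) h).1
  have h2 : (j : ℕ) < i := hij
  omega

/-- For symplectic `K` the inverse is `-J Kᵗ J`, which turns congruence of quadratic forms into
similarity of Hamilton maps. -/
theorem hamiltonMap_conj {K : Matrix (Fin n ⊕ Fin n) (Fin n ⊕ Fin n) ℂ}
    (hK : K ∈ Matrix.symplecticGroup (Fin n) ℂ) (N : Matrix (Fin n ⊕ Fin n) (Fin n ⊕ Fin n) ℂ) :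
    hamiltonMap (Kᵀ * N * K) = K⁻¹ * hamiltonMap N * K := by
  have h1 : K⁻¹ = -(Matrix.J (Fin n) ℂ * Kᵀ * Matrix.J (Fin n) ℂ) := by
    rw [SymplecticGroup.inv_eq_symplectic_inv K hK]
    simp
  rw [hamiltonMap_eq, hamiltonMap_eq, h1]
  have h2 := Matrix.J_squared (Fin n) ℂ
  calc _ = Matrix.J (Fin n) ℂ * Kᵀ * (-1 : Matrix _ _ ℂ) * N * K := by noncomm_ring
    _ = _ := by rw [← h2]; noncomm_ring

/-- The Hamilton map is similar to the block diagonal matrix of `M / 2` and `-Mᵗ / 2`, and a Jordan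
form is triangular, so the roots are read off the diagonal with multiplicities. -/
theorem roots_hamiltonMap (hQ : Q.IsSymm) {M : Matrix (Fin n) (Fin n) ℂ}
    {K : Matrix (Fin n ⊕ Fin n) (Fin n ⊕ Fin n) ℂ} (hK : K ∈ Matrix.symplecticGroup (Fin n) ℂ)
    (h : ∀ X, symbol Q X = (M *ᵥ fun j => (K *ᵥ X) (Sum.inl j)) ⬝ᵥ fun j => (K *ᵥ X) (Sum.inr j))
    (hM : IsJordanForm M) (lam : Fin n → ℂ) (hlam : ∀ j, M j j = 2 * lam j) :
    (hamiltonMap Q).charpoly.roots =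
      Finset.univ.val.map lam + Finset.univ.val.map (fun j => -lam j) := by
  have hdet := SymplecticGroup.symplectic_det hK
  have h1 : (hamiltonMap Q).charpoly = (hamiltonMap (pairMatrix M)).charpoly := by
    rw [eq_conj_pairMatrix hQ h, hamiltonMap_conj hK]
    obtain ⟨u, hu⟩ := (Matrix.isUnit_iff_isUnit_det K).2 hdet
    rw [← hu, ← Matrix.charpoly_units_conj' u (hamiltonMap (pairMatrix M))]
  have h2 : ((1 / 2 : ℂ) • M).IsUpperTriangular := fun i j hij => by
    rw [Matrix.smul_apply, hM.isUpperTriangular hij, smul_zero]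
  have h3 : (-((1 / 2 : ℂ) • M)).IsUpperTriangular := fun i j hij => by
    rw [Matrix.neg_apply, h2 hij, neg_zero]
  have h4 : -((1 / 2 : ℂ) • Mᵀ) = (-((1 / 2 : ℂ) • M))ᵀ := by simp
  rw [h1, hamiltonMap_pairMatrix, Matrix.charpoly_fromBlocks_zero₁₂, h4, Matrix.charpoly_transpose,
    Matrix.charpoly_of_isUpperTriangular _ h2, Matrix.charpoly_of_isUpperTriangular _ h3,
    Polynomial.roots_mul (mul_ne_zero
      (Polynomial.monic_prod_X_sub_C _ _).ne_zero (Polynomial.monic_prod_X_sub_C _ _).ne_zero)]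
  have h5 : ∀ f : Fin n → ℂ, (∏ i, (Polynomial.X - Polynomial.C (f i))).roots =
      Finset.univ.val.map f := by
    intro f
    rw [Polynomial.roots_prod _ _ (Polynomial.monic_prod_X_sub_C _ _).ne_zero]
    simp [Multiset.bind_singleton]
  rw [h5, h5]
  simp only [Matrix.neg_apply, Matrix.smul_apply, hlam, smul_eq_mul]
  congr 2 <;> · ext j; ring

end NormalForm

end QuadGrowth
end

noncomputable section
namespace QuadGrowth

/-! ### Lagrangian splitting and an adapted symplectic basis -/

section NormalFormExistence

variable {n : ℕ} {Q : Matrix (Fin n ⊕ Fin n) (Fin n ⊕ Fin n) ℂ}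

/-- Skewness of `F` says that the `σ`-adjoint of `p(F)` is `p(-F)`. -/
theorem sympl_aeval (hQ : Q.IsSymm) (p : Polynomial ℂ) (X Y : Fin n ⊕ Fin n → ℂ) :
    sympl (Polynomial.aeval (hamiltonMap Q).mulVecLin p X) Y =
      sympl X (Polynomial.aeval (hamiltonMap Q).mulVecLin (p.comp (-Polynomial.X)) Y) := by
  have hF : ∀ X Y : Fin n ⊕ Fin n → ℂ, sympl ((hamiltonMap Q).mulVecLin X) Y =
      -sympl X ((hamiltonMap Q).mulVecLin Y) := sympl_hamiltonMap_left hQ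
  induction p using Polynomial.induction_on' generalizing X Y with
  | add p q hp hq =>
    simp only [map_add, LinearMap.add_apply, sympl_add_left, Polynomial.add_comp, sympl_add_right,
      hp, hq]
  | monomial k a =>
    have hpow : ∀ (k : ℕ) (X Y : Fin n ⊕ Fin n → ℂ),
        sympl (((hamiltonMap Q).mulVecLin ^ k) X) Y =
          (-1) ^ k * sympl X (((hamiltonMap Q).mulVecLin ^ k) Y) := by
      intro k
      induction k with
      | zero => simp
      | succ k ih =>
        intro X Y
        conv_lhs => rw [pow_succ', Module.End.mul_apply, hF, ih, ← Module.End.mul_apply, ← pow_succ]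
        rw [pow_succ (-1 : ℂ)]
        ring
    rw [← Polynomial.C_mul_X_pow_eq_monomial]
    simp only [map_mul, Polynomial.aeval_C, map_pow, Polynomial.aeval_X, Polynomial.mul_comp,
      Polynomial.C_comp, Polynomial.pow_comp, Polynomial.X_comp, map_neg, Module.End.mul_apply,
      Module.algebraMap_end_apply, sympl_smul_left, sympl_smul_right, hpow]
    rw [neg_pow (hamiltonMap Q).mulVecLin, Module.End.mul_apply]
    have : ((-1 : Module.End ℂ (Fin n ⊕ Fin n → ℂ)) ^ k) =
        algebraMap ℂ (Module.End ℂ (Fin n ⊕ Fin n → ℂ)) ((-1) ^ k) := by simp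
    rw [this, Module.algebraMap_end_apply, sympl_smul_right]

/-- The kernel of a polynomial in the Hamilton map is isotropic if no two of its roots are
opposite. -/
theorem isotropic_ker (hQ : Q.IsSymm) {p : Polynomial ℂ}
    (hp : ∀ z, p.eval z = 0 → p.eval (-z) ≠ 0) {X Y : Fin n ⊕ Fin n → ℂ}
    (hX : Polynomial.aeval (hamiltonMap Q).mulVecLin p X = 0)
    (hY : Polynomial.aeval (hamiltonMap Q).mulVecLin p Y = 0) : sympl X Y = 0 := by
  -- By the root condition `p(F)` and `p(-F)` satisfy a Bézout identity, so `p(-F)` is invertible on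
  -- the kernel of `p(F)`. Writing `Y` as `p(-F)` of something and moving this factor across `σ`
  -- makes it act on `X` as `p(F)`, which is zero.
  have hcop : IsCoprime p (p.comp (-Polynomial.X)) := by
    rw [Polynomial.isCoprime_iff_aeval_ne_zero_of_isAlgClosed ℂ ℂ]
    intro a
    by_cases h : p.eval a = 0
    · right
      simpa [Polynomial.eval_comp] using hp a h
    · left; simpa using h
  obtain ⟨a, b, hab⟩ := hcop
  have h1 : Y = Polynomial.aeval (hamiltonMap Q).mulVecLin (p.comp (-Polynomial.X))
      (Polynomial.aeval (hamiltonMap Q).mulVecLin b Y) := by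
    have h2 := congrArg (fun r => Polynomial.aeval (hamiltonMap Q).mulVecLin r Y) hab
    simp only [map_add, map_mul, LinearMap.add_apply, Module.End.mul_apply, hY, map_zero, zero_add,
      map_one, Module.End.one_apply] at h2
    rw [← Module.End.mul_apply, ← map_mul, mul_comm, map_mul, Module.End.mul_apply]
    exact h2.symm
  rw [h1, ← sympl_aeval hQ, hX]
  simp [sympl]

/-- The splitting of `ℂ²ⁿ` into invariant isotropic subspaces on which the hermitian form
`i σ(X̄, X)` is positive and negative definite. -/
theorem exists_splitting (hQ : Q.IsSymm) (hre : ReNonneg Q) (hs : TrivialSingularSpace Q) :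
    ∃ Wp Wm : Submodule ℂ (Fin n ⊕ Fin n → ℂ), IsCompl Wp Wm ∧
      (∀ X ∈ Wp, hamiltonMap Q *ᵥ X ∈ Wp) ∧
      (∀ X ∈ Wp, ∀ Y ∈ Wp, sympl X Y = 0) ∧ (∀ X ∈ Wm, ∀ Y ∈ Wm, sympl X Y = 0) ∧
      (∀ X ∈ Wp, X ≠ 0 → ∀ l : ℂ, hamiltonMap Q *ᵥ X = l • X → 0 < l.im) ∧
      (∀ X ∈ Wm, hamiltonMap Q *ᵥ X ∈ Wm) ∧
      (∀ X ∈ Wp, X ≠ 0 → 0 < (herm X X).re) ∧ (∀ X ∈ Wm, X ≠ 0 → (herm X X).re < 0) := by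
  classical
  set F := (hamiltonMap Q).mulVecLin with hF
  set χ := (hamiltonMap Q).charpoly with hχ
  -- The characteristic polynomial factors according to the sign of the imaginary part of its roots.
  -- Absence of real roots makes the factors coprime, and Cayley–Hamilton makes their kernels
  -- complementary.
  set pp : Polynomial ℂ := ((χ.roots.filter fun z => 0 < z.im).map
    fun a => Polynomial.X - Polynomial.C a).prod with hpp
  set pm : Polynomial ℂ := ((χ.roots.filter fun z => ¬ 0 < z.im).map
    fun a => Polynomial.X - Polynomial.C a).prod with hpm
  have hmul : pp * pm = χ := by
    rw [hpp, hpm, ← Multiset.prod_add, ← Multiset.map_add, Multiset.filter_add_not]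
    exact (IsAlgClosed.splits χ).eq_prod_roots_of_monic (Matrix.charpoly_monic _) |>.symm
  have hroot : ∀ (m : Multiset ℂ) (z : ℂ), ((m.map
      fun a => Polynomial.X - Polynomial.C a).prod).eval z = 0 ↔ z ∈ m := by
    intro m z
    rw [Polynomial.eval_multiset_prod, Multiset.prod_eq_zero_iff, Multiset.map_map]
    simp [sub_eq_zero]
  have hev : ∀ X : Fin n ⊕ Fin n → ℂ, X ≠ 0 → ∀ l : ℂ, hamiltonMap Q *ᵥ X = l • X →
      l.im ≠ 0 := fun X hX l h => im_ne_zero_of_eigenvector hQ hre hs hX h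
  have hpproot : ∀ z, pp.eval z = 0 → 0 < z.im := by
    intro z hz
    rw [hpp, hroot, Multiset.mem_filter] at hz
    exact hz.2
  have hpmroot : ∀ z, pm.eval z = 0 → z.im < 0 := by
    intro z hz
    rw [hpm, hroot, Multiset.mem_filter] at hz
    refine lt_of_le_of_ne (not_lt.1 hz.2) ?_
    have h1 : (hamiltonMap Q - Matrix.scalar _ z).det = 0 := by
      have h2 := (Polynomial.mem_roots'.1 hz.1).2
      rw [Polynomial.IsRoot, hχ, Matrix.eval_charpoly] at h2
      rw [← neg_sub, Matrix.det_neg, h2, mul_zero]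
    obtain ⟨X, hX0, hX⟩ := Matrix.exists_mulVec_eq_zero_iff.2 h1
    refine hev X hX0 z ?_
    rw [Matrix.sub_mulVec, sub_eq_zero] at hX
    rw [hX]
    simp [← Matrix.smul_one_eq_diagonal, Matrix.smul_mulVec]
  have hcop : IsCoprime pp pm := by
    rw [Polynomial.isCoprime_iff_aeval_ne_zero_of_isAlgClosed ℂ ℂ]
    intro a
    by_contra! h
    have h1 := hpproot a (by simpa using h.1)
    have h2 := hpmroot a (by simpa using h.2)
    linarith
  have hinv : ∀ (p : Polynomial ℂ), ∀ X ∈ LinearMap.ker (Polynomial.aeval F p),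
      hamiltonMap Q *ᵥ X ∈ LinearMap.ker (Polynomial.aeval F p) := by
    intro p X hX
    rw [LinearMap.mem_ker] at hX ⊢
    have h1 : Polynomial.aeval F p (F X) = F (Polynomial.aeval F p X) := by
      have h2 : Polynomial.aeval F p * F = F * Polynomial.aeval F p := by
        have h3 := congrArg (Polynomial.aeval F) (mul_comm p Polynomial.X)
        rwa [map_mul, map_mul, Polynomial.aeval_X] at h3
      exact LinearMap.congr_fun h2 X
    rw [hX, map_zero] at h1
    exact h1
  have heval : ∀ (p : Polynomial ℂ), ∀ X ∈ LinearMap.ker (Polynomial.aeval F p), X ≠ 0 →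
      ∀ l : ℂ, hamiltonMap Q *ᵥ X = l • X → p.eval l = 0 := by
    intro p X hX hX0 l hl
    have h1 : Polynomial.aeval F p X = p.eval l • X :=
      Module.End.aeval_apply_of_hasEigenvector
        (Module.End.hasEigenvector_iff.2 ⟨Module.End.mem_eigenspace_iff.2 hl, hX0⟩)
    rw [LinearMap.mem_ker.1 hX] at h1
    exact (smul_eq_zero.1 h1.symm).resolve_right hX0
  refine ⟨LinearMap.ker (Polynomial.aeval F pp), LinearMap.ker (Polynomial.aeval F pm),
    ⟨Polynomial.disjoint_ker_aeval_of_isCoprime F hcop, ?_⟩, hinv _, ?_, ?_, ?_, hinv _, ?_, ?_⟩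
  · rw [codisjoint_iff, Polynomial.sup_ker_aeval_eq_ker_aeval_mul_of_coprime F hcop, hmul,
      LinearMap.ker_eq_top, hχ, hF]
    have h1 := Matrix.aeval_self_charpoly (hamiltonMap Q)
    have h2 := congrArg (Matrix.toLinAlgEquiv' (R := ℂ) (n := Fin n ⊕ Fin n)) h1
    rw [map_zero, ← Polynomial.aeval_algHom_apply] at h2
    exact h2
  · intro X hX Y hY
    exact isotropic_ker hQ (fun z h1 h2 => by
      have h3 := hpproot _ h1
      have h4 := hpproot _ h2
      rw [Complex.neg_im] at h4
      linarith) hX hY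
  · intro X hX Y hY
    exact isotropic_ker hQ (fun z h1 h2 => by
      have h3 := hpmroot _ h1
      have h4 := hpmroot _ h2
      rw [Complex.neg_im] at h4
      linarith) hX hY
  · intro X hX hX0 l hl
    exact hpproot l (heval _ X hX hX0 l hl)
  · intro X hX hX0
    have := herm_definite hQ hre hs (s := 1) one_ne_zero _ _ rfl (hinv pp) (fun X hX hX0 l hl => by
      rw [one_mul]; exact hpproot l (heval _ X hX hX0 l hl)) X hX hX0
    rwa [one_mul] at this
  · intro X hX hX0
    have := herm_definite hQ hre hs (s := -1) (by norm_num) _ _ rfl (hinv pm)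
      (fun X hX hX0 l hl => by
        have := hpmroot l (heval _ X hX hX0 l hl)
        linarith) X hX hX0
    linarith

/-- A pairing with no left kernel embeds the first space into the dual of the second. -/
theorem finrank_le_of_pairing {A B : Submodule ℂ (Fin n ⊕ Fin n → ℂ)}
    (h : ∀ X ∈ A, (∀ Y ∈ B, sympl X Y = 0) → X = 0) : Module.finrank ℂ A ≤ Module.finrank ℂ B := by
  set L : A →ₗ[ℂ] (Module.Dual ℂ B) :=
    (LinearMap.lcomp ℂ ℂ B.subtype) ∘ₗ symplB ∘ₗ A.subtype with hL
  have hinj : Function.Injective L := by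
    rw [← LinearMap.ker_eq_bot, LinearMap.ker_eq_bot']
    intro X hX
    exact Subtype.ext (h X X.2 fun Y hY => LinearMap.congr_fun hX ⟨Y, hY⟩)
  have := LinearMap.finrank_le_finrank_of_injective hinj
  rwa [Subspace.dual_finrank_eq] at this

/-- A symplectic basis whose first half is a Jordan basis of `2 F` on the positive subspace. -/
theorem exists_symplectic_basis (hQ : Q.IsSymm) (hre : ReNonneg Q) (hs : TrivialSingularSpace Q) :
    ∃ (v f : Fin n → (Fin n ⊕ Fin n → ℂ)) (M : Matrix (Fin n) (Fin n) ℂ), IsJordanForm M ∧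
      (∀ k, (2 : ℂ) • (hamiltonMap Q *ᵥ v k) = ∑ j, M j k • v j) ∧
      (∀ j k, sympl (v j) (v k) = 0) ∧ (∀ j k, sympl (f j) (f k) = 0) ∧
      (∀ j k, sympl (f j) (v k) = if j = k then 1 else 0) ∧
      (∀ j k, sympl (f j) (hamiltonMap Q *ᵥ f k) = 0) ∧
      (∀ j, 0 < (M j j).im) ∧
      (∀ a : Fin n → ℂ, a ≠ 0 → 0 < (herm (∑ j, a j • v j) (∑ j, a j • v j)).re) ∧
      (∀ a : Fin n → ℂ, a ≠ 0 → (herm (∑ j, a j • f j) (∑ j, a j • f j)).re < 0) := by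
  classical
  obtain ⟨Wp, Wm, hc, hinvp, hisop, hisom, hevp, hinvm, hpos, hneg⟩ := exists_splitting hQ hre hs
  have hsum : ∀ Z : Fin n ⊕ Fin n → ℂ, ∃ X ∈ Wp, ∃ Y ∈ Wm, X + Y = Z := fun Z =>
    Submodule.mem_sup.1 (hc.sup_eq_top ▸ Submodule.mem_top)
  have hndp : ∀ X ∈ Wp, (∀ Y ∈ Wm, sympl X Y = 0) → X = 0 := by
    intro X hX h
    refine eq_zero_of_sympl fun Z => ?_
    obtain ⟨A, hA, B, hB, rfl⟩ := hsum Z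
    rw [sympl_add_right, hisop X hX A hA, h B hB, add_zero]
  have hndm : ∀ X ∈ Wm, (∀ Y ∈ Wp, sympl X Y = 0) → X = 0 := by
    intro X hX h
    refine eq_zero_of_sympl fun Z => ?_
    obtain ⟨A, hA, B, hB, rfl⟩ := hsum Z
    rw [sympl_add_right, hisom X hX B hB, h A hA, add_zero]
  -- Each isotropic half embeds into the dual of the other, so the dimensions agree; together they
  -- add up to `2n`.
  have hrank : Module.finrank ℂ Wp = n ∧ Module.finrank ℂ Wm = n := by
    have h1 := finrank_le_of_pairing hndp
    have h2 := finrank_le_of_pairing hndm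
    have h3 := Submodule.finrank_add_eq_of_isCompl hc
    rw [Module.finrank_fintype_fun_eq_card, Fintype.card_sum, Fintype.card_fin] at h3
    omega
  obtain ⟨v, M, hv, hspan, hM, hTv⟩ := exists_jordanBasis ((2 : ℂ) • (hamiltonMap Q).mulVecLin) Wp n
    hrank.1 (fun X hX => Wp.smul_mem 2 (hinvp X hX))
  have hvW : ∀ j, v j ∈ Wp := fun j => hspan ▸ Submodule.subset_span ⟨j, rfl⟩
  -- Pairing with the Jordan basis identifies the negative subspace with `ℂⁿ`; the preimages of the
  -- standard basis vectors form the dual basis `f`.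
  set L : Wm →ₗ[ℂ] (Fin n → ℂ) := LinearMap.pi fun k => (symplB.flip (v k)) ∘ₗ Wm.subtype with hL
  have hLa : ∀ Y k, L Y k = sympl Y (v k) := fun _ _ => rfl
  have hinj : Function.Injective L := by
    rw [← LinearMap.ker_eq_bot, LinearMap.ker_eq_bot']
    intro Y hY
    refine Subtype.ext (hndm Y Y.2 fun X hX => ?_)
    rw [← hspan] at hX
    induction hX using Submodule.span_induction with
    | mem x hx => obtain ⟨k, rfl⟩ := hx; rw [← hLa, hY]; rfl
    | zero => simp [sympl]
    | add x y _ _ hx hy => rw [sympl_add_right, hx, hy, add_zero]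
    | smul a x _ hx => rw [sympl_smul_right, hx, mul_zero]
  set E := LinearMap.linearEquivOfInjective L hinj (by rw [hrank.2, Module.finrank_fin_fun])
  have hE : ∀ y, L (E.symm y) = y := fun y => E.apply_symm_apply y
  refine ⟨v, fun j => (E.symm (Pi.single j 1) : Fin n ⊕ Fin n → ℂ), M, hM, fun k => hTv k,
    fun j k => hisop _ (hvW j) _ (hvW k), fun j k => hisom _ (SetLike.coe_mem _) _ (SetLike.coe_mem _), ?_,
    fun j k => hisom _ (SetLike.coe_mem _) _ (hinvm _ (SetLike.coe_mem _)), ?_, ?_, ?_⟩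
  · intro j k
    rw [← hLa, hE, Pi.single_apply]
    simp [eq_comm]
  · intro j
    -- A diagonal entry of a triangular matrix is an eigenvalue of it, and an eigenvector of `M` is
    -- the coordinate vector of an eigenvector of `2F` in the positive subspace.
    have hdet : (M - Matrix.scalar _ (M j j)).det = 0 := by
      have h1 : (M - Matrix.scalar _ (M j j)).IsUpperTriangular := by
        intro i l hil
        have h2 := hM.isUpperTriangular hil
        have h3 : i ≠ l := ne_of_gt hil
        simp [Matrix.sub_apply, h2, Matrix.diagonal_apply_ne _ h3]
      rw [Matrix.det_of_isUpperTriangular h1]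
      exact Finset.prod_eq_zero (Finset.mem_univ j) (by simp)
    obtain ⟨y, hy0, hy⟩ := Matrix.exists_mulVec_eq_zero_iff.2 hdet
    rw [Matrix.sub_mulVec, sub_eq_zero] at hy
    have hy' : M *ᵥ y = M j j • y := by
      rw [hy]
      simp [← Matrix.smul_one_eq_diagonal, Matrix.smul_mulVec]
    have h1 := hevp (∑ k, y k • v k) (Submodule.sum_mem _ fun k _ => Wp.smul_mem _ (hvW k))
      (fun h => hy0 (funext fun k => Fintype.linearIndependent_iff.1 hv y h k)) (M j j / 2) (by
        have h2 : (2 : ℂ) • (hamiltonMap Q *ᵥ ∑ k, y k • v k) = M j j • ∑ k, y k • v k := by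
          have h3 : hamiltonMap Q *ᵥ ∑ k, y k • v k = ∑ k, y k • (hamiltonMap Q *ᵥ v k) := by
            rw [← Matrix.mulVecLin_apply, map_sum]
            simp only [map_smul, Matrix.mulVecLin_apply]
          have h4 : ∀ k, (2 : ℂ) • (hamiltonMap Q *ᵥ v k) = ∑ j, M j k • v j := hTv
          rw [h3, Finset.smul_sum, Finset.smul_sum]
          calc _ = ∑ k, y k • ∑ j, M j k • v j := by
                refine Finset.sum_congr rfl fun k _ => ?_
                rw [smul_comm, h4]
            _ = ∑ j, (M *ᵥ y) j • v j := by
                simp only [Finset.smul_sum, smul_smul, Matrix.mulVec, dotProduct, Finset.sum_smul]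
                rw [Finset.sum_comm]
                simp only [mul_comm]
            _ = _ := by simp [hy', smul_smul]
        rw [div_eq_inv_mul, mul_smul, ← h2, smul_smul]
        norm_num)
    have h2 : (M j j / 2).im = (M j j).im / 2 := by simp
    rw [h2] at h1
    linarith
  · intro a ha
    refine hpos _ (Submodule.sum_mem _ fun k _ => Wp.smul_mem _ (hvW k)) fun h => ha ?_
    exact funext fun k => Fintype.linearIndependent_iff.1 hv a h k
  · intro a ha
    refine hneg _ (Submodule.sum_mem _ fun k _ => Wm.smul_mem _ (SetLike.coe_mem _)) fun h => ha ?_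
    ext k
    have h1 : sympl (∑ j, a j • (E.symm (Pi.single j 1) : Fin n ⊕ Fin n → ℂ)) (v k) = a k := by
      have h2 : (∑ j, a j • (E.symm (Pi.single j 1) : Fin n ⊕ Fin n → ℂ)) =
          (E.symm a : Fin n ⊕ Fin n → ℂ) := by
        conv_rhs => rw [← Finset.univ_sum_single a, map_sum]
        rw [Submodule.coe_sum]
        refine Finset.sum_congr rfl fun j _ => ?_
        rw [← Submodule.coe_smul, ← map_smul, ← Pi.single_smul, smul_eq_mul, mul_one]
      rw [h2, ← hLa, hE]
    rw [h] at h1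
    rw [← h1]
    simp [sympl]

end NormalFormExistence

end QuadGrowth
end

noncomputable section
namespace QuadGrowth

/-! ### The canonical transformation and its weight -/

section NormalFormConstruction

variable {n : ℕ} {Q : Matrix (Fin n ⊕ Fin n) (Fin n ⊕ Fin n) ℂ}

theorem sympl_sum_left {ι : Type*} (t : Finset ι) (g : ι → (Fin n ⊕ Fin n → ℂ))
    (Y : Fin n ⊕ Fin n → ℂ) : sympl (∑ i ∈ t, g i) Y = ∑ i ∈ t, sympl (g i) Y := by
  have := LinearMap.congr_fun (map_sum symplB g t) Y
  rwa [LinearMap.sum_apply] at this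

theorem sympl_sum_right {ι : Type*} (t : Finset ι) (g : ι → (Fin n ⊕ Fin n → ℂ))
    (Y : Fin n ⊕ Fin n → ℂ) : sympl Y (∑ i ∈ t, g i) = ∑ i ∈ t, sympl Y (g i) := by
  exact map_sum (symplB Y) g t

theorem sympl_mulVec {K : Matrix (Fin n ⊕ Fin n) (Fin n ⊕ Fin n) ℂ}
    (hK : K ∈ Matrix.symplecticGroup (Fin n) ℂ) (X Y : Fin n ⊕ Fin n → ℂ) :
    sympl (K *ᵥ X) (K *ᵥ Y) = sympl X Y := by
  conv_rhs => rw [sympl, ← SymplecticGroup.mem_iff'.1 hK, ← Matrix.mulVec_mulVec,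
    ← Matrix.mulVec_mulVec, Matrix.mulVec_transpose, dotProduct_comm X, ← Matrix.dotProduct_mulVec,
    dotProduct_comm]
  rfl

theorem star_toC (X : Fin n ⊕ Fin n → ℝ) : star (toC X) = toC X := by
  ext a; simp [toC]

theorem sympl_toC_im (X Y : Fin n ⊕ Fin n → ℝ) : (sympl (toC X) (toC Y)).im = 0 :=
  Complex.conj_eq_iff_im.1 (by
    have := star_sympl (toC X) (toC Y)
    rwa [star_toC, star_toC] at this)

/-- The quadratic form `Re (x · G x)` has holomorphic gradient `G`, if `G` is real linear and
`Re (y · G x)` is symmetric. -/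
theorem exists_weight (G : (Fin n → ℂ) →ₗ[ℝ] (Fin n → ℂ))
    (hG : ∀ x y, (y ⬝ᵥ G x).re = (x ⬝ᵥ G y).re) :
    ∃ Φ : QuadraticForm ℝ (Fin n → ℂ), (∀ x, Φ x = (x ⬝ᵥ G x).re) ∧ ∀ x, gradX Φ x = G x := by
  set b : (Fin n → ℂ) →ₗ[ℝ] (Fin n → ℂ) →ₗ[ℝ] ℝ :=
    LinearMap.mk₂ ℝ (fun x y => (x ⬝ᵥ G y).re) (fun x y z => by simp [add_dotProduct])
      (fun c x y => by simp [smul_dotProduct]) (fun x y z => by simp [dotProduct_add])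
      (fun c x y => by simp [dotProduct_smul]) with hb
  set Φ : QuadraticForm ℝ (Fin n → ℂ) := LinearMap.BilinMap.toQuadraticMap b with hΦ
  have hΦa : ∀ x, Φ x = (x ⬝ᵥ G x).re := fun x => rfl
  have hpol : ∀ x y, QuadraticMap.polar Φ x y = 2 * (y ⬝ᵥ G x).re := by
    intro x y
    rw [QuadraticMap.polar, hΦa, hΦa, hΦa, map_add, add_dotProduct, dotProduct_add, dotProduct_add]
    simp only [Complex.add_re]
    rw [← hG x y]
    ring
  refine ⟨Φ, hΦa, fun x => ?_⟩
  ext j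
  have h1 : e j ⬝ᵥ G x = G x j := by simp [e]
  have h2 : ie j ⬝ᵥ G x = Complex.I * G x j := by simp [ie]
  apply Complex.ext
  · rw [gradX_re, hpol, h1]; ring
  · rw [gradX_im, hpol, h2, Complex.I_mul_re]; ring

/-- In the coordinates of the symplectic basis the positive subspace is `{ξ = 0}` and the negative
one is `{x = 0}`. Real phase space meets the latter only in zero, so it is a graph over `x`; reality
of `σ` on it makes the graph that of a gradient, and the two signs of the hermitian form make the
potential positive. -/
theorem exists_isNormalForm (hQ : Q.IsSymm) (hre : ReNonneg Q) (hs : TrivialSingularSpace Q) :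
    ∃ lam M K Φ, IsNormalForm Q lam M K Φ := by
  classical
  obtain ⟨v, f, M, hM, hFv, hvv, hff, hfv, hfFf, hMim, hpos, hneg⟩ :=
    exists_symplectic_basis hQ hre hs
  set P : Matrix (Fin n ⊕ Fin n) (Fin n ⊕ Fin n) ℂ := Matrix.of fun a c => Sum.elim v f c a with hP
  have hPapp : ∀ Z : Fin n ⊕ Fin n → ℂ,
      P *ᵥ Z = (∑ k, Z (Sum.inl k) • v k) + ∑ k, Z (Sum.inr k) • f k := by
    intro Z
    ext a
    simp [hP, Matrix.mulVec, dotProduct, mul_comm]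
  have hvf : ∀ j k, sympl (v j) (f k) = if j = k then -1 else 0 := by
    intro j k
    rw [sympl_swap, hfv]
    by_cases h : j = k
    · simp [h]
    · simp [h, Ne.symm h]
  have hPJ : Pᵀ * Matrix.J (Fin n) ℂ * P = Matrix.J (Fin n) ℂ := by
    have h1 : ∀ c d, (Pᵀ * Matrix.J (Fin n) ℂ * P) c d = sympl (Sum.elim v f c) (Sum.elim v f d) := by
      intro c d
      rw [sympl, Matrix.dotProduct_mulVec]
      rfl
    ext (c | c) (d | d) <;> rw [h1]
    · simp [hvv, Matrix.J]
    · simp [hvf, Matrix.J, Matrix.one_apply]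
      split_ifs <;> simp
    · simp [hfv, Matrix.J, Matrix.one_apply]
    · simp [hff, Matrix.J]
  have hPm : P ∈ Matrix.symplecticGroup (Fin n) ℂ := SymplecticGroup.mem_iff'.2 hPJ
  have hPdet : IsUnit P.det := SymplecticGroup.symplectic_det hPm
  set K := P⁻¹ with hK
  have hKm : K ∈ Matrix.symplecticGroup (Fin n) ℂ := by
    have := ((⟨P, hPm⟩ : Matrix.symplecticGroup (Fin n) ℂ)⁻¹).2
    rwa [SymplecticGroup.coe_inv'] at this
  have hPK : ∀ X, P *ᵥ (K *ᵥ X) = X := fun X => by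
    rw [Matrix.mulVec_mulVec, hK, Matrix.mul_nonsing_inv _ hPdet, Matrix.one_mulVec]
  have hKP : ∀ X, K *ᵥ (P *ᵥ X) = X := fun X => by
    rw [Matrix.mulVec_mulVec, hK, Matrix.nonsing_inv_mul _ hPdet, Matrix.one_mulVec]
  -- Write `q(X) = σ(X, F X)` and split `X` along the two subspaces. Both are isotropic and
  -- invariant, so only the mixed terms survive, and skewness makes these two equal.
  have hsymb : ∀ X, symbol Q X =
      (M *ᵥ fun j => (K *ᵥ X) (Sum.inl j)) ⬝ᵥ fun j => (K *ᵥ X) (Sum.inr j) := by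
    intro X
    set Z := K *ᵥ X with hZ
    have hX : X = P *ᵥ Z := (hPK X).symm
    set Xp := ∑ k, Z (Sum.inl k) • v k with hXp
    set Xm := ∑ k, Z (Sum.inr k) • f k with hXm
    have hFXp : (2 : ℂ) • (hamiltonMap Q *ᵥ Xp) =
        ∑ j, (M *ᵥ fun j => Z (Sum.inl j)) j • v j := by
      rw [hXp, ← Matrix.mulVecLin_apply, map_sum, Finset.smul_sum]
      simp only [map_smul, Matrix.mulVecLin_apply]
      calc _ = ∑ k, Z (Sum.inl k) • ∑ j, M j k • v j := by
            refine Finset.sum_congr rfl fun k _ => ?_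
            rw [smul_comm, hFv]
        _ = _ := by
            simp only [Finset.smul_sum, smul_smul, Matrix.mulVec, dotProduct, Finset.sum_smul]
            rw [Finset.sum_comm]
            simp only [mul_comm]
    have hpp : sympl Xp (hamiltonMap Q *ᵥ Xp) = 0 := by
      have h2 : sympl Xp ((2 : ℂ) • (hamiltonMap Q *ᵥ Xp)) = 0 := by
        rw [hFXp, hXp, sympl_sum_left]
        refine Finset.sum_eq_zero fun i _ => ?_
        rw [sympl_sum_right]
        refine Finset.sum_eq_zero fun j _ => ?_
        rw [sympl_smul_left, sympl_smul_right, hvv]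
        ring
      rw [sympl_smul_right] at h2
      exact (mul_eq_zero.1 h2).resolve_left two_ne_zero
    have hmm : sympl Xm (hamiltonMap Q *ᵥ Xm) = 0 := by
      rw [hXm, ← Matrix.mulVecLin_apply, map_sum, sympl_sum_left]
      refine Finset.sum_eq_zero fun i _ => ?_
      rw [sympl_sum_right]
      refine Finset.sum_eq_zero fun j _ => ?_
      rw [map_smul, sympl_smul_left, sympl_smul_right, Matrix.mulVecLin_apply, hfFf]
      ring
    have hmp : 2 * sympl Xm (hamiltonMap Q *ᵥ Xp) =
        (M *ᵥ fun j => Z (Sum.inl j)) ⬝ᵥ fun j => Z (Sum.inr j) := by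
      rw [← sympl_smul_right, hFXp, hXm, sympl_sum_left, dotProduct]
      refine Finset.sum_congr rfl fun i _ => ?_
      rw [sympl_sum_right, Finset.sum_eq_single i]
      · rw [sympl_smul_left, sympl_smul_right, hfv, if_pos rfl]; ring
      · intro j _ hj
        rw [sympl_smul_left, sympl_smul_right, hfv, if_neg hj.symm]; ring
      · simp
    rw [symbol, ← sympl_hamiltonMap, hX, hPapp, Matrix.mulVec_add, sympl_add_left, sympl_add_right,
      sympl_add_right, hpp, hmm, ← hmp, ← neg_neg (sympl Xp (hamiltonMap Q *ᵥ Xm)),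
      ← sympl_hamiltonMap_left hQ, ← sympl_swap]
    ring
  -- the weight
  set fst : (Fin n ⊕ Fin n → ℝ) →ₗ[ℝ] (Fin n → ℂ) :=
    { toFun := fun X j => (K *ᵥ toC X) (Sum.inl j)
      map_add' := fun X Y => by
        have : toC (X + Y) = toC X + toC Y := by ext a; simp [toC]
        ext j; rw [this, Matrix.mulVec_add]; rfl
      map_smul' := fun c X => by
        have : toC (c • X) = (c : ℂ) • toC X := by ext a; simp [toC]
        ext j; rw [this, Matrix.mulVec_smul]; simp } with hfst
  -- The factor `i / 2` undoes the `2 / i` in `ξ = (2 / i) ∂_x Φ(x)`.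
  set snd : (Fin n ⊕ Fin n → ℝ) →ₗ[ℝ] (Fin n → ℂ) :=
    { toFun := fun X j => (Complex.I / 2) * (K *ᵥ toC X) (Sum.inr j)
      map_add' := fun X Y => by
        have : toC (X + Y) = toC X + toC Y := by ext a; simp [toC]
        ext j; rw [this, Matrix.mulVec_add]; simp [mul_add]
      map_smul' := fun c X => by
        have : toC (c • X) = (c : ℂ) • toC X := by ext a; simp [toC]
        ext j; rw [this, Matrix.mulVec_smul]; simp; ring } with hsnd
  -- A real vector with vanishing `x`-component lies in the negative subspace, whereas `i σ(X̄, X) =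
  -- 0` for real `X`.
  have hinj : Function.Injective fst := by
    rw [← LinearMap.ker_eq_bot, LinearMap.ker_eq_bot']
    intro X hX
    have h1 : ∀ j, (K *ᵥ toC X) (Sum.inl j) = 0 := fun j => congrFun hX j
    have h2 : toC X = ∑ k, (K *ᵥ toC X) (Sum.inr k) • f k := by
      conv_lhs => rw [← hPK (toC X), hPapp]
      simp [h1]
    by_contra hX0
    have h3 : (fun k => (K *ᵥ toC X) (Sum.inr k)) ≠ 0 := by
      intro h
      have h4 : toC X = 0 := by
        rw [h2]
        exact Finset.sum_eq_zero fun k _ => by rw [show (K *ᵥ toC X) (Sum.inr k) = 0 from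
          congrFun h k, zero_smul]
      exact hX0 (funext fun a => by simpa [toC] using congrFun h4 a)
    have h5 := hneg _ h3
    rw [← h2, herm, star_toC, show sympl (toC X) (toC X) = 0 by
      have := sympl_swap (toC X) (toC X)
      linear_combination this / 2] at h5
    simp at h5
  set L := LinearMap.linearEquivOfInjective fst hinj (by
    rw [Module.finrank_fintype_fun_eq_card, ← Module.finrank_mul_finrank ℝ ℂ (Fin n → ℂ),
      Module.finrank_fintype_fun_eq_card, Complex.finrank_real_complex, Fintype.card_sum]
    ring) with hL
  have hLa : ∀ X, L X = fst X := fun _ => rfl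
  set G : (Fin n → ℂ) →ₗ[ℝ] (Fin n → ℂ) := snd ∘ₗ L.symm.toLinearMap with hG
  have hGL : ∀ X, G (fst X) = snd X := by
    intro X
    rw [← hLa, hG, LinearMap.comp_apply, LinearEquiv.coe_coe, L.symm_apply_apply]
  have hKX : ∀ X, K *ᵥ toC X = Sum.elim (fst X) (fun j => 2 / Complex.I * G (fst X) j) := by
    intro X
    rw [hGL]
    ext (j | j)
    · rfl
    · simp only [Sum.elim_inr, hsnd, LinearMap.coe_mk, AddHom.coe_mk]
      have := Complex.I_ne_zero
      field_simp
  -- This symmetry is the vanishing of `Im σ` on pairs of real vectors, which the canonical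
  -- transformation preserves.
  have hGsym : ∀ x y, (y ⬝ᵥ G x).re = (x ⬝ᵥ G y).re := by
    intro x y
    obtain ⟨X, rfl⟩ := L.surjective x
    obtain ⟨Y, rfl⟩ := L.surjective y
    simp only [hLa]
    have h1 := sympl_toC_im X Y
    rw [← sympl_mulVec hKm, hKX, hKX, sympl_eq] at h1
    replace h1 : ((fun j => 2 / Complex.I * G (fst X) j) ⬝ᵥ fst Y -
      fst X ⬝ᵥ (fun j => 2 / Complex.I * G (fst Y) j)).im = 0 := h1
    have h2 : ∀ w z : Fin n → ℂ, (fun j => 2 / Complex.I * w j) ⬝ᵥ z = 2 / Complex.I * (z ⬝ᵥ w) := by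
      intro w z
      rw [dotProduct_comm z]
      exact smul_dotProduct (2 / Complex.I : ℂ) w z
    rw [h2, dotProduct_comm (fst X), h2, ← mul_sub] at h1
    have h3 : (2 / Complex.I : ℂ) = -(2 * Complex.I) := by
      rw [Complex.div_I]
    rw [h3] at h1
    simp at h1
    linarith
  obtain ⟨Φ, hΦ, hgrad⟩ := exists_weight G hGsym
  refine ⟨fun j => M j j / 2, M, K, Φ, hKm, hsymb, hM, fun j => by ring, ?_, ?_, ?_⟩
  · rw [roots_hamiltonMap hQ hKm hsymb hM (fun j => M j j / 2) (fun j => by ring),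
      Multiset.filter_add, Multiset.filter_eq_self.2, Multiset.filter_eq_nil.2, add_zero]
    · intro z hz
      obtain ⟨j, -, rfl⟩ := Multiset.mem_map.1 hz
      have := hMim j
      simp
      linarith
    · intro z hz
      obtain ⟨j, -, rfl⟩ := Multiset.mem_map.1 hz
      have := hMim j
      simp
      linarith
  · refine strictConvexOn_of_posDef Φ fun z hz => ?_
    obtain ⟨X, rfl⟩ := L.surjective z
    rw [hLa] at hz ⊢
    set ζ : Fin n → ℂ := fun j => 2 / Complex.I * G (fst X) j with hζ
    set Xp := ∑ k, fst X k • v k with hXp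
    set Xm := ∑ k, ζ k • f k with hXm
    have hX : Xp + Xm = toC X := by
      rw [← hPK (toC X), hKX, hPapp]
      rfl
    have h1 : sympl Xp Xm = -(fst X ⬝ᵥ ζ) := by
      rw [hXp, sympl_sum_left, dotProduct, ← Finset.sum_neg_distrib]
      refine Finset.sum_congr rfl fun i _ => ?_
      rw [hXm, sympl_sum_right, Finset.sum_eq_single i]
      · rw [sympl_smul_left, sympl_smul_right, hvf, if_pos rfl]; ring
      · intro j _ hj
        rw [sympl_smul_left, sympl_smul_right, hvf, if_neg hj.symm]; ring
      · simp
    have h2 : (sympl Xp Xm).im = 2 * Φ (fst X) := by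
      rw [h1, hΦ, hζ, dotProduct_comm]
      have : (fun j => 2 / Complex.I * G (fst X) j) ⬝ᵥ fst X =
          -(2 * Complex.I) * (fst X ⬝ᵥ G (fst X)) := by
        rw [dotProduct_comm (fst X), ← Complex.div_I]
        exact smul_dotProduct (2 / Complex.I : ℂ) _ _
      rw [this]
      simp
    have hp := hpos _ hz
    have hm : (herm Xm Xm).re ≤ 0 := by
      by_cases h : ζ = 0
      · rw [hXm, h]; simp [herm, sympl]
      · exact (hneg _ h).le
    -- reality of `X`
    have h3 : star Xp + star Xm = Xp + Xm := by rw [← star_add, hX, star_toC]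
    -- Reality of `X = X₊ + X₋` expresses `X̄₊` and `X̄₋` through each other modulo `X`; isotropy
    -- removes the remaining diagonal terms, leaving `Im σ(X₊, X₋)`, which is `2Φ`.
    have h4 : herm Xp Xp - herm Xm Xm = 4 * (Φ (fst X) : ℂ) := by
      have e1 : star Xp = Xp + Xm - star Xm := by rw [← h3]; abel
      have e2 : sympl Xp Xp = 0 := by
        have := sympl_swap Xp Xp; linear_combination this / 2
      have e3 : sympl (star Xm) (star Xm) = 0 := by
        have := sympl_swap (star Xm) (star Xm); linear_combination this / 2
      have e4 : Xp = star Xp + star Xm - Xm := by rw [h3]; abel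
      have e5 : herm Xp Xp = Complex.I * (sympl Xm Xp - sympl (star Xm) Xp) := by
        rw [herm, e1, sub_eq_add_neg, sympl_add_left, sympl_add_left, e2,
          show -star Xm = (-1 : ℂ) • star Xm by simp, sympl_smul_left]
        ring
      have e6 : sympl (star Xm) Xp = star (sympl Xm Xp) - sympl (star Xm) Xm := by
        conv_lhs => rw [e4]
        rw [sub_eq_add_neg, sympl_add_right, sympl_add_right, e3,
          show -Xm = (-1 : ℂ) • Xm by simp, sympl_smul_right, star_sympl]
        ring
      have e7 : sympl Xm Xp - star (sympl Xm Xp) = -(4 * Φ (fst X) : ℝ) * Complex.I := by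
        rw [Complex.star_def, Complex.sub_conj, sympl_swap, Complex.neg_im, h2]
        push_cast; ring
      rw [e5, e6, herm]
      have : Complex.I * (sympl Xm Xp - (star (sympl Xm Xp) - sympl (star Xm) Xm)) -
          Complex.I * sympl (star Xm) Xm = Complex.I * (sympl Xm Xp - star (sympl Xm Xp)) := by ring
      rw [this, e7]
      push_cast
      linear_combination -(4 * (Φ (fst X) : ℂ)) * Complex.I_mul_I
    have h5 := congrArg Complex.re h4
    simp only [Complex.sub_re, Complex.mul_re, Complex.ofReal_re, Complex.ofReal_im, mul_zero,
      sub_zero, Complex.re_ofNat] at h5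
    linarith
  · ext Z
    constructor
    · rintro ⟨X, rfl⟩
      refine ⟨fst X, ?_⟩
      simp only [hgrad, hKX]
    · rintro ⟨x, rfl⟩
      obtain ⟨X, rfl⟩ := L.surjective x
      refine ⟨X, ?_⟩
      simp only [hgrad, hKX, hLa]

end NormalFormConstruction

end QuadGrowth
end

noncomputable section
namespace QuadGrowth

/-! ## The dual weight as a Legendre transform -/

section DualWeight

variable {n : ℕ} (Φ : QuadraticForm ℝ (Fin n → ℂ))

/-- The real linear map `c ↦ 4 conj (∂_x Φ(c))`. -/
def legendreMap : (Fin n → ℂ) →ₗ[ℝ] (Fin n → ℂ) where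
  toFun c := (4 : ℝ) • star (gradX Φ c)
  map_add' x y := by rw [gradX_add, star_add, smul_add]
  map_smul' r x := by
    rw [gradX_smul, star_smul, smul_comm]
    simp

theorem legendreMap_apply (c : Fin n → ℂ) : legendreMap Φ c = (4 : ℝ) • star (gradX Φ c) := rfl

variable {Φ}

theorem polar_eq_legendreMap (x c : Fin n → ℂ) :
    QuadraticMap.polar Φ x c = (1 / 2) * (star x ⬝ᵥ legendreMap Φ c).re := by
  rw [QuadraticMap.polar_comm, polar_eq_gradX, legendreMap_apply, dotProduct_smul,
    Matrix.star_dotProduct_star, Complex.smul_re, smul_eq_mul,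
    Complex.star_def, Complex.conj_re, dotProduct_comm]
  ring

theorem legendreMap_injective (hΦ : Φ.PosDef) : Function.Injective (legendreMap Φ) := by
  rw [← LinearMap.ker_eq_bot, LinearMap.ker_eq_bot']
  intro c hc
  by_contra h
  have h1 := polar_eq_legendreMap (Φ := Φ) c c
  rw [hc, QuadraticMap.polar_self, two_nsmul, dotProduct_zero] at h1
  have := hΦ c h
  simp at h1
  linarith

/-- `legendreMap` as an equivalence. -/
def legendreEquiv (hΦ : Φ.PosDef) : (Fin n → ℂ) ≃ₗ[ℝ] (Fin n → ℂ) :=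
  LinearEquiv.ofInjectiveEndo (legendreMap Φ) (legendreMap_injective hΦ)

theorem legendreEquiv_apply (hΦ : Φ.PosDef) (c : Fin n → ℂ) :
    legendreEquiv hΦ c = legendreMap Φ c := rfl

theorem legendreMap_symm (hΦ : Φ.PosDef) (y : Fin n → ℂ) :
    legendreMap Φ ((legendreEquiv hΦ).symm y) = y := (legendreEquiv hΦ).apply_symm_apply y

theorem star_legendreMap (c : Fin n → ℂ) :
    star (legendreMap Φ c) = ((4 : ℂ) • hessXX Φ) *ᵥ c +
      ((4 : ℂ) • hessBarX Φ).map star *ᵥ star c := by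
  have h : ((4 : ℂ) • hessBarX Φ).map star = (4 : ℂ) • (hessBarX Φ)ᵀ := by
    have h1 := hessBarX_conjTranspose Φ
    ext j k
    have h2 := congrFun (congrFun h1 k) j
    simp only [Matrix.conjTranspose_apply] at h2
    simp [← h2, map_ofNat]
  rw [legendreMap_apply, h, Matrix.smul_mulVec, Matrix.smul_mulVec, ← smul_add, ← gradX_eq]
  ext j
  simp

theorem hessBarX_injective (hΦ : Φ.PosDef) {v : Fin n → ℂ} (h : hessBarX Φ *ᵥ v = 0) : v = 0 := by
  by_contra hv
  have h1 := hΦ v hv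
  have h2 := hΦ (Complex.I • v) (smul_ne_zero Complex.I_ne_zero hv)
  rw [apply_I_smul, h] at h2
  rw [apply_eq_parts, h] at h1
  simp at h1 h2
  linarith

/-- The Legendre map is `c ↦ H c + P* c̄`. Eliminating `c̄` between this equation and its conjugate
produces the Schur complement `H - P* H̄⁻¹ P`, whose inverse is `dualH Φ`; Euler's identity
evaluates the result. Thus the matrix definition of the dual weight is `Φ` composed with the inverse
Legendre map. -/
theorem dualWeight_legendreMap (hΦ : Φ.PosDef) (c : Fin n → ℂ) :
    dualWeight Φ (legendreMap Φ c) = Φ c := by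
  set H := (4 : ℂ) • hessBarX Φ with hH
  set P := (4 : ℂ) • hessXX Φ with hP
  set Hc := H.map star with hHc
  set A := H - Pᴴ * Hc⁻¹ * P with hA
  have hHH : Hᴴ = H := by
    rw [hH, Matrix.conjTranspose_smul, hessBarX_conjTranspose]; simp
  have hHcH : Hcᴴ = Hc := by
    rw [hHc]
    ext j k
    have h2 := congrFun (congrFun hHH j) k
    simp only [Matrix.conjTranspose_apply, Matrix.map_apply, star_star] at h2 ⊢
    rw [← h2, star_star]
  have hHcT : Hc = Hᵀ := by
    conv_rhs => rw [← hHH]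
    rfl
  have hPT : Pᵀ = P := by rw [hP, Matrix.transpose_smul, hessXX_transpose]
  have hPs : Pᴴ = P.map star := by
    conv_rhs => rw [← hPT]
    rfl
  have hPHT : Pᴴᵀ = Pᴴ := by
    rw [hPs]
    ext j k
    simp only [Matrix.transpose_apply, Matrix.map_apply]
    rw [← Matrix.transpose_apply P, hPT]
  have hHdet : IsUnit H.det := by
    rw [isUnit_iff_ne_zero]
    intro h
    obtain ⟨v, hv0, hv⟩ := Matrix.exists_mulVec_eq_zero_iff.2 h
    rw [hH, Matrix.smul_mulVec] at hv
    exact hv0 (hessBarX_injective hΦ ((smul_eq_zero.1 hv).resolve_left (by norm_num)))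
  have hHcdet : IsUnit Hc.det := by rw [hHcT, Matrix.det_transpose]; exact hHdet
  have hstar : ∀ c, star (legendreMap Φ c) = P *ᵥ c + Hc *ᵥ star c := star_legendreMap
  have hleg : ∀ c, legendreMap Φ c = H *ᵥ c + Pᴴ *ᵥ star c := by
    intro c
    rw [← star_star (legendreMap Φ c), hstar, star_add, Matrix.star_mulVec, Matrix.star_mulVec,
      ← Matrix.mulVec_transpose, ← Matrix.mulVec_transpose, star_star, hHcH, add_comm]
    rw [hHcT, Matrix.transpose_transpose, hPHT]
  -- A null vector of the Schur complement gives a pair `(v, d)` solving the complexified system in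
  -- which `d` replaces the conjugate variable. Then `v + d` and `i (v - d)` are honest null vectors
  -- of the Legendre map.
  have hAdet : IsUnit A.det := by
    rw [isUnit_iff_ne_zero]
    intro h
    obtain ⟨v, hv0, hv⟩ := Matrix.exists_mulVec_eq_zero_iff.2 h
    set d := star (-(Hc⁻¹ *ᵥ (P *ᵥ v))) with hd
    have h1 : H *ᵥ v + Pᴴ *ᵥ star d = 0 := by
      rw [hd, star_star, Matrix.mulVec_neg, ← sub_eq_add_neg, Matrix.mulVec_mulVec,
        Matrix.mulVec_mulVec, ← Matrix.sub_mulVec]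
      exact hv
    have h2 : Hc *ᵥ star d = -(P *ᵥ v) := by
      rw [hd, star_star, Matrix.mulVec_neg, Matrix.mulVec_mulVec, Matrix.mul_nonsing_inv _ hHcdet,
        Matrix.one_mulVec]
    have h3 : H *ᵥ d + Pᴴ *ᵥ star v = 0 := by
      have h4 := congrArg star h2
      rw [Matrix.star_mulVec, star_star, hHcH, ← Matrix.mulVec_transpose, hHcT,
        Matrix.transpose_transpose, star_neg, Matrix.star_mulVec, ← Matrix.mulVec_transpose,
        hPHT] at h4
      rw [h4]
      exact neg_add_cancel _
    have h4 : legendreMap Φ (v + d) = 0 := by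
      rw [hleg, star_add, Matrix.mulVec_add, Matrix.mulVec_add]
      calc _ = (H *ᵥ v + Pᴴ *ᵥ star d) + (H *ᵥ d + Pᴴ *ᵥ star v) := by abel
        _ = 0 := by rw [h1, h3, add_zero]
    have h5 : legendreMap Φ (Complex.I • (v - d)) = 0 := by
      rw [hleg, star_smul, star_sub, Matrix.mulVec_smul, Matrix.mulVec_smul, Matrix.mulVec_sub,
        Matrix.mulVec_sub, Complex.star_def, Complex.conj_I]
      calc _ = Complex.I • ((H *ᵥ v + Pᴴ *ᵥ star d) - (H *ᵥ d + Pᴴ *ᵥ star v)) := by module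
        _ = 0 := by rw [h1, h3, sub_zero, smul_zero]
    have h6 := legendreMap_injective hΦ (h4.trans (map_zero _).symm)
    have h7 := (smul_eq_zero.1 (legendreMap_injective hΦ (h5.trans (map_zero _).symm))).resolve_left
      Complex.I_ne_zero
    apply hv0
    have h8 : (2 : ℂ) • v = (v + d) + (v - d) := by module
    rw [h6, h7, add_zero] at h8
    exact (smul_eq_zero.1 h8).resolve_left two_ne_zero
  have hK : dualH Φ = A⁻¹ := rfl
  have hdP : dualP Φ = -(Hc⁻¹ * P * A⁻¹) := rfl
  set y := legendreMap Φ c with hy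
  -- Elimination of `c̄` between the formulas for `y` and `ȳ`.
  have hAc : A *ᵥ c = y - (Pᴴ * Hc⁻¹) *ᵥ star y := by
    rw [hy, hstar, hleg, Matrix.mulVec_add, Matrix.mulVec_mulVec, Matrix.mulVec_mulVec,
      Matrix.mul_assoc Pᴴ Hc⁻¹ Hc, Matrix.nonsing_inv_mul _ hHcdet, Matrix.mul_one, hA,
      Matrix.sub_mulVec]
    abel
  have hKy : A⁻¹ *ᵥ y = c + (A⁻¹ * Pᴴ * Hc⁻¹) *ᵥ star y := by
    have h1 : y = A *ᵥ c + (Pᴴ * Hc⁻¹) *ᵥ star y := by rw [hAc]; abel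
    conv_lhs => rw [h1]
    rw [Matrix.mulVec_add, Matrix.mulVec_mulVec, Matrix.nonsing_inv_mul _ hAdet, Matrix.one_mulVec,
      Matrix.mulVec_mulVec, Matrix.mul_assoc]
  have hAH : Aᴴ = A := by
    rw [hA, Matrix.conjTranspose_sub, hHH, Matrix.conjTranspose_mul, Matrix.conjTranspose_mul,
      Matrix.conjTranspose_conjTranspose, Matrix.conjTranspose_nonsing_inv, hHcH, Matrix.mul_assoc]
  have hBH : (A⁻¹ * Pᴴ * Hc⁻¹)ᴴ = Hc⁻¹ * P * A⁻¹ := by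
    rw [Matrix.conjTranspose_mul, Matrix.conjTranspose_mul, Matrix.conjTranspose_conjTranspose,
      Matrix.conjTranspose_nonsing_inv, Matrix.conjTranspose_nonsing_inv, hHcH, hAH,
      Matrix.mul_assoc]
  have hcross : (y ⬝ᵥ ((Hc⁻¹ * P * A⁻¹) *ᵥ y)).re =
      (star y ⬝ᵥ ((A⁻¹ * Pᴴ * Hc⁻¹) *ᵥ star y)).re := by
    have h1 : star (star y ⬝ᵥ ((A⁻¹ * Pᴴ * Hc⁻¹) *ᵥ star y)) =
        y ⬝ᵥ ((Hc⁻¹ * P * A⁻¹) *ᵥ y) := by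
      rw [star_dotProduct_mulVec, star_star, ← hBH, Matrix.dotProduct_mulVec, dotProduct_comm,
        ← Matrix.mulVec_transpose]
      rfl
    rw [← h1, Complex.star_def, Complex.conj_re]
  have hyc : (star y ⬝ᵥ c).re = 4 * Φ c := by
    rw [hy, legendreMap_apply, star_smul, smul_dotProduct, star_star, two_mul_apply_eq_gradX Φ c,
      dotProduct_comm]
    simp
  rw [dualWeight, hK, hdP, hKy, dotProduct_add, Complex.add_re, Matrix.neg_mulVec, dotProduct_neg,
    Complex.neg_re, hcross, hyc]
  ring

variable (Φ) in
/-- The Fenchel identity for `Φ` and its dual weight. -/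
theorem fenchel (hΦ : Φ.PosDef) (x w : Fin n → ℂ) :
    Φ x + dualWeight Φ w - (1 / 2) * (star x ⬝ᵥ w).re = Φ (x - (legendreEquiv hΦ).symm w) := by
  set c := (legendreEquiv hΦ).symm w with hc
  have hw : w = legendreMap Φ c := (legendreMap_symm hΦ w).symm
  have h2 : Φ (x - c) = Φ x + Φ c - QuadraticMap.polar Φ x c := by
    have := QuadraticMap.map_add Φ x (-c)
    rw [← sub_eq_add_neg, QuadraticMap.map_neg, QuadraticMap.polar_neg_right] at this
    linarith
  rw [h2, polar_eq_legendreMap, hw, dualWeight_legendreMap hΦ]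

/-- The dual weight as a quadratic form. -/
def dualForm (hΦ : Φ.PosDef) : QuadraticForm ℝ (Fin n → ℂ) :=
  Φ.comp (legendreEquiv hΦ).symm.toLinearMap

theorem dualForm_apply (hΦ : Φ.PosDef) (w : Fin n → ℂ) : dualForm hΦ w = dualWeight Φ w := by
  rw [dualForm, QuadraticMap.comp_apply, LinearEquiv.coe_coe, ← dualWeight_legendreMap hΦ,
    legendreMap_symm]

theorem dualForm_posDef (hΦ : Φ.PosDef) : (dualForm hΦ).PosDef := by
  intro w hw
  rw [dualForm, QuadraticMap.comp_apply]
  exact hΦ _ ((legendreEquiv hΦ).symm.map_ne_zero_iff.2 hw)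

theorem fenchel_dual (hΦ : Φ.PosDef) (x w : Fin n → ℂ) :
    Φ x + dualForm hΦ w - (1 / 2) * (star x ⬝ᵥ w).re = dualForm hΦ (w - legendreMap Φ x) := by
  rw [dualForm_apply, fenchel Φ hΦ, dualForm, QuadraticMap.comp_apply, LinearEquiv.coe_coe,
    map_sub (legendreEquiv hΦ).symm,
    ← legendreEquiv_apply hΦ, LinearEquiv.symm_apply_apply, ← QuadraticMap.map_neg Φ, neg_sub]

end DualWeight

/-! ## Growth of quadratic forms and integrability of Gaussians -/

section GaussianBounds

open MeasureTheory

/-- Domination by a multiple of `(1 + ‖x‖)^{-r}`, with `r` one more than the dimension; completing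
the square supplies the constant `exp ((d + r)² / (4c))`. -/
theorem integrable_exp_norm {V : Type*} [NormedAddCommGroup V] [NormedSpace ℝ V]
    [FiniteDimensional ℝ V] [MeasurableSpace V] [BorelSpace V] (μ : Measure V) [μ.IsAddHaarMeasure]
    (d : ℝ) {c : ℝ} (hc : 0 < c) :
    Integrable (fun x : V => Real.exp (d * ‖x‖ - c * ‖x‖ ^ 2)) μ := by
  set r : ℝ := Module.finrank ℝ V + 1 with hr
  have h1 : Integrable (fun x : V => Real.exp ((d + r) ^ 2 / (4 * c)) * (1 + ‖x‖) ^ (-r)) μ :=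
    (integrable_one_add_norm (by rw [hr]; linarith)).const_mul _
  refine h1.mono' (by fun_prop) (Filter.Eventually.of_forall fun x => ?_)
  have ht : 0 ≤ ‖x‖ := norm_nonneg x
  rw [Real.norm_eq_abs, Real.abs_exp, Real.rpow_neg (by positivity), ← div_eq_mul_inv,
    le_div_iff₀ (by positivity)]
  have h2 : (1 + ‖x‖) ^ r ≤ Real.exp (‖x‖ * r) := by
    rw [Real.exp_mul]
    refine Real.rpow_le_rpow (by positivity) ?_ (by positivity)
    linarith [Real.add_one_le_exp ‖x‖]
  refine (mul_le_mul_of_nonneg_left h2 (Real.exp_nonneg _)).trans ?_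
  rw [← Real.exp_add, Real.exp_le_exp, le_div_iff₀ (by positivity)]
  nlinarith [sq_nonneg (2 * c * ‖x‖ - (d + r))]

variable {n : ℕ} (Φ : QuadraticForm ℝ (Fin n → ℂ))

@[fun_prop]
theorem continuous_weight : Continuous Φ := by
  have : (Φ : (Fin n → ℂ) → ℝ) = fun x => (x ⬝ᵥ (hessXX Φ *ᵥ x)).re +
      (star x ⬝ᵥ (hessBarX Φ *ᵥ x)).re := funext fun x => apply_eq_parts Φ x
  rw [this]
  fun_prop

theorem continuous_polar : Continuous fun p : (Fin n → ℂ) × (Fin n → ℂ) =>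
    QuadraticMap.polar Φ p.1 p.2 := by
  unfold QuadraticMap.polar
  fun_prop

variable {Φ}

theorem apply_norm_smul (x : Fin n → ℂ) (hx : x ≠ 0) : Φ x = ‖x‖ ^ 2 * Φ ((‖x‖⁻¹ : ℝ) • x) := by
  rw [QuadraticMap.map_smul, smul_eq_mul]
  have : ‖x‖ ≠ 0 := norm_ne_zero_iff.2 hx
  field_simp

theorem exists_weight_ge (hΦ : Φ.PosDef) : ∃ c > 0, ∀ x, c * ‖x‖ ^ 2 ≤ Φ x := by
  by_cases hne : (Metric.sphere (0 : Fin n → ℂ) 1).Nonempty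
  · obtain ⟨x0, hx0, hmin⟩ := (isCompact_sphere (0 : Fin n → ℂ) 1).exists_isMinOn hne
      (continuous_weight Φ).continuousOn
    have hx00 : x0 ≠ 0 := by
      rintro rfl
      simp at hx0
    refine ⟨Φ x0, hΦ x0 hx00, fun x => ?_⟩
    by_cases hx : x = 0
    · simp [hx]
    rw [apply_norm_smul x hx, mul_comm]
    refine mul_le_mul_of_nonneg_left (hmin ?_) (by positivity)
    rw [mem_sphere_zero_iff_norm, norm_smul, norm_inv, norm_norm,
      inv_mul_cancel₀ (norm_ne_zero_iff.2 hx)]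
  · refine ⟨1, one_pos, fun x => ?_⟩
    by_cases hx : x = 0
    · simp [hx]
    · exfalso
      refine hne ⟨(‖x‖⁻¹ : ℝ) • x, ?_⟩
      rw [mem_sphere_zero_iff_norm, norm_smul, norm_inv, norm_norm,
        inv_mul_cancel₀ (norm_ne_zero_iff.2 hx)]

variable (Φ)

theorem exists_gradX_le : ∃ C, 0 ≤ C ∧ ∀ x j, ‖gradX Φ x j‖ ≤ C * ‖x‖ := by
  set L : (Fin n → ℂ) →ₗ[ℝ] (Fin n → ℂ) :=
    { toFun := gradX Φ, map_add' := gradX_add Φ, map_smul' := gradX_smul Φ }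
  refine ⟨‖L.toContinuousLinearMap‖, norm_nonneg _, fun x j => ?_⟩
  exact (norm_le_pi_norm (gradX Φ x) j).trans (L.toContinuousLinearMap.le_opNorm x)

theorem exists_polar_le : ∃ C, 0 ≤ C ∧ ∀ x y, |QuadraticMap.polar Φ x y| ≤ C * ‖x‖ * ‖y‖ := by
  obtain ⟨C, hC0, hC⟩ := exists_gradX_le Φ
  refine ⟨2 * (n * C), by positivity, fun x y => ?_⟩
  rw [polar_eq_gradX, abs_mul, abs_two, mul_assoc, mul_assoc]
  refine mul_le_mul_of_nonneg_left ?_ zero_le_two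
  refine (Complex.abs_re_le_norm _).trans ((norm_sum_le _ _).trans ?_)
  have : ∀ j ∈ Finset.univ, ‖y j * gradX Φ x j‖ ≤ C * ‖x‖ * ‖y‖ := fun j _ => by
    rw [norm_mul, mul_comm]
    exact mul_le_mul (hC x j) (norm_le_pi_norm y j) (norm_nonneg _) (by positivity)
  refine (Finset.sum_le_sum this).trans ?_
  rw [Finset.sum_const, Finset.card_univ, Fintype.card_fin, nsmul_eq_mul]
  apply le_of_eq; ring

end GaussianBounds

end QuadGrowth
end

noncomputable section
namespace QuadGrowth

/-! ### Gaussian integrals with holomorphic parameters -/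

section GaussDecay

open MeasureTheory Complex

variable {n : ℕ}

/-- Functions bounded by a Gaussian times an exponential. -/
def GaussDecay (g : (Fin n → ℂ) → ℂ) : Prop :=
  AEStronglyMeasurable g volume ∧
    ∃ C c d : ℝ, 0 < c ∧ ∀ x, ‖g x‖ ≤ C * Real.exp (d * ‖x‖ - c * ‖x‖ ^ 2)

theorem GaussDecay.integrable {g : (Fin n → ℂ) → ℂ} (hg : GaussDecay g) : Integrable g := by
  obtain ⟨hm, C, c, d, hc, h⟩ := hg
  exact ((integrable_exp_norm volume d hc).const_mul C).mono' hm (Filter.Eventually.of_forall h)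

theorem GaussDecay.mul {g p : (Fin n → ℂ) → ℂ} (hg : GaussDecay g)
    (hp : AEStronglyMeasurable p volume) {C' d' : ℝ} (h' : ∀ x, ‖p x‖ ≤ C' * Real.exp (d' * ‖x‖)) :
    GaussDecay fun x => p x * g x := by
  obtain ⟨hm, C, c, d, hc, h⟩ := hg
  refine ⟨hp.mul hm, C' * C, c, d' + d, hc, fun x => ?_⟩
  rw [norm_mul]
  refine (mul_le_mul (h' x) (h x) (norm_nonneg _) ((norm_nonneg _).trans (h' x))).trans ?_
  apply le_of_eq
  rw [show (d' + d) * ‖x‖ - c * ‖x‖ ^ 2 = d' * ‖x‖ + (d * ‖x‖ - c * ‖x‖ ^ 2) by ring, Real.exp_add]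
  ring

theorem gaussDecay_exp_neg {Ψ : QuadraticForm ℝ (Fin n → ℂ)} (hΨ : Ψ.PosDef) {t : ℝ} (ht : 0 < t) :
    GaussDecay fun x => ((Real.exp (-t * Ψ x) : ℝ) : ℂ) := by
  obtain ⟨c, hc, h⟩ := exists_weight_ge hΨ
  refine ⟨Continuous.aestronglyMeasurable (by fun_prop), 1, t * c, 0, by positivity, fun x => ?_⟩
  rw [norm_real, Real.norm_eq_abs, Real.abs_exp, one_mul, Real.exp_le_exp]
  nlinarith [h x]

theorem integrable_exp_neg {Ψ : QuadraticForm ℝ (Fin n → ℂ)} (hΨ : Ψ.PosDef) {t : ℝ} (ht : 0 < t) :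
    Integrable fun x => Real.exp (-t * Ψ x) := by
  exact (gaussDecay_exp_neg hΨ ht).integrable.re

theorem integral_exp_neg_pos {Ψ : QuadraticForm ℝ (Fin n → ℂ)} (hΨ : Ψ.PosDef) {t : ℝ}
    (ht : 0 < t) : 0 < ∫ x, Real.exp (-t * Ψ x) :=
  integral_exp_pos (integrable_exp_neg hΨ ht)

variable {ι : Type*} [Fintype ι]

/-- The integral of `exp (∑ y_j L_j(w)) g(w)`. -/
def gaussTransform (L : ι → (Fin n → ℂ) → ℂ) (g : (Fin n → ℂ) → ℂ) (y : ι → ℂ) : ℂ :=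
  ∫ w, exp (∑ j, y j * L j w) * g w

theorem norm_sum_mul_le {L : ι → (Fin n → ℂ) → ℂ} {K : ℝ}
    (hK : ∀ j w, ‖L j w‖ ≤ K * ‖w‖) (y : ι → ℂ) (w : Fin n → ℂ) :
    ‖∑ j, y j * L j w‖ ≤ (Fintype.card ι * K * ‖y‖) * ‖w‖ := by
  refine (norm_sum_le _ _).trans ?_
  have : ∀ j ∈ Finset.univ, ‖y j * L j w‖ ≤ ‖y‖ * (K * ‖w‖) := fun j _ => by
    rw [norm_mul]
    exact mul_le_mul (norm_le_pi_norm y j) (hK j w) (norm_nonneg _) (norm_nonneg _)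
  refine (Finset.sum_le_sum this).trans ?_
  rw [Finset.sum_const, Finset.card_univ, nsmul_eq_mul]
  apply le_of_eq; ring

theorem norm_exp_le_exp_norm' (z : ℂ) : ‖exp z‖ ≤ Real.exp ‖z‖ := by
  rw [norm_exp]
  exact Real.exp_le_exp.2 (re_le_norm z)

/-- Differentiation under the integral sign: on a unit ball of parameters the exponential grows at
most like `e^{C ‖w‖}`, which the Gaussian absorbs. The derivative is returned together with its
values, so that it can be iterated. -/
theorem hasFDerivAt_gaussTransform {L : ι → (Fin n → ℂ) → ℂ} (hL : ∀ j, Continuous (L j)) {K : ℝ}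
    (hK : ∀ j w, ‖L j w‖ ≤ K * ‖w‖) {g : (Fin n → ℂ) → ℂ} (hg : GaussDecay g) (y : ι → ℂ) :
    ∃ D : (ι → ℂ) →L[ℂ] ℂ, HasFDerivAt (gaussTransform L g) D y ∧
      ∀ v, D v = gaussTransform L (fun w => (∑ j, v j * L j w) * g w) y := by
  classical
  wlog hK0 : 0 ≤ K generalizing K
  · exact this (K := |K|) (fun j w => (hK j w).trans
      (mul_le_mul_of_nonneg_right (le_abs_self K) (norm_nonneg w))) (abs_nonneg K)
  set F' : (ι → ℂ) → (Fin n → ℂ) → ((ι → ℂ) →L[ℂ] ℂ) := fun y w =>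
    (exp (∑ j, y j * L j w) * g w) • ∑ j, L j w • ContinuousLinearMap.proj j with hF'
  set A : ℝ := Fintype.card ι * K with hA
  have hA0 : 0 ≤ A := by positivity
  have hbexp : ∀ (y : ι → ℂ) (w : Fin n → ℂ), ‖exp (∑ j, y j * L j w)‖ ≤ 1 * Real.exp ((A * ‖y‖) * ‖w‖) := fun y w => by
    rw [one_mul]
    exact (norm_exp_le_exp_norm' _).trans (Real.exp_le_exp.2 (norm_sum_mul_le hK y w))
  have hdecay : ∀ y : ι → ℂ, GaussDecay fun w => exp (∑ j, y j * L j w) * g w := fun y =>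
    hg.mul (Continuous.aestronglyMeasurable (by fun_prop)) (hbexp y)
  have hpn : ∀ w, ‖∑ j, L j w • (ContinuousLinearMap.proj j : (ι → ℂ) →L[ℂ] ℂ)‖ ≤ A * ‖w‖ := by
    intro w
    refine ContinuousLinearMap.opNorm_le_bound _ (by positivity) fun v => ?_
    have := norm_sum_mul_le hK v w
    simp only [sum_apply, smul_apply,
      ContinuousLinearMap.proj_apply, smul_eq_mul]
    simp only [mul_comm] at this ⊢
    refine this.trans (le_of_eq ?_)
    rw [hA]; ring
  obtain ⟨C, c, d, hc, hgb⟩ := hg.2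
  have hC : 0 ≤ C := by
    have := (norm_nonneg _).trans (hgb 0)
    simpa using this
  have hmain : HasFDerivAt (gaussTransform L g) (∫ w, F' y w) y := by
    refine hasFDerivAt_integral_of_dominated_of_fderiv_le (s := Metric.ball y 1)
      (bound := fun w => (A * C) * Real.exp ((A * (‖y‖ + 1) + 1 + d) * ‖w‖ - c * ‖w‖ ^ 2))
      (Metric.ball_mem_nhds y one_pos) (Filter.Eventually.of_forall fun z => (hdecay z).1)
      (hdecay y).integrable ?_ (Filter.Eventually.of_forall fun w z hz => ?_)
      ((integrable_exp_norm volume _ hc).const_mul _)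
      (Filter.Eventually.of_forall fun w z _ => ?_)
    · refine (hdecay y).1.smul (Continuous.aestronglyMeasurable ?_)
      fun_prop
    · have hz' : ‖z‖ ≤ ‖y‖ + 1 := by
        have h1 : ‖z - y‖ < 1 := by rwa [← dist_eq_norm]
        have h2 := norm_add_le (z - y) y
        rw [sub_add_cancel] at h2
        linarith
      have h1 : ‖exp (∑ j, z j * L j w)‖ ≤ Real.exp (A * (‖y‖ + 1) * ‖w‖) := by
        refine (hbexp z w).trans ?_
        rw [one_mul]
        gcongr
      have h2 : ‖w‖ ≤ Real.exp ‖w‖ := by linarith [Real.add_one_le_exp ‖w‖]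
      have h3 : ‖F' z w‖ ≤ (Real.exp (A * (‖y‖ + 1) * ‖w‖) *
          (C * Real.exp (d * ‖w‖ - c * ‖w‖ ^ 2))) * (A * Real.exp ‖w‖) := by
        rw [hF', norm_smul, norm_mul]
        have h4 := hgb w
        have h5 := (hpn w).trans (mul_le_mul_of_nonneg_left h2 hA0)
        gcongr
      refine h3.trans (le_of_eq ?_)
      rw [show (A * (‖y‖ + 1) + 1 + d) * ‖w‖ - c * ‖w‖ ^ 2 = A * (‖y‖ + 1) * ‖w‖ +
        (d * ‖w‖ - c * ‖w‖ ^ 2) + ‖w‖ by ring, Real.exp_add, Real.exp_add]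
      ring
    · have h1 : HasFDerivAt (fun y : ι → ℂ => ∑ j, y j * L j w)
          (∑ j, L j w • (ContinuousLinearMap.proj j : (ι → ℂ) →L[ℂ] ℂ)) z := by
        refine HasFDerivAt.fun_sum fun j _ => ?_
        exact ((ContinuousLinearMap.proj j : (ι → ℂ) →L[ℂ] ℂ).hasFDerivAt).mul_const (L j w)
      have h2 := (h1.cexp).mul_const (g w)
      refine h2.congr_fderiv ?_
      rw [hF', smul_smul, mul_comm]
  refine ⟨_, hmain, fun v => ?_⟩
  rw [gaussTransform, ContinuousLinearMap.integral_apply]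
  · refine integral_congr_ae (Filter.Eventually.of_forall fun w => ?_)
    simp only [hF', smul_apply, sum_apply,
      ContinuousLinearMap.proj_apply, smul_eq_mul]
    simp only [mul_comm (L _ w)]
    ring
  · have h1 : GaussDecay fun w => (Real.exp ‖w‖ : ℂ) * (exp (∑ j, y j * L j w) * g w) :=
      (hdecay y).mul (Continuous.aestronglyMeasurable (by fun_prop)) (C' := 1) (d' := 1)
        fun w => by rw [norm_real, Real.norm_eq_abs, Real.abs_exp, one_mul, one_mul]
    refine (h1.integrable.norm.const_mul A).mono' ?_ (Filter.Eventually.of_forall fun w => ?_)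
    · refine (hdecay y).1.smul (Continuous.aestronglyMeasurable ?_)
      fun_prop
    · have h2 : ‖w‖ ≤ Real.exp ‖w‖ := by linarith [Real.add_one_le_exp ‖w‖]
      have h5 := (hpn w).trans (mul_le_mul_of_nonneg_left h2 hA0)
      rw [hF', norm_smul, norm_mul (Real.exp ‖w‖ : ℂ), norm_real, Real.norm_eq_abs, Real.abs_exp]
      refine (mul_le_mul_of_nonneg_left h5 (norm_nonneg _)).trans (le_of_eq (by ring))

theorem differentiable_gaussTransform {L : ι → (Fin n → ℂ) → ℂ} (hL : ∀ j, Continuous (L j)) {K : ℝ}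
    (hK : ∀ j w, ‖L j w‖ ≤ K * ‖w‖) {g : (Fin n → ℂ) → ℂ} (hg : GaussDecay g) :
    Differentiable ℂ (gaussTransform L g) := fun y =>
  (hasFDerivAt_gaussTransform hL hK hg y).choose_spec.1.differentiableAt

/-! ### Gaussian integrals -/

variable {Φ : QuadraticForm ℝ (Fin n → ℂ)}

/-- The Fenchel identity shows that the integrand is a constant times a translated Gaussian. -/
theorem integral_exp_dual (hΦ : Φ.PosDef) (x : Fin n → ℂ) :
    ∫ w, Real.exp ((star x ⬝ᵥ w).re - 2 * dualForm hΦ w) =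
      Real.exp (2 * Φ x) * ∫ w, Real.exp (-2 * dualForm hΦ w) := by
  have h1 : ∀ w, Real.exp ((star x ⬝ᵥ w).re - 2 * dualForm hΦ w) =
      Real.exp (2 * Φ x) * Real.exp (-2 * dualForm hΦ (w - legendreMap Φ x)) := by
    intro w
    rw [← fenchel_dual, ← Real.exp_add]
    congr 1; ring
  simp_rw [h1]
  rw [integral_const_mul,
    integral_sub_right_eq_self (fun w => Real.exp (-2 * dualForm hΦ w)) (legendreMap Φ x)]

theorem integral_exp_primal (hΦ : Φ.PosDef) (w : Fin n → ℂ) :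
    ∫ x, Real.exp ((star x ⬝ᵥ w).re - 2 * Φ x) =
      Real.exp (2 * dualForm hΦ w) * ∫ x, Real.exp (-2 * Φ x) := by
  have h1 : ∀ x, Real.exp ((star x ⬝ᵥ w).re - 2 * Φ x) =
      Real.exp (2 * dualForm hΦ w) * Real.exp (-2 * Φ (x - (legendreEquiv hΦ).symm w)) := by
    intro x
    rw [← fenchel, ← Real.exp_add, dualForm_apply]
    congr 1; ring
  simp_rw [h1]
  rw [integral_const_mul,
    integral_sub_right_eq_self (fun x => Real.exp (-2 * Φ x)) ((legendreEquiv hΦ).symm w)]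

theorem norm_dotProduct_le (x w : Fin n → ℂ) : ‖x ⬝ᵥ w‖ ≤ n * ‖x‖ * ‖w‖ := by
  refine (norm_sum_le _ _).trans ?_
  have : ∀ j ∈ Finset.univ, ‖x j * w j‖ ≤ ‖x‖ * ‖w‖ := fun j _ => by
    rw [norm_mul]
    exact mul_le_mul (norm_le_pi_norm x j) (norm_le_pi_norm w j) (norm_nonneg _) (norm_nonneg _)
  refine (Finset.sum_le_sum this).trans ?_
  rw [Finset.sum_const, Finset.card_univ, Fintype.card_fin, nsmul_eq_mul]
  apply le_of_eq; ring

theorem norm_star_pi (x : Fin n → ℂ) : ‖star x‖ = ‖x‖ := by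
  simp

theorem re_star_dot_comm (x w : Fin n → ℂ) : (star x ⬝ᵥ w).re = (star w ⬝ᵥ x).re := by
  have : star (star x ⬝ᵥ w) = star w ⬝ᵥ x := by
    conv_rhs => rw [← star_star x, Matrix.star_dotProduct_star]
  rw [← this, Complex.star_def, conj_re]

/-- The polarized form of `integral_exp_dual`. -/
theorem integral_cexp_dual (hΦ : Φ.PosDef) (s t : Fin n → ℂ) (z : ℂ) :
    ∫ w, exp ((1 / 2) * (star s ⬝ᵥ w + star w ⬝ᵥ s) + z * ((1 / 2) * (star t ⬝ᵥ w + star w ⬝ᵥ t))) *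
        ((Real.exp (-2 * dualForm hΦ w) : ℝ) : ℂ) =
      exp (2 * Φ s + 2 * z * QuadraticMap.polar Φ s t + 2 * z ^ 2 * Φ t) *
        ((∫ w, Real.exp (-2 * dualForm hΦ w) : ℝ) : ℂ) := by
  have hsym : ∀ s w : Fin n → ℂ, (1 / 2 : ℂ) * (star s ⬝ᵥ w + star w ⬝ᵥ s) =
      (((star s ⬝ᵥ w).re : ℝ) : ℂ) := by
    intro s w
    have h1 : star w ⬝ᵥ s = star (star s ⬝ᵥ w) := by
      conv_lhs => rw [← star_star s, Matrix.star_dotProduct_star]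
    rw [h1, Complex.star_def, Complex.add_conj]
    push_cast; ring
  set g : (Fin n → ℂ) → ℂ := fun w => exp ((1 / 2) * (star s ⬝ᵥ w + star w ⬝ᵥ s)) *
    ((Real.exp (-2 * dualForm hΦ w) : ℝ) : ℂ) with hg
  have hgd : GaussDecay g := by
    refine (gaussDecay_exp_neg (dualForm_posDef hΦ) two_pos).mul
      (Continuous.aestronglyMeasurable (by fun_prop)) (C' := 1) (d' := n * ‖s‖) fun w => ?_
    rw [hsym, ← ofReal_exp, norm_real, Real.norm_eq_abs, Real.abs_exp, one_mul, Real.exp_le_exp]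
    refine (re_le_norm _).trans ((norm_dotProduct_le _ _).trans ?_)
    rw [norm_star_pi]
  set L : Unit → (Fin n → ℂ) → ℂ := fun _ w => (1 / 2) * (star t ⬝ᵥ w + star w ⬝ᵥ t) with hL
  have hd : Differentiable ℂ fun z : ℂ => gaussTransform L g fun _ => z := by
    have h1 : Differentiable ℂ (gaussTransform L g) := by
      refine differentiable_gaussTransform (K := n * ‖t‖) (fun _ => by simp only [hL]; fun_prop)
        (fun _ w => ?_) hgd
      rw [hL]
      simp only [hsym, norm_real]
      refine (abs_re_le_norm _).trans ((norm_dotProduct_le _ _).trans ?_)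
      rw [norm_star_pi]
    exact h1.comp (differentiable_pi.2 fun _ => differentiable_id)
  have hd2 : Differentiable ℂ fun z : ℂ =>
      exp (2 * Φ s + 2 * z * QuadraticMap.polar Φ s t + 2 * z ^ 2 * Φ t) *
        ((∫ w, Real.exp (-2 * dualForm hΦ w) : ℝ) : ℂ) := by fun_prop
  have hreal : ∀ r : ℝ, gaussTransform L g (fun _ => (r : ℂ)) =
      exp (2 * Φ s + 2 * r * QuadraticMap.polar Φ s t + 2 * r ^ 2 * Φ t) *
        ((∫ w, Real.exp (-2 * dualForm hΦ w) : ℝ) : ℂ) := by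
    intro r
    have h1 := integral_exp_dual hΦ (s + (r : ℂ) • t)
    have h2 : Φ (s + (r : ℂ) • t) = Φ s + r * QuadraticMap.polar Φ s t + r ^ 2 * Φ t := by
      rw [Complex.coe_smul, QuadraticMap.map_add Φ, QuadraticMap.map_smul,
        QuadraticMap.polar_smul_right, smul_eq_mul, smul_eq_mul]
      ring
    have h3 : gaussTransform L g (fun _ => (r : ℂ)) =
        ((∫ w, Real.exp ((star (s + (r : ℂ) • t) ⬝ᵥ w).re - 2 * dualForm hΦ w) : ℝ) : ℂ) := by
      rw [← integral_complex_ofReal, gaussTransform]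
      refine integral_congr_ae (Filter.Eventually.of_forall fun w => ?_)
      simp only [hg, hL, Finset.univ_unique, Finset.sum_singleton, hsym]
      rw [← mul_assoc, ← Complex.exp_add, ofReal_exp, ← Complex.exp_add, ofReal_exp]
      congr 1
      rw [star_add, star_smul, add_dotProduct, smul_dotProduct, Complex.star_def, conj_ofReal,
        smul_eq_mul, add_re, re_ofReal_mul]
      push_cast; ring
    rw [h3, h1, h2]
    push_cast
    congr 2; ring
  have hfin : (fun z : ℂ => gaussTransform L g fun _ => z) = fun z : ℂ =>
      exp (2 * Φ s + 2 * z * QuadraticMap.polar Φ s t + 2 * z ^ 2 * Φ t) *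
        ((∫ w, Real.exp (-2 * dualForm hΦ w) : ℝ) : ℂ) := by
    -- Both sides are entire in `z`, and for real `z` the identity is the unpolarized one at `s + z
    -- t`; real points accumulate at the origin.
    refine AnalyticOnNhd.eq_of_frequently_eq (z₀ := 0)
      (fun z _ => hd.analyticAt z) (fun z _ => hd2.analyticAt z) ?_
    have h1 : Filter.Tendsto (fun r : ℝ => (r : ℂ)) (nhdsWithin 0 {0}ᶜ) (nhdsWithin 0 {0}ᶜ) := by
      refine tendsto_nhdsWithin_of_tendsto_nhds_of_eventually_within _ ?_ ?_
      · exact (Complex.continuous_ofReal.tendsto' 0 0 (by simp)).mono_left nhdsWithin_le_nhds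
      · filter_upwards [self_mem_nhdsWithin] with r hr
        simpa using hr
    exact h1.frequently (Filter.Eventually.of_forall hreal).frequently
  have := congrFun hfin z
  simp only [gaussTransform, hg, hL, Finset.univ_unique, Finset.sum_singleton] at this
  rw [← this]
  refine integral_congr_ae (Filter.Eventually.of_forall fun w => ?_)
  simp only
  rw [Complex.exp_add]
  ring

/-! ### The mean value property -/

theorem measurePreserving_circle_smul {c : ℂ} (hc : ‖c‖ = 1) :
    MeasurePreserving fun x : Fin n → ℂ => c • x := by
  have h1 : MeasurePreserving fun z : ℂ => c * z := by
    have := (rotation ⟨c, by simpa [Submonoid.unitSphere] using hc⟩).measurePreserving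
    exact this
  exact volume_preserving_pi fun _ => h1

/-- The mean value property of entire functions for measures invariant under the circle action. -/
theorem integral_mul_circle_invariant {f : (Fin n → ℂ) → ℂ} (hf : Differentiable ℂ f)
    {ρ : (Fin n → ℂ) → ℝ} (hρc : Continuous ρ)
    (hinv : ∀ (c : ℂ) (x : Fin n → ℂ), ‖c‖ = 1 → ρ (c • x) = ρ x)
    (hint : Integrable fun x => f x * ρ x) :
    ∫ x, f x * ρ x = f 0 * ((∫ x, ρ x : ℝ) : ℂ) := by
  -- The one-variable mean value property on each complex line through the origin.
  have hmean : ∀ x, Real.circleAverage (fun z : ℂ => f (z • x)) 0 1 = f 0 := by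
    intro x
    have h1 : Differentiable ℂ fun z : ℂ => f (z • x) := by fun_prop
    have h2 := circleAverage_of_differentiable_on_off_countable (f := fun z : ℂ => f (z • x))
      (c := 0) (R := 1) Set.countable_empty h1.continuous.continuousOn fun z _ => h1 z
    simpa using h2
  have hnorm : ∀ θ : ℝ, ‖circleMap 0 1 θ‖ = 1 := fun θ => by simp
  have hrot : ∀ θ : ℝ, ∫ x, f (circleMap 0 1 θ • x) * ρ x = ∫ x, f x * ρ x := by
    intro θ
    have h1 := (measurePreserving_circle_smul (n := n) (hnorm θ)).integral_comp
      (MeasurableEquiv.smul₀ (circleMap 0 1 θ) (by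
        intro h; have := hnorm θ; rw [h] at this; simp at this)).measurableEmbedding
      (fun x => f x * ρ x)
    simp only [hinv _ _ (hnorm θ)] at h1
    exact h1
  -- Fubini applies because rotations preserve the measure and `ρ`, so the inner `L¹` norm does not
  -- depend on the angle.
  have hswap : ∫ θ in (0 : ℝ)..2 * Real.pi, ∫ x, f (circleMap 0 1 θ • x) * ρ x =
      ∫ x, ∫ θ in (0 : ℝ)..2 * Real.pi, f (circleMap 0 1 θ • x) * ρ x := by
    rw [intervalIntegral.integral_of_le Real.two_pi_pos.le]
    simp_rw [intervalIntegral.integral_of_le Real.two_pi_pos.le]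
    refine integral_integral_swap ?_
    have hcont : Continuous (Function.uncurry fun (θ : ℝ) (x : Fin n → ℂ) =>
        f (circleMap 0 1 θ • x) * (ρ x : ℂ)) := by
      have := hf.continuous
      have := continuous_circleMap 0 1
      fun_prop
    rw [integrable_prod_iff hcont.aestronglyMeasurable]
    have hnint : ∀ θ : ℝ, Integrable fun x => f (circleMap 0 1 θ • x) * (ρ x : ℂ) := by
      intro θ
      have h1 := (measurePreserving_circle_smul (n := n) (hnorm θ)).integrable_comp_of_integrable hint
      simpa only [Function.comp_def, hinv _ _ (hnorm θ)] using h1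
    refine ⟨Filter.Eventually.of_forall fun θ => hnint θ, ?_⟩
    have hconst : ∀ θ : ℝ, ∫ x, ‖f (circleMap 0 1 θ • x) * (ρ x : ℂ)‖ = ∫ x, ‖f x * (ρ x : ℂ)‖ := by
      intro θ
      have h1 := (measurePreserving_circle_smul (n := n) (hnorm θ)).integral_comp
        (MeasurableEquiv.smul₀ (circleMap 0 1 θ) (by
          intro h; have := hnorm θ; rw [h] at this; simp at this)).measurableEmbedding
        (fun x => ‖f x * (ρ x : ℂ)‖)
      simp only [hinv _ _ (hnorm θ)] at h1
      exact h1
    simp only [Function.uncurry_apply_pair, hconst]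
    exact integrable_const _
  simp_rw [hrot] at hswap
  rw [intervalIntegral.integral_const, sub_zero] at hswap
  have h3 : ∀ x, ∫ θ in (0 : ℝ)..2 * Real.pi, f (circleMap 0 1 θ • x) * (ρ x : ℂ) =
      (2 * Real.pi) • (f 0 * (ρ x : ℂ)) := by
    intro x
    rw [intervalIntegral.integral_mul_const, ← hmean x, Real.circleAverage_def, smul_mul_assoc,
      smul_smul, mul_inv_cancel₀ Real.two_pi_pos.ne', one_smul]
  simp_rw [h3] at hswap
  rw [integral_smul] at hswap
  have h4 := smul_right_injective ℂ Real.two_pi_pos.ne' hswap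
  rw [h4, integral_const_mul, integral_complex_ofReal]

end GaussDecay

end QuadGrowth
end

noncomputable section
namespace QuadGrowth

/-! ### Weighted `L²` spaces, point evaluation and the reproducing kernel -/

section WeightedL2

open MeasureTheory Complex

variable {n : ℕ} (Φ : QuadraticForm ℝ (Fin n → ℂ))

/-- Multiplication by `e^{-Φ}`. -/
def wt (u : (Fin n → ℂ) → ℂ) (x : Fin n → ℂ) : ℂ := u x * (Real.exp (-Φ x) : ℝ)

theorem norm_wt (u : (Fin n → ℂ) → ℂ) (x : Fin n → ℂ) : ‖wt Φ u x‖ = ‖u x‖ * Real.exp (-Φ x) := by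
  rw [wt, norm_mul, norm_real, Real.norm_eq_abs, Real.abs_exp]

theorem measurable_weightDensity :
    Measurable fun x : Fin n → ℂ => ENNReal.ofReal (Real.exp (-2 * Φ x)) := by
  have := continuous_weight Φ
  fun_prop

theorem weightMeasure_ac : weightMeasure Φ ≪ volume := withDensity_absolutelyContinuous _ _

theorem ac_weightMeasure : volume ≪ weightMeasure Φ := by
  refine withDensity_absolutelyContinuous' (measurable_weightDensity Φ).aemeasurable ?_
  exact Filter.Eventually.of_forall fun x => by simp [Real.exp_pos]

theorem ae_weightMeasure_iff {p : (Fin n → ℂ) → Prop} :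
    (∀ᵐ x ∂(weightMeasure Φ), p x) ↔ ∀ᵐ x, p x :=
  ⟨fun h => (ac_weightMeasure Φ).ae_le h, fun h => (weightMeasure_ac Φ).ae_le h⟩

/-- Multiplication by `e^{-Φ}` is an isometry into unweighted `L²`, where translation and
Cauchy–Schwarz are available. -/
theorem eLpNorm_weight (u : (Fin n → ℂ) → ℂ) :
    eLpNorm u 2 (weightMeasure Φ) = eLpNorm (wt Φ u) 2 volume := by
  rw [eLpNorm_eq_lintegral_rpow_enorm_toReal two_ne_zero ENNReal.ofNat_ne_top,
    eLpNorm_eq_lintegral_rpow_enorm_toReal two_ne_zero ENNReal.ofNat_ne_top, weightMeasure,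
    lintegral_withDensity_eq_lintegral_mul_non_measurable _ (measurable_weightDensity Φ)
      (Filter.Eventually.of_forall fun x => ENNReal.ofReal_lt_top)]
  congr 1
  refine lintegral_congr fun x => ?_
  rw [Pi.mul_apply, wt, enorm_mul, ENNReal.toReal_ofNat, ENNReal.mul_rpow_of_nonneg _ _ zero_le_two,
    mul_comm]
  congr 1
  rw [← ofReal_norm, norm_real, Real.norm_eq_abs, Real.abs_exp,
    ENNReal.ofReal_rpow_of_nonneg (Real.exp_nonneg _) zero_le_two, ← Real.exp_mul]
  congr 2; ring

theorem aestronglyMeasurable_wt {u : (Fin n → ℂ) → ℂ} (hu : AEStronglyMeasurable u volume) :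
    AEStronglyMeasurable (wt Φ u) volume := by
  have := continuous_weight Φ
  exact hu.mul (Continuous.aestronglyMeasurable (by fun_prop))

theorem memLp_weight {u : (Fin n → ℂ) → ℂ} :
    MemLp u 2 (weightMeasure Φ) ↔ AEStronglyMeasurable u volume ∧ MemLp (wt Φ u) 2 volume := by
  constructor
  · intro h
    have h1 : AEStronglyMeasurable u volume := h.1.mono_ac (ac_weightMeasure Φ)
    exact ⟨h1, aestronglyMeasurable_wt Φ h1, by rw [← eLpNorm_weight]; exact h.2⟩
  · rintro ⟨h1, h2⟩
    exact ⟨h1.mono_ac (weightMeasure_ac Φ), by rw [eLpNorm_weight]; exact h2.2⟩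

/-- The norm in `L²(e^{-2Φ})`. -/
def wnorm (u : (Fin n → ℂ) → ℂ) : ℝ := (eLpNorm u 2 (weightMeasure Φ)).toReal

theorem wnorm_nonneg (u : (Fin n → ℂ) → ℂ) : 0 ≤ wnorm Φ u := ENNReal.toReal_nonneg

theorem norm_lp_eq_wnorm (u : Lp ℂ 2 (weightMeasure Φ)) {f : (Fin n → ℂ) → ℂ}
    (h : u =ᵐ[weightMeasure Φ] f) : ‖u‖ = wnorm Φ f := by
  rw [Lp.norm_def, wnorm, eLpNorm_congr_ae h]

theorem toReal_eLpNorm_two {α : Type*} [MeasurableSpace α] {μ : Measure α} {g : α → ℂ}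
    (hg : MemLp g 2 μ) :
    (eLpNorm g 2 μ).toReal = Real.sqrt (∫ x, ‖g x‖ ^ 2 ∂μ) := by
  rw [hg.eLpNorm_eq_integral_rpow_norm two_ne_zero ENNReal.ofNat_ne_top, ENNReal.toReal_ofReal
    (by positivity), ENNReal.toReal_ofNat, Real.sqrt_eq_rpow, one_div]
  simp

theorem integral_norm_mul_norm_le {α : Type*} [MeasurableSpace α] {μ : Measure α} {f g : α → ℂ}
    (hf : MemLp f 2 μ) (hg : MemLp g 2 μ) :
    ∫ x, ‖f x‖ * ‖g x‖ ∂μ ≤ (eLpNorm f 2 μ).toReal * (eLpNorm g 2 μ).toReal := by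
  have h2 : ENNReal.ofReal 2 = 2 := by norm_num
  have := integral_mul_norm_le_Lp_mul_Lq Real.HolderConjugate.two_two (h2.symm ▸ hf) (h2.symm ▸ hg)
  rw [toReal_eLpNorm_two hf, toReal_eLpNorm_two hg, Real.sqrt_eq_rpow, Real.sqrt_eq_rpow]
  simpa using this

theorem wnorm_sq {u : (Fin n → ℂ) → ℂ} (hu : MemLp u 2 (weightMeasure Φ)) :
    wnorm Φ u ^ 2 = ∫ x, ‖u x‖ ^ 2 * Real.exp (-2 * Φ x) := by
  rw [wnorm, eLpNorm_weight, toReal_eLpNorm_two ((memLp_weight Φ).1 hu).2,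
    Real.sq_sqrt (integral_nonneg fun x => by positivity)]
  refine integral_congr_ae (Filter.Eventually.of_forall fun x => ?_)
  simp only [norm_wt, mul_pow, ← Real.exp_nat_mul]
  congr 2
  push_cast; ring

theorem GaussDecay.memLp_two {g : (Fin n → ℂ) → ℂ} (hg : GaussDecay g) : MemLp g 2 volume := by
  rw [memLp_two_iff_integrable_sq_norm hg.1]
  obtain ⟨hm, C, c, d, hc, h⟩ := hg
  refine ((integrable_exp_norm volume (2 * d) (c := 2 * c) (by positivity)).const_mul (C ^ 2)).mono'
    (hm.norm.pow 2) (Filter.Eventually.of_forall fun x => ?_)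
  rw [Real.norm_eq_abs, abs_of_nonneg (by positivity)]
  refine (pow_le_pow_left₀ (norm_nonneg _) (h x) 2).trans (le_of_eq ?_)
  rw [mul_pow, ← Real.exp_nat_mul]
  congr 2
  push_cast; ring

variable {Φ}

/-- Functions dominated by `e^{Φ}` with a smaller Gaussian lie in `L²(e^{-2Φ})`. -/
theorem memLp_weight_of_bound (hΦ : Φ.PosDef) {u : (Fin n → ℂ) → ℂ} (hu : Continuous u) {C d : ℝ}
    (h : ∀ x, ‖u x‖ ≤ C * Real.exp (d * ‖x‖)) : MemLp u 2 (weightMeasure Φ) := by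
  refine (memLp_weight Φ).2 ⟨hu.aestronglyMeasurable, ?_⟩
  have h1 := (gaussDecay_exp_neg hΦ one_pos).mul hu.aestronglyMeasurable h
  have h2 : wt Φ u = fun x => u x * ((Real.exp (-1 * Φ x) : ℝ) : ℂ) := by
    ext x; rw [wt, neg_one_mul]
  rw [h2]
  exact h1.memLp_two

/-! ### Reproducing formula -/

variable (Φ) in
/-- The quadratic form `Φ(x) + Φ(i x)`, invariant under the circle action. -/
def circForm : QuadraticForm ℝ (Fin n → ℂ) :=
  Φ + Φ.comp ((LinearMap.lsmul ℂ (Fin n → ℂ) I).restrictScalars ℝ)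

theorem circForm_apply (x : Fin n → ℂ) : circForm Φ x = Φ x + Φ (I • x) := rfl

theorem circForm_posDef (hΦ : Φ.PosDef) : (circForm Φ).PosDef := fun x hx =>
  add_pos (hΦ x hx) (hΦ _ (smul_ne_zero I_ne_zero hx))

theorem circForm_smul {c : ℂ} (hc : ‖c‖ = 1) (x : Fin n → ℂ) :
    circForm Φ (c • x) = circForm Φ x := by
  have h : ∀ x, circForm Φ x = 2 * (star x ⬝ᵥ (hessBarX Φ *ᵥ x)).re := by
    intro x
    rw [circForm_apply, apply_eq_parts, apply_I_smul]; ring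
  rw [h, h, hermPart_smul Φ c hc]

theorem holPart_re (x : Fin n → ℂ) : (holPart Φ x).re = (Φ x - Φ (I • x)) / 2 := by
  rw [apply_eq_parts, apply_I_smul]; ring

theorem differentiable_holPart : Differentiable ℂ (holPart Φ) := by
  have : holPart Φ = fun x => ∑ j, x j * ∑ k, hessXX Φ j k * x k := rfl
  rw [this]
  fun_prop

variable (Φ) in
/-- The total mass `∫ e^{-(Φ(x) + Φ(ix))} dL(x)`. -/
def circMass : ℝ := ∫ x, Real.exp (-1 * circForm Φ x)

theorem circMass_pos (hΦ : Φ.PosDef) : 0 < circMass Φ :=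
  integral_exp_neg_pos (circForm_posDef hΦ) one_pos

/-- The factor `e^{-h}`, with `h` the holomorphic part of `Φ`, turns half of the circle-invariant
exponent into `Φ` itself; the other half remains as a square integrable Gaussian. -/
theorem norm_eval_zero_integrand (u : (Fin n → ℂ) → ℂ) (x : Fin n → ℂ) :
    ‖u x * exp (-holPart Φ x) * (Real.exp (-1 * circForm Φ x) : ℝ)‖ =
      ‖wt Φ u x‖ * ‖((Real.exp (-(1 / 2) * circForm Φ x) : ℝ) : ℂ)‖ := by
  rw [norm_wt, norm_mul, norm_mul, norm_exp, norm_real, norm_real, Real.norm_eq_abs,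
    Real.norm_eq_abs, Real.abs_exp, Real.abs_exp, neg_re, holPart_re, circForm_apply, mul_assoc,
    mul_assoc, ← Real.exp_add, ← Real.exp_add]
  congr 2; ring

theorem integrable_eval_zero (hΦ : Φ.PosDef) {u : (Fin n → ℂ) → ℂ} 
    (hu2 : MemLp u 2 (weightMeasure Φ)) :
    Integrable fun x => u x * exp (-holPart Φ x) * (Real.exp (-1 * circForm Φ x) : ℝ) := by
  have h1 := ((memLp_weight Φ).1 hu2).2
  have h2 := (gaussDecay_exp_neg (circForm_posDef hΦ) (t := 1 / 2) (by norm_num)).memLp_two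
  have h3 : Integrable fun x => ‖wt Φ u x‖ * ‖((Real.exp (-(1 / 2) * circForm Φ x) : ℝ) : ℂ)‖ :=
    h1.norm.integrable_mul h2.norm
  refine h3.mono' ?_ (Filter.Eventually.of_forall fun x => (norm_eval_zero_integrand u x).le)
  have := differentiable_holPart (Φ := Φ)
  have := this.continuous
  exact (((memLp_weight Φ).1 hu2).1.mul (Continuous.aestronglyMeasurable (by fun_prop))).mul
    (Continuous.aestronglyMeasurable (by fun_prop))

/-- The mean value property for the entire function `u e^{-h}` against a circle-invariant Gaussian,
with `h(0) = 0`. The factor `e^{-h}` is what adapts an invariant weight to a general `Φ`. -/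
theorem eval_zero_eq (hΦ : Φ.PosDef) {u : (Fin n → ℂ) → ℂ} (hu : Differentiable ℂ u)
    (hu2 : MemLp u 2 (weightMeasure Φ)) :
    u 0 * circMass Φ = ∫ x, u x * exp (-holPart Φ x) * (Real.exp (-1 * circForm Φ x) : ℝ) := by
  have h1 : Differentiable ℂ fun x => u x * exp (-holPart Φ x) :=
    hu.mul (differentiable_holPart.neg.cexp)
  rw [integral_mul_circle_invariant h1 (by fun_prop)
    (fun c x hc => by rw [circForm_smul hc]) (integrable_eval_zero hΦ hu2), circMass]
  simp [holPart]

theorem norm_eval_zero_le (hΦ : Φ.PosDef) {u : (Fin n → ℂ) → ℂ} (hu : Differentiable ℂ u)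
    (hu2 : MemLp u 2 (weightMeasure Φ)) :
    ‖u 0‖ * circMass Φ ≤ wnorm Φ u * Real.sqrt (circMass Φ) := by
  have h1 := congrArg norm (eval_zero_eq hΦ hu hu2)
  rw [norm_mul, norm_real, Real.norm_eq_abs, abs_of_pos (circMass_pos hΦ)] at h1
  rw [h1]
  refine (norm_integral_le_integral_norm _).trans ?_
  simp_rw [norm_eval_zero_integrand]
  have h2 := (gaussDecay_exp_neg (circForm_posDef hΦ) (t := 1 / 2) (by norm_num)).memLp_two
  refine (integral_norm_mul_norm_le ((memLp_weight Φ).1 hu2).2 h2).trans (le_of_eq ?_)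
  rw [← eLpNorm_weight, toReal_eLpNorm_two h2, wnorm, circMass]
  congr 3
  ext x
  rw [norm_real, Real.norm_eq_abs, Real.abs_exp, ← Real.exp_nat_mul]
  congr 1
  push_cast; ring

variable (Φ) in
/-- The unitary translation of `u` by `y`, up to the factor `e^{Φ(y)}`. -/
def wtrans (y : Fin n → ℂ) (u : (Fin n → ℂ) → ℂ) (x : Fin n → ℂ) : ℂ :=
  u (x + y) * exp (-(2 * (x ⬝ᵥ gradX Φ y)))

/-- The holomorphic exponential factor has modulus `e^{-(Φ(x + y) - Φ(x) - Φ(y))}`, which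
compensates exactly for the change of the weight under translation. -/
theorem norm_wt_wtrans (y : Fin n → ℂ) (u : (Fin n → ℂ) → ℂ) (x : Fin n → ℂ) :
    ‖wt Φ (wtrans Φ y u) x‖ = Real.exp (Φ y) * ‖wt Φ u (x + y)‖ := by
  rw [norm_wt, norm_wt, wtrans, norm_mul, norm_exp, QuadraticMap.map_add Φ,
    QuadraticMap.polar_comm, polar_eq_gradX]
  rw [mul_left_comm, ← Real.exp_add, mul_assoc, ← Real.exp_add]
  congr 2
  simp
  ring

theorem differentiable_wtrans {y : Fin n → ℂ} {u : (Fin n → ℂ) → ℂ} (hu : Differentiable ℂ u) :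
    Differentiable ℂ (wtrans Φ y u) := by
  have : (fun x : Fin n → ℂ => x ⬝ᵥ gradX Φ y) = fun x => ∑ j, x j * gradX Φ y j := rfl
  have h1 : Differentiable ℂ fun x : Fin n → ℂ => x ⬝ᵥ gradX Φ y := by rw [this]; fun_prop
  unfold wtrans
  fun_prop

theorem eLpNorm_comp_add_right {g : (Fin n → ℂ) → ℂ} (hg : AEStronglyMeasurable g volume)
    (y : Fin n → ℂ) : eLpNorm (fun x => g (x + y)) 2 volume = eLpNorm g 2 volume := by
  have h := eLpNorm_comp_measurePreserving (p := 2) hg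
    (measurePreserving_add_right (volume : Measure (Fin n → ℂ)) y)
  rwa [Function.comp_def] at h

theorem eLpNorm_wtrans (y : Fin n → ℂ) {u : (Fin n → ℂ) → ℂ}
    (hu2 : AEStronglyMeasurable u volume) :
    eLpNorm (wtrans Φ y u) 2 (weightMeasure Φ) =
      ENNReal.ofReal (Real.exp (Φ y)) * eLpNorm u 2 (weightMeasure Φ) := by
  have h1 : eLpNorm (wt Φ (wtrans Φ y u)) 2 volume =
      eLpNorm (fun x => ((Real.exp (Φ y) : ℝ) : ℂ) • wt Φ u (x + y)) 2 volume := by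
    refine eLpNorm_congr_norm_ae (Filter.Eventually.of_forall fun x => ?_)
    rw [norm_wt_wtrans, norm_smul, norm_real, Real.norm_eq_abs, Real.abs_exp]
  have h2 := eLpNorm_comp_add_right (aestronglyMeasurable_wt Φ hu2) y
  rw [eLpNorm_weight, eLpNorm_weight, h1, ← h2]
  rw [show (fun x => ((Real.exp (Φ y) : ℝ) : ℂ) • wt Φ u (x + y)) =
    ((Real.exp (Φ y) : ℝ) : ℂ) • fun x => wt Φ u (x + y) from rfl, eLpNorm_const_smul]
  congr 1
  rw [← ofReal_norm, norm_real, Real.norm_eq_abs, Real.abs_exp]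

theorem memLp_wtrans {y : Fin n → ℂ} {u : (Fin n → ℂ) → ℂ} (hu : Differentiable ℂ u)
    (hu2 : MemLp u 2 (weightMeasure Φ)) : MemLp (wtrans Φ y u) 2 (weightMeasure Φ) := by
  refine ⟨(differentiable_wtrans hu).continuous.aestronglyMeasurable, ?_⟩
  rw [eLpNorm_wtrans y hu.continuous.aestronglyMeasurable]
  exact ENNReal.mul_lt_top ENNReal.ofReal_lt_top hu2.2

/-- Elements of `H_Φ` are bounded by `e^{Φ}`. -/
theorem exists_pointwise_bound (hΦ : Φ.PosDef) : ∃ C, 0 < C ∧ ∀ u : (Fin n → ℂ) → ℂ,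
    Differentiable ℂ u → MemLp u 2 (weightMeasure Φ) →
      ∀ y, ‖u y‖ ≤ C * Real.exp (Φ y) * wnorm Φ u := by
  have hm := circMass_pos hΦ
  refine ⟨Real.sqrt (circMass Φ) / circMass Φ, by positivity, fun u hu hu2 y => ?_⟩
  have h1 := norm_eval_zero_le hΦ (differentiable_wtrans (y := y) hu) (memLp_wtrans hu hu2)
  rw [wnorm, eLpNorm_wtrans y hu.continuous.aestronglyMeasurable, ENNReal.toReal_mul,
    ENNReal.toReal_ofReal (Real.exp_nonneg _), ← wnorm] at h1
  have h2 : wtrans Φ y u 0 = u y := by simp [wtrans]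
  rw [h2, ← le_div_iff₀ hm] at h1
  refine h1.trans (le_of_eq ?_)
  ring

variable (Φ) in
/-- The exponent of the reproducing kernel. -/
def kernelExp (x y : Fin n → ℂ) : ℂ :=
  2 * Φ y + 2 * star ((x - y) ⬝ᵥ gradX Φ y) + star (holPart Φ (x - y))

/-- The reproducing formula in `H_Φ`. -/
theorem reproducing (hΦ : Φ.PosDef) {u : (Fin n → ℂ) → ℂ} (hu : Differentiable ℂ u)
    (hu2 : MemLp u 2 (weightMeasure Φ)) (y : Fin n → ℂ) :
    u y * circMass Φ = ∫ x, u x * exp (kernelExp Φ x y) * (Real.exp (-2 * Φ x) : ℝ) := by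
  -- The formula at a general point is the formula at the origin for the translated function.
  have h1 := eval_zero_eq hΦ (differentiable_wtrans (y := y) hu) (memLp_wtrans hu hu2)
  have h2 : wtrans Φ y u 0 = u y := by simp [wtrans]
  rw [h2] at h1
  rw [h1, ← integral_sub_right_eq_self _ y]
  refine integral_congr_ae (Filter.Eventually.of_forall fun x => ?_)
  simp only [wtrans, sub_add_cancel]
  set d := x - y with hd
  have hx : x = y + d := by rw [hd]; abel
  rw [ofReal_exp, ofReal_exp, mul_assoc, mul_assoc, mul_assoc, ← Complex.exp_add,
    ← Complex.exp_add, ← Complex.exp_add]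
  congr 2
  have e1 : (Φ x : ℂ) = Φ y + 2 * (d ⬝ᵥ gradX Φ y).re + Φ d := by
    rw [hx, QuadraticMap.map_add Φ, polar_eq_gradX]
    push_cast; ring
  have e2 : star (d ⬝ᵥ gradX Φ y) = 2 * (d ⬝ᵥ gradX Φ y).re - d ⬝ᵥ gradX Φ y := by
    rw [Complex.star_def, eq_sub_iff_add_eq, add_comm, Complex.add_conj]; push_cast; ring
  have e3 : star (holPart Φ d) = 2 * (holPart Φ d).re - holPart Φ d := by
    rw [Complex.star_def, eq_sub_iff_add_eq, add_comm, Complex.add_conj]; push_cast; ring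
  rw [kernelExp, ← hd, e2, e3, circForm_apply, holPart_re]
  push_cast
  rw [e1]
  ring

/-- The reproducing kernel as a Gaussian integral. -/
theorem integral_eq_kernel (hΦ : Φ.PosDef) (x y : Fin n → ℂ) :
    ∫ w, exp ((1 / 2) * (star x ⬝ᵥ w) + (1 / 2) * (star w ⬝ᵥ y)) *
        ((Real.exp (-2 * dualForm hΦ w) : ℝ) : ℂ) =
      exp (kernelExp Φ x y) * ((∫ w, Real.exp (-2 * dualForm hΦ w) : ℝ) : ℂ) := by
  set d := x - y with hd
  have hx : x = y + d := by rw [hd]; abel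
  -- With `s = (x + y) / 2`, `t = i (x - y) / 2` and `z = i`, the conjugate-linear slot `s̄ + z t̄`
  -- equals `x̄` while the linear slot `s + z t` equals `y`. Evaluating at `z = i` thus decouples
  -- the two arguments.
  have h1 := integral_cexp_dual hΦ (y + (1 / 2 : ℝ) • d) ((1 / 2 : ℝ) • (I • d)) I
  have h2 : ∀ w : Fin n → ℂ, (1 / 2 : ℂ) * (star (y + (1 / 2 : ℝ) • d) ⬝ᵥ w + star w ⬝ᵥ
      (y + (1 / 2 : ℝ) • d)) + I * ((1 / 2) * (star ((1 / 2 : ℝ) • (I • d)) ⬝ᵥ w +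
        star w ⬝ᵥ ((1 / 2 : ℝ) • (I • d)))) = (1 / 2) * (star x ⬝ᵥ w) + (1 / 2) * (star w ⬝ᵥ y) := by
    intro w
    rw [hx]
    simp only [star_add, star_smul, add_dotProduct, dotProduct_add, smul_dotProduct,
      dotProduct_smul, Complex.star_def, Complex.conj_I, Complex.real_smul, smul_eq_mul, star_trivial]
    push_cast
    linear_combination (-(1 / 4) * (star d ⬝ᵥ w) + (1 / 4) * (star w ⬝ᵥ d)) * I_mul_I
  simp_rw [h2] at h1
  rw [h1]
  congr 2
  rw [kernelExp, ← hd, QuadraticMap.map_add Φ, QuadraticMap.map_smul, QuadraticMap.map_smul,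
    QuadraticMap.polar_add_left, QuadraticMap.polar_smul_left,
    QuadraticMap.polar_smul_right, QuadraticMap.polar_smul_right,
    QuadraticMap.polar_smul_right, polar_I_smul, polar_eq_gradX Φ y d,
    polar_eq_gradX Φ y (I • d), smul_dotProduct]
  simp only [smul_eq_mul, I_mul_re]
  have e2 : star (d ⬝ᵥ gradX Φ y) = (d ⬝ᵥ gradX Φ y).re - (d ⬝ᵥ gradX Φ y).im * I := by
    rw [Complex.star_def]; apply Complex.ext <;> simp
  have e3 : star (holPart Φ d) = (Φ d - Φ (I • d)) / 2 - (holPart Φ d).im * I := by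
    rw [Complex.star_def]
    apply Complex.ext
    · rw [conj_re, holPart_re]
      have : ((Φ d : ℂ) - Φ (I • d)) / 2 = (((Φ d - Φ (I • d)) / 2 : ℝ) : ℂ) := by push_cast; ring
      rw [this]; simp
    · have : ((Φ d : ℂ) - Φ (I • d)) / 2 = (((Φ d - Φ (I • d)) / 2 : ℝ) : ℂ) := by push_cast; ring
      rw [this]; simp
  rw [e2, e3]
  push_cast
  linear_combination (1 / 2) * (Φ (I • d) : ℂ) * I_sq

end WeightedL2

end QuadGrowth
end

noncomputable section
namespace QuadGrowth

/-! ### Recovering a function from its pairings with exponentials -/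

section Inversion

open MeasureTheory Complex

variable {n : ℕ} {Φ : QuadraticForm ℝ (Fin n → ℂ)}

variable (Φ) in
/-- The pairing of `u` with the exponentials `x ↦ e^{x · w̄ / 2}` in `L²(e^{-2Φ})`. -/
def expPairing (u : (Fin n → ℂ) → ℂ) (w : Fin n → ℂ) : ℂ :=
  ∫ x, u x * exp ((1 / 2) * (star x ⬝ᵥ w)) * (Real.exp (-2 * Φ x) : ℝ)

theorem norm_expPairing_integrand (u : (Fin n → ℂ) → ℂ) (w x : Fin n → ℂ) :
    ‖u x * exp ((1 / 2) * (star x ⬝ᵥ w)) * (Real.exp (-2 * Φ x) : ℝ)‖ =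
      ‖wt Φ u x‖ * ‖wt Φ (fun x => exp ((1 / 2) * (star x ⬝ᵥ w))) x‖ := by
  rw [norm_wt, norm_wt, norm_mul, norm_mul, norm_real, Real.norm_eq_abs, Real.abs_exp,
    show -2 * Φ x = -Φ x + -Φ x by ring, Real.exp_add]
  ring

variable (Φ) in
/-- The constant `∫ e^{-2Φ}`. -/
def gaussMass : ℝ := ∫ x, Real.exp (-2 * Φ x)

theorem gaussMass_pos (hΦ : Φ.PosDef) : 0 < gaussMass Φ := integral_exp_neg_pos hΦ two_pos

theorem memLp_cexp (hΦ : Φ.PosDef) {f : (Fin n → ℂ) → ℂ} (hf : Continuous f) {K : ℝ}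
    (h : ∀ x, ‖f x‖ ≤ K * ‖x‖) : MemLp (fun x => exp (f x)) 2 (weightMeasure Φ) := by
  refine memLp_weight_of_bound hΦ (by fun_prop) (C := 1) (d := K) fun x => ?_
  rw [one_mul]
  exact (norm_exp_le_exp_norm' _).trans (Real.exp_le_exp.2 (h x))

theorem norm_half_dot_le (x w : Fin n → ℂ) : ‖(1 / 2 : ℂ) * (star x ⬝ᵥ w)‖ ≤ (n * ‖w‖) * ‖x‖ := by
  have h := norm_dotProduct_le (star x) w
  rw [norm_star_pi] at h
  rw [norm_mul]
  have h2 : ‖(1 / 2 : ℂ)‖ ≤ 1 := by norm_num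
  have h3 := mul_le_mul h2 h (norm_nonneg _) zero_le_one
  refine h3.trans (le_of_eq (by ring))

theorem memLp_exp_dot (hΦ : Φ.PosDef) (w : Fin n → ℂ) :
    MemLp (fun x : Fin n → ℂ => exp ((1 / 2) * (star x ⬝ᵥ w))) 2 (weightMeasure Φ) :=
  memLp_cexp hΦ (by fun_prop) fun x => norm_half_dot_le x w

/-- Only the modulus of `u` matters, so the formula serves both `e^{x̄ · w / 2}` and the holomorphic
`e^{w̄ · x / 2}`. -/
theorem wnorm_of_norm_exp_dot (hΦ : Φ.PosDef) (w : Fin n → ℂ) {u : (Fin n → ℂ) → ℂ}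
    (hu : MemLp u 2 (weightMeasure Φ))
    (h : ∀ x, ‖u x‖ = Real.exp ((1 / 2) * (star x ⬝ᵥ w).re)) :
    wnorm Φ u = Real.sqrt (gaussMass Φ) * Real.exp (dualForm hΦ w) := by
  have h1 := wnorm_sq Φ hu
  have h2 : ∀ x, ‖u x‖ ^ 2 * Real.exp (-2 * Φ x) = Real.exp ((star x ⬝ᵥ w).re - 2 * Φ x) := by
    intro x
    rw [h, ← Real.exp_nat_mul, ← Real.exp_add]
    congr 1; push_cast; ring
  simp_rw [h2] at h1
  rw [integral_exp_primal hΦ] at h1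
  rw [← Real.sqrt_sq (wnorm_nonneg Φ u), h1, Real.sqrt_mul (Real.exp_nonneg _), mul_comm]
  congr 1
  rw [show 2 * dualForm hΦ w = dualForm hΦ w + dualForm hΦ w by ring, Real.exp_add,
    Real.sqrt_mul_self (Real.exp_nonneg _)]

theorem wnorm_exp_dot (hΦ : Φ.PosDef) (w : Fin n → ℂ) :
    wnorm Φ (fun x : Fin n → ℂ => exp ((1 / 2) * (star x ⬝ᵥ w))) =
      Real.sqrt (gaussMass Φ) * Real.exp (dualForm hΦ w) := by
  refine wnorm_of_norm_exp_dot hΦ w (memLp_exp_dot hΦ w) fun x => ?_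
  rw [norm_exp]
  congr 1
  rw [mul_re]; norm_num

theorem aestronglyMeasurable_pairing {u : (Fin n → ℂ) → ℂ} (hu : AEStronglyMeasurable u volume) :
    AEStronglyMeasurable (Function.uncurry fun (w x : Fin n → ℂ) =>
      u x * exp ((1 / 2) * (star x ⬝ᵥ w)) * (Real.exp (-2 * Φ x) : ℝ)) (volume.prod volume) := by
  have := continuous_weight Φ
  have h1 : AEStronglyMeasurable (fun p : (Fin n → ℂ) × (Fin n → ℂ) => u p.2)
      ((volume : Measure (Fin n → ℂ)).prod volume) := hu.comp_snd
  have h2 : Continuous fun p : (Fin n → ℂ) × (Fin n → ℂ) =>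
    exp ((1 / 2) * (star p.2 ⬝ᵥ p.1)) := by fun_prop
  have h3 : Continuous fun p : (Fin n → ℂ) × (Fin n → ℂ) =>
    ((Real.exp (-2 * Φ p.2) : ℝ) : ℂ) := by fun_prop
  exact (h1.mul h2.aestronglyMeasurable).mul h3.aestronglyMeasurable

theorem integrable_pairing (hΦ : Φ.PosDef) {u : (Fin n → ℂ) → ℂ}
    (hu : MemLp u 2 (weightMeasure Φ)) (w : Fin n → ℂ) :
    Integrable fun x => u x * exp ((1 / 2) * (star x ⬝ᵥ w)) * (Real.exp (-2 * Φ x) : ℝ) := by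
  have h1 := (memLp_weight Φ).1 hu
  have h2 := (memLp_weight Φ).1 (memLp_exp_dot hΦ w)
  have h3 : Integrable fun x =>
      ‖wt Φ u x‖ * ‖wt Φ (fun x : Fin n → ℂ => exp ((1 / 2) * (star x ⬝ᵥ w))) x‖ :=
    h1.2.norm.integrable_mul h2.2.norm
  have := continuous_weight Φ
  refine h3.mono' ?_ (Filter.Eventually.of_forall fun x => (norm_expPairing_integrand u w x).le)
  exact (h1.1.mul h2.1).mul (Continuous.aestronglyMeasurable (by fun_prop))

theorem integral_norm_pairing_le (hΦ : Φ.PosDef) {u : (Fin n → ℂ) → ℂ}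
    (hu : MemLp u 2 (weightMeasure Φ)) (w : Fin n → ℂ) :
    ∫ x, ‖u x * exp ((1 / 2) * (star x ⬝ᵥ w)) * (Real.exp (-2 * Φ x) : ℝ)‖ ≤
      wnorm Φ u * Real.sqrt (gaussMass Φ) * Real.exp (dualForm hΦ w) := by
  have h1 := (memLp_weight Φ).1 hu
  have h2 := (memLp_weight Φ).1 (memLp_exp_dot hΦ w)
  simp_rw [norm_expPairing_integrand]
  refine (integral_norm_mul_norm_le h1.2 h2.2).trans (le_of_eq ?_)
  rw [← eLpNorm_weight, ← eLpNorm_weight, ← wnorm, ← wnorm, wnorm_exp_dot hΦ, mul_assoc]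

/-- Cauchy–Schwarz: a pairing grows at most like the norm of the exponential, that is, like
`e^{Φ†(w)}`. -/
theorem norm_expPairing_le (hΦ : Φ.PosDef) {u : (Fin n → ℂ) → ℂ}
    (hu : MemLp u 2 (weightMeasure Φ)) (w : Fin n → ℂ) :
    ‖expPairing Φ u w‖ ≤ wnorm Φ u * Real.sqrt (gaussMass Φ) * Real.exp (dualForm hΦ w) :=
  (norm_integral_le_integral_norm _).trans (integral_norm_pairing_le hΦ hu w)

theorem expPairing_add (hΦ : Φ.PosDef) {u v : (Fin n → ℂ) → ℂ} (hu : MemLp u 2 (weightMeasure Φ))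
    (hv : MemLp v 2 (weightMeasure Φ)) (w : Fin n → ℂ) :
    expPairing Φ (u + v) w = expPairing Φ u w + expPairing Φ v w := by
  rw [expPairing, expPairing, expPairing,
    ← integral_add (integrable_pairing hΦ hu w) (integrable_pairing hΦ hv w)]
  refine integral_congr_ae (Filter.Eventually.of_forall fun x => ?_)
  simp only [Pi.add_apply]; ring

theorem expPairing_smul (c : ℂ) (u : (Fin n → ℂ) → ℂ) (w : Fin n → ℂ) :
    expPairing Φ (c • u) w = c * expPairing Φ u w := by
  rw [expPairing, expPairing, ← integral_const_mul]
  refine integral_congr_ae (Filter.Eventually.of_forall fun x => ?_)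
  simp only [Pi.smul_apply, smul_eq_mul]; ring

/-- The density `⟨u, e_w⟩ e^{-2Φ†(w)}` in the inversion formula. -/
def pairingDensity (hΦ : Φ.PosDef) (u : (Fin n → ℂ) → ℂ) (w : Fin n → ℂ) : ℂ :=
  expPairing Φ u w * (Real.exp (-2 * dualForm hΦ w) : ℝ)

theorem norm_pairingDensity_le (hΦ : Φ.PosDef) {u : (Fin n → ℂ) → ℂ}
    (hu : MemLp u 2 (weightMeasure Φ)) (w : Fin n → ℂ) :
    ‖pairingDensity hΦ u w‖ ≤
      wnorm Φ u * Real.sqrt (gaussMass Φ) * Real.exp (-1 * dualForm hΦ w) := by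
  rw [pairingDensity, norm_mul, norm_real, Real.norm_eq_abs, Real.abs_exp]
  refine (mul_le_mul_of_nonneg_right (norm_expPairing_le hΦ hu w) (Real.exp_nonneg _)).trans
    (le_of_eq ?_)
  rw [mul_assoc, ← Real.exp_add]
  congr 2; ring

/-- Growth `e^{Φ†}` against the factor `e^{-2Φ†}` leaves `e^{-Φ†}`. Holomorphy of `u` is not
involved, so the inversion integral makes sense for every `u` in the weighted `L²` space. -/
theorem gaussDecay_pairingDensity (hΦ : Φ.PosDef) {u : (Fin n → ℂ) → ℂ}
    (hu : MemLp u 2 (weightMeasure Φ)) : GaussDecay (pairingDensity hΦ u) := by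
  have hc := continuous_weight (dualForm hΦ)
  obtain ⟨_, C, c, d, hc', h⟩ := gaussDecay_exp_neg (dualForm_posDef hΦ) one_pos
  refine ⟨?_, wnorm Φ u * Real.sqrt (gaussMass Φ) * C, c, d, hc', fun w => ?_⟩
  · refine AEStronglyMeasurable.mul ?_ (Continuous.aestronglyMeasurable (by fun_prop))
    exact (aestronglyMeasurable_pairing ((memLp_weight Φ).1 hu).1).integral_prod_right'
  · refine (norm_pairingDensity_le hΦ hu w).trans ?_
    have h1 := h w
    rw [norm_real, Real.norm_eq_abs, Real.abs_exp] at h1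
    rw [mul_assoc _ C]
    exact mul_le_mul_of_nonneg_left h1 (mul_nonneg (wnorm_nonneg _ _) (Real.sqrt_nonneg _))

/-- The linear forms `w ↦ w̄_j / 2`. -/
def halfConj (j : Fin n) (w : Fin n → ℂ) : ℂ := (1 / 2) * star (w j)

theorem continuous_halfConj (j : Fin n) : Continuous (halfConj j) := by
  unfold halfConj; fun_prop

theorem norm_halfConj (j : Fin n) (w : Fin n → ℂ) : ‖halfConj j w‖ = (1 / 2) * ‖w j‖ := by
  rw [halfConj, norm_mul, norm_star]; norm_num

theorem norm_halfConj_le (j : Fin n) (w : Fin n → ℂ) : ‖halfConj j w‖ ≤ 1 * ‖w‖ := by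
  rw [norm_halfConj]
  have := norm_le_pi_norm w j
  have := norm_nonneg w
  linarith

theorem sum_halfConj (y w : Fin n → ℂ) : ∑ j, y j * halfConj j w = (1 / 2) * (star w ⬝ᵥ y) := by
  rw [dotProduct, Finset.mul_sum]
  refine Finset.sum_congr rfl fun j _ => ?_
  rw [halfConj, Pi.star_apply]; ring

variable (Φ) in
/-- The constant in the inversion formula. -/
def inversionConst (hΦ : Φ.PosDef) : ℝ := circMass Φ * gaussMass (dualForm hΦ)

theorem inversionConst_pos (hΦ : Φ.PosDef) : 0 < inversionConst Φ hΦ :=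
  mul_pos (circMass_pos hΦ) (gaussMass_pos (dualForm_posDef hΦ))

/-- Integrability for Fubini: after integration in `x` the bound is `e^{Φ†(w)}` times an exponential
of linear growth, against `e^{-2Φ†(w)}`. -/
theorem integrable_inversion (hΦ : Φ.PosDef) {u : (Fin n → ℂ) → ℂ}
    (hu2 : MemLp u 2 (weightMeasure Φ)) (y : Fin n → ℂ) :
    Integrable (Function.uncurry fun (w x : Fin n → ℂ) =>
      (u x * exp ((1 / 2) * (star x ⬝ᵥ w)) * (Real.exp (-2 * Φ x) : ℝ)) *
        (exp (∑ j, y j * halfConj j w) * (Real.exp (-2 * dualForm hΦ w) : ℝ)))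
      (volume.prod volume) := by
  have hc := continuous_weight (dualForm hΦ)
  have hh := fun j => continuous_halfConj (n := n) j
  have hm := aestronglyMeasurable_pairing (Φ := Φ) ((memLp_weight Φ).1 hu2).1
  have hm2 : AEStronglyMeasurable (Function.uncurry fun (w x : Fin n → ℂ) =>
      (u x * exp ((1 / 2) * (star x ⬝ᵥ w)) * (Real.exp (-2 * Φ x) : ℝ)) *
        (exp (∑ j, y j * halfConj j w) * (Real.exp (-2 * dualForm hΦ w) : ℝ)))
      (volume.prod volume) := by
    have h2 : Continuous fun p : (Fin n → ℂ) × (Fin n → ℂ) =>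
      exp (∑ j, y j * halfConj j p.1) * ((Real.exp (-2 * dualForm hΦ p.1) : ℝ) : ℂ) := by fun_prop
    exact hm.mul h2.aestronglyMeasurable
  rw [integrable_prod_iff hm2]
  simp only [Function.uncurry_apply_pair]
  refine ⟨Filter.Eventually.of_forall fun w => (integrable_pairing hΦ hu2 w).mul_const _, ?_⟩
  have hdec : GaussDecay fun w => exp (∑ j, y j * halfConj j w) *
      ((Real.exp (-1 * dualForm hΦ w) : ℝ) : ℂ) := by
    refine (gaussDecay_exp_neg (dualForm_posDef hΦ) one_pos).mul
      (Continuous.aestronglyMeasurable (by fun_prop))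
      (C' := 1) (d' := Fintype.card (Fin n) * 1 * ‖y‖) fun w => ?_
    rw [one_mul]
    exact (norm_exp_le_exp_norm' _).trans
      (Real.exp_le_exp.2 (norm_sum_mul_le norm_halfConj_le y w))
  refine (hdec.integrable.norm.const_mul (wnorm Φ u * Real.sqrt (gaussMass Φ))).mono'
    hm2.norm.integral_prod_right' (Filter.Eventually.of_forall fun w => ?_)
  rw [Real.norm_eq_abs, abs_of_nonneg (integral_nonneg fun _ => norm_nonneg _)]
  simp_rw [norm_mul _ (exp (∑ j, y j * halfConj j w) * _)]
  rw [integral_mul_const]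
  refine (mul_le_mul_of_nonneg_right (integral_norm_pairing_le hΦ hu2 w) (norm_nonneg _)).trans
    (le_of_eq ?_)
  rw [norm_mul, norm_mul, norm_real, norm_real, Real.norm_eq_abs, Real.norm_eq_abs, Real.abs_exp,
    Real.abs_exp, show -1 * dualForm hΦ w = dualForm hΦ w + -2 * dualForm hΦ w by ring,
    Real.exp_add]
  ring

/-- An element of `H_Φ` is recovered from its pairings with exponentials. -/
theorem inversion (hΦ : Φ.PosDef) {u : (Fin n → ℂ) → ℂ} (hu : Differentiable ℂ u)
    (hu2 : MemLp u 2 (weightMeasure Φ)) (y : Fin n → ℂ) :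
    gaussTransform halfConj (pairingDensity hΦ u) y = inversionConst Φ hΦ * u y := by
  have h1 : gaussTransform halfConj (pairingDensity hΦ u) y = ∫ w, ∫ x,
      (u x * exp ((1 / 2) * (star x ⬝ᵥ w)) * (Real.exp (-2 * Φ x) : ℝ)) *
        (exp (∑ j, y j * halfConj j w) * (Real.exp (-2 * dualForm hΦ w) : ℝ)) := by
    refine integral_congr_ae (Filter.Eventually.of_forall fun w => ?_)
    simp only
    rw [integral_mul_const, pairingDensity, expPairing]
    ring
  rw [h1, integral_integral_swap (integrable_inversion hΦ hu2 y)]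
  -- The `w`-integral of a product of two exponentials is the reproducing kernel at `(x, y)`.
  have h2 : ∀ x, ∫ w, (u x * exp ((1 / 2) * (star x ⬝ᵥ w)) * (Real.exp (-2 * Φ x) : ℝ)) *
        (exp (∑ j, y j * halfConj j w) * (Real.exp (-2 * dualForm hΦ w) : ℝ)) =
      (u x * exp (kernelExp Φ x y) * (Real.exp (-2 * Φ x) : ℝ)) * (gaussMass (dualForm hΦ) : ℝ) := by
    intro x
    rw [gaussMass, mul_right_comm (u x), mul_assoc _ (exp (kernelExp Φ x y)),
      ← integral_eq_kernel hΦ x y, ← integral_const_mul]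
    refine integral_congr_ae (Filter.Eventually.of_forall fun w => ?_)
    simp only
    rw [sum_halfConj, Complex.exp_add]
    ring
  simp_rw [h2]
  rw [integral_mul_const, ← reproducing hΦ hu hu2, inversionConst]
  push_cast; ring

theorem pderiv_gaussTransform {g : (Fin n → ℂ) → ℂ} (hg : GaussDecay g) (j : Fin n) :
    pderiv j (gaussTransform halfConj g) = gaussTransform halfConj fun w => halfConj j w * g w := by
  ext y
  obtain ⟨D, h1, h2⟩ := hasFDerivAt_gaussTransform continuous_halfConj norm_halfConj_le hg y
  rw [pderiv, h1.fderiv, h2]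
  congr 1
  ext w
  congr 1
  simp [e, Pi.single_apply]

theorem GaussDecay.halfConj_mul {g : (Fin n → ℂ) → ℂ} (hg : GaussDecay g) (j : Fin n) :
    GaussDecay fun w => halfConj j w * g w := by
  refine hg.mul (continuous_halfConj j).aestronglyMeasurable (C' := 1) (d' := 1) fun w => ?_
  refine (norm_halfConj_le j w).trans ?_
  rw [one_mul, one_mul]
  linarith [Real.add_one_le_exp ‖w‖]

theorem iterate_pderiv_gaussTransform {g : (Fin n → ℂ) → ℂ} (hg : GaussDecay g) (j : Fin n) (k : ℕ) :
    (pderiv j)^[k] (gaussTransform halfConj g) =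
      gaussTransform halfConj (fun w => halfConj j w ^ k * g w) ∧
    GaussDecay fun w => halfConj j w ^ k * g w := by
  induction k with
  | zero => simpa using hg
  | succ k ih =>
    have h : (fun w => halfConj j w ^ (k + 1) * g w) =
        fun w => halfConj j w * (halfConj j w ^ k * g w) := by
      ext w; rw [pow_succ]; ring
    rw [Function.iterate_succ_apply', ih.1, pderiv_gaussTransform ih.2, h]
    exact ⟨rfl, ih.2.halfConj_mul j⟩

theorem multiDeriv_gaussTransform {g : (Fin n → ℂ) → ℂ} (hg : GaussDecay g) (α : Fin n → ℕ) :
    multiDeriv α (gaussTransform halfConj g) =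
      gaussTransform halfConj (fun w => (∏ j, halfConj j w ^ α j) * g w) ∧
    GaussDecay fun w => (∏ j, halfConj j w ^ α j) * g w := by
  have key : ∀ l : List (Fin n), l.foldr (fun j g => (pderiv j)^[α j] g) (gaussTransform halfConj g) =
      gaussTransform halfConj (fun w => (l.map fun j => halfConj j w ^ α j).prod * g w) ∧
      GaussDecay fun w => (l.map fun j => halfConj j w ^ α j).prod * g w := by
    intro l
    induction l with
    | nil => simpa using hg
    | cons j l ih =>
      rw [List.foldr_cons, ih.1]
      have := iterate_pderiv_gaussTransform ih.2 j (α j)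
      simp only [List.map_cons, List.prod_cons, mul_assoc]
      exact this
  have h := key (List.finRange n)
  have h2 : ∀ w : Fin n → ℂ, ((List.finRange n).map fun j => halfConj j w ^ α j).prod =
      ∏ j, halfConj j w ^ α j := fun w => by
    rw [← List.ofFn_eq_map, List.prod_ofFn]
  simp only [h2] at h
  exact h

theorem multiDeriv_const_smul_gaussTransform (c : ℂ) {g : (Fin n → ℂ) → ℂ} (hg : GaussDecay g)
    (α : Fin n → ℕ) : multiDeriv α (fun y => c * gaussTransform halfConj g y) =
      fun y => c * multiDeriv α (gaussTransform halfConj g) y := by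
  have h1 : ∀ g, (fun y => c * gaussTransform (ι := Fin n) halfConj g y) =
      gaussTransform (n := n) halfConj fun w => c * g w := by
    intro g
    ext y
    rw [gaussTransform, gaussTransform, ← integral_const_mul]
    refine integral_congr_ae (Filter.Eventually.of_forall fun w => ?_)
    simp only; ring
  have h2 : GaussDecay fun w => c * g w :=
    hg.mul aestronglyMeasurable_const (C' := ‖c‖) (d' := 0) fun _ => by simp
  rw [h1, (multiDeriv_gaussTransform h2 α).1, (multiDeriv_gaussTransform hg α).1, h1]
  congr 1
  ext w; ring

/-- Cauchy-type formula for the derivatives at the origin. -/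
theorem multiDeriv_zero (hΦ : Φ.PosDef) {u : (Fin n → ℂ) → ℂ} (hu : Differentiable ℂ u)
    (hu2 : MemLp u 2 (weightMeasure Φ)) (α : Fin n → ℕ) :
    multiDeriv α u 0 =
      (inversionConst Φ hΦ : ℂ)⁻¹ * ∫ w, (∏ j, halfConj j w ^ α j) * pairingDensity hΦ u w := by
  have hc : (inversionConst Φ hΦ : ℂ) ≠ 0 := ofReal_ne_zero.2 (inversionConst_pos hΦ).ne'
  have h1 : u = fun y => (inversionConst Φ hΦ : ℂ)⁻¹ *
      gaussTransform halfConj (pairingDensity hΦ u) y := by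
    ext y
    rw [inversion hΦ hu hu2, inv_mul_cancel_left₀ hc]
  have hg := gaussDecay_pairingDensity hΦ hu2
  conv_lhs => rw [h1]
  rw [multiDeriv_const_smul_gaussTransform _ hg, (multiDeriv_gaussTransform hg α).1]
  simp only [gaussTransform]
  simp

variable (Φ) in
/-- The moment `∫ |w^α| e^{-Φ}`. -/
def absMoment (α : Fin n → ℕ) : ℝ := ∫ w, (∏ j, ‖w j‖ ^ α j) * Real.exp (-1 * Φ w)

theorem norm_prod_halfConj (α : Fin n → ℕ) (w : Fin n → ℂ) :
    ‖∏ j, halfConj j w ^ α j‖ = (1 / 2) ^ (∑ j, α j) * ∏ j, ‖w j‖ ^ α j := by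
  simp_rw [norm_prod, norm_pow, norm_halfConj, mul_pow]
  rw [Finset.prod_mul_distrib, Finset.prod_pow_eq_pow_sum]

/-- Each derivative of the superposition of exponentials brings down `w̄_j / 2`, whence the power of
`1 / 2` and the absolute moment of the dual weight. -/
theorem norm_multiDeriv_zero_le (hΦ : Φ.PosDef) {u : (Fin n → ℂ) → ℂ} (hu : Differentiable ℂ u)
    (hu2 : MemLp u 2 (weightMeasure Φ)) (α : Fin n → ℕ) :
    ‖multiDeriv α u 0‖ ≤ (inversionConst Φ hΦ)⁻¹ * Real.sqrt (gaussMass Φ) *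
      ((1 / 2) ^ (∑ j, α j) * absMoment (dualForm hΦ) α) * wnorm Φ u := by
  have hp := inversionConst_pos hΦ
  rw [multiDeriv_zero hΦ hu hu2, norm_mul, norm_inv, norm_real, Real.norm_eq_abs,
    abs_of_pos hp, mul_assoc, mul_assoc]
  refine mul_le_mul_of_nonneg_left ?_ (inv_nonneg.2 hp.le)
  rw [absMoment, ← integral_const_mul, ← integral_mul_const, ← integral_const_mul]
  have hint := (multiDeriv_gaussTransform (gaussDecay_exp_neg (dualForm_posDef hΦ) one_pos) α).2
  refine norm_integral_le_of_norm_le ?_ (Filter.Eventually.of_forall fun w => ?_)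
    (g := fun w => Real.sqrt (gaussMass Φ) * ((1 / 2) ^ (∑ j, α j) *
      ((∏ j, ‖w j‖ ^ α j) * Real.exp (-1 * dualForm hΦ w)) * wnorm Φ u))
  · have h1 := hint.integrable.norm
    simp only [norm_mul, norm_prod_halfConj, norm_real, Real.norm_eq_abs, Real.abs_exp] at h1
    simp only [mul_assoc] at h1 ⊢
    have h2 := (h1.mul_const (wnorm Φ u)).const_mul (Real.sqrt (gaussMass Φ))
    simpa only [mul_assoc] using h2
  · rw [norm_mul, norm_prod_halfConj]
    refine (mul_le_mul_of_nonneg_left (norm_pairingDensity_le hΦ hu2 w)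
      (by positivity)).trans (le_of_eq (by ring))

end Inversion

end QuadGrowth
end

noncomputable section
namespace QuadGrowth

/-! ### Derivatives at the origin and the rank one structure of `Π_α` -/

section TaylorProj

open MeasureTheory Complex

variable {n : ℕ}

/-! ### Derivatives of products of functions of one variable -/

theorem differentiable_prod_apply {f : Fin n → ℂ → ℂ} (hf : ∀ j, Differentiable ℂ (f j)) :
    Differentiable ℂ fun x : Fin n → ℂ => ∏ j, f j (x j) := by
  intro x
  have h : ∀ j ∈ Finset.univ, HasFDerivAt (fun x : Fin n → ℂ => f j (x j))
      (fderiv ℂ (fun x : Fin n → ℂ => f j (x j)) x) x := fun j _ =>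
    (((hf j).comp (differentiable_apply j)) x).hasFDerivAt
  exact (HasFDerivAt.finsetProd h).differentiableAt

theorem pderiv_prod_apply {f : Fin n → ℂ → ℂ} (hf : ∀ j, Differentiable ℂ (f j)) (j : Fin n) :
    pderiv j (fun x : Fin n → ℂ => ∏ k, f k (x k)) =
      fun x => ∏ k, Function.update f j (deriv (f j)) k (x k) := by
  ext x
  have h1 := (differentiable_prod_apply hf).differentiableAt (x := x)
  have h2 : HasDerivAt (fun t : ℂ => x + t • e j) (e j) 0 := by
    simpa using ((hasDerivAt_id (0 : ℂ)).smul_const (e j)).const_add x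
  have h3 : HasFDerivAt (fun x : Fin n → ℂ => ∏ k, f k (x k))
      (fderiv ℂ (fun x : Fin n → ℂ => ∏ k, f k (x k)) x) (x + (0 : ℂ) • e j) := by
    rw [zero_smul, add_zero]; exact h1.hasFDerivAt
  have h4 := h3.comp_hasDerivAt (0 : ℂ) h2
  -- Along the line `x + t e_j` only the `j`-th factor varies.
  have h5 : (fun x : Fin n → ℂ => ∏ k, f k (x k)) ∘ (fun t : ℂ => x + t • e j) =
      fun t => f j (x j + t) * ∏ k ∈ Finset.univ.erase j, f k (x k) := by
    ext t
    simp only [Function.comp]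
    rw [← Finset.mul_prod_erase _ _ (Finset.mem_univ j)]
    congr 1
    · simp [e]
    · refine Finset.prod_congr rfl fun k hk => ?_
      simp [e, Finset.ne_of_mem_erase hk]
  rw [h5] at h4
  have h6 : HasDerivAt (fun t => f j (x j + t) * ∏ k ∈ Finset.univ.erase j, f k (x k))
      (deriv (f j) (x j) * ∏ k ∈ Finset.univ.erase j, f k (x k)) 0 := by
    refine HasDerivAt.mul_const ?_ _
    have := ((hf j).differentiableAt (x := x j + 0)).hasDerivAt
    have h7 := this.comp_const_add (x j) 0
    simpa using h7
  rw [pderiv, h4.unique h6, ← Finset.mul_prod_erase _ _ (Finset.mem_univ j), Function.update_self]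
  congr 1
  refine Finset.prod_congr rfl fun k hk => ?_
  rw [Function.update_of_ne (Finset.ne_of_mem_erase hk)]

theorem differentiable_iterate_deriv {f : ℂ → ℂ} (hf : Differentiable ℂ f) (k : ℕ) :
    Differentiable ℂ (deriv^[k] f) := by
  induction k with
  | zero => simpa using hf
  | succ k ih =>
    rw [Function.iterate_succ_apply']
    intro z
    exact ((ih.contDiff (n := 2)).differentiable_deriv_two z)

theorem iterate_pderiv_prod_apply {f : Fin n → ℂ → ℂ} (hf : ∀ j, Differentiable ℂ (f j))
    (j : Fin n) (k : ℕ) :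
    (pderiv j)^[k] (fun x : Fin n → ℂ => ∏ i, f i (x i)) =
      fun x => ∏ i, Function.update f j (deriv^[k] (f j)) i (x i) := by
  induction k with
  | zero => simp
  | succ k ih =>
    rw [Function.iterate_succ_apply', ih, pderiv_prod_apply]
    · simp [Function.iterate_succ_apply']
    · intro i
      rcases eq_or_ne i j with rfl | h
      · simpa using differentiable_iterate_deriv (hf i) k
      · simpa [Function.update_of_ne h] using hf i

theorem multiDeriv_prod_apply {f : Fin n → ℂ → ℂ} (hf : ∀ j, Differentiable ℂ (f j))
    (α : Fin n → ℕ) :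
    multiDeriv α (fun x : Fin n → ℂ => ∏ j, f j (x j)) =
      fun x => ∏ j, deriv^[α j] (f j) (x j) := by
  -- The absence of repetitions ensures that the factor in variable `j` has not been differentiated
  -- before its turn.
  have key : ∀ l : List (Fin n), l.Nodup →
      l.foldr (fun j g => (pderiv j)^[α j] g) (fun x : Fin n → ℂ => ∏ j, f j (x j)) =
        fun x => ∏ j, (if j ∈ l then deriv^[α j] (f j) else f j) (x j) := by
    intro l
    induction l with
    | nil => simp
    | cons j l ih =>
      intro hl
      obtain ⟨hj, hl⟩ := List.nodup_cons.1 hl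
      rw [List.foldr_cons, ih hl, iterate_pderiv_prod_apply (f := fun j =>
        if j ∈ l then deriv^[α j] (f j) else f j)]
      · ext x
        refine Finset.prod_congr rfl fun i _ => ?_
        rcases eq_or_ne i j with rfl | h
        · simp [hj]
        · simp [h]
      · intro i
        split_ifs
        · exact differentiable_iterate_deriv (hf i) _
        · exact hf i
  rw [multiDeriv, key _ (List.nodup_finRange n)]
  simp

theorem iterate_deriv_pow_zero (k m : ℕ) :
    deriv^[k] (fun z : ℂ => z ^ m) 0 = if k = m then (m.factorial : ℂ) else 0 := by
  rw [iter_deriv_pow]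
  rcases lt_trichotomy k m with h | h | h
  · rw [if_neg h.ne]
    simp [Nat.sub_ne_zero_of_lt h]
  · subst h
    rw [if_pos rfl, Nat.sub_self, pow_zero, mul_one, ← Nat.descFactorial_self]
    rw [Nat.descFactorial_eq_prod_range]
    push_cast
    refine Finset.prod_congr rfl fun i hi => ?_
    rw [Nat.cast_sub (Finset.mem_range.1 hi).le]
  · rw [if_neg h.ne']
    have : ∏ i ∈ Finset.range k, ((m : ℂ) - i) = 0 :=
      Finset.prod_eq_zero (Finset.mem_range.2 h) (sub_self _)
    rw [this, zero_mul]

theorem iterate_deriv_cexp (c : ℂ) (k : ℕ) :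
    deriv^[k] (fun z : ℂ => exp (c * z)) = fun z => c ^ k * exp (c * z) := by
  induction k with
  | zero => simp
  | succ k ih =>
    rw [Function.iterate_succ_apply', ih]
    ext z
    have h : HasDerivAt (fun z : ℂ => c ^ k * exp (c * z)) (c ^ k * (exp (c * z) * (c * 1))) z :=
      (((hasDerivAt_id z).const_mul c).cexp).const_mul _
    rw [h.deriv]; ring

/-- The monomial `x^α`. -/
def mono (α : Fin n → ℕ) (x : Fin n → ℂ) : ℂ := ∏ j, x j ^ α j

theorem differentiable_mono (α : Fin n → ℕ) : Differentiable ℂ (mono α) :=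
  differentiable_prod_apply (f := fun j z => z ^ α j) fun _ => differentiable_pow _

theorem multiDeriv_mono (α γ : Fin n → ℕ) :
    multiDeriv α (mono γ) 0 = if α = γ then ∏ j, ((α j).factorial : ℂ) else 0 := by
  have h := congrFun (multiDeriv_prod_apply (f := fun j z => z ^ γ j)
    (fun _ => differentiable_pow _) α) 0
  have h2 : mono γ = fun x : Fin n → ℂ => ∏ j, (fun j z => z ^ γ j : Fin n → ℂ → ℂ) j (x j) := rfl
  rw [h2, h]
  simp only [Pi.zero_apply, iterate_deriv_pow_zero]
  split_ifs with h3
  · subst h3; simp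
  · obtain ⟨j, hj⟩ := Function.ne_iff.1 h3
    exact Finset.prod_eq_zero (Finset.mem_univ j) (if_neg hj)

theorem multiDeriv_cexp_zero (α : Fin n → ℕ) (c : Fin n → ℂ) :
    multiDeriv α (fun x : Fin n → ℂ => exp (∑ j, c j * x j)) 0 = ∏ j, c j ^ α j := by
  have h := congrFun (multiDeriv_prod_apply (f := fun j z => exp (c j * z))
    (fun j => by fun_prop) α) 0
  have h2 : (fun x : Fin n → ℂ => exp (∑ j, c j * x j)) =
    fun x : Fin n → ℂ => ∏ j, (fun j z => exp (c j * z) : Fin n → ℂ → ℂ) j (x j) := by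
      ext x; rw [Complex.exp_sum]
  rw [h2, h]
  simp [iterate_deriv_cexp]

/-- Entire functions of exponential type. -/
def ExpType (f : (Fin n → ℂ) → ℂ) : Prop :=
  Differentiable ℂ f ∧ ∃ C d : ℝ, ∀ x, ‖f x‖ ≤ C * Real.exp (d * ‖x‖)

theorem ExpType.mul {f g : (Fin n → ℂ) → ℂ} (hf : ExpType f) (hg : ExpType g) :
    ExpType fun x => f x * g x := by
  obtain ⟨hf, C, d, h1⟩ := hf
  obtain ⟨hg, C', d', h2⟩ := hg
  refine ⟨hf.mul hg, C * C', d + d', fun x => ?_⟩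
  rw [norm_mul, add_mul, Real.exp_add]
  refine (mul_le_mul (h1 x) (h2 x) (norm_nonneg _) ((norm_nonneg _).trans (h1 x))).trans
    (le_of_eq (by ring))

theorem ExpType.add {f g : (Fin n → ℂ) → ℂ} (hf : ExpType f) (hg : ExpType g) :
    ExpType fun x => f x + g x := by
  obtain ⟨hf, C, d, h1⟩ := hf
  obtain ⟨hg, C', d', h2⟩ := hg
  refine ⟨hf.add hg, |C| + |C'|, max d d', fun x => ?_⟩
  refine (norm_add_le _ _).trans ?_
  rw [add_mul]
  refine add_le_add ((h1 x).trans ?_) ((h2 x).trans ?_)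
  · exact mul_le_mul (le_abs_self _) (Real.exp_le_exp.2 (mul_le_mul_of_nonneg_right
      (le_max_left _ _) (norm_nonneg _))) (Real.exp_nonneg _) (abs_nonneg _)
  · exact mul_le_mul (le_abs_self _) (Real.exp_le_exp.2 (mul_le_mul_of_nonneg_right
      (le_max_right _ _) (norm_nonneg _))) (Real.exp_nonneg _) (abs_nonneg _)

theorem expType_const (c : ℂ) : ExpType fun _ : Fin n → ℂ => c :=
  ⟨differentiable_const c, ‖c‖, 0, fun x => by simp⟩

theorem expType_coord (j : Fin n) : ExpType fun x : Fin n → ℂ => x j :=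
  ⟨differentiable_apply j, 1, 1, fun x => by
    rw [one_mul, one_mul]
    linarith [norm_le_pi_norm x j, Real.add_one_le_exp ‖x‖]⟩

theorem expType_eval (p : MvPolynomial (Fin n) ℂ) : ExpType fun x => MvPolynomial.eval x p := by
  induction p using MvPolynomial.induction_on with
  | C a => simpa using expType_const a
  | add p q hp hq => simpa using hp.add hq
  | mul_X p j hp => simpa using hp.mul (expType_coord j)

theorem eval_monomial_eq_mono (γ : Fin n →₀ ℕ) (x : Fin n → ℂ) :
    MvPolynomial.eval x (MvPolynomial.monomial γ 1) = mono γ x := by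
  rw [MvPolynomial.eval_monomial, one_mul, mono, Finsupp.prod_fintype]
  simp

theorem expType_mono (α : Fin n → ℕ) : ExpType (mono α) := by
  have h := expType_eval (MvPolynomial.monomial (Finsupp.equivFunOnFinite.symm α) (1 : ℂ))
  simp only [eval_monomial_eq_mono] at h
  exact h

variable {Φ : QuadraticForm ℝ (Fin n → ℂ)}

theorem ExpType.memLp (hΦ : Φ.PosDef) {f : (Fin n → ℂ) → ℂ} (hf : ExpType f) :
    MemLp f 2 (weightMeasure Φ) := by
  obtain ⟨hf, C, d, h1⟩ := hf
  exact memLp_weight_of_bound hΦ hf.continuous h1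

/-- The element of `H_Φ` defined by an entire function. -/
def toHPhi (f : (Fin n → ℂ) → ℂ) (hf : Differentiable ℂ f) (hf2 : MemLp f 2 (weightMeasure Φ)) :
    HPhi Φ := ⟨hf2.toLp f, f, hf, hf2.coeFn_toLp⟩

theorem coeFn_toHPhi {f : (Fin n → ℂ) → ℂ} (hf : Differentiable ℂ f)
    (hf2 : MemLp f 2 (weightMeasure Φ)) :
    ((toHPhi f hf hf2 : HPhi Φ) : Lp ℂ 2 (weightMeasure Φ)) =ᵐ[weightMeasure Φ] f :=
  hf2.coeFn_toLp

theorem norm_toHPhi {f : (Fin n → ℂ) → ℂ} (hf : Differentiable ℂ f)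
    (hf2 : MemLp f 2 (weightMeasure Φ)) : ‖(toHPhi f hf hf2 : HPhi Φ)‖ = wnorm Φ f :=
  norm_lp_eq_wnorm Φ _ (coeFn_toHPhi hf hf2)

/-- The entire representative of an element of `H_Φ`. -/
def entireRep (u : HPhi Φ) : (Fin n → ℂ) → ℂ := u.2.choose

theorem differentiable_entireRep (u : HPhi Φ) : Differentiable ℂ (entireRep u) :=
  u.2.choose_spec.1

theorem coeFn_entireRep (u : HPhi Φ) :
    (u : Lp ℂ 2 (weightMeasure Φ)) =ᵐ[weightMeasure Φ] entireRep u := u.2.choose_spec.2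

theorem memLp_entireRep (u : HPhi Φ) : MemLp (entireRep u) 2 (weightMeasure Φ) :=
  (memLp_congr_ae (coeFn_entireRep u)).1 (Lp.memLp _)

theorem norm_eq_wnorm_entireRep (u : HPhi Φ) : ‖u‖ = wnorm Φ (entireRep u) :=
  norm_lp_eq_wnorm Φ _ (coeFn_entireRep u)

theorem eq_of_ae_eq_weight {f g : (Fin n → ℂ) → ℂ} (hf : Continuous f) (hg : Continuous g)
    (h : f =ᵐ[weightMeasure Φ] g) : f = g :=
  (hf.ae_eq_iff_eq volume hg).1 ((ae_weightMeasure_iff Φ).1 h)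

theorem entireRep_unique {u : HPhi Φ} {f : (Fin n → ℂ) → ℂ} (hf : Continuous f)
    (h : (u : Lp ℂ 2 (weightMeasure Φ)) =ᵐ[weightMeasure Φ] f) : entireRep u = f :=
  eq_of_ae_eq_weight (differentiable_entireRep u).continuous hf ((coeFn_entireRep u).symm.trans h)

theorem entireRep_add (u v : HPhi Φ) : entireRep (u + v) = entireRep u + entireRep v :=
  entireRep_unique ((differentiable_entireRep u).add (differentiable_entireRep v)).continuous
    ((Lp.coeFn_add _ _).trans ((coeFn_entireRep u).add (coeFn_entireRep v)))

theorem entireRep_smul (c : ℂ) (u : HPhi Φ) : entireRep (c • u) = c • entireRep u :=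
  entireRep_unique ((differentiable_entireRep u).const_smul c).continuous
    ((Lp.coeFn_smul _ _).trans ((coeFn_entireRep u).const_smul c))

/-- Read off from the integral formula of `multiDeriv_zero`, whose integrand is additive in `u`; no
differentiability of iterated derivatives has to be discussed. -/
theorem multiDeriv_zero_add (hΦ : Φ.PosDef) (u v : HPhi Φ) (α : Fin n → ℕ) :
    multiDeriv α (entireRep (u + v)) 0 =
      multiDeriv α (entireRep u) 0 + multiDeriv α (entireRep v) 0 := by
  have hi := fun u : HPhi Φ => ((multiDeriv_gaussTransform
    (gaussDecay_pairingDensity hΦ (memLp_entireRep u)) α).2).integrable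
  rw [multiDeriv_zero hΦ (differentiable_entireRep _) (memLp_entireRep _),
    multiDeriv_zero hΦ (differentiable_entireRep _) (memLp_entireRep _),
    multiDeriv_zero hΦ (differentiable_entireRep _) (memLp_entireRep _), ← mul_add,
    ← integral_add (hi u) (hi v)]
  congr 1
  refine integral_congr_ae (Filter.Eventually.of_forall fun w => ?_)
  simp only
  rw [entireRep_add, pairingDensity, expPairing_add hΦ (memLp_entireRep u) (memLp_entireRep v),
    pairingDensity, pairingDensity]
  ring

theorem multiDeriv_zero_smul (hΦ : Φ.PosDef) (c : ℂ) (u : HPhi Φ) (α : Fin n → ℕ) :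
    multiDeriv α (entireRep (c • u)) 0 = c * multiDeriv α (entireRep u) 0 := by
  rw [multiDeriv_zero hΦ (differentiable_entireRep _) (memLp_entireRep _),
    multiDeriv_zero hΦ (differentiable_entireRep _) (memLp_entireRep _), mul_left_comm,
    ← integral_const_mul c]
  refine congrArg _ (integral_congr_ae (Filter.Eventually.of_forall fun w => ?_))
  simp only
  rw [entireRep_smul, pairingDensity, expPairing_smul, pairingDensity]
  ring

/-- The functional `u ↦ ∂^α u(0)`. -/
def taylorFunctional (hΦ : Φ.PosDef) (α : Fin n → ℕ) : HPhi Φ →L[ℂ] ℂ :=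
  LinearMap.mkContinuous
    { toFun := fun u => multiDeriv α (entireRep u) 0
      map_add' := fun u v => multiDeriv_zero_add hΦ u v α
      map_smul' := fun c u => multiDeriv_zero_smul hΦ c u α }
    ((inversionConst Φ hΦ)⁻¹ * Real.sqrt (gaussMass Φ) *
      ((1 / 2) ^ (∑ j, α j) * absMoment (dualForm hΦ) α))
    fun u => by
      rw [norm_eq_wnorm_entireRep]
      exact norm_multiDeriv_zero_le hΦ (differentiable_entireRep u) (memLp_entireRep u) α

theorem taylorFunctional_apply (hΦ : Φ.PosDef) (α : Fin n → ℕ) (u : HPhi Φ) :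
    taylorFunctional hΦ α u = multiDeriv α (entireRep u) 0 := rfl

theorem absMoment_nonneg (α : Fin n → ℕ) : 0 ≤ absMoment Φ α :=
  integral_nonneg fun _ => mul_nonneg (Finset.prod_nonneg fun _ _ => by positivity)
    (Real.exp_nonneg _)

theorem norm_taylorFunctional_le (hΦ : Φ.PosDef) (α : Fin n → ℕ) :
    ‖taylorFunctional hΦ α‖ ≤ (inversionConst Φ hΦ)⁻¹ * Real.sqrt (gaussMass Φ) *
      ((1 / 2) ^ (∑ j, α j) * absMoment (dualForm hΦ) α) := by
  refine LinearMap.mkContinuous_norm_le _ ?_ _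
  have := absMoment_nonneg (Φ := dualForm hΦ) α
  have := inversionConst_pos hΦ
  positivity

/-- The monomial `x^α` as an element of `H_Φ`. -/
def monoHPhi (hΦ : Φ.PosDef) (α : Fin n → ℕ) : HPhi Φ :=
  toHPhi (mono α) (differentiable_mono α) ((expType_mono α).memLp hΦ)

theorem isTaylorProj_smulRight (hΦ : Φ.PosDef) (α : Fin n → ℕ) :
    IsTaylorProj Φ α ((taylorFunctional hΦ α).smulRight
      ((∏ j, ((α j).factorial : ℂ))⁻¹ • monoHPhi hΦ α)) := by
  intro u f hf huf
  have h1 : entireRep u = f := entireRep_unique hf.continuous huf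
  rw [ContinuousLinearMap.smulRight_apply, taylorFunctional_apply, h1, smul_smul]
  refine (Lp.coeFn_smul _ _).trans ?_
  filter_upwards [coeFn_toHPhi (Φ := Φ) (differentiable_mono α) ((expType_mono α).memLp hΦ)]
    with x hx
  rw [Pi.smul_apply, monoHPhi, hx, smul_eq_mul, mono]
  ring

theorem isTaylorProj_taylorProj (hΦ : Φ.PosDef) (α : Fin n → ℕ) :
    IsTaylorProj Φ α (taylorProj Φ α) := by
  have h : ∃ T, IsTaylorProj Φ α T := ⟨_, isTaylorProj_smulRight hΦ α⟩
  rw [taylorProj, dif_pos h]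
  exact h.choose_spec

theorem taylorProj_eq (hΦ : Φ.PosDef) (α : Fin n → ℕ) :
    taylorProj Φ α = (taylorFunctional hΦ α).smulRight
      ((∏ j, ((α j).factorial : ℂ))⁻¹ • monoHPhi hΦ α) := by
  ext1 u
  apply Subtype.ext
  refine Lp.ext ?_
  exact (isTaylorProj_taylorProj hΦ α u _ (differentiable_entireRep u) (coeFn_entireRep u)).trans
    (isTaylorProj_smulRight hΦ α u _ (differentiable_entireRep u) (coeFn_entireRep u)).symm

theorem taylorProj_apply (hΦ : Φ.PosDef) (α : Fin n → ℕ) (u : HPhi Φ) :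
    taylorProj Φ α u = ((∏ j, ((α j).factorial : ℂ))⁻¹ * multiDeriv α (entireRep u) 0) •
      monoHPhi hΦ α := by
  rw [taylorProj_eq hΦ, ContinuousLinearMap.smulRight_apply, smul_smul, mul_comm,
    taylorFunctional_apply]

/-- The norm of a rank one operator is the product of the norms of its functional and its vector, so
the two can be estimated separately. -/
theorem norm_taylorProj (hΦ : Φ.PosDef) (α : Fin n → ℕ) :
    ‖taylorProj Φ α‖ = (∏ j, ((α j).factorial : ℝ))⁻¹ * ‖taylorFunctional hΦ α‖ *
      wnorm Φ (mono α) := by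
  rw [taylorProj_eq hΦ, ContinuousLinearMap.norm_smulRight_apply, norm_smul, monoHPhi, norm_toHPhi,
    norm_inv, norm_prod]
  simp only [norm_natCast]
  ring

/-- The Taylor functional is bounded below by its values on exponentials. -/
theorem le_norm_taylorFunctional (hΦ : Φ.PosDef) (α : Fin n → ℕ) (w : Fin n → ℂ) :
    (1 / 2) ^ (∑ j, α j) * (∏ j, ‖w j‖ ^ α j) ≤ ‖taylorFunctional hΦ α‖ *
      (Real.sqrt (gaussMass Φ) * Real.exp (dualForm hΦ w)) := by
  -- The test function `e^{w̄ · x / 2}`: its derivative at the origin is `∏ (w̄_j / 2)^{α_j}` and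
  -- its norm is a Gaussian integral.
  set f : (Fin n → ℂ) → ℂ := fun x => exp (∑ j, halfConj j w * x j) with hf
  have hfe : ∀ x, ∑ j, halfConj j w * x j = (1 / 2) * (star w ⬝ᵥ x) := by
    intro x
    rw [← sum_halfConj]
    exact Finset.sum_congr rfl fun j _ => mul_comm _ _
  have hd : Differentiable ℂ f := by rw [hf]; fun_prop
  have hm : MemLp f 2 (weightMeasure Φ) := by
    refine memLp_cexp hΦ (by fun_prop) (K := n * ‖w‖) fun x => ?_
    rw [hfe]
    have h := norm_dotProduct_le (star w) x
    rw [norm_star_pi] at h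
    rw [norm_mul]
    have h2 : ‖(1 / 2 : ℂ)‖ ≤ 1 := by norm_num
    have h3 := mul_le_mul h2 h (norm_nonneg _) zero_le_one
    rwa [one_mul] at h3
  have h1 : wnorm Φ f = Real.sqrt (gaussMass Φ) * Real.exp (dualForm hΦ w) := by
    refine wnorm_of_norm_exp_dot hΦ w hm fun x => ?_
    rw [hf, norm_exp, hfe, re_star_dot_comm x w, mul_re]
    norm_num
  have h2 := (taylorFunctional hΦ α).le_opNorm (toHPhi f hd hm)
  have h3 : multiDeriv α f 0 = _ := multiDeriv_cexp_zero α fun j => halfConj j w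
  rw [taylorFunctional_apply, entireRep_unique hd.continuous (coeFn_toHPhi hd hm), h3,
    norm_prod_halfConj, norm_toHPhi, h1] at h2
  exact h2

end TaylorProj

end QuadGrowth
end

noncomputable section
namespace QuadGrowth

/-! ### The rate of growth of `Π_α` -/

section Growth

open MeasureTheory

variable {n : ℕ}

/-- The supremum of `|ω^β|² / (4 Ψ(ω))` over the unit sphere. -/
def supRatio (Ψ : (Fin n → ℂ) → ℝ) (β : Fin n → ℝ) : ℝ :=
  sSup ((fun ω => (4 * Ψ ω)⁻¹ * absPowSq β ω) '' unitSphere n)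

theorem isCompact_unitSphere : IsCompact (unitSphere n) := by
  refine (isCompact_closedBall (0 : Fin n → ℂ) 1).of_isClosed_subset ?_ fun ω hω => ?_
  · exact isClosed_eq (by fun_prop) continuous_const
  · rw [mem_closedBall_zero_iff, pi_norm_le_iff_of_nonneg zero_le_one]
    intro j
    have h1 : ‖ω j‖ ^ 2 ≤ ∑ j, ‖ω j‖ ^ 2 :=
      Finset.single_le_sum (f := fun j => ‖ω j‖ ^ 2) (fun _ _ => by positivity) (Finset.mem_univ j)
    rw [show ∑ j, ‖ω j‖ ^ 2 = 1 from hω] at h1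
    exact (sq_le_one_iff₀ (norm_nonneg _)).1 h1

theorem zero_notMem_unitSphere : (0 : Fin n → ℂ) ∉ unitSphere n := by
  simp [unitSphere]

theorem absPowSq_nonneg (β : Fin n → ℝ) (ω : Fin n → ℂ) : 0 ≤ absPowSq β ω :=
  Finset.prod_nonneg fun _ _ => by positivity

theorem continuous_absPowSq {β : Fin n → ℝ} (hβ : ∀ j, 0 ≤ β j) : Continuous (absPowSq β) := by
  unfold absPowSq
  refine continuous_finsetProd _ fun j _ => ?_
  exact ((continuous_apply j).norm).rpow_const fun _ => Or.inr (by linarith [hβ j])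

/-- Compactness of the sphere. The condition `∑ β_j = 1` forces `n > 0`, without which the sphere is
empty. -/
theorem exists_supRatio_eq {Ψ : QuadraticForm ℝ (Fin n → ℂ)} (hΨ : Ψ.PosDef) {β : Fin n → ℝ}
    (hβ : ∀ j, 0 ≤ β j) (hβ1 : ∑ j, β j = 1) :
    (∃ ω ∈ unitSphere n, supRatio Ψ β = (4 * Ψ ω)⁻¹ * absPowSq β ω) ∧
      (∀ ω ∈ unitSphere n, (4 * Ψ ω)⁻¹ * absPowSq β ω ≤ supRatio Ψ β) ∧ 0 < supRatio Ψ β := by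
  have hn : 0 < n := by
    rcases Nat.eq_zero_or_pos n with rfl | h
    · simp at hβ1
    · exact h
  have hpos : ∀ ω ∈ unitSphere n, 0 < Ψ ω := fun ω hω =>
    hΨ ω fun h => zero_notMem_unitSphere (h ▸ hω)
  have hcont : ContinuousOn (fun ω => (4 * Ψ ω)⁻¹ * absPowSq β ω) (unitSphere n) := by
    have h1 := continuous_weight Ψ
    refine ContinuousOn.mul (ContinuousOn.inv₀ (by fun_prop) fun ω hω => ?_)
      (continuous_absPowSq hβ).continuousOn
    have := hpos ω hω
    positivity
  -- A point of the sphere with no vanishing coordinate, which makes the supremum positive for every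
  -- `β`.
  set ω₀ : Fin n → ℂ := fun _ => ((Real.sqrt n)⁻¹ : ℝ) with hω₀
  have hsq : 0 < Real.sqrt n := Real.sqrt_pos.2 (by exact_mod_cast hn)
  have hnorm : ∀ j, ‖ω₀ j‖ = (Real.sqrt n)⁻¹ := fun j => by
    rw [hω₀, Complex.norm_real, Real.norm_eq_abs, abs_of_pos (inv_pos.2 hsq)]
  have hmem : ω₀ ∈ unitSphere n := by
    change ∑ j, ‖ω₀ j‖ ^ 2 = 1
    simp_rw [hnorm]
    rw [Finset.sum_const, Finset.card_univ, Fintype.card_fin, nsmul_eq_mul, inv_pow,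
      Real.sq_sqrt (Nat.cast_nonneg n), mul_inv_cancel₀ (by exact_mod_cast hn.ne')]
  have hbdd : BddAbove ((fun ω => (4 * Ψ ω)⁻¹ * absPowSq β ω) '' unitSphere n) :=
    (isCompact_unitSphere.image_of_continuousOn hcont).bddAbove
  have hle : ∀ ω ∈ unitSphere n, (4 * Ψ ω)⁻¹ * absPowSq β ω ≤ supRatio Ψ β := fun ω hω =>
    le_csSup hbdd (Set.mem_image_of_mem _ hω)
  refine ⟨?_, hle, ?_⟩
  · obtain ⟨ω, h1, h2⟩ := isCompact_unitSphere.exists_sSup_image_eq ⟨ω₀, hmem⟩ hcont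
    exact ⟨ω, h1, h2⟩
  · refine lt_of_lt_of_le ?_ (hle ω₀ hmem)
    refine mul_pos (inv_pos.2 (mul_pos four_pos (hpos _ hmem))) (Finset.prod_pos fun j _ => ?_)
    rw [hnorm j]
    positivity

/-- `|w^α|`. -/
def absMono (α : Fin n → ℕ) (w : Fin n → ℂ) : ℝ := ∏ j, ‖w j‖ ^ α j

theorem absMono_nonneg (α : Fin n → ℕ) (w : Fin n → ℂ) : 0 ≤ absMono α w :=
  Finset.prod_nonneg fun _ _ => by positivity

theorem norm_mono (α : Fin n → ℕ) (w : Fin n → ℂ) : ‖mono α w‖ = absMono α w := by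
  simp [mono, absMono, norm_prod]

theorem absMono_smul (α : Fin n → ℕ) (r : ℝ) (hr : 0 ≤ r) (w : Fin n → ℂ) :
    absMono α (r • w) = r ^ (∑ j, α j) * absMono α w := by
  simp only [absMono, Pi.smul_apply, norm_smul, Real.norm_eq_abs, abs_of_nonneg hr, mul_pow,
    Finset.prod_mul_distrib, Finset.prod_pow_eq_pow_sum]

theorem absMono_sq {α : Fin n → ℕ} {β : Fin n → ℝ} {k : ℕ} (h : ∀ j, (α j : ℝ) = k * β j)
    (w : Fin n → ℂ) : absMono α w ^ 2 = absPowSq β w ^ k := by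
  rw [absMono, absPowSq, ← Finset.prod_pow, ← Finset.prod_pow]
  refine Finset.prod_congr rfl fun j _ => ?_
  rw [← Real.rpow_natCast (‖w j‖ ^ (2 * β j)), ← Real.rpow_mul (norm_nonneg _),
    show 2 * β j * k = ((α j * 2 : ℕ) : ℝ) by push_cast; rw [h]; ring, Real.rpow_natCast, pow_mul]

theorem exists_smul_unitSphere {w : Fin n → ℂ} (hw : w ≠ 0) :
    ∃ r : ℝ, 0 < r ∧ ∃ ω ∈ unitSphere n, w = r • ω := by
  set s : ℝ := ∑ j, ‖w j‖ ^ 2 with hs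
  have hs0 : 0 < s := by
    obtain ⟨j, hj⟩ := Function.ne_iff.1 hw
    exact Finset.sum_pos' (fun _ _ => by positivity)
      ⟨j, Finset.mem_univ j, by have := norm_pos_iff.2 hj; positivity⟩
  have hr : 0 < Real.sqrt s := Real.sqrt_pos.2 hs0
  refine ⟨Real.sqrt s, hr, (Real.sqrt s)⁻¹ • w, ?_, by rw [smul_inv_smul₀ hr.ne']⟩
  change ∑ j, ‖((Real.sqrt s)⁻¹ • w) j‖ ^ 2 = 1
  simp only [Pi.smul_apply, norm_smul, mul_pow, norm_inv, Real.norm_eq_abs, inv_pow, sq_abs,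
    Real.sq_sqrt hs0.le]
  rw [← Finset.mul_sum, ← hs, inv_mul_cancel₀ hs0.ne']

/-- Since `∑ β_j = 1`, both `|w^β|²` and `Ψ` are homogeneous of degree two, so the bound on the
sphere holds everywhere; its `k`-th power is the statement. -/
theorem absMono_sq_le {Ψ : QuadraticForm ℝ (Fin n → ℂ)} (hΨ : Ψ.PosDef) {β : Fin n → ℝ}
    (hβ : ∀ j, 0 ≤ β j) (hβ1 : ∑ j, β j = 1) {α : Fin n → ℕ} (hk : ∑ j, α j ≠ 0)
    (h : ∀ j, (α j : ℝ) = (∑ j, α j : ℕ) * β j) (w : Fin n → ℂ) :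
    absMono α w ^ 2 ≤ (4 * supRatio Ψ β * Ψ w) ^ (∑ j, α j) := by
  rcases eq_or_ne w 0 with rfl | hw
  · obtain ⟨j, _, hj⟩ := Finset.exists_ne_zero_of_sum_ne_zero hk
    have : absMono α (0 : Fin n → ℂ) = 0 :=
      Finset.prod_eq_zero (Finset.mem_univ j) (by simp [hj])
    rw [this, QuadraticMap.map_zero]
    simp [hk]
  · obtain ⟨r, hr, ω, hω, rfl⟩ := exists_smul_unitSphere hw
    have hpos : 0 < Ψ ω := hΨ ω fun h => zero_notMem_unitSphere (h ▸ hω)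
    have h1 := (exists_supRatio_eq hΨ hβ hβ1).2.1 ω hω
    rw [absMono_smul _ _ hr.le, mul_pow, absMono_sq h, QuadraticMap.map_smul, ← pow_mul,
      mul_comm (∑ j, α j) 2, pow_mul, ← mul_pow]
    refine pow_le_pow_left₀ (mul_nonneg (by positivity) (absPowSq_nonneg _ _)) ?_ _
    rw [inv_mul_le_iff₀ (by positivity)] at h1
    rw [smul_eq_mul]
    nlinarith [mul_le_mul_of_nonneg_left h1 (mul_self_nonneg r)]

/-- The constant is the maximum of `t^k e^{-ct}`, attained at `t = k / c`; the proof is `1 + s ≤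
e^s` at `s = ct/k - 1`. -/
theorem pow_le_exp {t c : ℝ} (ht : 0 ≤ t) (hc : 0 < c) {k : ℕ} (hk : k ≠ 0) :
    t ^ k ≤ (k / c) ^ k * Real.exp (-k) * Real.exp (c * t) := by
  have hk' : (0 : ℝ) < k := by exact_mod_cast Nat.pos_of_ne_zero hk
  have h1 : t ≤ (k / c) * Real.exp (t * c / k - 1) := by
    have h2 := Real.add_one_le_exp (t * c / k - 1)
    rw [sub_add_cancel] at h2
    have h3 := mul_le_mul_of_nonneg_left h2 (show 0 ≤ k / c by positivity)
    refine le_trans (le_of_eq ?_) h3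
    field_simp
  refine (pow_le_pow_left₀ ht h1 k).trans (le_of_eq ?_)
  rw [mul_pow, ← Real.exp_nat_mul, mul_assoc, ← Real.exp_add]
  congr 2
  field_simp
  ring

/-- The bound for `(|w^α| e^{-Ψ(w)})²`. -/
def growthBound (S : ℝ) (k : ℕ) : ℝ := (4 * S) ^ k * (((k : ℝ) + 1) / 2) ^ k * Real.exp (-k)

theorem growthBound_pos {S : ℝ} (hS : 0 < S) (k : ℕ) : 0 < growthBound S k := by
  unfold growthBound; positivity

/-- Only the fraction `k / (k + 1)` of the Gaussian is spent on controlling the polynomial. What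
remains is a Gaussian dilated by `√(k + 1)`, still integrable, with an integral that is only
polynomially large in `k`. -/
theorem absMono_sq_mul_exp_le {Ψ : QuadraticForm ℝ (Fin n → ℂ)} (hΨ : Ψ.PosDef) {β : Fin n → ℝ}
    (hβ : ∀ j, 0 ≤ β j) (hβ1 : ∑ j, β j = 1) {α : Fin n → ℕ} (hk : ∑ j, α j ≠ 0)
    (h : ∀ j, (α j : ℝ) = (∑ j, α j : ℕ) * β j) (w : Fin n → ℂ) :
    absMono α w ^ 2 * Real.exp (-2 * Ψ w) ≤ growthBound (supRatio Ψ β) (∑ j, α j) *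
      Real.exp (-2 * Ψ ((Real.sqrt ((∑ j, α j : ℕ) + 1))⁻¹ • w)) := by
  set k := ∑ j, α j with hkdef
  have hS := (exists_supRatio_eq hΨ hβ hβ1).2.2
  have hk' : (0 : ℝ) < k := by exact_mod_cast Nat.pos_of_ne_zero hk
  have h1 := absMono_sq_le hΨ hβ hβ1 hk h w
  rw [← hkdef, mul_pow] at h1
  have hΨw : 0 ≤ Ψ w := hΨ.nonneg w
  -- This rate leaves `2 - 2k/(k + 1) = 2/(k + 1)` in the exponent.
  have h2 := pow_le_exp hΨw (c := 2 * k / (k + 1)) (by positivity) hk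
  have h3 : (k : ℝ) / (2 * k / (k + 1)) = (k + 1) / 2 := by field_simp
  rw [h3] at h2
  have h4 := h1.trans (mul_le_mul_of_nonneg_left h2 (by positivity))
  refine (mul_le_mul_of_nonneg_right h4 (Real.exp_nonneg _)).trans (le_of_eq ?_)
  have h5 : Real.exp (-2 * Ψ ((Real.sqrt ((k : ℝ) + 1))⁻¹ • w)) =
      Real.exp (2 * k / (k + 1) * Ψ w) * Real.exp (-2 * Ψ w) := by
    rw [← Real.exp_add, QuadraticMap.map_smul, smul_eq_mul, ← mul_inv,
      Real.mul_self_sqrt (by positivity)]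
    congr 1
    field_simp
    ring
  rw [h5, growthBound]
  ring

theorem integral_comp_inv_smul (f : (Fin n → ℂ) → ℝ) {r : ℝ} (hr : 0 < r) :
    ∫ x, f (r⁻¹ • x) = r ^ (Module.finrank ℝ (Fin n → ℂ)) * ∫ x, f x := by
  rw [Measure.integral_comp_inv_smul_of_nonneg _ _ hr.le, smul_eq_mul]

theorem integrable_comp_inv_smul {f : (Fin n → ℂ) → ℝ} (hf : Integrable f) {r : ℝ} (hr : 0 < r) :
    Integrable fun x => f (r⁻¹ • x) :=
  hf.comp_smul (inv_ne_zero hr.ne')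

theorem absMoment_le {Ψ : QuadraticForm ℝ (Fin n → ℂ)} (hΨ : Ψ.PosDef) {β : Fin n → ℝ}
    (hβ : ∀ j, 0 ≤ β j) (hβ1 : ∑ j, β j = 1) {α : Fin n → ℕ} (hk : ∑ j, α j ≠ 0)
    (h : ∀ j, (α j : ℝ) = (∑ j, α j : ℕ) * β j) :
    absMoment Ψ α ≤ Real.sqrt (growthBound (supRatio Ψ β) (∑ j, α j)) *
      (Real.sqrt ((∑ j, α j : ℕ) + 1) ^ (Module.finrank ℝ (Fin n → ℂ)) *
        ∫ x, Real.exp (-1 * Ψ x)) := by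
  have hr : 0 < Real.sqrt ((∑ j, α j : ℕ) + 1 : ℝ) := Real.sqrt_pos.2 (by positivity)
  rw [← integral_comp_inv_smul _ hr, ← integral_const_mul, absMoment]
  refine integral_mono_of_nonneg (Filter.Eventually.of_forall fun w => ?_)
    ((integrable_comp_inv_smul (integrable_exp_neg hΨ one_pos) hr).const_mul _)
    (Filter.Eventually.of_forall fun w => ?_)
  · exact mul_nonneg (absMono_nonneg α w) (Real.exp_nonneg _)
  · have h1 := Real.sqrt_le_sqrt (absMono_sq_mul_exp_le hΨ hβ hβ1 hk h w)
    have h2 : ∀ t : ℝ, Real.exp (-2 * t) = Real.exp (-1 * t) ^ 2 := fun t => by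
      rw [← Real.exp_nat_mul]; congr 1; push_cast; ring
    rw [h2, h2, Real.sqrt_mul' _ (by positivity), Real.sqrt_mul' _ (by positivity),
      Real.sqrt_sq (absMono_nonneg α w), Real.sqrt_sq (Real.exp_nonneg _),
      Real.sqrt_sq (Real.exp_nonneg _)] at h1
    exact h1

theorem wnorm_mono_sq_le {Φ : QuadraticForm ℝ (Fin n → ℂ)} (hΦ : Φ.PosDef) {β : Fin n → ℝ}
    (hβ : ∀ j, 0 ≤ β j) (hβ1 : ∑ j, β j = 1) {α : Fin n → ℕ} (hk : ∑ j, α j ≠ 0)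
    (h : ∀ j, (α j : ℝ) = (∑ j, α j : ℕ) * β j) :
    wnorm Φ (mono α) ^ 2 ≤ growthBound (supRatio Φ β) (∑ j, α j) *
      (Real.sqrt ((∑ j, α j : ℕ) + 1) ^ (Module.finrank ℝ (Fin n → ℂ)) * gaussMass Φ) := by
  have hr : 0 < Real.sqrt ((∑ j, α j : ℕ) + 1 : ℝ) := Real.sqrt_pos.2 (by positivity)
  rw [gaussMass, ← integral_comp_inv_smul _ hr, ← integral_const_mul,
    wnorm_sq Φ ((expType_mono α).memLp hΦ)]
  simp_rw [norm_mono]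
  refine integral_mono_of_nonneg (Filter.Eventually.of_forall fun w => by positivity)
    ((integrable_comp_inv_smul (integrable_exp_neg hΦ two_pos) hr).const_mul _)
    (Filter.Eventually.of_forall fun w => absMono_sq_mul_exp_le hΦ hβ hβ1 hk h w)

/-- The maximum of `(|w^α| e^{-Ψ(w)})²`. -/
def growthMax (S : ℝ) (k : ℕ) : ℝ := (4 * S) ^ k * ((k : ℝ) / 2) ^ k * Real.exp (-k)

theorem growthMax_pos {S : ℝ} (hS : 0 < S) {k : ℕ} (hk : k ≠ 0) : 0 < growthMax S k := by
  have : (0 : ℝ) < k := by exact_mod_cast Nat.pos_of_ne_zero hk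
  unfold growthMax; positivity

/-- The maximum lies on the ray through a maximizer on the sphere, at the radius where `Ψ = k / 2`.
-/
theorem exists_absMono_eq {Ψ : QuadraticForm ℝ (Fin n → ℂ)} (hΨ : Ψ.PosDef) {β : Fin n → ℝ}
    (hβ : ∀ j, 0 ≤ β j) (hβ1 : ∑ j, β j = 1) {α : Fin n → ℕ} (hk : ∑ j, α j ≠ 0)
    (h : ∀ j, (α j : ℝ) = (∑ j, α j : ℕ) * β j) :
    ∃ w, absMono α w = Real.sqrt (growthMax (supRatio Ψ β) (∑ j, α j)) * Real.exp (Ψ w) := by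
  obtain ⟨⟨ω, hω, hS⟩, -, hS0⟩ := exists_supRatio_eq hΨ hβ hβ1
  set k := ∑ j, α j with hkdef
  have hk' : (0 : ℝ) < k := by exact_mod_cast Nat.pos_of_ne_zero hk
  have hpos : 0 < Ψ ω := hΨ ω fun h => zero_notMem_unitSphere (h ▸ hω)
  set r := Real.sqrt (k / 2 / Ψ ω) with hr
  have hr2 : r * r = k / 2 / Ψ ω := Real.mul_self_sqrt (by positivity)
  have hΨr : Ψ (r • ω) = k / 2 := by
    rw [QuadraticMap.map_smul, hr2, smul_eq_mul]
    field_simp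
  refine ⟨r • ω, ?_⟩
  have h0 := absMono_nonneg α (r • ω)
  rw [← Real.sqrt_sq h0, hΨr, ← Real.sqrt_sq (Real.exp_nonneg ((k : ℝ) / 2)),
    ← Real.sqrt_mul' _ (by positivity)]
  congr 1
  have h1 : absPowSq β ω = supRatio Ψ β * (4 * Ψ ω) := by
    rw [hS]; field_simp
  rw [absMono_smul _ _ (Real.sqrt_nonneg _), mul_pow, absMono_sq h, ← hkdef, ← pow_mul,
    mul_comm k 2, pow_mul, ← mul_pow, pow_two r, hr2, h1, growthMax, ← Real.exp_nat_mul,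
    mul_assoc, ← Real.exp_add, ← mul_pow, show (-(k : ℝ) + ((2 : ℕ) : ℝ) * (k / 2)) = 0 by
      push_cast; ring, Real.exp_zero, mul_one]
  congr 1
  field_simp

theorem log_growthMax {S : ℝ} (hS : 0 < S) {k : ℕ} (hk : k ≠ 0) :
    Real.log (growthMax S k) = k * (Real.log S + Real.log 2 + Real.log k - 1) := by
  have hk' : (0 : ℝ) < k := by exact_mod_cast Nat.pos_of_ne_zero hk
  rw [growthMax, Real.log_mul (by positivity) (Real.exp_ne_zero _), Real.log_exp,
    ← mul_pow, Real.log_pow, show 4 * S * (k / 2) = S * 2 * k by ring,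
    Real.log_mul (by positivity) hk'.ne', Real.log_mul hS.ne' two_ne_zero]
  ring

/-- Because `k log (1 + 1/k) ≤ 1`, the bound used in the integrals exceeds the true maximum by at
most a factor `e`. -/
theorem log_growthBound_le {S : ℝ} (hS : 0 < S) {k : ℕ} (hk : k ≠ 0) :
    Real.log (growthBound S k) ≤ k * (Real.log S + Real.log 2 + Real.log k - 1) + 1 := by
  have hk' : (0 : ℝ) < k := by exact_mod_cast Nat.pos_of_ne_zero hk
  have h1 : Real.log ((k : ℝ) + 1) ≤ Real.log k + 1 / k := by
    have h2 := Real.log_le_sub_one_of_pos (show (0 : ℝ) < (k + 1) / k by positivity)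
    rw [Real.log_div (by positivity) hk'.ne'] at h2
    have h3 : ((k : ℝ) + 1) / k - 1 = 1 / k := by field_simp; ring
    linarith
  rw [growthBound, Real.log_mul (by positivity) (Real.exp_ne_zero _), Real.log_exp,
    ← mul_pow, Real.log_pow, show 4 * S * ((k + 1) / 2) = S * 2 * ((k : ℝ) + 1) by ring,
    Real.log_mul (by positivity) (by positivity), Real.log_mul hS.ne' two_ne_zero]
  have h4 := mul_le_mul_of_nonneg_left h1 hk'.le
  rw [mul_add, mul_one_div_cancel hk'.ne'] at h4
  linarith

theorem log_factorial_ge (k : ℕ) : k * Real.log k - k ≤ Real.log (k.factorial) := by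
  rcases Nat.eq_zero_or_pos k with rfl | hk
  · simp
  · have hk' : (0 : ℝ) < k := by exact_mod_cast hk
    have h1 := Stirling.le_log_factorial_stirling hk.ne'
    have h2 : 0 ≤ Real.log (2 * Real.pi) := Real.log_nonneg (by linarith [Real.pi_gt_three])
    have h3 : 0 ≤ Real.log k := Real.log_nonneg (by exact_mod_cast hk)
    linarith

theorem log_factorial_le (k : ℕ) :
    Real.log (k.factorial) ≤ k * Real.log k - k + 1 + Real.log k := by
  rcases Nat.eq_zero_or_pos k with rfl | hk
  -- For `k = 0` the convention `log 0 = 0` makes the claim `0 ≤ 1`.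
  · simp
  · induction k, hk using Nat.le_induction with
    | base => simp
    | succ k hk ih =>
      have hk' : (0 : ℝ) < k := by exact_mod_cast hk
      have h1 := Real.one_sub_inv_le_log_of_pos (show (0 : ℝ) < (k + 1) / k by positivity)
      rw [Real.log_div (by positivity) hk'.ne', inv_div] at h1
      have h2 := mul_le_mul_of_nonneg_left h1 (show (0 : ℝ) ≤ k + 1 by positivity)
      have h3 : ((k : ℝ) + 1) * (1 - k / (k + 1)) = 1 := by field_simp; ring
      rw [h3] at h2
      rw [Nat.factorial_succ, Nat.cast_mul, Real.log_mul (by positivity) (by positivity)]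
      push_cast
      nlinarith

/-- The source of the entropy term: with `α = k β` the main term of `log α!` splits into `k log k`
and `k ∑ β_j log β_j`. Vanishing entries contribute nothing on either side. -/
theorem sum_mul_log {α : Fin n → ℕ} {β : Fin n → ℝ} (hβ1 : ∑ j, β j = 1) {k : ℕ} (hk : k ≠ 0)
    (h : ∀ j, (α j : ℝ) = k * β j) :
    ∑ j, (α j : ℝ) * Real.log (α j) =
      k * Real.log k + k * ∑ j with β j ≠ 0, β j * Real.log (β j) := by
  have hk' : (0 : ℝ) < k := by exact_mod_cast Nat.pos_of_ne_zero hk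
  have h1 : ∀ j, (α j : ℝ) * Real.log (α j) = k * Real.log k * β j + k * (β j * Real.log (β j)) := by
    intro j
    rw [h]
    rcases eq_or_ne (β j) 0 with h0 | h0
    · simp [h0]
    · rw [Real.log_mul hk'.ne' h0]; ring
  rw [Finset.sum_congr rfl fun j _ => h1 j, Finset.sum_add_distrib, ← Finset.mul_sum, hβ1, mul_one,
    ← Finset.mul_sum]
  congr 2
  refine (Finset.sum_filter_of_ne fun j _ hj => ?_).symm
  exact left_ne_zero_of_mul hj

theorem growthRate_eq {Φ : QuadraticForm ℝ (Fin n → ℂ)} (hΦ : Φ.PosDef) (β : Fin n → ℝ) :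
    growthRate Φ β = (1 / 2) * Real.log (supRatio Φ β) +
      (1 / 2) * Real.log (supRatio (dualForm hΦ) β) - ∑ j with β j ≠ 0, β j * Real.log (β j) := by
  have h : (dualForm hΦ : (Fin n → ℂ) → ℝ) = dualWeight Φ := funext (dualForm_apply hΦ)
  rw [growthRate, supRatio, supRatio, h]

/-- In the logarithm, the factor `2^{-k}`, the two square roots of growth bounds and `1 / α!`
contribute terms in `k log 2`, `k log k` and `k` that cancel, leaving `k` times the growth rate. The
constant depends on `Φ` only, not on `β`. -/
theorem exists_log_norm_taylorProj_le {Φ : QuadraticForm ℝ (Fin n → ℂ)} (hΦ : Φ.PosDef) :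
    ∃ K, ∀ (β : Fin n → ℝ), (∀ j, 0 ≤ β j) → ∑ j, β j = 1 → ∀ α : Fin n → ℕ, ∑ j, α j ≠ 0 →
      (∀ j, (α j : ℝ) = (∑ j, α j : ℕ) * β j) → 0 < ‖taylorProj Φ α‖ →
      Real.log ‖taylorProj Φ α‖ ≤ (∑ j, α j : ℕ) * growthRate Φ β + K +
        Module.finrank ℝ (Fin n → ℂ) * Real.log ((∑ j, α j : ℕ) + 1) := by
  set Ψ := dualForm hΦ with hΨdef
  have hΨ : Ψ.PosDef := dualForm_posDef hΦ
  set c₁ := (inversionConst Φ hΦ)⁻¹ * Real.sqrt (gaussMass Φ) with hc₁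
  have hc₁pos : 0 < c₁ := mul_pos (inv_pos.2 (inversionConst_pos hΦ))
    (Real.sqrt_pos.2 (gaussMass_pos hΦ))
  set m := ∫ x, Real.exp (-1 * Ψ x) with hm
  have hmpos : 0 < m := integral_exp_neg_pos hΨ one_pos
  refine ⟨Real.log c₁ + Real.log m + (1 / 2) * Real.log (gaussMass Φ) + 1,
    fun β hβ hβ1 α hk h hpos => ?_⟩
  have hS := (exists_supRatio_eq hΨ hβ hβ1).2.2
  have hS' := (exists_supRatio_eq hΦ hβ hβ1).2.2
  have hA := norm_taylorFunctional_le hΦ α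
  have hB := absMoment_le hΨ hβ hβ1 hk h
  have hW := wnorm_mono_sq_le hΦ hβ hβ1 hk h
  rw [← hc₁] at hA
  rw [← hm] at hB
  have hsum := sum_mul_log hβ1 hk h
  set k := ∑ j, α j with hkdef
  set N := Module.finrank ℝ (Fin n → ℂ) with hN
  have hk' : (0 : ℝ) < k := by exact_mod_cast Nat.pos_of_ne_zero hk
  have hgm := gaussMass_pos hΦ
  have hb1 := growthBound_pos hS k
  have hb2 := growthBound_pos hS' k
  have hsq : 0 < Real.sqrt ((k : ℝ) + 1) := Real.sqrt_pos.2 (by positivity)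
  rw [norm_taylorProj hΦ] at hpos ⊢
  have hfac : (0 : ℝ) < ∏ j, ((α j).factorial : ℝ) :=
    Finset.prod_pos fun j _ => by exact_mod_cast (α j).factorial_pos
  have hTpos : 0 < ‖taylorFunctional hΦ α‖ := by
    rcases (norm_nonneg (taylorFunctional hΦ α)).eq_or_lt with h0 | h0
    · rw [← h0] at hpos; simp at hpos
    · exact h0
  have hwpos : 0 < wnorm Φ (mono α) := by
    rcases (wnorm_nonneg Φ (mono α)).eq_or_lt with h0 | h0
    · rw [← h0] at hpos; simp at hpos
    · exact h0
  clear_value c₁ m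
  have hT := Real.log_le_log hTpos (hA.trans (mul_le_mul_of_nonneg_left
    (mul_le_mul_of_nonneg_left hB (by positivity)) hc₁pos.le))
  have hw := Real.log_le_log (by positivity) hW
  rw [Real.log_mul hc₁pos.ne' (by positivity), Real.log_mul (by positivity) (by positivity),
    Real.log_mul (by positivity) (by positivity), Real.log_mul (by positivity) (by positivity),
    Real.log_pow, Real.log_pow, Real.log_sqrt hb1.le, Real.log_sqrt (by positivity), one_div,
    Real.log_inv] at hT
  rw [Real.log_pow, Real.log_mul (by positivity) (by positivity),
    Real.log_mul (by positivity) (by positivity), Real.log_pow, Real.log_sqrt (by positivity)] at hw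
  have hl1 := log_growthBound_le hS hk
  have hl2 := log_growthBound_le hS' hk
  have hfl : (k : ℝ) * Real.log k + k * (∑ j with β j ≠ 0, β j * Real.log (β j)) - k ≤
      Real.log (∏ j, ((α j).factorial : ℝ)) := by
    rw [Real.log_prod fun j _ => by positivity, ← hsum]
    have h1 := Finset.sum_le_sum fun j (_ : j ∈ Finset.univ) => log_factorial_ge (α j)
    rw [Finset.sum_sub_distrib, ← Nat.cast_sum, ← hkdef] at h1
    exact h1
  rw [growthRate_eq hΦ, Real.log_mul (by positivity) hwpos.ne', Real.log_mul (by positivity)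
    hTpos.ne', Real.log_inv, ← hΨdef]
  push_cast at hw
  have hNlog : 0 ≤ (N : ℝ) * Real.log (k + 1) :=
    mul_nonneg (Nat.cast_nonneg N) (Real.log_nonneg (by linarith))
  linarith

/-- The counterpart of the upper bound with both integrals replaced by values at maximizing points:
exponentials test the functional at a maximizer for the dual weight, and the pointwise bound tests
`x^α` at a maximizer for `Φ`. -/
theorem exists_log_norm_taylorProj_ge {Φ : QuadraticForm ℝ (Fin n → ℂ)} (hΦ : Φ.PosDef) :
    ∃ K, ∀ (β : Fin n → ℝ), (∀ j, 0 ≤ β j) → ∑ j, β j = 1 → ∀ α : Fin n → ℕ, ∑ j, α j ≠ 0 →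
      (∀ j, (α j : ℝ) = (∑ j, α j : ℕ) * β j) → 0 < ‖taylorProj Φ α‖ ∧
      (∑ j, α j : ℕ) * growthRate Φ β ≤ Real.log ‖taylorProj Φ α‖ + K +
        n * Real.log (∑ j, α j : ℕ) := by
  set Ψ := dualForm hΦ with hΨdef
  have hΨ : Ψ.PosDef := dualForm_posDef hΦ
  obtain ⟨C, hC, hpt⟩ := exists_pointwise_bound hΦ
  refine ⟨(1 / 2) * Real.log (gaussMass Φ) + Real.log C + n,
    fun β hβ hβ1 α hk h => ?_⟩
  have hS := (exists_supRatio_eq hΨ hβ hβ1).2.2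
  have hS' := (exists_supRatio_eq hΦ hβ hβ1).2.2
  obtain ⟨w, hw⟩ := exists_absMono_eq hΨ hβ hβ1 hk h
  obtain ⟨x, hx⟩ := exists_absMono_eq hΦ hβ hβ1 hk h
  have hA := le_norm_taylorFunctional hΦ α w
  have hB := hpt (mono α) (differentiable_mono α) ((expType_mono α).memLp hΦ) x
  have hsum := sum_mul_log hβ1 hk h
  set k := ∑ j, α j with hkdef
  have hk' : (0 : ℝ) < k := by exact_mod_cast Nat.pos_of_ne_zero hk
  have hgm := gaussMass_pos hΦ
  have hb1 := growthMax_pos hS hk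
  have hb2 := growthMax_pos hS' hk
  rw [show (∏ j, ‖w j‖ ^ α j) = absMono α w from rfl, hw, ← mul_assoc, ← mul_assoc] at hA
  have hA' := le_of_mul_le_mul_right hA (Real.exp_pos _)
  rw [norm_mono, hx, mul_right_comm] at hB
  have hB' := le_of_mul_le_mul_right hB (Real.exp_pos _)
  have hTpos : 0 < ‖taylorFunctional hΦ α‖ := by
    refine pos_of_mul_pos_left (lt_of_lt_of_le ?_ hA') (Real.sqrt_nonneg _)
    positivity
  have hwpos : 0 < wnorm Φ (mono α) := by
    refine pos_of_mul_pos_right (lt_of_lt_of_le ?_ hB') hC.le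
    positivity
  have hfac : (0 : ℝ) < ∏ j, ((α j).factorial : ℝ) :=
    Finset.prod_pos fun j _ => by exact_mod_cast (α j).factorial_pos
  have hT := Real.log_le_log (by positivity) hA'
  have hw := Real.log_le_log (by positivity) hB'
  rw [Real.log_mul (by positivity) (by positivity), Real.log_mul (by positivity) (by positivity),
    Real.log_pow, Real.log_sqrt hb1.le, Real.log_sqrt hgm.le, one_div, Real.log_inv,
    log_growthMax hS hk] at hT
  rw [Real.log_mul (by positivity) (by positivity), Real.log_sqrt hb2.le,
    log_growthMax hS' hk] at hw
  have hfl : Real.log (∏ j, ((α j).factorial : ℝ)) ≤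
      (k : ℝ) * Real.log k + k * (∑ j with β j ≠ 0, β j * Real.log (β j)) - k + n +
        n * Real.log k := by
    rw [Real.log_prod fun j _ => by positivity, ← hsum]
    have h1 : ∀ j ∈ Finset.univ, Real.log ((α j).factorial) ≤
        (α j : ℝ) * Real.log (α j) - α j + 1 + Real.log k := fun j _ => by
      refine (log_factorial_le (α j)).trans ?_
      have h2 : Real.log (α j) ≤ Real.log k := by
        rcases Nat.eq_zero_or_pos (α j) with h0 | h0
        · rw [h0]; simpa using Real.log_natCast_nonneg k
        · refine Real.log_le_log (by exact_mod_cast h0) ?_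
          exact_mod_cast Finset.single_le_sum (f := α) (fun _ _ => Nat.zero_le _)
            (Finset.mem_univ j)
      linarith
    have h3 := Finset.sum_le_sum h1
    rw [Finset.sum_add_distrib, Finset.sum_add_distrib, Finset.sum_sub_distrib, ← Nat.cast_sum,
      ← hkdef, Finset.sum_const, Finset.sum_const, Finset.card_univ, Fintype.card_fin,
      nsmul_eq_mul, nsmul_eq_mul, mul_one] at h3
    exact h3
  rw [norm_taylorProj hΦ]
  refine ⟨by positivity, ?_⟩
  rw [growthRate_eq hΦ, Real.log_mul (by positivity) hwpos.ne', Real.log_mul (by positivity)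
    hTpos.ne', Real.log_inv]
  linarith

/-- The exponential growth rate of the norms of the projections `Π_α`. -/
theorem norm_taylorProj_asymptotics {Φ : QuadraticForm ℝ (Fin n → ℂ)} (hΦ : Φ.PosDef)
    {β : Fin n → ℝ} (hβ : ∀ j, 0 ≤ β j) (hβ1 : ∑ j, β j = 1) :
    ∃ C L₀ : ℝ, ∀ (L : ℝ) (α : Fin n → ℕ), L₀ ≤ L → (∀ j, (α j : ℝ) = L * β j) →
      |L⁻¹ * Real.log ‖taylorProj Φ α‖ - growthRate Φ β| ≤ C * (L⁻¹ * Real.log L) := by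
  obtain ⟨K₁, h1⟩ := exists_log_norm_taylorProj_le hΦ
  obtain ⟨K₂, h2⟩ := exists_log_norm_taylorProj_ge hΦ
  set N : ℝ := ((Module.finrank ℝ (Fin n → ℂ) : ℕ) : ℝ) with hN
  -- The threshold `2` keeps `log L ≥ log 2 > 0`, so that additive constants can be absorbed into a
  -- multiple of `log L`.
  refine ⟨(|K₁| + |K₂|) / Real.log 2 + 2 * N + n, 2, fun L α hL hα => ?_⟩
  have hL0 : 0 < L := by linarith
  -- As `∑ β_j = 1`, the parameter `L` is the degree of the monomial.
  have hLk : L = ((∑ j, α j : ℕ) : ℝ) := by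
    push_cast
    rw [Finset.sum_congr rfl fun j _ => hα j, ← Finset.mul_sum, hβ1, mul_one]
  have hk : ∑ j, α j ≠ 0 := by
    intro h0
    rw [h0] at hLk
    simp at hLk
    linarith
  have hα' : ∀ j, (α j : ℝ) = (∑ j, α j : ℕ) * β j := by rw [← hLk]; exact hα
  obtain ⟨hpos, hlow⟩ := h2 β hβ hβ1 α hk hα'
  have hup := h1 β hβ hβ1 α hk hα' hpos
  rw [← hLk] at hlow hup
  have hlog2 : 0 < Real.log 2 := Real.log_pos one_lt_two
  have hlogL : Real.log 2 ≤ Real.log L := Real.log_le_log two_pos hL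
  have hlogL1 : Real.log (L + 1) ≤ 2 * Real.log L := by
    have h3 : Real.log (L + 1) ≤ Real.log (L ^ 2) := Real.log_le_log (by positivity) (by nlinarith)
    rwa [Real.log_pow] at h3
  have hK : |K₁| + |K₂| ≤ (|K₁| + |K₂|) / Real.log 2 * Real.log L := by
    rw [div_mul_eq_mul_div, le_div_iff₀ hlog2]
    exact mul_le_mul_of_nonneg_left hlogL (by positivity)
  have hN0 : 0 ≤ N := Nat.cast_nonneg _
  have hlogL0 : 0 ≤ Real.log L := hlog2.le.trans hlogL
  have hnn : 0 ≤ (n : ℝ) * Real.log L := by positivity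
  have hNL : 0 ≤ N * Real.log L := by positivity
  have hNN := mul_le_mul_of_nonneg_left hlogL1 hN0
  have key : |Real.log ‖taylorProj Φ α‖ - L * growthRate Φ β| ≤
      ((|K₁| + |K₂|) / Real.log 2 + 2 * N + n) * Real.log L := by
    rw [abs_le]
    have := le_abs_self K₁
    have := le_abs_self K₂
    have := abs_nonneg K₁
    have := abs_nonneg K₂
    constructor
    · linarith
    · linarith
  have h5 : L⁻¹ * Real.log ‖taylorProj Φ α‖ - growthRate Φ β =
      L⁻¹ * (Real.log ‖taylorProj Φ α‖ - L * growthRate Φ β) := by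
    field_simp
  rw [h5, abs_mul, abs_of_pos (inv_pos.2 hL0)]
  refine (mul_le_mul_of_nonneg_left key (inv_nonneg.2 hL0.le)).trans (le_of_eq (by ring))

end Growth

end QuadGrowth
end

noncomputable section
namespace QuadGrowth

/-! ### Polynomial models -/

section PolynomialModel

open MvPolynomial

variable {n : ℕ}

open scoped IsMulCommutative in
/-- A commuting family of endomorphisms extends to an action of the polynomial ring. -/
theorem exists_algHom_of_commute {V : Type*} [AddCommGroup V] [Module ℂ V]
    (T : Fin n → Module.End ℂ V) (hT : ∀ j k, T j * T k = T k * T j) :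
    ∃ ρ : MvPolynomial (Fin n) ℂ →ₐ[ℂ] Module.End ℂ V, ∀ j, ρ (X j) = T j := by
  -- Evaluation of polynomials requires a commutative target, which the algebra generated by the
  -- commuting operators provides.
  have := Algebra.isMulCommutative_adjoin ℂ (s := Set.range T) (by
    rintro _ ⟨j, rfl⟩ _ ⟨k, rfl⟩
    exact hT j k)
  refine ⟨(Algebra.adjoin ℂ (Set.range T)).val.comp (aeval fun j =>
    ⟨T j, Algebra.subset_adjoin ⟨j, rfl⟩⟩), fun j => ?_⟩
  rw [AlgHom.comp_apply, aeval_X]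
  rfl

/-- The action of the annihilation operators on the polynomial model. -/
theorem annihilation_apply {V : Type*} [AddCommGroup V] [Module ℂ V]
    {T Y : Fin n → Module.End ℂ V} {c : ℂ}
    (hYT : ∀ j k, Y j * T k = T k * Y j + if j = k then c • 1 else 0)
    {ρ : MvPolynomial (Fin n) ℂ →ₐ[ℂ] Module.End ℂ V} (hρ : ∀ j, ρ (X j) = T j)
    {u : V} (hu : ∀ j, Y j u = 0) (j : Fin n) (p : MvPolynomial (Fin n) ℂ) :
    Y j (ρ p u) = c • ρ (MvPolynomial.pderiv j p) u := by
  induction p using MvPolynomial.induction_on with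
  | C a =>
    rw [MvPolynomial.pderiv_C, map_zero, ← MvPolynomial.algebraMap_eq, AlgHom.commutes,
      Module.algebraMap_end_apply, map_smul, hu]
    simp
  | add p q hp hq => simp only [map_add, LinearMap.add_apply, hp, hq, smul_add]
  | mul_X p k hp =>
    have h1 : ρ (p * X k) u = T k (ρ p u) := by
      rw [mul_comm, map_mul, hρ, Module.End.mul_apply]
    have h2 : Y j (T k (ρ p u)) = T k (Y j (ρ p u)) + if j = k then c • ρ p u else 0 := by
      have h3 := LinearMap.congr_fun (hYT j k) (ρ p u)
      rw [Module.End.mul_apply, LinearMap.add_apply, Module.End.mul_apply] at h3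
      rw [h3]
      split_ifs <;> simp
    rw [h1, h2, hp, map_smul, Derivation.leibniz, MvPolynomial.pderiv_X, smul_eq_mul, smul_eq_mul,
      map_add, LinearMap.add_apply, smul_add, add_comm]
    congr 1
    · by_cases h : j = k
      · subst h; simp
      · simp [h, Ne.symm h]
    · rw [map_mul, hρ, Module.End.mul_apply]

variable {E F : Type*} [NormedAddCommGroup E] [InnerProductSpace ℂ E] [NormedAddCommGroup F]
  [InnerProductSpace ℂ F]

/-- The relation `⟨q, ∂_j p⟩ = 2 ∑ a_jk ⟨q, x_k p⟩ + 2 ∑ b_jk ⟨x_k q, p⟩` for the scalar product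
induced by a linear map on polynomials. -/
def WeightRelation (a b : Matrix (Fin n) (Fin n) ℂ) (U : MvPolynomial (Fin n) ℂ →ₗ[ℂ] E) : Prop :=
  ∀ q p j, inner ℂ (U q) (U (MvPolynomial.pderiv j p)) =
    2 * ∑ k, a j k * inner ℂ (U q) (U (X k * p)) + 2 * ∑ k, b j k * inner ℂ (U (X k * q)) (U p)

/-- The scalar product is determined by `WeightRelation` up to a factor. -/
theorem WeightRelation.inner_eq {a b : Matrix (Fin n) (Fin n) ℂ}
    (hab : ∀ v w : Fin n → ℂ, a *ᵥ v + b *ᵥ w = 0 → a.map star *ᵥ w + b.map star *ᵥ v = 0 →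
      v = 0 ∧ w = 0) (hb : ∀ w : Fin n → ℂ, b *ᵥ w = 0 → w = 0)
    {U : MvPolynomial (Fin n) ℂ →ₗ[ℂ] E} {V : MvPolynomial (Fin n) ℂ →ₗ[ℂ] F}
    (hU : WeightRelation a b U) (hV : WeightRelation a b V) {c : ℝ}
    (h1 : inner ℂ (U 1) (U 1) = c * inner ℂ (V 1) (V 1)) (q p : MvPolynomial (Fin n) ℂ) :
    inner ℂ (U q) (U p) = c * inner ℂ (V q) (V p) := by
  -- The relation is linear in the scalar product, so the difference satisfies it too, together with
  -- its conjugate, and vanishes at `(1, 1)`.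
  set D : MvPolynomial (Fin n) ℂ → MvPolynomial (Fin n) ℂ → ℂ := fun q p =>
    inner ℂ (U q) (U p) - c * inner ℂ (V q) (V p) with hD
  have hrel : ∀ q p j, D q (MvPolynomial.pderiv j p) =
      2 * ((a *ᵥ fun k => D q (X k * p)) j + (b *ᵥ fun k => D (X k * q) p) j) := by
    intro q p j
    simp only [hD, hU q p j, hV q p j, Matrix.mulVec, dotProduct, mul_sub, Finset.sum_sub_distrib]
    simp only [mul_left_comm _ (c : ℂ), ← Finset.mul_sum]
    ring
  have hstar : ∀ q p, star (D q p) = D p q := by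
    intro q p
    simp only [hD, star_sub, star_mul', Complex.star_def, inner_conj_symm, Complex.conj_ofReal]
  have hrel' : ∀ q p j, D (MvPolynomial.pderiv j q) p =
      2 * ((a.map star *ᵥ fun k => D (X k * q) p) j + (b.map star *ᵥ fun k => D q (X k * p)) j) := by
    intro q p j
    rw [← hstar, hrel]
    simp only [Matrix.mulVec, dotProduct, star_mul', star_add, star_sum, hstar, Matrix.map_apply]
    simp
  have hsmul : ∀ q (z : ℂ) p, D q (z • p) = z * D q p := by
    intro q z p
    simp only [hD, map_smul, inner_smul_right]; ring
  have hadd : ∀ q p p', D q (p + p') = D q p + D q p' := by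
    intro q p p'
    simp only [hD, map_add, inner_add_right]; ring
  have h11 : D 1 1 = 0 := by simp only [hD, h1, sub_self]
  -- Induction on the degree of the right argument, with left argument `1`. Differentiation lowers
  -- the degree of `p` and kills `1`, so the relation and its conjugate become a homogeneous linear
  -- system for `D(1, x_k p)` and `D(x_k, p)`, which has only the zero solution by `hab`.
  have hmono : ∀ d : ℕ, ∀ γ : Fin n →₀ ℕ, γ.degree = d → D 1 (monomial γ 1) = 0 := by
    intro d
    induction d using Nat.strong_induction_on with
    | _ d ih =>
      intro γ hγ
      rcases eq_or_ne γ 0 with rfl | h0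
      · simpa using h11
      · obtain ⟨k, hk⟩ := Finsupp.ne_iff.1 h0
        obtain ⟨γ', rfl⟩ : ∃ γ', γ = Finsupp.single k 1 + γ' :=
          exists_add_of_le (Finsupp.single_le_iff.2 (Nat.one_le_iff_ne_zero.2 hk))
        rw [map_add, Finsupp.degree_single] at hγ
        set p : MvPolynomial (Fin n) ℂ := monomial γ' 1 with hp
        have hX : ∀ k, monomial (Finsupp.single k 1 + γ') (1 : ℂ) = X k * p := fun k => by
          rw [hp, X, monomial_mul, one_mul]
        have hd : ∀ j, D 1 (MvPolynomial.pderiv j p) = 0 := by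
          intro j
          rw [hp, MvPolynomial.pderiv_monomial, one_mul, ← mul_one ((γ' j : ℕ) : ℂ), ← smul_eq_mul,
            ← smul_monomial, hsmul]
          rcases Nat.eq_zero_or_pos (γ' j) with h0 | h0
          · rw [h0]; simp
          · have hle : Finsupp.single j 1 ≤ γ' := Finsupp.single_le_iff.2 h0
            have h2 : (γ' - Finsupp.single j 1).degree + 1 = γ'.degree := by
              conv_rhs => rw [← tsub_add_cancel_of_le hle]
              rw [map_add, Finsupp.degree_single]
            rw [ih (γ' - Finsupp.single j 1).degree (by omega) _ rfl, mul_zero]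
        have h3 := hab (fun k => D 1 (X k * p)) (fun k => D (X k * 1) p) (by
          ext j
          have := hrel 1 p j
          rw [hd] at this
          simpa using this.symm) (by
          ext j
          have := hrel' 1 p j
          rw [MvPolynomial.pderiv_one] at this
          have h0 : D 0 p = 0 := by simp [hD]
          rw [h0] at this
          simpa using this.symm)
        rw [hX]
        exact congrFun h3.1 k
  have hone : ∀ p, D 1 p = 0 := by
    intro p
    induction p using MvPolynomial.induction_on' with
    | monomial γ z =>
      rw [← mul_one z, ← smul_eq_mul, ← smul_monomial, hsmul, hmono _ γ rfl, mul_zero]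
    | add p q hp hq => rw [hadd, hp, hq, add_zero]
  have hall : ∀ q p, D q p = 0 := by
    intro q
    induction q using MvPolynomial.induction_on with
    | C z =>
      intro p
      rw [← hstar, ← mul_one (C z), ← smul_eq_C_mul, hsmul, ← hstar, hone]
      simp
    | add q q' hq hq' =>
      intro p
      rw [← hstar, hadd, ← hstar, hq, ← hstar q', hq']
      simp
    | mul_X q k hq =>
      intro p
      -- Once `D(q, ·) = 0`, the relation reduces to the terms with `x_k q` on the left, and
      -- injectivity of `b` raises the degree of the left argument.
      have h2 := hb (fun k => D (X k * q) p) (by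
        ext j
        have := hrel q p j
        simp only [hq] at this
        have h0 : (a *ᵥ fun _ : Fin n => (0 : ℂ)) = 0 := Matrix.mulVec_zero a
        rw [h0] at this
        simpa using this.symm)
      rw [mul_comm]
      exact congrFun h2 k
  exact sub_eq_zero.1 (hall q p)

/-! ### The operator `(1/i) (M x · ∂_x + ∑ λ_j)` on polynomials -/

/-- The operator `(1/i) (∑ M_jk x_k ∂_j + ∑ λ_j)` on polynomials. -/
def normalOp (M : Matrix (Fin n) (Fin n) ℂ) (lam : Fin n → ℂ) :
    Module.End ℂ (MvPolynomial (Fin n) ℂ) :=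
  (1 / Complex.I) • (∑ j, ∑ k, M j k • (LinearMap.mulLeft ℂ (X k) ∘ₗ
    (MvPolynomial.pderiv j).toLinearMap) + (∑ j, lam j) • 1)

theorem normalOp_apply (M : Matrix (Fin n) (Fin n) ℂ) (lam : Fin n → ℂ)
    (p : MvPolynomial (Fin n) ℂ) : normalOp M lam p = (1 / Complex.I) •
      (∑ j, ∑ k, M j k • (X k * MvPolynomial.pderiv j p) + (∑ j, lam j) • p) := by
  simp [normalOp]

/-- The span of the monomials of degree `d` and eigenvalue `ν` with `∑ j γ_j ≥ s`. -/
def monoSpan (lam : Fin n → ℂ) (ν : ℂ) (d s : ℕ) : Submodule ℂ (MvPolynomial (Fin n) ℂ) :=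
  Submodule.span ℂ {p | ∃ γ : Fin n →₀ ℕ, p = monomial γ 1 ∧ ∑ j, γ j = d ∧ mu lam γ = ν ∧
    s ≤ ∑ j : Fin n, (j : ℕ) * γ j}

theorem X_mul_pderiv_monomial_self (γ : Fin n →₀ ℕ) (j : Fin n) :
    X j * MvPolynomial.pderiv j (monomial γ (1 : ℂ)) = (γ j : ℂ) • monomial γ 1 := by
  rw [MvPolynomial.pderiv_monomial, X, monomial_mul, one_mul, one_mul]
  rcases Nat.eq_zero_or_pos (γ j) with h | h
  · simp [h]
  · rw [add_tsub_cancel_of_le (Finsupp.single_le_iff.2 h), smul_monomial, smul_eq_mul, mul_one]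

/-- The diagonal of `M` acts on `x^γ` as multiplication by `μ_γ`. An off-diagonal Jordan entry
contributes `x_{j+1} ∂_j` inside one block: degree and eigenvalue are kept, while the weight `∑ j
γ_j` goes up by one. -/
theorem normalOp_sub_mem {M : Matrix (Fin n) (Fin n) ℂ} {lam : Fin n → ℂ} (hM : IsJordanForm M)
    (hdiag : ∀ j, M j j = 2 * lam j) {ν : ℂ} {d s : ℕ} {p : MvPolynomial (Fin n) ℂ}
    (hp : p ∈ monoSpan lam ν d s) :
    (normalOp M lam - ν • 1) p ∈ monoSpan lam ν d (s + 1) := by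
  suffices h : monoSpan lam ν d s ≤
      (monoSpan lam ν d (s + 1)).comap (normalOp M lam - ν • 1) from h hp
  refine Submodule.span_le.2 ?_
  rintro _ ⟨γ, rfl, hd, hν, hs⟩
  simp only [Submodule.comap_coe, Set.mem_preimage, SetLike.mem_coe]
  have h1 : (normalOp M lam - ν • 1) (monomial γ (1 : ℂ)) = (1 / Complex.I) •
      ∑ j, ∑ k ∈ Finset.univ.erase j, M j k • (X k * MvPolynomial.pderiv j (monomial γ (1 : ℂ))) := by
    rw [LinearMap.sub_apply, normalOp_apply, LinearMap.smul_apply, Module.End.one_apply, ← hν, mu]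
    have h2 : ∀ j, ∑ k, M j k • (X k * MvPolynomial.pderiv j (monomial γ (1 : ℂ))) =
        (2 * lam j * γ j) • monomial γ 1 + ∑ k ∈ Finset.univ.erase j,
          M j k • (X k * MvPolynomial.pderiv j (monomial γ 1)) := by
      intro j
      rw [← Finset.add_sum_erase _ _ (Finset.mem_univ j), X_mul_pderiv_monomial_self, hdiag,
        smul_smul]
    rw [Finset.sum_congr rfl fun j _ => h2 j, Finset.sum_add_distrib, ← Finset.sum_smul]
    have h3 : ∑ j, (2 * (γ j : ℂ) + 1) * lam j = ∑ j, 2 * lam j * γ j + ∑ j, lam j := by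
      rw [← Finset.sum_add_distrib]
      exact Finset.sum_congr rfl fun j _ => by ring
    rw [h3]
    module
  rw [h1]
  refine Submodule.smul_mem _ _ (Submodule.sum_mem _ fun j _ => Submodule.sum_mem _ fun k hk => ?_)
  have hjk : j ≠ k := (Finset.ne_of_mem_erase hk).symm
  by_cases hMjk : M j k = 0
  · rw [hMjk, zero_smul]; exact Submodule.zero_mem _
  obtain ⟨hk1, -, hMd⟩ := hM j k hjk hMjk
  rw [hdiag, hdiag] at hMd
  have hlam : lam j = lam k := mul_left_cancel₀ two_ne_zero hMd
  refine Submodule.smul_mem _ _ ?_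
  rcases Nat.eq_zero_or_pos (γ j) with h0 | h0
  · rw [MvPolynomial.pderiv_monomial, h0]
    simp
  obtain ⟨γ', rfl⟩ : ∃ γ', γ = γ' + Finsupp.single j 1 :=
    ⟨γ - Finsupp.single j 1, (tsub_add_cancel_of_le (Finsupp.single_le_iff.2 h0)).symm⟩
  rw [MvPolynomial.pderiv_monomial, X, monomial_mul, one_mul, one_mul, add_tsub_cancel_right,
    add_comm (Finsupp.single k 1)]
  have hz : ∀ (δ : Fin n →₀ ℕ) (z : ℂ), monomial δ z = z • monomial δ (1 : ℂ) := fun δ z => by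
    rw [smul_monomial, smul_eq_mul, mul_one]
  rw [hz]
  have hsum : ∀ (f : Fin n → ℕ) (i : Fin n), ∑ l, f l * (γ' + Finsupp.single i 1 : Fin n →₀ ℕ) l =
      ∑ l, f l * γ' l + f i := by
    intro f i
    simp [Finsupp.single_apply, mul_add, Finset.sum_add_distrib]
  have hmu : ∀ i, mu lam (γ' + Finsupp.single i 1 : Fin n →₀ ℕ) = mu lam γ' + 1 / Complex.I * (2 * lam i) := by
    intro i
    rw [mu, mu, ← mul_add]
    congr 1
    simp [Finsupp.single_apply, mul_add, add_mul, Finset.sum_add_distrib]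
    ring
  have hdeg := hsum fun _ => 1
  have hwt := hsum fun l => l
  simp only [one_mul] at hdeg
  refine Submodule.smul_mem _ _ (Submodule.subset_span ⟨_, rfl, ?_, ?_, ?_⟩)
  · rw [← hd, hdeg, hdeg]
  · rw [← hν, hmu, hmu, hlam]
  · rw [hwt] at hs ⊢
    omega

/-- In degree `d` the weight is at most `n d`, so raising it repeatedly is nilpotent. -/
theorem monoSpan_eq_bot (lam : Fin n → ℂ) (ν : ℂ) (d : ℕ) : monoSpan lam ν d (n * d + 1) = ⊥ := by
  rw [monoSpan, Submodule.span_eq_bot]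
  rintro _ ⟨γ, -, hd, -, hs⟩
  exfalso
  have h1 : ∑ j : Fin n, (j : ℕ) * γ j ≤ ∑ j : Fin n, n * γ j :=
    Finset.sum_le_sum fun j _ => Nat.mul_le_mul_right _ j.2.le
  rw [← Finset.mul_sum, hd] at h1
  omega

/-- Monomials are generalized eigenvectors of `normalOp`. -/
theorem exists_pow_normalOp_sub_eq_zero {M : Matrix (Fin n) (Fin n) ℂ} {lam : Fin n → ℂ}
    (hM : IsJordanForm M) (hdiag : ∀ j, M j j = 2 * lam j) (γ : Fin n →₀ ℕ) :
    ∃ m : ℕ, ((normalOp M lam - mu lam γ • 1) ^ m)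
      (monomial γ (1 : ℂ)) = 0 := by
  have h : ∀ s : ℕ, ((normalOp M lam - mu lam γ • 1) ^ s)
      (monomial γ (1 : ℂ)) ∈ monoSpan lam (mu lam γ) (∑ j, γ j) s := by
    intro s
    induction s with
    | zero => exact Submodule.subset_span ⟨γ, rfl, rfl, rfl, Nat.zero_le _⟩
    | succ s ih =>
      rw [pow_succ', Module.End.mul_apply]
      exact normalOp_sub_mem hM hdiag ih
  refine ⟨n * (∑ j, γ j) + 1, ?_⟩
  have := h (n * (∑ j, γ j) + 1)
  rwa [monoSpan_eq_bot, Submodule.mem_bot] at this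

end PolynomialModel

end QuadGrowth
end

noncomputable section
namespace QuadGrowth

/-! ### The polynomial model of `H_Φ` -/

section PolyHPhi

open MeasureTheory Complex

variable {n : ℕ} {Φ : QuadraticForm ℝ (Fin n → ℂ)}

/-- Polynomials as elements of `H_Φ`. -/
def polyHPhi (hΦ : Φ.PosDef) : MvPolynomial (Fin n) ℂ →ₗ[ℂ] HPhi Φ where
  toFun p := toHPhi (fun x => MvPolynomial.eval x p) (expType_eval p).1 ((expType_eval p).memLp hΦ)
  map_add' p q := by
    refine Subtype.ext (Lp.ext ?_)
    refine (coeFn_toHPhi _ _).trans (Filter.EventuallyEq.symm ((Lp.coeFn_add _ _).trans ?_))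
    filter_upwards [coeFn_toHPhi (expType_eval p).1 ((expType_eval p).memLp hΦ),
      coeFn_toHPhi (expType_eval q).1 ((expType_eval q).memLp hΦ)] with x h1 h2
    rw [Pi.add_apply, h1, h2, map_add]
  map_smul' c p := by
    refine Subtype.ext (Lp.ext ?_)
    refine (coeFn_toHPhi _ _).trans (Filter.EventuallyEq.symm ((Lp.coeFn_smul _ _).trans ?_))
    filter_upwards [coeFn_toHPhi (expType_eval p).1 ((expType_eval p).memLp hΦ)] with x h1
    rw [Pi.smul_apply, h1, MvPolynomial.smul_eval, RingHom.id_apply, smul_eq_mul]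

theorem coeFn_polyHPhi (hΦ : Φ.PosDef) (p : MvPolynomial (Fin n) ℂ) :
    ((polyHPhi hΦ p : HPhi Φ) : Lp ℂ 2 (weightMeasure Φ)) =ᵐ[weightMeasure Φ]
      fun x => MvPolynomial.eval x p :=
  coeFn_toHPhi (expType_eval p).1 ((expType_eval p).memLp hΦ)

theorem entireRep_polyHPhi (hΦ : Φ.PosDef) (p : MvPolynomial (Fin n) ℂ) :
    entireRep (polyHPhi hΦ p) = fun x => MvPolynomial.eval x p :=
  entireRep_unique (expType_eval p).1.continuous (coeFn_polyHPhi hΦ p)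

theorem inner_HPhi (u v : HPhi Φ) {f g : (Fin n → ℂ) → ℂ}
    (hu : (u : Lp ℂ 2 (weightMeasure Φ)) =ᵐ[weightMeasure Φ] f)
    (hv : (v : Lp ℂ 2 (weightMeasure Φ)) =ᵐ[weightMeasure Φ] g) :
    inner ℂ u v = ∫ x, star (f x) * g x * (Real.exp (-2 * Φ x) : ℝ) := by
  rw [Submodule.coe_inner, L2.inner_def]
  have h1 : ∫ x, inner ℂ ((u : Lp ℂ 2 (weightMeasure Φ)) x) ((v : Lp ℂ 2 (weightMeasure Φ)) x)
      ∂(weightMeasure Φ) = ∫ x, star (f x) * g x ∂(weightMeasure Φ) := by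
    refine integral_congr_ae ?_
    filter_upwards [hu, hv] with x h1 h2
    rw [h1, h2, RCLike.inner_apply', Complex.star_def]
  rw [h1, weightMeasure, integral_withDensity_eq_integral_toReal_smul (measurable_weightDensity Φ)
    (Filter.Eventually.of_forall fun x => ENNReal.ofReal_lt_top)]
  refine integral_congr_ae (Filter.Eventually.of_forall fun x => ?_)
  simp only
  rw [ENNReal.toReal_ofReal (Real.exp_nonneg _), Complex.real_smul, mul_comm]

theorem polyHPhi_injective (hΦ : Φ.PosDef) : Function.Injective (polyHPhi hΦ) := by
  intro p q h
  refine MvPolynomial.funext fun x => ?_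
  have h1 := entireRep_polyHPhi hΦ p
  rw [h, entireRep_polyHPhi] at h1
  exact (congrFun h1 x).symm

theorem monoHPhi_eq (hΦ : Φ.PosDef) (γ : Fin n →₀ ℕ) :
    monoHPhi hΦ γ = polyHPhi hΦ (MvPolynomial.monomial γ 1) := by
  refine Subtype.ext (Lp.ext ?_)
  refine (coeFn_toHPhi _ _).trans (Filter.EventuallyEq.symm ((coeFn_polyHPhi hΦ _).trans ?_))
  exact Filter.Eventually.of_forall fun x => eval_monomial_eq_mono γ x

/-- `Π_α` picks the coefficient of `x^α` of a polynomial. -/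
theorem taylorProj_polyHPhi (hΦ : Φ.PosDef) (α : Fin n →₀ ℕ) (p : MvPolynomial (Fin n) ℂ) :
    taylorProj Φ α (polyHPhi hΦ p) = p.coeff α • polyHPhi hΦ (MvPolynomial.monomial α 1) := by
  induction p using MvPolynomial.induction_on' with
  | monomial γ z =>
    have h1 : (MvPolynomial.monomial γ z : MvPolynomial (Fin n) ℂ) =
        z • MvPolynomial.monomial γ 1 := by
      rw [MvPolynomial.smul_monomial, smul_eq_mul, mul_one]
    rw [h1, map_smul, map_smul, taylorProj_apply hΦ, entireRep_polyHPhi]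
    have h2 : (fun x => MvPolynomial.eval x (MvPolynomial.monomial γ (1 : ℂ))) = mono γ :=
      funext (eval_monomial_eq_mono γ)
    rw [h2, multiDeriv_mono, monoHPhi_eq, MvPolynomial.coeff_smul, MvPolynomial.coeff_monomial]
    have h3 : (∏ j, ((α j).factorial : ℂ)) ≠ 0 :=
      Finset.prod_ne_zero_iff.2 fun j _ => by exact_mod_cast (α j).factorial_ne_zero
    by_cases h : α = γ
    · subst h
      rw [if_pos rfl, if_pos rfl, inv_mul_cancel₀ h3, one_smul, smul_eq_mul, mul_one]
    · rw [if_neg (fun h' => h (DFunLike.coe_injective h')), if_neg (Ne.symm h)]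
      simp
  | add p q hp hq => rw [map_add, map_add, hp, hq, MvPolynomial.coeff_add, add_smul]

/-! #### The weight relation -/

theorem hasDerivAt_eval_line (p : MvPolynomial (Fin n) ℂ) (x : Fin n → ℂ) (j : Fin n) (c : ℂ) :
    HasDerivAt (fun t : ℝ => MvPolynomial.eval (x + t • (c • e j)) p)
      (c * MvPolynomial.eval x (MvPolynomial.pderiv j p)) 0 := by
  induction p using MvPolynomial.induction_on with
  | C a => simpa using hasDerivAt_const (0 : ℝ) a
  | add p q hp hq => simpa [mul_add, Pi.add_def] using hp.add hq
  | mul_X p k hp =>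
    have h1 : HasDerivAt (fun t : ℝ => x k + (t : ℂ) * (c * e j k)) (c * e j k) 0 := by
      simpa using ((Complex.ofRealCLM.hasDerivAt (x := (0 : ℝ))).mul_const (c * e j k)).const_add
        (x k)
    have h2 := hp.mul h1
    have h3 : (fun t : ℝ => MvPolynomial.eval (x + t • (c • e j)) (p * MvPolynomial.X k)) =
        (fun t : ℝ => MvPolynomial.eval (x + t • (c • e j)) p) *
          fun t : ℝ => x k + (t : ℂ) * (c * e j k) := by
      ext t
      simp
    rw [h3]
    refine h2.congr_deriv ?_
    rw [Derivation.leibniz, MvPolynomial.pderiv_X]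
    by_cases h : j = k
    · subst h
      simp [e]; ring
    · simp [e, Ne.symm h]; ring

theorem hasDerivAt_weight_line (x v : Fin n → ℂ) :
    HasDerivAt (fun t : ℝ => Φ (x + t • v)) (QuadraticMap.polar Φ x v) 0 := by
  have h1 : (fun t : ℝ => Φ (x + t • v)) =
      fun t => Φ x + t * t * Φ v + t * QuadraticMap.polar Φ x v := by
    ext t
    rw [QuadraticMap.map_add Φ, QuadraticMap.map_smul, QuadraticMap.polar_smul_right, smul_eq_mul,
      smul_eq_mul]
  rw [h1]
  have h2 := ((((hasDerivAt_id (0 : ℝ)).mul (hasDerivAt_id (0 : ℝ))).mul_const (Φ v)).const_add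
    (Φ x)).add ((hasDerivAt_id (0 : ℝ)).mul_const (QuadraticMap.polar Φ x v))
  refine h2.congr_deriv ?_
  simp

theorem gaussDecay_weighted (hΦ : Φ.PosDef) {f g : (Fin n → ℂ) → ℂ} (hf : ExpType f)
    (hg : ExpType g) : GaussDecay fun x => star (f x) * g x * (Real.exp (-2 * Φ x) : ℝ) := by
  obtain ⟨hfg, C, d, h⟩ := hf.mul hg
  have h1 := hf.1.continuous
  have h2 := hg.1.continuous
  refine (gaussDecay_exp_neg hΦ two_pos).mul (Continuous.aestronglyMeasurable (by fun_prop))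
    (C' := C) (d' := d) fun x => ?_
  have := h x
  rw [norm_mul] at this ⊢
  rwa [norm_star]

/-- The derivative of a function with integrable line derivative has vanishing integral. -/
theorem integral_lineDeriv_eq_zero {G G' : (Fin n → ℂ) → ℂ} {v : Fin n → ℂ} (hG : Integrable G)
    (hG' : Integrable G') (h : ∀ x, HasDerivAt (fun t : ℝ => G (x + t • v)) (G' x) 0) :
    ∫ x, G' x = 0 := by
  have := integral_bilinear_hasLineDerivAt_right_eq_neg_left_of_integrable
    (μ := (volume : Measure (Fin n → ℂ))) (v := v)
    (f := fun _ : Fin n → ℂ => (1 : ℂ)) (f' := fun _ => 0) (g := G) (g' := G')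
    (B := ContinuousLinearMap.mul ℝ ℂ) (by simp) (by simpa using hG') (by simpa using hG)
    (fun x _ => by
      rw [HasLineDerivAt]
      exact hasDerivAt_const _ _) (fun x _ => h x)
  simpa using this

/-- Integration by parts with `∂_{x_j}`: it annihilates the antiholomorphic factor `q̄` and takes
`e^{-2Φ}` to `-2 (∂_{x_j} Φ) e^{-2Φ}`. -/
theorem integral_star_mul_pderiv (hΦ : Φ.PosDef) (q p : MvPolynomial (Fin n) ℂ) (j : Fin n) :
    ∫ x, star (MvPolynomial.eval x q) * MvPolynomial.eval x (MvPolynomial.pderiv j p) *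
      (Real.exp (-2 * Φ x) : ℝ) =
    2 * ∫ x, gradX Φ x j * (star (MvPolynomial.eval x q) * MvPolynomial.eval x p *
      (Real.exp (-2 * Φ x) : ℝ)) := by
  have hint := fun q p : MvPolynomial (Fin n) ℂ =>
    gaussDecay_weighted hΦ (expType_eval q) (expType_eval p)
  set S : MvPolynomial (Fin n) ℂ → MvPolynomial (Fin n) ℂ → (Fin n → ℂ) → ℂ := fun q p x =>
    star (MvPolynomial.eval x q) * MvPolynomial.eval x p * (Real.exp (-2 * Φ x) : ℝ) with hS
  have hpol : ∀ v, Integrable fun x => ((QuadraticMap.polar Φ x v : ℝ) : ℂ) * S q p x := by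
    intro v
    obtain ⟨C, hC, h⟩ := exists_polar_le (Φ := Φ)
    have hc : Continuous fun x => ((QuadraticMap.polar Φ x v : ℝ) : ℂ) :=
      continuous_ofReal.comp ((continuous_polar Φ).comp (Continuous.prodMk_left v))
    refine ((hint q p).mul hc.aestronglyMeasurable (C' := C * ‖v‖) (d' := 1) fun x => ?_).integrable
    rw [norm_real, Real.norm_eq_abs]
    have h2 : ‖x‖ ≤ Real.exp (1 * ‖x‖) := by rw [one_mul]; linarith [Real.add_one_le_exp ‖x‖]
    calc _ ≤ C * ‖x‖ * ‖v‖ := h x v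
      _ = C * ‖v‖ * ‖x‖ := by ring
      _ ≤ _ := mul_le_mul_of_nonneg_left h2 (by positivity)
  -- The real directional derivatives along `e_j` (`c = 1`) and `i e_j` (`c = i`); subtracting `i`
  -- times the second from the first cancels the derivative of `q̄` and doubles that of `p`.
  have key : ∀ c : ℂ, ∫ x, (star c * S (MvPolynomial.pderiv j q) p x +
      c * S q (MvPolynomial.pderiv j p) x -
        2 * (((QuadraticMap.polar Φ x (c • e j) : ℝ) : ℂ) * S q p x)) = 0 := by
    intro c
    refine integral_lineDeriv_eq_zero (G := S q p) (v := c • e j) (hint q p).integrable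
      ((((hint _ p).integrable.const_mul _).add ((hint q _).integrable.const_mul _)).sub
        ((hpol _).const_mul 2)) fun x => ?_
    have h1 := (hasDerivAt_eval_line q x j c).star
    have h2 := hasDerivAt_eval_line p x j c
    have h3 := (((hasDerivAt_weight_line (Φ := Φ) x (c • e j)).const_mul (-2)).exp).ofReal_comp
    refine ((h1.mul h2).mul h3).congr_deriv ?_
    simp only [hS, Pi.mul_apply, zero_smul, add_zero, star_mul']
    push_cast
    ring
  have h1 := key 1
  have h2 := key I
  have hi1 := fun c : ℂ => ((((hint (MvPolynomial.pderiv j q) p).integrable.const_mul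
    (star c)).add ((hint q (MvPolynomial.pderiv j p)).integrable.const_mul c)).sub
        ((hpol (c • e j)).const_mul 2))
  have h3 : ∫ x, ((star (1 : ℂ) * S (MvPolynomial.pderiv j q) p x +
      1 * S q (MvPolynomial.pderiv j p) x -
        2 * (((QuadraticMap.polar Φ x ((1 : ℂ) • e j) : ℝ) : ℂ) * S q p x)) -
      I * (star I * S (MvPolynomial.pderiv j q) p x +
      I * S q (MvPolynomial.pderiv j p) x -
        2 * (((QuadraticMap.polar Φ x (I • e j) : ℝ) : ℂ) * S q p x))) = 0 := by
    have h4 := integral_sub (hi1 1) ((hi1 I).const_mul I)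
    rw [integral_const_mul] at h4
    simp only [Pi.add_apply, Pi.sub_apply] at h4
    rw [h1, h2, mul_zero, sub_zero] at h4
    exact h4
  have hie : I • (e j : Fin n → ℂ) = ie j := by
    ext k; simp [e, ie, Pi.single_apply]
  have h5 : ∀ x, ((star (1 : ℂ) * S (MvPolynomial.pderiv j q) p x +
      1 * S q (MvPolynomial.pderiv j p) x -
        2 * (((QuadraticMap.polar Φ x ((1 : ℂ) • e j) : ℝ) : ℂ) * S q p x)) -
      I * (star I * S (MvPolynomial.pderiv j q) p x +
      I * S q (MvPolynomial.pderiv j p) x -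
        2 * (((QuadraticMap.polar Φ x (I • e j) : ℝ) : ℂ) * S q p x))) =
      2 * S q (MvPolynomial.pderiv j p) x - 4 * (gradX Φ x j * S q p x) := by
    intro x
    rw [one_smul, hie, gradX, bil_eq, bil_eq, Complex.star_def, Complex.conj_I, map_one]
    linear_combination (S (MvPolynomial.pderiv j q) p x - S q (MvPolynomial.pderiv j p) x) * I_mul_I
  simp_rw [h5] at h3
  have hgrad : Integrable fun x => gradX Φ x j * S q p x := by
    have : (fun x => gradX Φ x j * S q p x) = fun x =>
        (1 / 2) * (((QuadraticMap.polar Φ x (e j) : ℝ) : ℂ) * S q p x) -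
          (I / 2) * (((QuadraticMap.polar Φ x (ie j) : ℝ) : ℂ) * S q p x) := by
      ext x
      rw [gradX, bil_eq, bil_eq]; ring
    rw [this]
    exact ((hpol _).const_mul _).sub ((hpol _).const_mul _)
  rw [integral_sub ((hint q _).integrable.const_mul 2) (hgrad.const_mul 4), integral_const_mul,
    integral_const_mul] at h3
  linear_combination (1 / 2) * h3

/-- The gradient splits into a part linear in `x` and a part linear in `x̄`; a factor `x̄_k` moves
into the conjugated left argument. -/
theorem weightRelation_polyHPhi (hΦ : Φ.PosDef) :
    WeightRelation (hessXX Φ) (hessBarX Φ)ᵀ (polyHPhi hΦ) := by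
  intro q p j
  have hint := fun q p : MvPolynomial (Fin n) ℂ =>
    (gaussDecay_weighted hΦ (expType_eval q) (expType_eval p)).integrable
  simp only [inner_HPhi _ _ (coeFn_polyHPhi hΦ _) (coeFn_polyHPhi hΦ _)]
  rw [integral_star_mul_pderiv hΦ, ← mul_add]
  congr 1
  simp only [← integral_const_mul]
  rw [← integral_finsetSum _ fun k _ => (hint q _).const_mul _,
    ← integral_finsetSum _ fun k _ => (hint _ p).const_mul _,
    ← integral_add (integrable_finsetSum _ fun k _ => (hint q _).const_mul _)
      (integrable_finsetSum _ fun k _ => (hint _ p).const_mul _)]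
  refine integral_congr_ae (Filter.Eventually.of_forall fun x => ?_)
  simp only [gradX_eq, Pi.add_apply, Matrix.mulVec, dotProduct, add_mul, Finset.sum_mul,
    map_mul, MvPolynomial.eval_X, star_mul', Pi.star_apply]
  congr 1
  · exact Finset.sum_congr rfl fun k _ => by ring
  · exact Finset.sum_congr rfl fun k _ => by ring

theorem gradX_injective (hΦ : Φ.PosDef) {x : Fin n → ℂ} (h : gradX Φ x = 0) : x = 0 := by
  by_contra h0
  have h1 := polar_eq_gradX Φ x x
  rw [h, dotProduct_zero, QuadraticMap.polar_self, two_nsmul] at h1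
  have := hΦ x h0
  simp at h1
  linarith

/-- Complexified injectivity of the real linear map `∂_x Φ`, with `w` in the place of the conjugate
of `v`: both `v + w̄` and `i (v - w̄)` are in its kernel. -/
theorem hessian_injective (hΦ : Φ.PosDef) (v w : Fin n → ℂ)
    (h1 : hessXX Φ *ᵥ v + (hessBarX Φ)ᵀ *ᵥ w = 0)
    (h2 : (hessXX Φ).map star *ᵥ w + ((hessBarX Φ)ᵀ).map star *ᵥ v = 0) : v = 0 ∧ w = 0 := by
  have hst : ∀ (A : Matrix (Fin n) (Fin n) ℂ) (x : Fin n → ℂ), star (A.map star *ᵥ x) =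
      A *ᵥ star x := by
    intro A x
    ext i
    simp [Matrix.mulVec, dotProduct]
  have h3 := congrArg star h2
  rw [star_add, hst, hst, star_zero] at h3
  have e1 : v + star w = 0 := by
    refine gradX_injective hΦ ?_
    rw [gradX_eq, star_add, star_star, Matrix.mulVec_add, Matrix.mulVec_add]
    linear_combination (exp := 1) h1 + h3
  have e2 : I • (v - star w) = 0 := by
    refine gradX_injective hΦ ?_
    rw [gradX_eq, star_smul, star_sub, star_star, Matrix.mulVec_smul, Matrix.mulVec_smul,
      Matrix.mulVec_sub, Matrix.mulVec_sub, Complex.star_def, Complex.conj_I]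
    have : I • (hessXX Φ *ᵥ v - hessXX Φ *ᵥ star w) +
        -I • ((hessBarX Φ)ᵀ *ᵥ star v - (hessBarX Φ)ᵀ *ᵥ w) =
        I • ((hessXX Φ *ᵥ v + (hessBarX Φ)ᵀ *ᵥ w) -
          (hessXX Φ *ᵥ star w + (hessBarX Φ)ᵀ *ᵥ star v)) := by module
    rw [this, h1, h3, sub_zero, smul_zero]
  have e3 := (smul_eq_zero.1 e2).resolve_left I_ne_zero
  have e4 : v = 0 := by
    have h : (2 : ℂ) • v = 0 := by
      have : (2 : ℂ) • v = (v + star w) + (v - star w) := by module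
      rw [this, e1, e3, add_zero]
    exact (smul_eq_zero.1 h).resolve_left two_ne_zero
  refine ⟨e4, ?_⟩
  rw [e4, zero_add] at e1
  exact star_eq_zero.1 e1

theorem hessBarX_transpose_injective (hΦ : Φ.PosDef) (w : Fin n → ℂ)
    (h : (hessBarX Φ)ᵀ *ᵥ w = 0) : w = 0 := by
  have h1 : star ((hessBarX Φ)ᵀ *ᵥ w) = hessBarX Φ *ᵥ star w := by
    have h2 := hessBarX_conjTranspose Φ
    ext i
    simp only [Pi.star_apply, Matrix.mulVec, dotProduct, star_sum, star_mul',
      Matrix.transpose_apply]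
    refine Finset.sum_congr rfl fun k _ => ?_
    rw [← congrFun (congrFun h2 i) k, Matrix.conjTranspose_apply]
  rw [h, star_zero] at h1
  exact star_eq_zero.1 (hessBarX_injective hΦ h1.symm)

/-! #### Completeness and density -/

/-- The inversion formula assigns an entire function to every element of the weighted `L²` space,
continuously at each point. Applied to a limit of entire functions it gives their pointwise limit,
which agrees almost everywhere with the `L²` limit along a subsequence. -/
theorem isClosed_HPhi (hΦ : Φ.PosDef) : IsClosed (HPhi Φ : Set (Lp ℂ 2 (weightMeasure Φ))) := by
  refine IsSeqClosed.isClosed fun u k hu hk => ?_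
  have hc : (inversionConst Φ hΦ : ℂ) ≠ 0 := ofReal_ne_zero.2 (inversionConst_pos hΦ).ne'
  have hkL : MemLp k 2 (weightMeasure Φ) := Lp.memLp k
  set F : (Fin n → ℂ) → ℂ := fun y =>
    (inversionConst Φ hΦ : ℂ)⁻¹ * gaussTransform halfConj (pairingDensity hΦ k) y with hF
  have hFd : Differentiable ℂ F := (differentiable_const _).mul
    (differentiable_gaussTransform continuous_halfConj norm_halfConj_le
      (gaussDecay_pairingDensity hΦ hkL))
  choose f hfd hfu using hu
  refine ⟨F, hFd, ?_⟩
  have hbexp : ∀ y : Fin n → ℂ, GaussDecay fun w => exp (∑ j, y j * halfConj j w) *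
      ((Real.exp (-1 * dualForm hΦ w) : ℝ) : ℂ) := fun y => by
    have := fun j => continuous_halfConj (n := n) j
    refine (gaussDecay_exp_neg (dualForm_posDef hΦ) one_pos).mul
      (Continuous.aestronglyMeasurable (by fun_prop))
      (C' := 1) (d' := Fintype.card (Fin n) * 1 * ‖y‖) fun w => ?_
    rw [one_mul]
    exact (norm_exp_le_exp_norm' _).trans
      (Real.exp_le_exp.2 (norm_sum_mul_le norm_halfConj_le y w))
  have hlim : ∀ y, Filter.Tendsto (fun m => f m y) Filter.atTop (nhds (F y)) := by
    intro y
    have hfm : ∀ m, MemLp (f m) 2 (weightMeasure Φ) := fun m =>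
      (memLp_congr_ae (hfu m)).1 (Lp.memLp _)
    rw [tendsto_iff_norm_sub_tendsto_zero]
    set B : ℝ := ‖(inversionConst Φ hΦ : ℂ)⁻¹‖ * (Real.sqrt (gaussMass Φ) *
      ∫ w, ‖exp (∑ j, y j * halfConj j w) * ((Real.exp (-1 * dualForm hΦ w) : ℝ) : ℂ)‖) with hB
    have hle : ∀ m, ‖f m y - F y‖ ≤ B * ‖u m - k‖ := by
      intro m
      have h1 : f m y - F y = (inversionConst Φ hΦ : ℂ)⁻¹ *
          gaussTransform halfConj (pairingDensity hΦ (f m - k)) y := by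
        have hint := fun v (hv : MemLp v 2 (weightMeasure Φ)) =>
          ((gaussDecay_pairingDensity hΦ hv).mul (p := fun w => exp (∑ j, y j * halfConj j w))
            (Continuous.aestronglyMeasurable (by
              have := fun j => continuous_halfConj (n := n) j
              fun_prop)) (C' := 1) (d' := Fintype.card (Fin n) * 1 * ‖y‖) fun w => by
              rw [one_mul]
              exact (norm_exp_le_exp_norm' _).trans
                (Real.exp_le_exp.2 (norm_sum_mul_le norm_halfConj_le y w))).integrable
        have h2 : f m y = (inversionConst Φ hΦ : ℂ)⁻¹ *
            gaussTransform halfConj (pairingDensity hΦ (f m)) y := by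
          rw [inversion hΦ (hfd m) (hfm m), inv_mul_cancel_left₀ hc]
        rw [h2, hF]
        simp only
        rw [← mul_sub, gaussTransform, gaussTransform, gaussTransform,
          ← integral_sub (hint _ (hfm m)) (hint _ hkL)]
        congr 1
        refine integral_congr_ae (Filter.Eventually.of_forall fun w => ?_)
        simp only [pairingDensity]
        have h3 : f m - (k : (Fin n → ℂ) → ℂ) = f m + (-1 : ℂ) • (k : (Fin n → ℂ) → ℂ) := by
          rw [neg_one_smul, sub_eq_add_neg]
        rw [h3, expPairing_add hΦ (hfm m) (hkL.const_smul _), expPairing_smul]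
        ring
      have h4 : wnorm Φ (f m - k) = ‖u m - k‖ :=
        (norm_lp_eq_wnorm Φ _ ((Lp.coeFn_sub _ _).trans ((hfu m).sub (ae_eq_refl _)))).symm
      rw [h1, norm_mul, hB, mul_assoc]
      refine mul_le_mul_of_nonneg_left ?_ (norm_nonneg _)
      rw [← h4, mul_right_comm, ← integral_const_mul]
      refine norm_integral_le_of_norm_le ((hbexp y).integrable.norm.const_mul _)
        (Filter.Eventually.of_forall fun w => ?_)
      rw [norm_mul, norm_mul, norm_real, Real.norm_eq_abs, Real.abs_exp]
      have h5 := norm_pairingDensity_le hΦ ((hfm m).sub hkL) w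
      refine (mul_le_mul_of_nonneg_left h5 (norm_nonneg _)).trans (le_of_eq (by ring))
    have h6 : Filter.Tendsto (fun m => B * ‖u m - k‖) Filter.atTop (nhds 0) := by
      have := (tendsto_iff_norm_sub_tendsto_zero.1 hk).const_mul B
      rwa [mul_zero] at this
    exact squeeze_zero (fun _ => norm_nonneg _) hle h6
  obtain ⟨ns, hns, hae⟩ := (tendstoInMeasure_of_tendsto_Lp hk).exists_seq_tendsto_ae
  have hall : ∀ᵐ x ∂(weightMeasure Φ), ∀ m, u m x = f m x := ae_all_iff.2 hfu
  filter_upwards [hae, hall] with x h1 h2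
  simp only [h2] at h1
  exact tendsto_nhds_unique h1 ((hlim x).comp hns.tendsto_atTop)

/-- Orthogonality to polynomials passes to exponentials by integrating the power series termwise;
the weight dominates `e^{K ‖x‖}`, which justifies the interchange. -/
theorem expPairing_eq_zero (hΦ : Φ.PosDef) {f : (Fin n → ℂ) → ℂ}
    (hf : MemLp f 2 (weightMeasure Φ))
    (h : ∀ p : MvPolynomial (Fin n) ℂ,
      ∫ x, star (MvPolynomial.eval x p) * f x * (Real.exp (-2 * Φ x) : ℝ) = 0) (w : Fin n → ℂ) :
    expPairing Φ f w = 0 := by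
  set P : MvPolynomial (Fin n) ℂ := ∑ j, MvPolynomial.C ((1 / 2) * star (w j)) * MvPolynomial.X j
    with hP
  have hPe : ∀ x, star (MvPolynomial.eval x P) = (1 / 2) * (star x ⬝ᵥ w) := by
    intro x
    rw [hP, map_sum, star_sum, dotProduct, Finset.mul_sum]
    refine Finset.sum_congr rfl fun j _ => ?_
    simp
    ring
  have hm := (memLp_weight Φ).1 hf
  have hcont := continuous_weight Φ
  set K : ℝ := n * ‖w‖ with hK
  have hsum := hasSum_integral_of_dominated_convergence
    (μ := (volume : Measure (Fin n → ℂ)))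
    (F := fun (k : ℕ) x => ((1 / 2) * (star x ⬝ᵥ w)) ^ k / (k.factorial : ℂ) *
      (f x * (Real.exp (-2 * Φ x) : ℝ)))
    (f := fun x => f x * exp ((1 / 2) * (star x ⬝ᵥ w)) * (Real.exp (-2 * Φ x) : ℝ))
    (bound := fun k x => (K * ‖x‖) ^ k / (k.factorial : ℝ) * ‖f x * (Real.exp (-2 * Φ x) : ℝ)‖)
    (fun k => ?_) (fun k => Filter.Eventually.of_forall fun x => ?_)
    (Filter.Eventually.of_forall fun x => ?_) ?_ (Filter.Eventually.of_forall fun x => ?_)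
  · have hz : ∀ k : ℕ, ∫ x, ((1 / 2) * (star x ⬝ᵥ w)) ^ k / (k.factorial : ℂ) *
        (f x * (Real.exp (-2 * Φ x) : ℝ)) = 0 := by
      intro k
      have h1 := h (P ^ k)
      simp only [map_pow, star_pow, hPe] at h1
      have h2 : ∀ x : Fin n → ℂ, ((1 / 2) * (star x ⬝ᵥ w)) ^ k / (k.factorial : ℂ) *
          (f x * (Real.exp (-2 * Φ x) : ℝ)) = (k.factorial : ℂ)⁻¹ *
            (((1 / 2) * (star x ⬝ᵥ w)) ^ k * f x * (Real.exp (-2 * Φ x) : ℝ)) := fun x => by ring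
      simp_rw [h2]
      rw [integral_const_mul, h1, mul_zero]
    simp only [hz] at hsum
    exact hsum.unique hasSum_zero
  · refine AEStronglyMeasurable.mul (Continuous.aestronglyMeasurable (by fun_prop))
      (hm.1.mul (Continuous.aestronglyMeasurable (by fun_prop)))
  · rw [norm_mul, norm_div, norm_pow, norm_natCast]
    gcongr
    exact norm_half_dot_le x w
  · exact (Real.summable_pow_div_factorial (K * ‖x‖)).mul_right _
  · simp_rw [tsum_mul_right]
    have h1 : ∀ x : Fin n → ℂ, ∑' k : ℕ, (K * ‖x‖) ^ k / (k.factorial : ℝ) =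
        Real.exp (K * ‖x‖) := fun x => by
      rw [Real.exp_eq_exp_ℝ, NormedSpace.exp_eq_tsum_div]
    simp_rw [h1]
    have h2 : MemLp (fun x : Fin n → ℂ => ((Real.exp (K * ‖x‖) : ℝ) : ℂ)) 2 (weightMeasure Φ) :=
      memLp_weight_of_bound hΦ (by fun_prop) (C := 1) (d := K) fun x => by
        rw [norm_real, Real.norm_eq_abs, Real.abs_exp, one_mul]
    have h3 := ((memLp_weight Φ).1 h2).2.norm.integrable_mul hm.2.norm
    refine h3.congr (Filter.Eventually.of_forall fun x => ?_)
    simp only [Pi.mul_apply, norm_wt, norm_mul, norm_real, Real.norm_eq_abs, Real.abs_exp]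
    rw [show -2 * Φ x = -Φ x + -Φ x by ring, Real.exp_add]
    ring
  · have h1 := NormedSpace.expSeries_div_hasSum_exp ((1 / 2) * (star x ⬝ᵥ w) : ℂ)
    rw [← Complex.exp_eq_exp_ℂ] at h1
    have h2 := h1.mul_right (f x * (Real.exp (-2 * Φ x) : ℝ))
    rwa [mul_left_comm, ← mul_assoc] at h2

/-- A vector orthogonal to all polynomials has vanishing pairings with exponentials, hence is zero
by inversion. Completeness of `H_Φ` makes this criterion imply density. -/
theorem denseRange_polyHPhi (hΦ : Φ.PosDef) : DenseRange (polyHPhi hΦ) := by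
  have : CompleteSpace (HPhi Φ) := (isClosed_HPhi hΦ).completeSpace_coe
  have h1 : (LinearMap.range (polyHPhi hΦ)).topologicalClosure = ⊤ := by
    rw [Submodule.topologicalClosure_eq_top_iff, Submodule.eq_bot_iff]
    intro u hu
    have h2 : ∀ p : MvPolynomial (Fin n) ℂ, ∫ x, star (MvPolynomial.eval x p) * entireRep u x *
        (Real.exp (-2 * Φ x) : ℝ) = 0 := by
      intro p
      rw [← inner_HPhi _ _ (coeFn_polyHPhi hΦ p) (coeFn_entireRep u)]
      exact (Submodule.mem_orthogonal _ _).1 hu _ ⟨p, rfl⟩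
    have h3 : entireRep u = 0 := by
      ext y
      have h4 := inversion hΦ (differentiable_entireRep u) (memLp_entireRep u) y
      have h5 : pairingDensity hΦ (entireRep u) = 0 := by
        ext w
        rw [pairingDensity, expPairing_eq_zero hΦ (memLp_entireRep u) h2, zero_mul]
        rfl
      rw [h5] at h4
      simp only [gaussTransform, Pi.zero_apply, mul_zero, integral_zero] at h4
      exact (mul_eq_zero.1 h4.symm).resolve_left (ofReal_ne_zero.2 (inversionConst_pos hΦ).ne')
    have h6 := norm_eq_wnorm_entireRep u
    rw [h3, wnorm] at h6
    simpa using h6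
  have h7 := Submodule.dense_iff_topologicalClosure_eq_top.2 h1
  exact h7

end PolyHPhi

end QuadGrowth
end

noncomputable section
namespace QuadGrowth

/-! ### Position and momentum operators on the Schwartz space -/

section PhaseOperators

open MeasureTheory

variable {n : ℕ}

theorem momOp_apply (j : Fin n) (φ : 𝓢(EuclideanSpace ℝ (Fin n), ℂ))
    (x : EuclideanSpace ℝ (Fin n)) :
    momOp j φ x = (1 / Complex.I) * fderiv ℝ φ x (EuclideanSpace.single j 1) := by
  rw [momOp, _root_.smul_apply, _root_.smul_apply, LineDeriv.lineDerivOpCLM_apply,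
    SchwartzMap.lineDerivOp_apply_eq_fderiv, smul_eq_mul]

theorem posOp_comm (j k : Fin n) (φ : 𝓢(EuclideanSpace ℝ (Fin n), ℂ)) :
    posOp j (posOp k φ) = posOp k (posOp j φ) := by
  ext x
  simp only [posOp_apply]
  ring

theorem momOp_comm (j k : Fin n) (φ : 𝓢(EuclideanSpace ℝ (Fin n), ℂ)) :
    momOp j (momOp k φ) = momOp k (momOp j φ) := by
  have hsymm : ∀ x (v w : EuclideanSpace ℝ (Fin n)),
      fderiv ℝ (fderiv ℝ φ) x v w = fderiv ℝ (fderiv ℝ φ) x w v := fun x v w =>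
    ((φ.smooth 2).contDiffAt.isSymmSndFDerivAt (by simp)) v w
  have hd : Differentiable ℝ (fderiv ℝ φ) :=
    ((φ.smooth 2).fderiv_right (m := 1) (by norm_num)).differentiable (by norm_num)
  have key : ∀ (j k : Fin n) x, momOp j (momOp k φ) x = (1 / Complex.I) * ((1 / Complex.I) *
      fderiv ℝ (fderiv ℝ φ) x (EuclideanSpace.single j 1) (EuclideanSpace.single k 1)) := by
    intro j k x
    have h1 : ((momOp k φ : 𝓢(EuclideanSpace ℝ (Fin n), ℂ)) : EuclideanSpace ℝ (Fin n) → ℂ) =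
        fun x => (1 / Complex.I) * fderiv ℝ φ x (EuclideanSpace.single k 1) :=
      funext fun x => momOp_apply k φ x
    rw [momOp_apply, h1, fderiv_const_mul ((hd x).clm_apply (differentiableAt_const _)),
      fderiv_clm_apply (hd x) (differentiableAt_const _)]
    simp
  ext x
  rw [key, key, hsymm]

theorem momOp_posOp (j k : Fin n) (φ : 𝓢(EuclideanSpace ℝ (Fin n), ℂ)) :
    momOp j (posOp k φ) = posOp k (momOp j φ) + if j = k then (1 / Complex.I) • φ else 0 := by
  have hl : ∀ x, HasFDerivAt (fun x : EuclideanSpace ℝ (Fin n) => (x k : ℂ))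
      (Complex.ofRealCLM ∘L (EuclideanSpace.proj k : EuclideanSpace ℝ (Fin n) →L[ℝ] ℝ)) x :=
    fun x => (Complex.ofRealCLM ∘L
      (EuclideanSpace.proj k : EuclideanSpace ℝ (Fin n) →L[ℝ] ℝ)).hasFDerivAt
  ext x
  have h1 : ((posOp k φ : 𝓢(EuclideanSpace ℝ (Fin n), ℂ)) : EuclideanSpace ℝ (Fin n) → ℂ) =
      fun x => (x k : ℂ) * φ x := funext fun x => posOp_apply k φ x
  have h2 : HasFDerivAt (fun x : EuclideanSpace ℝ (Fin n) => (x k : ℂ) * φ x) _ x :=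
    (hl x).mul (φ.differentiableAt (x := x)).hasFDerivAt
  have h3 : ∀ f g : 𝓢(EuclideanSpace ℝ (Fin n), ℂ), (f + g) x = f x + g x := fun f g => rfl
  rw [momOp_apply, h1, h2.fderiv, h3, posOp_apply, momOp_apply]
  by_cases hjk : j = k
  · subst hjk
    simp
    ring
  · simp [hjk, Ne.symm hjk]
    ring

/-- The phase space operators as endomorphisms of the Schwartz space. -/
def phaseEnd (a : Fin n ⊕ Fin n) : Module.End ℂ 𝓢(EuclideanSpace ℝ (Fin n), ℂ) :=
  (phaseOp a).toLinearMap

theorem phaseEnd_apply (a : Fin n ⊕ Fin n) (φ : 𝓢(EuclideanSpace ℝ (Fin n), ℂ)) :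
    phaseEnd a φ = phaseOp a φ := rfl

/-- The canonical commutation relations. -/
theorem phaseEnd_mul (a b : Fin n ⊕ Fin n) : phaseEnd a * phaseEnd b =
    phaseEnd b * phaseEnd a + ((1 / Complex.I) * Matrix.J (Fin n) ℂ a b) • 1 := by
  refine LinearMap.ext fun φ => ?_
  rw [LinearMap.add_apply, LinearMap.smul_apply, Module.End.mul_apply, Module.End.mul_apply,
    Module.End.one_apply]
  simp only [phaseEnd_apply, Matrix.J]
  rcases a with j | j <;> rcases b with k | k <;>
    simp only [phaseOp, Sum.elim_inl, Sum.elim_inr, Matrix.fromBlocks_apply₁₁,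
      Matrix.fromBlocks_apply₁₂, Matrix.fromBlocks_apply₂₁, Matrix.fromBlocks_apply₂₂,
      Matrix.zero_apply, mul_zero, zero_smul, add_zero, Matrix.neg_apply, Matrix.one_apply]
  · exact posOp_comm j k φ
  · rw [momOp_posOp]
    by_cases h : j = k
    · subst h; simp
    · simp [h, Ne.symm h]
  · rw [momOp_posOp]
    by_cases h : j = k
    · subst h; simp
    · simp [h]
  · exact momOp_comm j k φ

/-- The quantization of the linear forms `X ↦ (K X)_a`. -/
def canonEnd (K : Matrix (Fin n ⊕ Fin n) (Fin n ⊕ Fin n) ℂ) (a : Fin n ⊕ Fin n) :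
    Module.End ℂ 𝓢(EuclideanSpace ℝ (Fin n), ℂ) := ∑ b, K a b • phaseEnd b

theorem canonEnd_apply (K : Matrix (Fin n ⊕ Fin n) (Fin n ⊕ Fin n) ℂ) (a : Fin n ⊕ Fin n)
    (φ : 𝓢(EuclideanSpace ℝ (Fin n), ℂ)) : canonEnd K a φ = ∑ b, K a b • phaseOp b φ := by
  simp [canonEnd, LinearMap.sum_apply, phaseEnd_apply]

/-- A symplectic change of variables preserves the commutation relations because `K J Kᵗ = J`. -/
theorem canonEnd_mul {K : Matrix (Fin n ⊕ Fin n) (Fin n ⊕ Fin n) ℂ}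
    (hK : K ∈ Matrix.symplecticGroup (Fin n) ℂ) (a b : Fin n ⊕ Fin n) :
    canonEnd K a * canonEnd K b =
      canonEnd K b * canonEnd K a + ((1 / Complex.I) * Matrix.J (Fin n) ℂ a b) • 1 := by
  have hJ : ∑ c, ∑ d, K a c * K b d * Matrix.J (Fin n) ℂ c d = Matrix.J (Fin n) ℂ a b := by
    conv_rhs => rw [← SymplecticGroup.mem_iff.1 hK]
    simp only [Matrix.mul_apply, Matrix.transpose_apply, Finset.sum_mul]
    rw [Finset.sum_comm]
    exact Finset.sum_congr rfl fun _ _ => Finset.sum_congr rfl fun _ _ => by ring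
  have h1 : ∀ a b : Fin n ⊕ Fin n, canonEnd K a * canonEnd K b =
      ∑ c, ∑ d, (K a c * K b d) • (phaseEnd c * phaseEnd d) := fun a b => by
    simp only [canonEnd, Finset.sum_mul, Finset.mul_sum, smul_mul_smul_comm]
    exact Finset.sum_comm
  rw [h1, h1, ← hJ, Finset.sum_comm (f := fun c d => (K b c * K a d) • (phaseEnd c * phaseEnd d)),
    Finset.mul_sum, Finset.sum_smul, ← Finset.sum_add_distrib]
  refine Finset.sum_congr rfl fun c _ => ?_
  rw [Finset.mul_sum, Finset.sum_smul, ← Finset.sum_add_distrib]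
  refine Finset.sum_congr rfl fun d _ => ?_
  rw [phaseEnd_mul c d, smul_add, smul_smul, mul_comm (K b d)]
  congr 2
  ring

theorem canonEnd_inl_comm {K : Matrix (Fin n ⊕ Fin n) (Fin n ⊕ Fin n) ℂ}
    (hK : K ∈ Matrix.symplecticGroup (Fin n) ℂ) (j k : Fin n) :
    canonEnd K (Sum.inl j) * canonEnd K (Sum.inl k) =
      canonEnd K (Sum.inl k) * canonEnd K (Sum.inl j) := by
  rw [canonEnd_mul hK]
  simp [Matrix.J]

theorem canonEnd_inr_inl {K : Matrix (Fin n ⊕ Fin n) (Fin n ⊕ Fin n) ℂ}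
    (hK : K ∈ Matrix.symplecticGroup (Fin n) ℂ) (j k : Fin n) :
    canonEnd K (Sum.inr j) * canonEnd K (Sum.inl k) =
      canonEnd K (Sum.inl k) * canonEnd K (Sum.inr j) +
        if j = k then (1 / Complex.I) • 1 else 0 := by
  rw [canonEnd_mul hK]
  by_cases h : j = k
  · subst h; simp [Matrix.J]
  · simp [Matrix.J, h]

theorem weylSchwartz_toLinearMap (Q : Matrix (Fin n ⊕ Fin n) (Fin n ⊕ Fin n) ℂ)
    (φ : 𝓢(EuclideanSpace ℝ (Fin n), ℂ)) : weylSchwartz Q φ =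
      (∑ a, ∑ b, (Q a b / 2) • (phaseEnd a * phaseEnd b + phaseEnd b * phaseEnd a)) φ := by
  simp only [weylSchwartz, LinearMap.sum_apply, LinearMap.smul_apply, LinearMap.add_apply,
    Module.End.mul_apply, phaseEnd_apply, _root_.sum_apply, _root_.smul_apply, _root_.add_apply,
    ContinuousLinearMap.comp_apply]

/-- Covariance of the Weyl quantization under linear changes of the phase space variables. -/
theorem weylSchwartz_conj (K N : Matrix (Fin n ⊕ Fin n) (Fin n ⊕ Fin n) ℂ)
    (φ : 𝓢(EuclideanSpace ℝ (Fin n), ℂ)) : weylSchwartz (Kᵀ * N * K) φ =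
      (∑ c, ∑ d, (N c d / 2) • (canonEnd K c * canonEnd K d + canonEnd K d * canonEnd K c)) φ := by
  rw [weylSchwartz_toLinearMap]
  congr 1
  have h1 : ∀ c d : Fin n ⊕ Fin n, canonEnd K c * canonEnd K d =
      ∑ a, ∑ b, (K c a * K d b) • (phaseEnd a * phaseEnd b) := fun a b => by
    simp only [canonEnd, Finset.sum_mul, Finset.mul_sum, smul_mul_smul_comm]
    exact Finset.sum_comm
  have h2 : ∀ c d : Fin n ⊕ Fin n, canonEnd K c * canonEnd K d + canonEnd K d * canonEnd K c =
      ∑ a, ∑ b, (K c a * K d b) • (phaseEnd a * phaseEnd b + phaseEnd b * phaseEnd a) := by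
    intro c d
    rw [h1 c d, h1 d c, Finset.sum_comm (f := fun a b => (K d a * K c b) • _),
      ← Finset.sum_add_distrib]
    refine Finset.sum_congr rfl fun a _ => ?_
    rw [← Finset.sum_add_distrib]
    exact Finset.sum_congr rfl fun b _ => by rw [smul_add, mul_comm (K d b)]
  simp only [h2, Finset.smul_sum, smul_smul]
  have h3 : ∀ a b, (Kᵀ * N * K) a b / 2 = ∑ c, ∑ d, N c d / 2 * (K c a * K d b) := by
    intro a b
    rw [Finset.sum_comm]
    simp only [Matrix.mul_apply, Matrix.transpose_apply, Finset.sum_mul, Finset.sum_div]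
    exact Finset.sum_congr rfl fun _ _ => Finset.sum_congr rfl fun _ _ => by ring
  simp only [h3, Finset.sum_smul]
  have h4 : ∀ (F : Fin n ⊕ Fin n → Fin n ⊕ Fin n → Fin n ⊕ Fin n → Fin n ⊕ Fin n →
      Module.End ℂ 𝓢(EuclideanSpace ℝ (Fin n), ℂ)),
      ∑ a, ∑ b, ∑ c, ∑ d, F a b c d = ∑ c, ∑ d, ∑ a, ∑ b, F a b c d := by
    intro F
    calc _ = ∑ a, ∑ c, ∑ b, ∑ d, F a b c d :=
          Finset.sum_congr rfl fun a _ => Finset.sum_comm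
      _ = ∑ c, ∑ a, ∑ b, ∑ d, F a b c d := Finset.sum_comm
      _ = ∑ c, ∑ a, ∑ d, ∑ b, F a b c d := Finset.sum_congr rfl fun c _ =>
          Finset.sum_congr rfl fun a _ => Finset.sum_comm
      _ = _ := Finset.sum_congr rfl fun c _ => Finset.sum_comm
  exact h4 _

/-- In the variables of a normal form, `q^w` is `∑ M_jk x_k ξ_j + (1/i) ∑ λ_j`. -/
theorem weylSchwartz_pairMatrix {K : Matrix (Fin n ⊕ Fin n) (Fin n ⊕ Fin n) ℂ}
    (hK : K ∈ Matrix.symplecticGroup (Fin n) ℂ) {M : Matrix (Fin n) (Fin n) ℂ} {lam : Fin n → ℂ}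
    (hdiag : ∀ j, M j j = 2 * lam j) (φ : 𝓢(EuclideanSpace ℝ (Fin n), ℂ)) :
    weylSchwartz (Kᵀ * pairMatrix M * K) φ =
      (∑ j, ∑ k, M j k • canonEnd K (Sum.inl k) (canonEnd K (Sum.inr j) φ)) +
        ((1 / Complex.I) * ∑ j, lam j) • φ := by
  -- Normal ordering of the symmetrized product costs a commutator `1 / i` on the diagonal; weighted
  -- by `M_jj / 2 = λ_j` these give the constant term.
  have h1 : ∀ c d : Fin n, canonEnd K (Sum.inl c) * canonEnd K (Sum.inr d) +
      canonEnd K (Sum.inr d) * canonEnd K (Sum.inl c) =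
      (2 : ℂ) • (canonEnd K (Sum.inl c) * canonEnd K (Sum.inr d)) +
        if d = c then (1 / Complex.I) • 1 else 0 := by
    intro c d
    rw [canonEnd_inr_inl hK, ← add_assoc, ← two_smul ℂ]
  have h2 : ∀ F : Fin n ⊕ Fin n → Fin n ⊕ Fin n → Module.End ℂ 𝓢(EuclideanSpace ℝ (Fin n), ℂ),
      (∀ c d, F c d = F d c) →
      ∑ c, ∑ d, (pairMatrix M c d / 2) • F c d =
        ∑ j, ∑ k, (M j k / 2) • F (Sum.inl k) (Sum.inr j) := by
    intro F hF
    simp only [Fintype.sum_sum_type, pairMatrix, Matrix.smul_apply, Matrix.fromBlocks_apply₁₁,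
      Matrix.fromBlocks_apply₁₂, Matrix.fromBlocks_apply₂₁, Matrix.fromBlocks_apply₂₂,
      Matrix.zero_apply, smul_zero, zero_div, zero_smul, Finset.sum_const_zero, zero_add, add_zero,
      Matrix.transpose_apply]
    rw [Finset.sum_comm, ← Finset.sum_add_distrib]
    refine Finset.sum_congr rfl fun j _ => ?_
    rw [← Finset.sum_add_distrib]
    refine Finset.sum_congr rfl fun k _ => ?_
    rw [hF (Sum.inr j), ← add_smul, smul_eq_mul]
    congr 1
    ring
  rw [weylSchwartz_conj, h2 _ fun c d => add_comm _ _]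
  simp only [h1, smul_add, smul_smul, Finset.sum_add_distrib, LinearMap.add_apply,
    LinearMap.sum_apply, LinearMap.smul_apply, Module.End.mul_apply]
  congr 1
  · exact Finset.sum_congr rfl fun j _ => Finset.sum_congr rfl fun k _ => by
      congr 1; ring
  · rw [Finset.mul_sum, Finset.sum_smul]
    refine Finset.sum_congr rfl fun j _ => ?_
    rw [Finset.sum_eq_single j]
    · simp only [if_pos, LinearMap.smul_apply, Module.End.one_apply, smul_smul, hdiag]
      congr 1
      ring
    · intro k _ hk
      simp [Ne.symm hk]
    · simp

/-- `q^w(x, D)` on the polynomial multiples of a ground state. -/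
theorem weylSchwartz_algHom_apply {K : Matrix (Fin n ⊕ Fin n) (Fin n ⊕ Fin n) ℂ}
    (hK : K ∈ Matrix.symplecticGroup (Fin n) ℂ) {M : Matrix (Fin n) (Fin n) ℂ} {lam : Fin n → ℂ}
    (hdiag : ∀ j, M j j = 2 * lam j)
    {ρ : MvPolynomial (Fin n) ℂ →ₐ[ℂ] Module.End ℂ 𝓢(EuclideanSpace ℝ (Fin n), ℂ)}
    (hρ : ∀ j, ρ (MvPolynomial.X j) = canonEnd K (Sum.inl j))
    {u : 𝓢(EuclideanSpace ℝ (Fin n), ℂ)} (hu : ∀ j, canonEnd K (Sum.inr j) u = 0)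
    (p : MvPolynomial (Fin n) ℂ) :
    weylSchwartz (Kᵀ * pairMatrix M * K) (ρ p u) = ρ (normalOp M lam p) u := by
  rw [weylSchwartz_pairMatrix hK hdiag, normalOp_apply]
  simp only [annihilation_apply (canonEnd_inr_inl hK) hρ hu, map_smul, map_add, map_sum, map_mul,
    hρ, LinearMap.smul_apply, LinearMap.add_apply, LinearMap.sum_apply, Module.End.mul_apply,
    smul_add, Finset.smul_sum, smul_smul]
  congr 1
  exact Finset.sum_congr rfl fun j _ => Finset.sum_congr rfl fun k _ => by rw [mul_comm]

/-- The phase space operators are formally self-adjoint. -/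
theorem inner_phaseOp (a : Fin n ⊕ Fin n) (φ ψ : 𝓢(EuclideanSpace ℝ (Fin n), ℂ)) :
    inner ℂ ((phaseOp a φ).toLp 2 : L2 n) (ψ.toLp 2 : L2 n) =
      inner ℂ (φ.toLp 2 : L2 n) ((phaseOp a ψ).toLp 2) := by
  rw [SchwartzMap.inner_toL2_toL2_eq _ _ volume, SchwartzMap.inner_toL2_toL2_eq _ _ volume]
  rcases a with j | j
  · refine integral_congr_ae (Filter.Eventually.of_forall fun x => ?_)
    simp only [phaseOp, Sum.elim_inl, posOp_apply, RCLike.inner_apply, map_mul, Complex.conj_ofReal]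
    ring
  · have h := SchwartzMap.integral_bilinear_lineDerivOp_right_eq_neg_left (μ := volume) φ ψ
      ((ContinuousLinearMap.mul ℝ ℂ).comp (Complex.conjCLE : ℂ →L[ℝ] ℂ))
      (EuclideanSpace.single j 1)
    simp only [ContinuousLinearMap.comp_apply, ContinuousLinearMap.mul_apply',
      ContinuousLinearEquiv.coe_coe, Complex.conjCLE_apply] at h
    simp only [phaseOp, Sum.elim_inr, momOp, _root_.smul_apply,
      LineDeriv.lineDerivOpCLM_apply, RCLike.inner_apply, smul_eq_mul, map_mul, map_div₀, map_one,
      Complex.conj_I]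
    calc _ = ∫ x, (1 / -Complex.I) * ((starRingEnd ℂ) ((∂_{EuclideanSpace.single j (1 : ℝ)} φ) x) *
          ψ x) := integral_congr_ae (Filter.Eventually.of_forall fun x => by simp only []; ring)
      _ = (1 / Complex.I) * -∫ x, ((starRingEnd ℂ) ((∂_{EuclideanSpace.single j (1 : ℝ)} φ) x) *
          ψ x) := by rw [integral_const_mul, div_neg]; ring
      _ = ∫ x, (1 / Complex.I) * ((starRingEnd ℂ) (φ x) *
          (∂_{EuclideanSpace.single j (1 : ℝ)} ψ) x) := by rw [← h, integral_const_mul]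
      _ = _ := integral_congr_ae (Filter.Eventually.of_forall fun x => by simp only []; ring)

theorem inner_weylSchwartz {Q : Matrix (Fin n ⊕ Fin n) (Fin n ⊕ Fin n) ℂ}
    (φ ψ : 𝓢(EuclideanSpace ℝ (Fin n), ℂ)) :
    inner ℂ (φ.toLp 2 : L2 n) ((weylSchwartz Q ψ).toLp 2) =
      inner ℂ ((weylSchwartz (Q.map star) φ).toLp 2 : L2 n) (ψ.toLp 2) := by
  have hL : ∀ f : 𝓢(EuclideanSpace ℝ (Fin n), ℂ),
      (f.toLp 2 : L2 n) = SchwartzMap.toLpCLM ℂ ℂ 2 volume f := fun f => rfl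
  simp only [hL, weylSchwartz, _root_.sum_apply, _root_.smul_apply, _root_.add_apply, map_sum,
    map_smul, map_add, inner_sum, sum_inner, inner_smul_left, inner_smul_right, inner_add_left,
    inner_add_right, ContinuousLinearMap.comp_apply, Matrix.map_apply, map_div₀]
  simp only [← hL, ← inner_phaseOp]
  refine Finset.sum_congr rfl fun a _ => Finset.sum_congr rfl fun b _ => ?_
  rw [add_comm]
  congr 1
  rw [Complex.star_def, Complex.conj_conj, Complex.conj_ofNat]

/-- Schwartz functions belong to the maximal domain, and there the distributional operator is the
one on the Schwartz space. -/
theorem mem_weylGraph (Q : Matrix (Fin n ⊕ Fin n) (Fin n ⊕ Fin n) ℂ)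
    (ψ : 𝓢(EuclideanSpace ℝ (Fin n), ℂ)) :
    ((ψ.toLp 2, (weylSchwartz Q ψ).toLp 2) : L2 n × L2 n) ∈ weylGraph Q :=
  fun φ => inner_weylSchwartz φ ψ

end PhaseOperators

end QuadGrowth
end

noncomputable section
namespace QuadGrowth

/-! ### The ground state of a normal form -/

section GroundState

open MeasureTheory

variable {n : ℕ} {Q : Matrix (Fin n ⊕ Fin n) (Fin n ⊕ Fin n) ℂ} {lam : Fin n → ℂ}
  {M : Matrix (Fin n) (Fin n) ℂ} {K : Matrix (Fin n ⊕ Fin n) (Fin n ⊕ Fin n) ℂ}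
  {Φ : QuadraticForm ℝ (Fin n → ℂ)}

theorem IsNormalForm.inr_eq_gradX (h : IsNormalForm Q lam M K Φ) (X : Fin n ⊕ Fin n → ℝ)
    (j : Fin n) : (K *ᵥ toC X) (Sum.inr j) =
      2 / Complex.I * gradX Φ (fun k => (K *ᵥ toC X) (Sum.inl k)) j := by
  obtain ⟨x, hx⟩ := h.lagrangian.subset ⟨X, rfl⟩
  simp only at hx
  rw [← hx]
  rfl

/-- The Lagrangian condition evaluated on real basis vectors: it expresses the lower rows of `K`
through the upper rows and their conjugates. -/
theorem IsNormalForm.inr_entry (h : IsNormalForm Q lam M K Φ) (j : Fin n) (c : Fin n ⊕ Fin n) :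
    K (Sum.inr j) c = 2 / Complex.I * (∑ k, hessXX Φ j k * K (Sum.inl k) c +
      ∑ k, (hessBarX Φ)ᵀ j k * star (K (Sum.inl k) c)) := by
  have h1 : toC (Pi.single c 1) = (Pi.single c 1 : Fin n ⊕ Fin n → ℂ) := by
    ext a
    by_cases hac : a = c
    · subst hac; simp [toC]
    · simp [toC, hac]
  have h2 := h.inr_eq_gradX (Pi.single c 1) j
  rw [h1, gradX_eq, Matrix.mulVec_single_one] at h2
  exact h2

/-- The polynomial multiples of a ground state satisfy the weight relation of `H_Φ`. -/
theorem IsNormalForm.weightRelation (h : IsNormalForm Q lam M K Φ)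
    {ρ : MvPolynomial (Fin n) ℂ →ₐ[ℂ] Module.End ℂ 𝓢(EuclideanSpace ℝ (Fin n), ℂ)}
    (hρ : ∀ j, ρ (MvPolynomial.X j) = canonEnd K (Sum.inl j))
    {u : 𝓢(EuclideanSpace ℝ (Fin n), ℂ)} (hu : ∀ j, canonEnd K (Sum.inr j) u = 0)
    {U : MvPolynomial (Fin n) ℂ →ₗ[ℂ] L2 n} (hU : ∀ p, U p = (ρ p u).toLp 2) :
    WeightRelation (hessXX Φ) (hessBarX Φ)ᵀ U := by
  intro q p j
  have hL : ∀ f : 𝓢(EuclideanSpace ℝ (Fin n), ℂ),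
      (f.toLp 2 : L2 n) = SchwartzMap.toLpCLM ℂ ℂ 2 volume f := fun f => rfl
  have hX : ∀ k p, U (MvPolynomial.X k * p) =
      ∑ c, K (Sum.inl k) c • ((phaseOp c (ρ p u)).toLp 2 : L2 n) := by
    intro k p
    rw [hU, map_mul, hρ, Module.End.mul_apply, canonEnd_apply]
    simp only [hL, map_sum, map_smul]
  have hD : U (MvPolynomial.pderiv j p) =
      ∑ c, (Complex.I * K (Sum.inr j) c) • ((phaseOp c (ρ p u)).toLp 2 : L2 n) := by
    have h1 := annihilation_apply (canonEnd_inr_inl h.canonical) hρ hu j p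
    have h2 : ρ (MvPolynomial.pderiv j p) u = Complex.I • canonEnd K (Sum.inr j) (ρ p u) := by
      rw [h1, smul_smul, mul_one_div_cancel Complex.I_ne_zero, one_smul]
    rw [hU, h2, canonEnd_apply]
    simp only [hL, map_sum, map_smul, Finset.smul_sum, smul_smul]
  -- Positions and momenta are symmetric, so the adjoint of the quantized `x_k` has the conjugate
  -- coefficients; this is how `inr_entry` becomes the weight relation.
  have hin : ∀ k, inner ℂ (U (MvPolynomial.X k * q)) (U p) =
      ∑ c, star (K (Sum.inl k) c) * inner ℂ (U q) ((phaseOp c (ρ p u)).toLp 2 : L2 n) := by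
    intro k
    rw [hX, sum_inner]
    refine Finset.sum_congr rfl fun c _ => ?_
    rw [inner_smul_left, hU p, inner_phaseOp, hU q]
    rfl
  rw [hD, inner_sum]
  simp only [hin]
  simp only [hX, inner_sum, inner_smul_right]
  rw [Finset.mul_sum, Finset.mul_sum, ← Finset.sum_add_distrib]
  simp only [Finset.mul_sum, ← Finset.sum_add_distrib]
  rw [Finset.sum_comm]
  refine Finset.sum_congr rfl fun c _ => ?_
  rw [h.inr_entry, ← mul_assoc, mul_div_cancel₀ _ Complex.I_ne_zero, ← Finset.sum_add_distrib,
    Finset.mul_sum, Finset.sum_mul]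
  exact Finset.sum_congr rfl fun k _ => by ring

theorem IsNormalForm.mulVec_injective (h : IsNormalForm Q lam M K Φ) {z : Fin n ⊕ Fin n → ℂ}
    (hz : K *ᵥ z = 0) : z = 0 := by
  have h1 : IsUnit K.det := SymplecticGroup.symplectic_det h.canonical
  have h2 : K⁻¹ *ᵥ (K *ᵥ z) = z := by
    rw [Matrix.mulVec_mulVec, Matrix.nonsing_inv_mul _ h1, Matrix.one_mulVec]
  rw [← h2, hz, Matrix.mulVec_zero]

/-- `Im (x̄ · ξ) > 0` on the preimage of the fibre `{(y, 0)}`. -/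
theorem IsNormalForm.im_star_dotProduct_pos (h : IsNormalForm Q lam M K Φ)
    {z : Fin n ⊕ Fin n → ℂ} (hz : ∀ j, (K *ᵥ z) (Sum.inr j) = 0) (hz0 : z ≠ 0) :
    0 < (star (fun j => z (Sum.inl j)) ⬝ᵥ fun j => z (Sum.inr j)).im := by
  have hΦ := posDef_of_strictConvexOn Φ h.convex
  set X₁ : Fin n ⊕ Fin n → ℝ := fun a => (z a).re with hX₁
  set X₂ : Fin n ⊕ Fin n → ℝ := fun a => (z a).im with hX₂
  have hz12 : z = toC X₁ + Complex.I • toC X₂ := by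
    ext a
    simp only [toC, Pi.add_apply, Pi.smul_apply, smul_eq_mul, hX₁, hX₂]
    rw [mul_comm, Complex.re_add_im]
  have hzs : star z = toC X₁ + (-Complex.I) • toC X₂ := by
    rw [hz12, star_add, star_smul, star_toC, star_toC, Complex.star_def, Complex.conj_I]
  set x₁ : Fin n → ℂ := fun k => (K *ᵥ toC X₁) (Sum.inl k) with hx₁
  set x₂ : Fin n → ℂ := fun k => (K *ᵥ toC X₂) (Sum.inl k) with hx₂
  -- Vanishing of the `ξ`-component of `K z`, where `z = X₁ + i X₂` with real `X₁`, `X₂`. It lets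
  -- `σ(z̄, z)` be evaluated through the weight as a sum of `Φ(x₁)` and `Φ(x₂)`.
  have hg : ∀ j, gradX Φ x₁ j + Complex.I * gradX Φ x₂ j = 0 := by
    intro j
    have h1 := hz j
    rw [hz12, Matrix.mulVec_add, Matrix.mulVec_smul, Pi.add_apply, Pi.smul_apply, smul_eq_mul,
      h.inr_eq_gradX, h.inr_eq_gradX] at h1
    have h2 : 2 / Complex.I * (gradX Φ x₁ j + Complex.I * gradX Φ x₂ j) = 0 := by
      rw [← h1]; ring
    exact (mul_eq_zero.1 h2).resolve_left (div_ne_zero two_ne_zero Complex.I_ne_zero)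
  have hs0 : ∀ X : Fin n ⊕ Fin n → ℂ, sympl X X = 0 := fun X => by
    have := sympl_swap X X
    exact self_eq_neg.1 this
  have hs1 : sympl (star z) z = 2 * Complex.I * sympl (toC X₁) (toC X₂) := by
    rw [hzs, hz12]
    simp only [sympl_add_left, sympl_add_right, sympl_smul_left, sympl_smul_right, hs0]
    rw [sympl_swap (toC X₂) (toC X₁)]
    ring
  have hs2 : sympl (toC X₁) (toC X₂) = -2 * (x₁ ⬝ᵥ gradX Φ x₁ + x₂ ⬝ᵥ gradX Φ x₂) := by
    rw [← sympl_mulVec h.canonical, sympl_eq]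
    simp only [h.inr_eq_gradX]
    simp only [← hx₁, ← hx₂, dotProduct, Finset.mul_sum, ← Finset.sum_add_distrib,
      ← Finset.sum_sub_distrib]
    refine Finset.sum_congr rfl fun j _ => ?_
    have h1 : gradX Φ x₁ j = -(Complex.I * gradX Φ x₂ j) := eq_neg_of_add_eq_zero_left (hg j)
    have h2 : (K *ᵥ toC X₁) (Sum.inl j) = x₁ j := rfl
    have h3 : (K *ᵥ toC X₂) (Sum.inl j) = x₂ j := rfl
    rw [h2, h3, h1, div_eq_mul_inv, Complex.inv_I]
    linear_combination (2 * gradX Φ x₂ j * x₂ j) * Complex.I_sq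
  have hs3 : sympl (star z) z =
      -(2 * Complex.I * (star (fun j => z (Sum.inl j)) ⬝ᵥ fun j => z (Sum.inr j)).im) := by
    have h1 : (fun j => star z (Sum.inr j)) ⬝ᵥ (fun j => z (Sum.inl j)) =
        star (star (fun j => z (Sum.inl j)) ⬝ᵥ fun j => z (Sum.inr j)) := by
      simp only [dotProduct, star_sum, star_mul', Pi.star_apply, star_star]
      exact Finset.sum_congr rfl fun j _ => mul_comm _ _
    have h2 : (fun j => star z (Sum.inl j)) = star (fun j => z (Sum.inl j)) := rfl
    rw [sympl_eq, h1, h2]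
    set w := star (fun j => z (Sum.inl j)) ⬝ᵥ fun j => z (Sum.inr j)
    rw [Complex.star_def]
    have := Complex.sub_conj w
    push_cast at this
    linear_combination -this
  have hval : ((star (fun j => z (Sum.inl j)) ⬝ᵥ fun j => z (Sum.inr j)).im : ℂ) =
      2 * (x₁ ⬝ᵥ gradX Φ x₁ + x₂ ⬝ᵥ gradX Φ x₂) := by
    have h1 : (2 * Complex.I) ≠ 0 := mul_ne_zero two_ne_zero Complex.I_ne_zero
    refine mul_left_cancel₀ h1 ?_
    rw [hs1, hs2] at hs3
    linear_combination hs3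
  have hre : (star (fun j => z (Sum.inl j)) ⬝ᵥ fun j => z (Sum.inr j)).im =
      2 * (Φ x₁ + Φ x₂) := by
    have h1 := congrArg Complex.re hval
    rw [Complex.ofReal_re] at h1
    rw [h1, two_mul_apply_eq_gradX, two_mul_apply_eq_gradX Φ x₂]
    simp
  rw [hre]
  by_contra hneg
  have hn1 : 0 ≤ Φ x₁ := hΦ.nonneg x₁
  have hn2 : 0 ≤ Φ x₂ := hΦ.nonneg x₂
  have hzero : ∀ X : Fin n ⊕ Fin n → ℝ, Φ (fun k => (K *ᵥ toC X) (Sum.inl k)) = 0 → toC X = 0 := by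
    intro X hX
    have h1 := hΦ.anisotropic _ hX
    refine h.mulVec_injective ?_
    ext (j | j)
    · exact congrFun h1 j
    · rw [h.inr_eq_gradX, h1, gradX_eq]
      simp
  refine hz0 ?_
  rw [hz12, hzero X₁ (by linarith), hzero X₂ (by linarith)]
  simp

/-- The exponent of the ground state. -/
theorem IsNormalForm.exists_groundMatrix (h : IsNormalForm Q lam M K Φ) :
    ∃ A : Matrix (Fin n) (Fin n) ℂ, A.IsSymm ∧
      (∀ x : Fin n → ℂ, x ≠ 0 → 0 < (star x ⬝ᵥ (A *ᵥ x)).im) ∧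
      K.toBlocks₂₁ + K.toBlocks₂₂ * A = 0 := by
  have hK : ∀ (x y : Fin n → ℂ) j, (K *ᵥ Sum.elim x y) (Sum.inr j) =
      (K.toBlocks₂₁ *ᵥ x + K.toBlocks₂₂ *ᵥ y) j := by
    intro x y j
    conv_lhs => rw [← Matrix.fromBlocks_toBlocks K, Matrix.fromBlocks_mulVec]
    rfl
  -- A null vector `y` of this block would put `(0, y)` in the preimage of `{ξ = 0}`, where `Im (x̄
  -- · ξ)` is positive although it vanishes at `(0, y)`.
  have hinj : Function.Injective (K.toBlocks₂₂).mulVec := by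
    intro y y' hy
    rw [← sub_eq_zero]
    by_contra hne
    have h1 := h.im_star_dotProduct_pos (z := Sum.elim 0 (y - y')) (fun j => by
      rw [hK, Matrix.mulVec_zero, zero_add, Matrix.mulVec_sub]
      exact congrFun (sub_eq_zero.2 hy) j) (fun h0 => hne (by
        ext j
        exact congrFun h0 (Sum.inr j)))
    simp [dotProduct] at h1
  have hdet : IsUnit (K.toBlocks₂₂).det :=
    (Matrix.isUnit_iff_isUnit_det _).1 (Matrix.mulVec_injective_iff_isUnit.1 hinj)
  have hsum : K.toBlocks₂₁ + K.toBlocks₂₂ * (-((K.toBlocks₂₂)⁻¹ * K.toBlocks₂₁)) = 0 := by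
    rw [mul_neg, ← mul_assoc, Matrix.mul_nonsing_inv _ hdet, one_mul, add_neg_cancel]
  -- The preimage of `{ξ = 0}` is the graph of `A`. It is Lagrangian, which is the symmetry of `A`,
  -- and positive, which is the decay of `e^{(i/2) x · A x}`.
  set A := -((K.toBlocks₂₂)⁻¹ * K.toBlocks₂₁)
  clear_value A
  have hz : ∀ x j, (K *ᵥ Sum.elim x (A *ᵥ x)) (Sum.inr j) = 0 := by
    intro x j
    rw [hK, Matrix.mulVec_mulVec, ← Matrix.add_mulVec, hsum, Matrix.zero_mulVec]
    rfl
  refine ⟨A, ?_, fun x hx => ?_, hsum⟩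
  · have h1 : ∀ x y : Fin n → ℂ, (A *ᵥ x) ⬝ᵥ y = x ⬝ᵥ (A *ᵥ y) := by
      intro x y
      have h2 := sympl_mulVec h.canonical (Sum.elim x (A *ᵥ x)) (Sum.elim y (A *ᵥ y))
      rw [sympl_eq, sympl_eq] at h2
      simp only [hz, Sum.elim_inl, Sum.elim_inr] at h2
      refine sub_eq_zero.1 (h2.symm.trans ?_)
      simp [dotProduct]
    refine Matrix.IsSymm.ext fun i j => ?_
    have h2 := h1 (Pi.single i 1) (Pi.single j 1)
    simpa using h2
  · exact h.im_star_dotProduct_pos (hz x) (fun h0 => hx (by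
      ext j
      exact congrFun h0 (Sum.inl j)))

end GroundState

end QuadGrowth
end

noncomputable section
namespace QuadGrowth

/-! ### Gaussian Schwartz functions -/

section GaussianSchwartz

open MeasureTheory

/-- From `f' = f T` with `T` of temperate growth, Leibniz bounds each derivative by lower ones times
powers of `1 + ‖x‖`; the induction is therefore over all weights `k` at once. -/
theorem pow_mul_iteratedFDeriv_le {E : Type*} [NormedAddCommGroup E] [NormedSpace ℝ E]
    {f : E → ℂ} {T : E → E →L[ℝ] ℂ} (hT : T.HasTemperateGrowth) (hf : ContDiff ℝ ⊤ f)
    (hfT : ∀ x, fderiv ℝ f x = f x • T x)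
    (hdec : ∀ k : ℕ, ∃ C, ∀ x, (1 + ‖x‖) ^ k * ‖f x‖ ≤ C) (m k : ℕ) :
    ∃ C, ∀ x, (1 + ‖x‖) ^ k * ‖iteratedFDeriv ℝ m f x‖ ≤ C := by
  induction m using Nat.strong_induction_on generalizing k with
  | _ m ih =>
    rcases m with _ | m
    · simpa using hdec k
    obtain ⟨l, D, hD, hTD⟩ := hT.norm_iteratedFDeriv_le_uniform m
    choose! C hC using fun i (hi : i < m + 1) => ih i hi (k + l)
    refine ⟨∑ i ∈ Finset.range (m + 1), (m.choose i : ℝ) * (C i * D), fun x => ?_⟩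
    have h1 : fderiv ℝ f = fun x => f x • T x := funext hfT
    rw [← norm_iteratedFDeriv_fderiv, h1]
    have h2 := norm_iteratedFDeriv_smul_le (N := ((⊤ : ℕ∞) : WithTop ℕ∞)) (hf.of_le le_top) hT.1 x
      (n := m) (by exact_mod_cast le_top)
    refine (mul_le_mul_of_nonneg_left h2 (by positivity)).trans ?_
    rw [Finset.mul_sum]
    refine Finset.sum_le_sum fun i hi => ?_
    have h3 := hC i (Finset.mem_range.1 hi) x
    have h4 := hTD (m - i) (Nat.sub_le _ _) x
    calc _ ≤ (1 + ‖x‖) ^ k * ((m.choose i : ℝ) * ‖iteratedFDeriv ℝ i f x‖ *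
          (D * (1 + ‖x‖) ^ l)) := by gcongr
      _ = (m.choose i : ℝ) * (((1 + ‖x‖) ^ (k + l) * ‖iteratedFDeriv ℝ i f x‖) * D) := by
          rw [pow_add]; ring
      _ ≤ _ := by gcongr

theorem one_add_pow_mul_exp_le {c : ℝ} (hc : 0 < c) (k : ℕ) {r : ℝ} (hr : 0 ≤ r) :
    (1 + r) ^ k * Real.exp (-c * r ^ 2) ≤ k.factorial * Real.exp (1 + 1 / (4 * c)) := by
  have h1 := Real.pow_div_factorial_le_exp (1 + r) (by positivity) k
  rw [div_le_iff₀ (by positivity)] at h1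
  have h2 : 1 + r + -c * r ^ 2 ≤ 1 + 1 / (4 * c) := by
    have h3 : r - c * r ^ 2 = 1 / (4 * c) - c * (r - 1 / (2 * c)) ^ 2 := by
      field_simp; ring
    have h4 : 0 ≤ c * (r - 1 / (2 * c)) ^ 2 := by positivity
    linarith
  calc _ ≤ Real.exp (1 + r) * k.factorial * Real.exp (-c * r ^ 2) := by gcongr
    _ = k.factorial * Real.exp (1 + r + -c * r ^ 2) := by
        rw [Real.exp_add (1 + r)]; ring
    _ ≤ _ := by gcongr

variable {n : ℕ}

/-- The phase `x · A x` for real `x`. -/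
def quadPhase (A : Matrix (Fin n) (Fin n) ℂ) (x : EuclideanSpace ℝ (Fin n)) : ℂ :=
  ∑ j, ∑ k, A j k * (x j : ℂ) * (x k : ℂ)

/-- Compactness of the sphere and homogeneity of degree two. -/
theorem exists_quadPhase_im_ge {A : Matrix (Fin n) (Fin n) ℂ}
    (hA : ∀ x : Fin n → ℂ, x ≠ 0 → 0 < (star x ⬝ᵥ (A *ᵥ x)).im) :
    ∃ c > 0, ∀ x, c * ‖x‖ ^ 2 ≤ (quadPhase A x).im := by
  have hcont : Continuous fun x : EuclideanSpace ℝ (Fin n) => (quadPhase A x).im := by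
    unfold quadPhase
    fun_prop
  have hpos : ∀ x : EuclideanSpace ℝ (Fin n), x ≠ 0 → 0 < (quadPhase A x).im := by
    intro x hx
    have h1 := hA (fun j => (x j : ℂ)) (fun h => hx (by
      ext j
      exact Complex.ofReal_eq_zero.1 (congrFun h j)))
    convert h1 using 2
    simp only [quadPhase, dotProduct, Matrix.mulVec, Finset.mul_sum, Pi.star_apply,
      Complex.star_def, Complex.conj_ofReal]
    exact Finset.sum_congr rfl fun _ _ => Finset.sum_congr rfl fun _ _ => by ring
  have hhom : ∀ (t : ℝ) (x : EuclideanSpace ℝ (Fin n)),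
      (quadPhase A (t • x)).im = t ^ 2 * (quadPhase A x).im := by
    intro t x
    rw [← Complex.im_ofReal_mul]
    congr 1
    simp only [quadPhase, Finset.mul_sum, PiLp.smul_apply, smul_eq_mul]
    push_cast
    exact Finset.sum_congr rfl fun _ _ => Finset.sum_congr rfl fun _ _ => by ring
  have hnorm : ∀ c, (∀ y ∈ Metric.sphere (0 : EuclideanSpace ℝ (Fin n)) 1,
      c ≤ (quadPhase A y).im) → ∀ x, c * ‖x‖ ^ 2 ≤ (quadPhase A x).im := by
    intro c hc x
    rcases eq_or_ne x 0 with rfl | hx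
    · simp [quadPhase]
    · have hx' : ‖x‖ ≠ 0 := norm_ne_zero_iff.2 hx
      have h1 := hc (‖x‖⁻¹ • x) (by simp [norm_smul, hx'])
      rw [hhom, inv_pow, ← div_eq_inv_mul, le_div_iff₀ (by positivity)] at h1
      exact h1
  rcases (Metric.sphere (0 : EuclideanSpace ℝ (Fin n)) 1).eq_empty_or_nonempty with he | hne
  · exact ⟨1, one_pos, hnorm 1 fun y hy => by simp [he] at hy⟩
  · obtain ⟨y, hy, hmin⟩ := (isCompact_sphere _ _).exists_isMinOn hne hcont.continuousOn
    refine ⟨_, hpos y fun h => ?_, hnorm _ fun z hz => hmin hz⟩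
    simp [h] at hy

/-- The differential of `(i/2) x · A x`. -/
def gaussSlope (A : Matrix (Fin n) (Fin n) ℂ) (x : EuclideanSpace ℝ (Fin n)) :
    EuclideanSpace ℝ (Fin n) →L[ℝ] ℂ :=
  ∑ j, (∑ k, A j k * (x k : ℂ)) • (Complex.I • (Complex.ofRealCLM ∘L
    (EuclideanSpace.proj j : EuclideanSpace ℝ (Fin n) →L[ℝ] ℝ)))

theorem hasTemperateGrowth_coord (k : Fin n) :
    Function.HasTemperateGrowth fun x : EuclideanSpace ℝ (Fin n) => (x k : ℂ) :=
  (Complex.ofRealCLM ∘L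
    (EuclideanSpace.proj k : EuclideanSpace ℝ (Fin n) →L[ℝ] ℝ)).hasTemperateGrowth

theorem hasTemperateGrowth_gaussSlope (A : Matrix (Fin n) (Fin n) ℂ) :
    (gaussSlope A).HasTemperateGrowth := by
  unfold gaussSlope
  refine Function.HasTemperateGrowth.sum fun j _ => ?_
  have h1 : Function.HasTemperateGrowth
      fun x : EuclideanSpace ℝ (Fin n) => ∑ k, A j k * (x k : ℂ) :=
    Function.HasTemperateGrowth.sum fun k _ =>
      (Function.HasTemperateGrowth.const (A j k)).mul (hasTemperateGrowth_coord k)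
  exact h1.smul (Function.HasTemperateGrowth.const _)

theorem hasFDerivAt_quadPhase {A : Matrix (Fin n) (Fin n) ℂ} (hA : A.IsSymm)
    (x : EuclideanSpace ℝ (Fin n)) :
    HasFDerivAt (fun x => Complex.I / 2 * quadPhase A x) (gaussSlope A x) x := by
  have hl : ∀ k, HasFDerivAt (fun x : EuclideanSpace ℝ (Fin n) => (x k : ℂ))
      (Complex.ofRealCLM ∘L (EuclideanSpace.proj k : EuclideanSpace ℝ (Fin n) →L[ℝ] ℝ)) x :=
    fun k => (Complex.ofRealCLM ∘L
      (EuclideanSpace.proj k : EuclideanSpace ℝ (Fin n) →L[ℝ] ℝ)).hasFDerivAt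
  have h1 := (HasFDerivAt.fun_sum (u := Finset.univ) fun j _ =>
    HasFDerivAt.fun_sum (u := Finset.univ) fun k _ =>
      ((hl j).const_mul (A j k)).mul (hl k)).const_mul (Complex.I / 2)
  refine h1.congr_fderiv ?_
  ext v
  simp only [gaussSlope, _root_.sum_apply, _root_.smul_apply, _root_.add_apply, smul_eq_mul,
    ContinuousLinearMap.comp_apply, Complex.ofRealCLM_apply, PiLp.proj_apply,
    Finset.sum_add_distrib]
  have h2 : ∑ j, ∑ k, A j k * (x j : ℂ) * (v k : ℂ) = ∑ j, ∑ k, (x k : ℂ) * (A j k * (v j : ℂ)) := by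
    rw [Finset.sum_comm]
    exact Finset.sum_congr rfl fun j _ => Finset.sum_congr rfl fun k _ => by
      rw [hA.apply]; ring
  rw [h2, ← two_mul, ← mul_assoc, div_mul_cancel₀ _ (two_ne_zero), Finset.mul_sum]
  refine Finset.sum_congr rfl fun j _ => ?_
  rw [Finset.sum_mul, Finset.mul_sum]
  exact Finset.sum_congr rfl fun k _ => by ring

/-- The Gaussian `exp ((i/2) x · A x)` as a Schwartz function. -/
theorem exists_gaussian {A : Matrix (Fin n) (Fin n) ℂ} (hA : A.IsSymm) {c : ℝ} (hc : 0 < c)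
    (hAc : ∀ x, c * ‖x‖ ^ 2 ≤ (quadPhase A x).im) :
    ∃ u : 𝓢(EuclideanSpace ℝ (Fin n), ℂ),
      (∀ x, u x = Complex.exp (Complex.I / 2 * quadPhase A x)) ∧
      (∀ x, ‖u x‖ ≤ Real.exp (-(c / 2) * ‖x‖ ^ 2)) ∧
      ∀ j x, momOp j u x = (∑ k, A j k * (x k : ℂ)) * u x := by
  set f : EuclideanSpace ℝ (Fin n) → ℂ := fun x => Complex.exp (Complex.I / 2 * quadPhase A x)
    with hf
  have hd : ∀ x, HasFDerivAt f (f x • gaussSlope A x) x := fun x =>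
    (hasFDerivAt_quadPhase hA x).cexp
  have hbd : ∀ x, ‖f x‖ ≤ Real.exp (-(c / 2) * ‖x‖ ^ 2) := by
    intro x
    rw [hf, Complex.norm_exp]
    refine Real.exp_le_exp.2 ?_
    have h1 : (Complex.I / 2 * quadPhase A x).re = -(quadPhase A x).im / 2 := by
      rw [div_mul_eq_mul_div, Complex.div_ofNat_re]
      simp
    rw [h1]
    linarith [hAc x]
  have hsm : ContDiff ℝ ⊤ f := by
    rw [hf]
    unfold quadPhase
    have hl : ∀ k : Fin n, ContDiff ℝ ⊤ fun x : EuclideanSpace ℝ (Fin n) => (x k : ℂ) :=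
      fun k => (Complex.ofRealCLM ∘L
        (EuclideanSpace.proj k : EuclideanSpace ℝ (Fin n) →L[ℝ] ℝ)).contDiff
    refine (contDiff_const.mul (ContDiff.sum fun j _ => ContDiff.sum fun k _ => ?_)).cexp
    exact (contDiff_const.mul (hl j)).mul (hl k)
  have hdec : ∀ k : ℕ, ∃ C, ∀ x, (1 + ‖x‖) ^ k * ‖f x‖ ≤ C := fun k =>
    ⟨_, fun x => (mul_le_mul_of_nonneg_left (hbd x) (by positivity)).trans
      (one_add_pow_mul_exp_le (half_pos hc) k (norm_nonneg x))⟩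
  let u : 𝓢(EuclideanSpace ℝ (Fin n), ℂ) :=
    { toFun := f
      smooth' := hsm.of_le le_top
      decay' := fun k m => by
        obtain ⟨C, hC⟩ := pow_mul_iteratedFDeriv_le (hasTemperateGrowth_gaussSlope A) hsm
          (fun x => (hd x).fderiv) hdec m k
        refine ⟨C, fun x => le_trans ?_ (hC x)⟩
        gcongr
        linarith }
  refine ⟨u, fun x => rfl, hbd, fun j x => ?_⟩
  have h1 : fderiv ℝ u x = f x • gaussSlope A x := (hd x).fderiv
  rw [momOp_apply, h1, _root_.smul_apply, smul_eq_mul]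
  have h2 : gaussSlope A x (EuclideanSpace.single j 1) = Complex.I * ∑ k, A j k * (x k : ℂ) := by
    simp only [gaussSlope, _root_.sum_apply, _root_.smul_apply, smul_eq_mul,
      ContinuousLinearMap.comp_apply, Complex.ofRealCLM_apply, PiLp.proj_apply]
    rw [Finset.sum_eq_single j]
    · simp
      ring
    · intro k _ hk
      simp [hk]
    · simp
  rw [h2]
  have h3 : u x = f x := rfl
  rw [h3]
  field_simp

/-- The ground state of a normal form. -/
theorem IsNormalForm.exists_groundState {Q : Matrix (Fin n ⊕ Fin n) (Fin n ⊕ Fin n) ℂ}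
    {lam : Fin n → ℂ} {M : Matrix (Fin n) (Fin n) ℂ}
    {K : Matrix (Fin n ⊕ Fin n) (Fin n ⊕ Fin n) ℂ} {Φ : QuadraticForm ℝ (Fin n → ℂ)}
    (h : IsNormalForm Q lam M K Φ) : ∃ u : 𝓢(EuclideanSpace ℝ (Fin n), ℂ),
      (∀ x, u x ≠ 0) ∧ (∃ c > 0, ∀ x, ‖u x‖ ≤ Real.exp (-c * ‖x‖ ^ 2)) ∧
      ∀ j, canonEnd K (Sum.inr j) u = 0 := by
  obtain ⟨A, hA, hpos, hKA⟩ := h.exists_groundMatrix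
  obtain ⟨c, hc, hAc⟩ := exists_quadPhase_im_ge hpos
  obtain ⟨u, hu, hbd, hmom⟩ := exists_gaussian hA hc hAc
  refine ⟨u, fun x => by rw [hu]; exact Complex.exp_ne_zero _, ⟨c / 2, half_pos hc, hbd⟩,
    fun j => ?_⟩
  ext x
  rw [canonEnd_apply, Fintype.sum_sum_type]
  have h1 : (∑ k, K (Sum.inr j) (Sum.inl k) • phaseOp (Sum.inl k) u +
      ∑ l, K (Sum.inr j) (Sum.inr l) • phaseOp (Sum.inr l) u) x =
      ∑ k, K (Sum.inr j) (Sum.inl k) * posOp k u x + ∑ l, K (Sum.inr j) (Sum.inr l) * momOp l u x := by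
    simp [phaseOp]
  rw [h1]
  simp only [posOp_apply, hmom]
  -- The entries of `K₂₁ + K₂₂ A = 0`: since `D` acts on the Gaussian as multiplication by `A x`,
  -- this is precisely the annihilation condition.
  have h2 : ∀ k, K (Sum.inr j) (Sum.inl k) + ∑ l, K (Sum.inr j) (Sum.inr l) * A l k = 0 := by
    intro k
    have := congrFun (congrFun hKA j) k
    rwa [Matrix.add_apply, Matrix.mul_apply] at this
  have h3 : ∑ l, K (Sum.inr j) (Sum.inr l) * ((∑ k, A l k * (x k : ℂ)) * u x) =
      ∑ k, (∑ l, K (Sum.inr j) (Sum.inr l) * A l k) * ((x k : ℂ) * u x) := by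
    simp only [Finset.sum_mul, Finset.mul_sum]
    rw [Finset.sum_comm]
    exact Finset.sum_congr rfl fun _ _ => Finset.sum_congr rfl fun _ _ => by ring
  rw [h3, ← Finset.sum_add_distrib]
  refine Finset.sum_eq_zero fun k _ => ?_
  rw [← add_mul, h2, zero_mul]

end GaussianSchwartz

end QuadGrowth
end

noncomputable section
namespace QuadGrowth

/-! ### Completeness of the polynomial multiples of the ground state -/

section HermiteDensity

open MeasureTheory FourierTransform

variable {n : ℕ}

/-- Duality: a test function is the Fourier transform of a Schwartz function, and moving the
transform onto `w` gives zero. -/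
theorem ae_eq_zero_of_fourier_eq_zero {w : EuclideanSpace ℝ (Fin n) → ℂ} (hw : Integrable w)
    (h : ∀ ξ, 𝓕 w ξ = 0) : ∀ᵐ x, w x = 0 := by
  refine ae_eq_zero_of_integral_contDiff_smul_eq_zero hw.locallyIntegrable fun g hg hgs => ?_
  have hs : HasCompactSupport fun x => (g x : ℂ) := hgs.comp_left Complex.ofReal_zero
  set G : 𝓢(EuclideanSpace ℝ (Fin n), ℂ) :=
    hs.toSchwartzMap (Complex.ofRealCLM.contDiff.comp hg) with hG
  have h1 := VectorFourier.integral_fourierIntegral_smul_eq_flip (L := innerₗ _)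
    (μ := (volume : Measure (EuclideanSpace ℝ (Fin n)))) (ν := volume)
    Real.continuous_fourierChar continuous_inner hw (𝓕⁻ G).integrable
  have h2 : ∀ ξ, VectorFourier.fourierIntegral Real.fourierChar volume (innerₗ _) w ξ = 0 := h
  simp only [h2, zero_smul, integral_zero, flip_innerₗ] at h1
  have h3 : ∀ x, VectorFourier.fourierIntegral Real.fourierChar volume
      (innerₗ (EuclideanSpace ℝ (Fin n))) (𝓕⁻ G : 𝓢(EuclideanSpace ℝ (Fin n), ℂ)) x = G x := by
    intro x
    have h4 : 𝓕 (𝓕⁻ G) = G := FourierTransform.fourier_fourierInv_eq G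
    conv_rhs => rw [← h4]
    rw [SchwartzMap.fourier_coe]
    rfl
  simp only [h3] at h1
  rw [h1]
  refine integral_congr_ae (Filter.Eventually.of_forall fun x => ?_)
  simp only [smul_eq_mul, Complex.real_smul]
  rw [mul_comm]
  rfl

/-- Exponential moments allow the character to be expanded in its power series under the integral.
-/
theorem fourier_eq_zero_of_moments {w : EuclideanSpace ℝ (Fin n) → ℂ}
    (hw : AEStronglyMeasurable w) (hexp : ∀ a : ℝ, Integrable fun x => Real.exp (a * ‖x‖) * ‖w x‖)
    (h : ∀ (ξ : EuclideanSpace ℝ (Fin n)) (k : ℕ), ∫ x, (inner ℝ x ξ : ℂ) ^ k * w x = 0)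
    (ξ : EuclideanSpace ℝ (Fin n)) : 𝓕 w ξ = 0 := by
  set K : ℝ := 2 * Real.pi * ‖ξ‖ with hK
  have hnorm : ∀ x : EuclideanSpace ℝ (Fin n),
      ‖((-2 * Real.pi * inner ℝ x ξ : ℝ) : ℂ) * Complex.I‖ ≤ K * ‖x‖ := by
    intro x
    rw [norm_mul, Complex.norm_I, mul_one, Complex.norm_real, Real.norm_eq_abs, abs_mul, abs_mul,
      abs_neg, abs_of_pos (zero_lt_two), abs_of_pos Real.pi_pos, hK]
    have := abs_real_inner_le_norm x ξ
    calc _ ≤ 2 * Real.pi * (‖x‖ * ‖ξ‖) := by gcongr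
      _ = _ := by ring
  have hsum := hasSum_integral_of_dominated_convergence
    (μ := (volume : Measure (EuclideanSpace ℝ (Fin n))))
    (F := fun (k : ℕ) x =>
      (((-2 * Real.pi * inner ℝ x ξ : ℝ) : ℂ) * Complex.I) ^ k / (k.factorial : ℂ) * w x)
    (f := fun x => Complex.exp (((-2 * Real.pi * inner ℝ x ξ : ℝ) : ℂ) * Complex.I) * w x)
    (bound := fun k x => (K * ‖x‖) ^ k / (k.factorial : ℝ) * ‖w x‖)
    (fun k => ?_) (fun k => Filter.Eventually.of_forall fun x => ?_)
    (Filter.Eventually.of_forall fun x => ?_) ?_ (Filter.Eventually.of_forall fun x => ?_)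
  · have hz : ∀ k : ℕ, ∫ x, (((-2 * Real.pi * inner ℝ x ξ : ℝ) : ℂ) * Complex.I) ^ k /
        (k.factorial : ℂ) * w x = 0 := by
      intro k
      have h2 : ∀ x, (((-2 * Real.pi * inner ℝ x ξ : ℝ) : ℂ) * Complex.I) ^ k /
          (k.factorial : ℂ) * w x = ((-2 * Real.pi * Complex.I) ^ k / (k.factorial : ℂ)) *
            ((inner ℝ x ξ : ℂ) ^ k * w x) := fun x => by
        push_cast
        ring
      simp_rw [h2]
      rw [integral_const_mul, h, mul_zero]
    simp only [hz] at hsum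
    rw [Real.fourier_eq']
    simp only [smul_eq_mul]
    exact hsum.unique hasSum_zero
  · exact (Continuous.aestronglyMeasurable (by fun_prop)).mul hw
  · rw [norm_mul, norm_div, norm_pow, Complex.norm_natCast]
    gcongr
    exact hnorm x
  · exact (Real.summable_pow_div_factorial (K * ‖x‖)).mul_right _
  · simp_rw [tsum_mul_right]
    have h1 : ∀ x : EuclideanSpace ℝ (Fin n), ∑' k : ℕ, (K * ‖x‖) ^ k / (k.factorial : ℝ) =
        Real.exp (K * ‖x‖) := fun x => by
      rw [Real.exp_eq_exp_ℝ, NormedSpace.exp_eq_tsum_div]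
    simp_rw [h1]
    exact hexp K
  · have h1 := NormedSpace.expSeries_div_hasSum_exp
      (((-2 * Real.pi * inner ℝ x ξ : ℝ) : ℂ) * Complex.I)
    rw [← Complex.exp_eq_exp_ℂ] at h1
    exact h1.mul_right (w x)

/-- Completing the square: `2(a r - c r²) ≤ a²/c - c r²`. -/
theorem memLp_exp_mul_norm {u : 𝓢(EuclideanSpace ℝ (Fin n), ℂ)} {c : ℝ} (hc : 0 < c)
    (hu : ∀ x, ‖u x‖ ≤ Real.exp (-c * ‖x‖ ^ 2)) (a : ℝ) :
    MemLp (fun x => Real.exp (a * ‖x‖) * ‖u x‖) 2 := by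
  have hcont : Continuous fun x => Real.exp (a * ‖x‖) * ‖u x‖ := by
    have := u.continuous
    fun_prop
  rw [memLp_two_iff_integrable_sq hcont.aestronglyMeasurable]
  have h1 : Integrable fun x : EuclideanSpace ℝ (Fin n) => Real.exp (-c * ‖x‖ ^ 2) := by
    have := (GaussianFourier.integrable_cexp_neg_mul_sq_norm_add (b := (c : ℂ))
      (by simpa using hc) 0 (0 : EuclideanSpace ℝ (Fin n))).norm
    refine this.congr (Filter.Eventually.of_forall fun x => ?_)
    simp only [Complex.norm_exp]
    congr 1
    rw [← Complex.ofReal_pow]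
    simp [-Complex.ofReal_pow]
  refine (h1.const_mul (Real.exp (a ^ 2 / c))).mono' (by fun_prop)
    (Filter.Eventually.of_forall fun x => ?_)
  rw [Real.norm_of_nonneg (by positivity), ← Real.exp_add]
  calc (Real.exp (a * ‖x‖) * ‖u x‖) ^ 2
      ≤ (Real.exp (a * ‖x‖) * Real.exp (-c * ‖x‖ ^ 2)) ^ 2 := by gcongr; exact hu x
    _ = Real.exp (2 * (a * ‖x‖ + -c * ‖x‖ ^ 2)) := by
        rw [← Real.exp_add, ← Real.exp_nat_mul]
        norm_num
    _ ≤ _ := by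
        refine Real.exp_le_exp.2 ?_
        have h2 : a ^ 2 / c + -c * ‖x‖ ^ 2 - 2 * (a * ‖x‖ + -c * ‖x‖ ^ 2) =
            c * (‖x‖ - a / c) ^ 2 := by field_simp; ring
        have h3 : 0 ≤ c * (‖x‖ - a / c) ^ 2 := by positivity
        linarith

variable {Q : Matrix (Fin n ⊕ Fin n) (Fin n ⊕ Fin n) ℂ} {lam : Fin n → ℂ}
  {M : Matrix (Fin n) (Fin n) ℂ} {K : Matrix (Fin n ⊕ Fin n) (Fin n ⊕ Fin n) ℂ}
  {ρ : MvPolynomial (Fin n) ℂ →ₐ[ℂ] Module.End ℂ 𝓢(EuclideanSpace ℝ (Fin n), ℂ)}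
  {u : 𝓢(EuclideanSpace ℝ (Fin n), ℂ)}

/-- Inverting `K` writes multiplication by `x_j` through the quantized normal form variables, which
act on the model as multiplications and derivatives. -/
theorem exists_algHom_eq_posOp (hK : K ∈ Matrix.symplecticGroup (Fin n) ℂ)
    (hρ : ∀ j, ρ (MvPolynomial.X j) = canonEnd K (Sum.inl j))
    (hu : ∀ j, canonEnd K (Sum.inr j) u = 0) (p : MvPolynomial (Fin n) ℂ) (j : Fin n) :
    ∃ p', ρ p' u = posOp j (ρ p u) := by
  have hdet : IsUnit K.det := SymplecticGroup.symplectic_det hK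
  have h1 : posOp j (ρ p u) = ∑ a, K⁻¹ (Sum.inl j) a • canonEnd K a (ρ p u) := by
    simp only [canonEnd_apply, Finset.smul_sum, smul_smul]
    rw [Finset.sum_comm]
    simp only [← Finset.sum_smul, ← Matrix.mul_apply, Matrix.nonsing_inv_mul _ hdet]
    rw [Finset.sum_eq_single (Sum.inl j)]
    · simp [phaseOp]
    · intro b _ hb
      rw [Matrix.one_apply_ne hb.symm, zero_smul]
    · simp
  refine ⟨∑ k, K⁻¹ (Sum.inl j) (Sum.inl k) • (MvPolynomial.X k * p) +
    ∑ k, (K⁻¹ (Sum.inl j) (Sum.inr k) * (1 / Complex.I)) • MvPolynomial.pderiv k p, ?_⟩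
  rw [h1, Fintype.sum_sum_type]
  simp only [annihilation_apply (canonEnd_inr_inl hK) hρ hu, map_add, map_sum, map_smul, map_mul,
    hρ, LinearMap.add_apply, LinearMap.sum_apply, LinearMap.smul_apply, Module.End.mul_apply,
    smul_smul]

theorem exists_algHom_eq_eval_mul (hK : K ∈ Matrix.symplecticGroup (Fin n) ℂ)
    (hρ : ∀ j, ρ (MvPolynomial.X j) = canonEnd K (Sum.inl j))
    (hu : ∀ j, canonEnd K (Sum.inr j) u = 0) (r : MvPolynomial (Fin n) ℂ) :
    ∃ p, ∀ x : EuclideanSpace ℝ (Fin n),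
      ρ p u x = MvPolynomial.eval (fun j => (x j : ℂ)) r * u x := by
  induction r using MvPolynomial.induction_on with
  | C a =>
    refine ⟨MvPolynomial.C a, fun x => ?_⟩
    rw [← MvPolynomial.algebraMap_eq, AlgHom.commutes, Module.algebraMap_end_apply,
      MvPolynomial.algebraMap_eq, MvPolynomial.eval_C]
    rfl
  | add r s hr hs =>
    obtain ⟨p, hp⟩ := hr
    obtain ⟨p', hp'⟩ := hs
    refine ⟨p + p', fun x => ?_⟩
    rw [map_add, map_add, add_mul, ← hp, ← hp']
    rfl
  | mul_X r j hr =>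
    obtain ⟨p, hp⟩ := hr
    obtain ⟨p', hp'⟩ := exists_algHom_eq_posOp hK hρ hu p j
    refine ⟨p', fun x => ?_⟩
    rw [hp', posOp_apply, hp, map_mul, MvPolynomial.eval_X]
    ring

/-- The polynomial multiples of a nowhere vanishing Gaussian ground state are dense in `L²`. -/
theorem denseRange_groundState (hK : K ∈ Matrix.symplecticGroup (Fin n) ℂ)
    (hρ : ∀ j, ρ (MvPolynomial.X j) = canonEnd K (Sum.inl j))
    (hu : ∀ j, canonEnd K (Sum.inr j) u = 0) (hne : ∀ x, u x ≠ 0) {c : ℝ} (hc : 0 < c)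
    (hdec : ∀ x, ‖u x‖ ≤ Real.exp (-c * ‖x‖ ^ 2))
    {U : MvPolynomial (Fin n) ℂ →ₗ[ℂ] L2 n} (hU : ∀ p, U p = (ρ p u).toLp 2) : DenseRange U := by
  have h1 : (LinearMap.range U).topologicalClosure = ⊤ := by
    rw [Submodule.topologicalClosure_eq_top_iff, Submodule.eq_bot_iff]
    intro f hf
    -- Orthogonality of `f` to all polynomials times `u` says that `ū f` has vanishing moments. As
    -- `u` has no zeros, `ū f = 0` gives `f = 0`.
    set w : EuclideanSpace ℝ (Fin n) → ℂ := fun x => star (u x) * f x with hw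
    have hwm : AEStronglyMeasurable w :=
      (Continuous.aestronglyMeasurable (by have := u.continuous; fun_prop)).mul
        (Lp.aestronglyMeasurable f)
    have hexp : ∀ a : ℝ, Integrable fun x => Real.exp (a * ‖x‖) * ‖w x‖ := by
      intro a
      have := (memLp_exp_mul_norm hc hdec a).integrable_mul (Lp.memLp f).norm
      refine this.congr (Filter.Eventually.of_forall fun x => ?_)
      simp only [hw, Pi.mul_apply, norm_mul, norm_star]
      ring
    have hmom : ∀ (ξ : EuclideanSpace ℝ (Fin n)) (k : ℕ),
        ∫ x, (inner ℝ x ξ : ℂ) ^ k * w x = 0 := by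
      intro ξ k
      obtain ⟨p, hp⟩ := exists_algHom_eq_eval_mul hK hρ hu
        ((∑ j, MvPolynomial.C (ξ j : ℂ) * MvPolynomial.X j) ^ k)
      have h2 : inner ℂ (U p) f = 0 := hf _ ⟨p, rfl⟩
      rw [hU, L2.inner_def] at h2
      rw [← h2]
      refine integral_congr_ae ?_
      filter_upwards [SchwartzMap.coeFn_toLp (ρ p u) 2 volume] with x hx
      rw [hx, hp, RCLike.inner_apply]
      simp only [map_pow, map_sum, map_mul, MvPolynomial.eval_C, MvPolynomial.eval_X,
        Complex.conj_ofReal, hw, Complex.star_def]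
      rw [PiLp.inner_apply]
      simp only [RCLike.inner_apply, conj_trivial]
      push_cast
      ring
    have hwi : Integrable w := by
      have := hexp 0
      simp only [zero_mul, Real.exp_zero, one_mul] at this
      exact (integrable_norm_iff hwm).1 this
    have hz := ae_eq_zero_of_fourier_eq_zero hwi (fourier_eq_zero_of_moments hwm hexp hmom)
    rw [Lp.eq_zero_iff_ae_eq_zero]
    filter_upwards [hz] with x hx
    exact (mul_eq_zero.1 hx).resolve_left (star_ne_zero.2 (hne x))
  have h7 := Submodule.dense_iff_topologicalClosure_eq_top.2 h1
  exact h7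

end HermiteDensity

end QuadGrowth
end

noncomputable section
namespace QuadGrowth

/-! ### Riesz projections and generalized eigenvectors -/

section Riesz

variable {H V : Type*} [NormedAddCommGroup H] [NormedSpace ℂ H] [AddCommGroup V] [Module ℂ V]
  {A : H →ₗ.[ℂ] H} {U : V →ₗ[ℂ] H} {N : Module.End ℂ V}

theorem isResolvent_resolv {z : ℂ} (hz : z ∉ spec A) : IsResolvent A z (resolv A z) := by
  have h : ∃ R, IsResolvent A z R := not_not.1 hz
  rw [resolv, dif_pos h]
  exact h.choose_spec

/-- The resolvent on a vector of a subspace on which `A` acts as `N`. -/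
theorem IsResolvent.apply_intertwined {z : ℂ} {R : H →L[ℂ] H} (hR : IsResolvent A z R)
    (hU : ∀ p, ∃ h : U p ∈ A.domain, A ⟨U p, h⟩ = U (N p)) (ν : ℂ) (p : V) :
    (z - ν) • R (U p) - R (U ((N - ν • 1) p)) = U p := by
  obtain ⟨h, hA⟩ := hU p
  have h1 : R (z • U p - A ⟨U p, h⟩) = U p := hR.2 ⟨U p, h⟩
  rw [hA] at h1
  conv_rhs => rw [← h1]
  simp only [LinearMap.sub_apply, LinearMap.smul_apply, Module.End.one_apply, map_sub, map_smul,
    sub_smul]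
  abel

/-- A resolvent at `ν` would invert `N - ν` from the left on the model, so a power of it could not
annihilate a nonzero vector. -/
theorem mem_spec_of_generalized_eigenvector (hinj : Function.Injective U)
    (hU : ∀ p, ∃ h : U p ∈ A.domain, A ⟨U p, h⟩ = U (N p)) {ν : ℂ} {p : V} (hp : p ≠ 0) {m : ℕ}
    (hm : ((N - ν • 1) ^ m) p = 0) : ν ∈ spec A := by
  rintro ⟨R, hR⟩
  have key : ∀ (m : ℕ) (q : V), ((N - ν • 1) ^ m) q = 0 → q = 0 := by
    intro m
    induction m with
    | zero => intro q hq; simpa using hq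
    | succ m ih =>
      intro q hq
      rw [pow_succ, Module.End.mul_apply] at hq
      have h1 := hR.apply_intertwined hU ν q
      rw [ih _ hq, map_zero, map_zero, sub_self, zero_smul, sub_zero] at h1
      exact hinj (by rw [← h1, map_zero])
  exact hp (key m p hm)

/-- The Neumann series of `(z - ν - (N - ν))⁻¹`, finite by nilpotency. -/
theorem IsResolvent.apply_generalized_eigenvector {z : ℂ} {R : H →L[ℂ] H} (hR : IsResolvent A z R)
    (hU : ∀ p, ∃ h : U p ∈ A.domain, A ⟨U p, h⟩ = U (N p)) {ν : ℂ} (hν : z ≠ ν) {m : ℕ} {p : V}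
    (hm : ((N - ν • 1) ^ m) p = 0) :
    R (U p) = ∑ j ∈ Finset.range m, (z - ν) ^ (-((j : ℤ) + 1)) • U (((N - ν • 1) ^ j) p) := by
  have hne : z - ν ≠ 0 := sub_ne_zero.2 hν
  induction m generalizing p with
  | zero =>
    rw [pow_zero, Module.End.one_apply] at hm
    simp [hm]
  | succ m ih =>
    rw [pow_succ, Module.End.mul_apply] at hm
    have h1 := hR.apply_intertwined hU ν p
    rw [ih hm, sub_eq_iff_eq_add] at h1
    have h2 : R (U p) = (z - ν)⁻¹ • ((z - ν) • R (U p)) := by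
      rw [smul_smul, inv_mul_cancel₀ hne, one_smul]
    rw [h2, h1, Finset.sum_range_succ', smul_add, add_comm, Finset.smul_sum]
    congr 1
    · refine Finset.sum_congr rfl fun j _ => ?_
      rw [smul_smul, pow_succ, Module.End.mul_apply, ← zpow_neg_one, ← zpow_add₀ hne]
      congr 2
      push_cast
      ring
    · simp

/-- For `j = 0` the integrand is holomorphic on the disc; for larger `j` it has a primitive. -/
theorem circleIntegral_zpow_of_notMem {c w : ℂ} {r : ℝ} (hr : 0 < r)
    (hw : w ∉ Metric.closedBall c r) (j : ℕ) : (∮ z in C(c, r), (z - w) ^ (-((j : ℤ) + 1))) = 0 := by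
  rcases eq_or_ne j 0 with rfl | hj
  · have hne : ∀ z ∈ Metric.closedBall c r, z - w ≠ 0 := fun z hz h =>
      hw (by rwa [← sub_eq_zero.1 h])
    refine Complex.circleIntegral_eq_zero_of_differentiable_on_off_countable hr.le
      Set.countable_empty (fun z hz => ContinuousAt.continuousWithinAt ?_) fun z hz => ?_
    · exact (continuousAt_id.sub continuousAt_const).zpow₀ _ (Or.inl (hne z hz))
    · exact (differentiableAt_id.sub_const w).zpow
        (Or.inl (hne z (Metric.ball_subset_closedBall hz.1)))
  · exact circleIntegral.integral_sub_zpow_of_ne (by omega) _ _ _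

/-- The Riesz projection on generalized eigenvectors. -/
theorem rieszProj_generalized_eigenvector [CompleteSpace H] {z : ℂ} (hz : rieszProj A z ≠ 0)
    (hinj : Function.Injective U)
    (hU : ∀ p, ∃ h : U p ∈ A.domain, A ⟨U p, h⟩ = U (N p)) {ν : ℂ} {m : ℕ} {p : V}
    (hm : ((N - ν • 1) ^ m) p = 0) : rieszProj A z (U p) = if ν = z then U p else 0 := by
  rcases eq_or_ne p 0 with rfl | hp
  · simp
  have hν := mem_spec_of_generalized_eigenvector hinj hU hp hm
  by_cases h : ∃ r, IsIsolatingRadius A z r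
  swap
  · rw [rieszProj, dif_neg h] at hz
    exact absurd rfl hz
  obtain ⟨hr, hspec⟩ := h.choose_spec
  rw [rieszProj, dif_pos h] at hz ⊢
  set r := h.choose
  -- Integrability is extracted from `hz`: for a non-integrable resolvent the integral would have
  -- its default value zero.
  have hci : CircleIntegrable (resolv A) z r := by
    by_contra hn
    rw [circleIntegral.integral_undef hn, smul_zero] at hz
    exact hz rfl
  have happ : (∮ ζ in C(z, r), resolv A ζ) (U p) = ∮ ζ in C(z, r), resolv A ζ (U p) := by
    rw [circleIntegral, circleIntegral]
    have h1 := (ContinuousLinearMap.apply ℂ H (U p)).intervalIntegral_comp_comm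
      (μ := MeasureTheory.volume) hci.out
    simp only [ContinuousLinearMap.apply_apply] at h1
    rw [← h1]
    rfl
  have hsum : ∀ m : ℕ, ((N - ν • 1) ^ m) p = 0 → (∮ ζ in C(z, r), resolv A ζ (U p)) =
      ∑ j ∈ Finset.range m, (∮ ζ in C(z, r), (ζ - ν) ^ (-((j : ℤ) + 1))) •
        U (((N - ν • 1) ^ j) p) := by
    intro m hm
    have hns : ∀ ζ ∈ Metric.sphere z r, ζ ∉ spec A := by
      intro ζ hζ hs
      have h1 : ζ = z := hspec ⟨Metric.sphere_subset_closedBall hζ, hs⟩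
      rw [h1, Metric.mem_sphere, dist_self] at hζ
      exact hr.ne hζ
    have hne : ∀ ζ ∈ Metric.sphere z r, ζ ≠ ν := fun ζ hζ h1 => hns ζ hζ (h1 ▸ hν)
    rw [circleIntegral.integral_congr hr.le fun ζ hζ =>
      (isResolvent_resolv (hns ζ hζ)).apply_generalized_eigenvector hU (hne ζ hζ) hm]
    rw [circleIntegral.integral_fun_sum]
    · simp only [circleIntegral.integral_smul_const]
    · intro j _
      refine ContinuousOn.circleIntegrable hr.le fun ζ hζ => ContinuousAt.continuousWithinAt ?_
      exact ((continuousAt_id.sub continuousAt_const).zpow₀ _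
        (Or.inl (sub_ne_zero.2 (hne ζ hζ)))).smul continuousAt_const
  -- One more power guarantees that the `j = 0` term, the only one with a residue, occurs in the
  -- sum.
  have hm' : ((N - ν • 1) ^ (m + 1)) p = 0 := by
    rw [pow_succ', Module.End.mul_apply, hm, map_zero]
  rw [_root_.smul_apply, happ, hsum (m + 1) hm']
  split_ifs with hνz
  · subst hνz
    rw [Finset.sum_eq_single 0]
    · have h1 : (∮ ζ in C(ν, r), (ζ - ν) ^ (-(((0 : ℕ) : ℤ) + 1))) = 2 * Real.pi * Complex.I := by
        simpa using circleIntegral.integral_sub_center_inv ν hr.ne'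
      rw [h1, pow_zero, Module.End.one_apply, smul_smul, inv_mul_cancel₀, one_smul]
      exact Complex.two_pi_I_ne_zero
    · intro j _ hj
      rw [circleIntegral.integral_sub_zpow_of_ne (by omega), zero_smul]
    · simp
  · have hnb : ν ∉ Metric.closedBall z r := fun hb => hνz (hspec ⟨hb, hν⟩)
    rw [Finset.sum_eq_zero, smul_zero]
    intro j _
    rw [circleIntegral_zpow_of_notMem hr hnb, zero_smul]

/-- Two bounded operators that agree on dense subspaces with proportional norms have the same
norm. -/
theorem norm_le_of_denseRange {E F : Type*} [NormedAddCommGroup E] [NormedSpace ℂ E]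
    [NormedAddCommGroup F] [NormedSpace ℂ F] {S : E →L[ℂ] E} {T : F →L[ℂ] F} {U : V →ₗ[ℂ] E}
    {W : V →ₗ[ℂ] F} {s : ℝ} (hs : 0 < s) (hUW : ∀ p, ‖U p‖ = s * ‖W p‖) (hd : DenseRange U)
    (P : V → V) (hS : ∀ p, S (U p) = U (P p)) (hT : ∀ p, T (W p) = W (P p)) : ‖S‖ ≤ ‖T‖ := by
  refine S.opNorm_le_bound (norm_nonneg _) fun x => ?_
  refine hd.induction_on (p := fun x => ‖S x‖ ≤ ‖T‖ * ‖x‖) x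
    (isClosed_le (by fun_prop) (by fun_prop)) fun p => ?_
  rw [hS, hUW, hUW, ← hT]
  have := T.le_opNorm (W p)
  calc _ ≤ s * (‖T‖ * ‖W p‖) := by gcongr
    _ = _ := by ring

end Riesz

/-! ### Transfer between `L²` and `H_Φ` -/

section Main

open MeasureTheory

variable {n : ℕ} {Q : Matrix (Fin n ⊕ Fin n) (Fin n ⊕ Fin n) ℂ} {lam : Fin n → ℂ}
  {M : Matrix (Fin n) (Fin n) ℂ} {K : Matrix (Fin n ⊕ Fin n) (Fin n ⊕ Fin n) ℂ}
  {Φ : QuadraticForm ℝ (Fin n → ℂ)}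

/-- A unitary equivalence, up to a factor, between `L²` and `H_Φ` on polynomials, under which
`q^w` becomes `normalOp`. -/
theorem IsNormalForm.exists_model (hQ : Q.IsSymm) (h : IsNormalForm Q lam M K Φ)
    (hΦ : Φ.PosDef) : ∃ (U : MvPolynomial (Fin n) ℂ →ₗ[ℂ] L2 n) (s : ℝ), 0 < s ∧
      DenseRange U ∧ (∀ p, ‖U p‖ = s * ‖polyHPhi hΦ p‖) ∧
      ∀ p, ∃ hp : U p ∈ (weylOp Q).domain, weylOp Q ⟨U p, hp⟩ = U (normalOp M lam p) := by
  obtain ⟨u, hne, ⟨c, hc, hdec⟩, hu⟩ := h.exists_groundState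
  obtain ⟨ρ, hρ⟩ := exists_algHom_of_commute (fun j => canonEnd K (Sum.inl j))
    fun j k => canonEnd_inl_comm h.canonical j k
  let U : MvPolynomial (Fin n) ℂ →ₗ[ℂ] L2 n :=
    { toFun := fun p => (ρ p u).toLp 2
      map_add' := fun p q => by
        rw [map_add, LinearMap.add_apply]
        exact map_add (SchwartzMap.toLpCLM ℂ ℂ 2 volume) _ _
      map_smul' := fun a p => by
        rw [map_smul, LinearMap.smul_apply]
        exact map_smul (SchwartzMap.toLpCLM ℂ ℂ 2 volume) _ _ }
  have hU : ∀ p, U p = (ρ p u).toLp 2 := fun p => rfl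
  have hV1 : polyHPhi hΦ 1 ≠ 0 := fun h0 =>
    one_ne_zero (polyHPhi_injective hΦ (h0.trans (map_zero (polyHPhi hΦ)).symm))
  have hU1 : U 1 ≠ 0 := by
    intro h0
    have h1 : U 1 = (0 : 𝓢(EuclideanSpace ℝ (Fin n), ℂ)).toLp 2 :=
      h0.trans (map_zero (SchwartzMap.toLpCLM ℂ ℂ 2 volume)).symm
    have h2 := SchwartzMap.injective_toLp 2 volume h1
    rw [map_one, Module.End.one_apply] at h2
    exact hne 0 (by rw [h2]; rfl)
  have hself : ∀ v : HPhi Φ, inner ℂ v v = (‖v‖ : ℂ) ^ 2 := fun v => inner_self_eq_norm_sq_to_K v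
  have hself' : ∀ v : L2 n, inner ℂ v v = (‖v‖ : ℂ) ^ 2 := fun v => inner_self_eq_norm_sq_to_K v
  -- The scalar products agree up to one constant, which is fixed by comparing the squared norms of
  -- the image of `1`, the ground state on the `L²` side.
  have hinner := WeightRelation.inner_eq (hessian_injective hΦ) (hessBarX_transpose_injective hΦ)
    (h.weightRelation hρ hu hU) (weightRelation_polyHPhi hΦ)
    (c := (‖U 1‖ / ‖polyHPhi hΦ 1‖) ^ 2) (by
      rw [hself, hself']
      have : (‖polyHPhi hΦ 1‖ : ℂ) ≠ 0 := by simpa using hV1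
      push_cast
      rw [div_pow, div_mul_cancel₀ _ (pow_ne_zero 2 this)])
  have hs : 0 < ‖U 1‖ / ‖polyHPhi hΦ 1‖ := div_pos (norm_pos_iff.2 hU1) (norm_pos_iff.2 hV1)
  refine ⟨U, ‖U 1‖ / ‖polyHPhi hΦ 1‖, hs,
    denseRange_groundState h.canonical hρ hu hne hc hdec hU, fun p => ?_, fun p => ?_⟩
  · have h1 := hinner p p
    rw [hself, hself'] at h1
    have h2 : ‖U p‖ ^ 2 = (‖U 1‖ / ‖polyHPhi hΦ 1‖ * ‖polyHPhi hΦ p‖) ^ 2 := by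
      rw [mul_pow]
      exact_mod_cast h1
    exact (pow_left_inj₀ (norm_nonneg _) (by positivity) two_ne_zero).1 h2
  · have h1 : ((U p, U (normalOp M lam p)) : L2 n × L2 n) ∈ (weylOp Q).graph := by
      rw [weylOp_graph]
      have h2 := weylSchwartz_algHom_apply h.canonical h.diag hρ hu p
      rw [← eq_conj_pairMatrix hQ h.symbol_eq] at h2
      have h3 := mem_weylGraph Q (ρ p u)
      rw [h2] at h3
      exact h3
    obtain ⟨y, hy1, hy2⟩ := (LinearPMap.mem_graph_iff _).1 h1
    refine ⟨?_, ?_⟩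
    · rw [← show (y : L2 n) = U p from hy1]
      exact y.2
    · rw [← show weylOp Q y = U (normalOp M lam p) from hy2]
      exact congrArg _ (Subtype.ext hy1.symm)

/-- The norm of a spectral projection of rank one is the norm of the corresponding projection
on `H_Φ`. -/
theorem IsNormalForm.norm_rieszProj (hQ : Q.IsSymm) (h : IsNormalForm Q lam M K Φ)
    (α : Fin n → ℕ) (hα : IsSimpleEigenvalue (weylOp Q) (mu lam α)) :
    ‖rieszProj (weylOp Q) (mu lam α)‖ = ‖taylorProj Φ α‖ := by
  have hΦ := posDef_of_strictConvexOn Φ h.convex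
  obtain ⟨U, s, hs, hdU, hUV, hgr⟩ := h.exists_model hQ hΦ
  obtain ⟨a, rfl⟩ : ∃ a : Fin n →₀ ℕ, (a : Fin n → ℕ) = α :=
    ⟨Finsupp.equivFunOnFinite.symm α, rfl⟩
  have hinj : Function.Injective U := by
    refine (injective_iff_map_eq_zero U).2 fun p hp => ?_
    have h1 := hUV p
    rw [hp, norm_zero] at h1
    have h2 : polyHPhi hΦ p = 0 :=
      norm_eq_zero.1 ((mul_eq_zero.1 h1.symm).resolve_left hs.ne')
    exact polyHPhi_injective hΦ (h2.trans (map_zero _).symm)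
  set S := rieszProj (weylOp Q) (mu lam a) with hS
  -- Rank one gives a nonzero projection, which excludes the default values of `rieszProj`.
  have hS0 : S ≠ 0 := by
    intro h0
    have h1 := hα.2.2
    rw [← hS, h0] at h1
    have h2 : LinearMap.range (0 : L2 n →L[ℂ] L2 n).toLinearMap = ⊥ := LinearMap.range_zero
    rw [h2, finrank_bot] at h1
    exact zero_ne_one h1
  have hmono : ∀ γ : Fin n →₀ ℕ, S (U (MvPolynomial.monomial γ 1)) =
      if mu lam γ = mu lam a then U (MvPolynomial.monomial γ 1) else 0 := by
    intro γ
    obtain ⟨m, hm⟩ := exists_pow_normalOp_sub_eq_zero h.jordan h.diag γ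
    exact rieszProj_generalized_eigenvector hS0 hinj hgr hm
  -- Two distinct multi-indices with the same eigenvalue would put two independent monomials into a
  -- one-dimensional range.
  have huniq : ∀ γ : Fin n →₀ ℕ, mu lam γ = mu lam a → γ = a := by
    intro γ hγ
    have hmem : ∀ γ : Fin n →₀ ℕ, mu lam γ = mu lam a →
        U (MvPolynomial.monomial γ 1) ∈ LinearMap.range S.toLinearMap := fun γ hγ =>
      ⟨_, (hmono γ).trans (if_pos hγ)⟩
    obtain ⟨v, hv, hspan⟩ := finrank_eq_one_iff'.1 hα.2.2
    obtain ⟨c₁, h1⟩ := hspan ⟨_, hmem γ hγ⟩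
    obtain ⟨c₂, h2⟩ := hspan ⟨_, hmem a rfl⟩
    have h3 : c₂ • U (MvPolynomial.monomial γ 1) = c₁ • U (MvPolynomial.monomial a 1) := by
      have h1' := congrArg Subtype.val h1
      have h2' := congrArg Subtype.val h2
      simp only at h1' h2'
      rw [← h1', ← h2']
      exact smul_comm _ _ _
    rw [← U.map_smul, ← U.map_smul] at h3
    have h4 := congrArg (MvPolynomial.coeff a) (hinj h3)
    have hc₂ : c₂ ≠ 0 := by
      rintro rfl
      rw [zero_smul] at h2
      have h5 := congrArg Subtype.val h2
      have h6 := hinj (h5.symm.trans (map_zero U).symm)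
      simp at h6
    by_contra hne
    rw [MvPolynomial.coeff_smul, MvPolynomial.coeff_smul, MvPolynomial.coeff_monomial,
      MvPolynomial.coeff_monomial, if_neg hne, if_pos rfl, smul_zero, smul_eq_mul, mul_one] at h4
    have hc₁ : c₁ = 0 := h4.symm
    rw [hc₁, zero_smul] at h1
    have h6 := hinj ((congrArg Subtype.val h1).symm.trans (map_zero U).symm)
    simp at h6
  have hSU : ∀ p : MvPolynomial (Fin n) ℂ, S (U p) = U (p.coeff a • MvPolynomial.monomial a 1) := by
    intro p
    induction p using MvPolynomial.induction_on' with
    | monomial γ z =>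
      have h1 : (MvPolynomial.monomial γ z : MvPolynomial (Fin n) ℂ) =
          z • MvPolynomial.monomial γ 1 := by
        rw [MvPolynomial.smul_monomial, smul_eq_mul, mul_one]
      rw [h1, map_smul, map_smul, hmono, MvPolynomial.coeff_smul, MvPolynomial.coeff_monomial]
      by_cases hγ : γ = a
      · subst hγ
        simp
      · rw [if_neg fun h2 => hγ (huniq γ h2), if_neg hγ]
        simp
    | add p q hp hq =>
      rw [map_add, map_add, hp, hq, MvPolynomial.coeff_add, add_smul, map_add]
  have hTV : ∀ p : MvPolynomial (Fin n) ℂ, taylorProj Φ a (polyHPhi hΦ p) =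
      polyHPhi hΦ (p.coeff a • MvPolynomial.monomial a 1) := fun p => by
    rw [taylorProj_polyHPhi, map_smul]
  -- Both operators are coefficient extraction on polynomials, which are dense on both sides, so the
  -- comparison runs in either direction with reciprocal scaling factors.
  refine le_antisymm (norm_le_of_denseRange hs hUV hdU _ hSU hTV)
    (norm_le_of_denseRange (inv_pos.2 hs) (fun p => ?_) (denseRange_polyHPhi hΦ) _ hTV hSU)
  rw [hUV, inv_mul_cancel_left₀ hs.ne']

end Main

end QuadGrowth
end

open QuadGrowth
theorem corollary1p7 (n : ℕ) :
    (∀ Φ : QuadraticForm ℝ (Fin n → ℂ), StrictConvexOn ℝ Set.univ Φ →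
      (∀ α : Fin n → ℕ, IsTaylorProj Φ α (taylorProj Φ α)) ∧
      ∀ β : Fin n → ℝ, (∀ j, 0 ≤ β j) → ∑ j, β j = 1 →
        ∃ C L₀ : ℝ, ∀ (L : ℝ) (α : Fin n → ℕ), L₀ ≤ L → (∀ j, (α j : ℝ) = L * β j) →
          |L⁻¹ * Real.log ‖taylorProj Φ α‖ - growthRate Φ β| ≤ C * (L⁻¹ * Real.log L)) ∧
    (∀ Q : Matrix (Fin n ⊕ Fin n) (Fin n ⊕ Fin n) ℂ, Q.IsSymm → ReNonneg Q →
      TrivialSingularSpace Q →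
      (∃ lam M ϰ Φ, IsNormalForm Q lam M ϰ Φ) ∧
      ∀ lam M ϰ Φ, IsNormalForm Q lam M ϰ Φ →
        (∀ α : Fin n → ℕ, IsSimpleEigenvalue (weylOp Q) (mu lam α) →
          ‖rieszProj (weylOp Q) (mu lam α)‖ = ‖taylorProj Φ α‖) ∧
        ∀ β : Fin n → ℝ, (∀ j, 0 ≤ β j) → ∑ j, β j = 1 →
          ∃ C L₀ : ℝ, ∀ (L : ℝ) (α : Fin n → ℕ), L₀ ≤ L → (∀ j, (α j : ℝ) = L * β j) →
            IsSimpleEigenvalue (weylOp Q) (mu lam α) →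
              |L⁻¹ * Real.log ‖rieszProj (weylOp Q) (mu lam α)‖ - growthRate Φ β| ≤
                C * (L⁻¹ * Real.log L)) := by
  refine ⟨fun Φ hΦ => ?_, fun Q hQ hre hs =>
    ⟨exists_isNormalForm hQ hre hs, fun lam M ϰ Φ h => ⟨h.norm_rieszProj hQ, fun β hβ hβ1 => ?_⟩⟩⟩
  · have hpos := posDef_of_strictConvexOn Φ hΦ
    exact ⟨isTaylorProj_taylorProj hpos, fun β hβ hβ1 => norm_taylorProj_asymptotics hpos hβ hβ1⟩
  · obtain ⟨C, L₀, hC⟩ := norm_taylorProj_asymptotics (posDef_of_strictConvexOn Φ h.convex) hβ hβ1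
    refine ⟨C, L₀, fun L α hL hα hsimple => ?_⟩
    -- Simplicity enters only here; the constants are those found for `Π_α` on `H_Φ` and do not
    -- depend on which eigenvalues are simple.
    rw [h.norm_rieszProj hQ α hsimple]
    exact hC L α hL hα
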